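/- Let $d\ge 2$, $\langle x\rangle=(1+|x|^2)^{1/2}$, $\hat f(\xi)=\int_{\mathbb R^d} e^{-2\pi i\xi\cdot x}f(x)\,dx$, and let $(\chi,\varphi)$ be a pair of smooth real functions on $\mathbb R^d$ with $\operatorname{supp}\chi\subseteq\{|\xi|\le 4/3\}$, $\operatorname{supp}\varphi\subseteq\{3/4\le|\xi|\le 8/3\}$ and $\chi(\xi)+\sum_{n\ge0}\varphi(2^{-n}\xi)=1$ for all $\xi$. Put $\Delta_{-1}f=\mathcal F^{-1}(\chi\hat f)$ and $\Delta_nf=\mathcal F^{-1}(\varphi(2^{-n}\cdot)\hat f)$ for $n\ge0$. For $r,\eta\in\mathbb R$ and $\lambda>0$ let $$\|f\|_{H^r(\langle x\rangle^{\eta},\lambda)}=\Big(\sum_{n\ge-1}2^{2nr}\int_{\mathbb R^d}|\Delta_nf(x)|^2\langle\lambda x\rangle^{2\eta}\,dx\Big)^{1/2},$$ and let $H^r(\langle x\rangle^\eta)$ be the space of tempered distributions on $\mathbb R^d$ for which this norm with $\lambda=1$ is finite. For $k>0$, $\gamma\in\mathbb R^d$ and $\tau\in\mathbb R\setminus\{0\}$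 put $r_{k,\gamma}=(k^2+|\gamma|^2)^{1/2}$ and let $\mathcal H_{k,\gamma,\tau}$ be the regularized inverse of $-(\Delta+r_{k,\gamma}^2-2\gamma\cdot\nabla+i\tau)$, that is, the Fourier multiplier (where $\nabla$ corresponds to $i\xi$) with symbol $1/m_{k,\gamma,\tau}$, $m_{k,\gamma,\tau}(\xi)=|\xi|^2-r_{k,\gamma}^2+2i\gamma\cdot\xi-i\tau$, defined on Schwartz functions by duality. **Theorem.** Let $r\in\mathbb R$. (1) Let $k>0$, $\gamma\in\mathbb R^d$, $\eta>1/2$. For every $s\in[0,2]$ and all sufficiently small $\tau\ne0$, the operator $\mathcal H_{k,\gamma,\tau}$ extends to a bounded linear operator from $H^r(\langle x\rangle^\eta)$ to $H^{r+s}(\langle x\rangle^{-\eta})$. As $\tau\to0^+$ (respectively $\tau\to0^-$) these extensions converge in the operator norm to a bounded linear operator from $H^r(\langle x\rangle^\eta)$ to $H^{r+s}(\langle x\rangle^{-\eta})$. This limit is unique and the same for all $s\in[0,2]$; it is denoted by $\mathcal H^{+}_{k,\gamma}$ (respectively $\mathcal H^-_{k,\gamma}$). (2) $\mathcal H^\pm_{k,\gamma}$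 is a two-sided inverse of $-(\Delta+r_{k,\gamma}^2-2\gamma\cdot\nabla)$ in the sense of distributions: $-(\Delta+r_{k,\gamma}^2-2\gamma\cdot\nabla)\mathcal H^\pm_{k,\gamma}f=f$ for all $f\in H^r(\langle x\rangle^\eta)$, and $-\mathcal H^\pm_{k,\gamma}(\Delta+r_{k,\gamma}^2-2\gamma\cdot\nabla)f=f$ for all $f\in H^r(\langle x\rangle^\eta)$ with $(\Delta+r_{k,\gamma}^2-2\gamma\cdot\nabla)f\in H^r(\langle x\rangle^\eta)$. (3) For every $s\in[0,2]$ and $\eta_0>1/2$ there is a constant $C>0$ such that for all $k>0$, $\gamma\in\mathbb R^d$, $\eta\ge\eta_0$ and $f\in H^r(\langle x\rangle^\eta)$ $$\|\mathcal H^\pm_{k,\gamma}f\|_{H^{r+s}(\langle x\rangle^{-\eta},1)}\le\frac{C\,(1+r_{k,\gamma})^s}{\min\{r_{k,\gamma},1\}\,r_{k,\gamma}}\|f\|_{H^r(\langle x\rangle^\eta,1)},$$ and for all $\lambda\in(0,1)$ $$\|\mathcal H^\pm_{k,\gamma}f\|_{H^{r+s}(\langle x\rangle^{-\eta},\lambda)}\le\frac{C\,\lambda^{-2\eta}(1+r_{k,\gamma})^s}{\min\{r_{k,\gamma},1\}\,r_{k,\gamma}}\|f\|_{H^r(\langle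 x\rangle^\eta,\lambda)}.$$ The constant $C$ depends only on $d$, $r$, $s$, $\eta_0$ and the pair $(\chi,\varphi)$; in particular it does not depend on $k$, $\gamma$, $\lambda$ and $f$. -/

import Mathlib

open SchwartzMap TemperedDistribution MeasureTheory Filter Topology Set
open scoped ENNReal FourierTransform LineDeriv Laplacian ContDiff RealInnerProductSpace

noncomputable section

namespace Faddeev

/-- The Euclidean space `ℝᵈ`. -/
abbrev Eucl (d : ℕ) : Type := EuclideanSpace ℝ (Fin d)

/-! ### Weighted Sobolev spaces through Littlewood-Paley blocks -/

/-- An admissible partition pair `(χ, φ)`: smooth functions with `supp χ ⊆ {|ξ| ≤ 4/3}`,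
`supp φ ⊆ {3/4 ≤ |ξ| ≤ 8/3}` and `χ(ξ) + ∑_{n ≥ 0} φ(2⁻ⁿ ξ) = 1`. The support conditions imply
that `supp φ(2⁻ⁱ ·)` and `supp φ(2⁻ʲ ·)` are disjoint for `|i - j| ≥ 2` and that
`supp φ(2⁻ⁱ ·)` and `supp χ` are disjoint for `i ≥ 1`. -/
structure DyadicPartition (d : ℕ) where
  χ : Eucl d → ℝ
  φ : Eucl d → ℝ
  contDiff_χ : ContDiff ℝ ∞ χ
  contDiff_φ : ContDiff ℝ ∞ φ
  tsupport_χ : tsupport χ ⊆ {ξ | ‖ξ‖ ≤ 4 / 3}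
  tsupport_φ : tsupport φ ⊆ {ξ | 3 / 4 ≤ ‖ξ‖ ∧ ‖ξ‖ ≤ 8 / 3}
  hasSum_eq : ∀ ξ, HasSum (fun n : ℕ => φ (((2 : ℝ) ^ n)⁻¹ • ξ)) (1 - χ ξ)

variable {d : ℕ}

/-- The dyadic cutoffs, with the index shifted by one: `cutoff 0 = χ` is the usual `φ₋₁`,
and `cutoff (n + 1)` is the usual `φ_n = φ(2⁻ⁿ ·)`. -/
def DyadicPartition.cutoff (P : DyadicPartition d) : ℕ → Eucl d → ℝ
  | 0 => P.χ
  | n + 1 => fun ξ => P.φ (((2 : ℝ) ^ n)⁻¹ • ξ)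

/-- The Littlewood-Paley operator `u ↦ 𝓕⁻¹(φ_{n-1} 𝓕 u)` on tempered distributions
(the index is shifted by one). -/
def DyadicPartition.block (P : DyadicPartition d) (n : ℕ) :
    𝓢'(Eucl d, ℂ) →L[ℂ] 𝓢'(Eucl d, ℂ) :=
  TemperedDistribution.fourierMultiplierCLM ℂ (fun ξ => (P.cutoff n ξ : ℂ))

/-- The `L²` norm of a tempered distribution: the norm of the `L²` function (unique, if there
is one) that represents it, and `∞` if it is not represented by an `L²` function. -/
def l2Norm (u : 𝓢'(Eucl d, ℂ)) : ℝ≥0∞ :=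
  ⨅ (g : Lp ℂ 2 (volume : Measure (Eucl d))) (_ : (g : 𝓢'(Eucl d, ℂ)) = u), ‖g‖ₑ

/-- The rescaled weight `x ↦ ⟨lam x⟩ ^ η`, where `⟨x⟩ = (1 + |x|²) ^ (1/2)`. The unscaled weight
is the case `lam = 1`. -/
def weight (η lam : ℝ) (x : Eucl d) : ℝ := (1 + ‖lam • x‖ ^ 2) ^ (η / 2)

/-- The norm of `L²(⟨x⟩ ^ η, lam)`, that is `‖⟨lam x⟩ ^ η u‖_{L²}`. -/
def weightedL2Norm (η lam : ℝ) (u : 𝓢'(Eucl d, ℂ)) : ℝ≥0∞ :=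
  l2Norm (TemperedDistribution.smulLeftCLM ℂ (fun x => (weight η lam x : ℂ)) u)

/-- The norm of the rescaled weighted Sobolev space
`H^r(⟨x⟩ ^ η, lam) = B^r_{2,2}(⟨x⟩ ^ η, lam)`, with values in `[0, ∞]`:
`(∑_{j ≥ -1} (2 ^ (j r) ‖Δ_j f‖_{L²(⟨x⟩ ^ η, lam)})²) ^ (1/2)`, where `j = n - 1`. -/
def sobolevNorm (P : DyadicPartition d) (r η lam : ℝ) (f : 𝓢'(Eucl d, ℂ)) : ℝ≥0∞ :=
  (∑' n : ℕ, (ENNReal.ofReal ((2 : ℝ) ^ (((n : ℝ) - 1) * r)) *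
    weightedL2Norm η lam (P.block n f)) ^ 2) ^ (1 / 2 : ℝ)

theorem l2Norm_coe (g : Lp ℂ 2 (volume : Measure (Eucl d))) :
    l2Norm (g : 𝓢'(Eucl d, ℂ)) = ‖g‖ₑ := by
  apply le_antisymm
  · unfold l2Norm
    exact iInf₂_le_of_le g rfl le_rfl
  · unfold l2Norm
    refine le_iInf₂ fun a ha => ?_
    have h0 : a - g ∈ (Lp.toTemperedDistributionCLM ℂ (volume : Measure (Eucl d)) 2).ker := by
      rw [LinearMap.mem_ker]
      exact (map_sub (Lp.toTemperedDistributionCLM ℂ (volume : Measure (Eucl d)) 2) a g).trans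
        (sub_eq_zero.2 ha)
    rw [Lp.ker_toTemperedDistributionCLM_eq_bot, Submodule.mem_bot, sub_eq_zero] at h0
    rw [h0]

theorem exists_of_l2Norm_lt_top {u : 𝓢'(Eucl d, ℂ)} (hu : l2Norm u < ⊤) :
    ∃ g : Lp ℂ 2 (volume : Measure (Eucl d)), (g : 𝓢'(Eucl d, ℂ)) = u := by
  obtain ⟨g, hg⟩ := iInf_lt_iff.1 hu
  obtain ⟨h, -⟩ := iInf_lt_iff.1 hg
  exact ⟨g, h⟩

theorem l2Norm_add_le (u v : 𝓢'(Eucl d, ℂ)) : l2Norm (u + v) ≤ l2Norm u + l2Norm v := by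
  rcases eq_or_ne (l2Norm u) ⊤ with hu | hu
  · simp [hu]
  rcases eq_or_ne (l2Norm v) ⊤ with hv | hv
  · simp [hv]
  obtain ⟨a, rfl⟩ := exists_of_l2Norm_lt_top hu.lt_top
  obtain ⟨b, rfl⟩ := exists_of_l2Norm_lt_top hv.lt_top
  have h := map_add (Lp.toTemperedDistributionCLM ℂ (volume : Measure (Eucl d)) 2) a b
  simp only [Lp.toTemperedDistributionCLM_apply] at h
  rw [← h, l2Norm_coe, l2Norm_coe, l2Norm_coe]
  exact enorm_add_le a b

theorem l2Norm_smul_le (c : ℂ) (u : 𝓢'(Eucl d, ℂ)) (hu : l2Norm u < ⊤) :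
    l2Norm (c • u) ≤ ‖c‖ₑ * l2Norm u := by
  obtain ⟨a, rfl⟩ := exists_of_l2Norm_lt_top hu
  have h := map_smul (Lp.toTemperedDistributionCLM ℂ (volume : Measure (Eucl d)) 2) c a
  simp only [Lp.toTemperedDistributionCLM_apply] at h
  rw [← h, l2Norm_coe, l2Norm_coe, enorm_smul]

theorem sobolevNorm_lt_top_iff (P : DyadicPartition d) (r η lam : ℝ) (f : 𝓢'(Eucl d, ℂ)) :
    sobolevNorm P r η lam f < ⊤ ↔
      ∑' n : ℕ, (ENNReal.ofReal ((2 : ℝ) ^ (((n : ℝ) - 1) * r)) *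
        weightedL2Norm η lam (P.block n f)) ^ 2 ≠ ⊤ := by
  rw [sobolevNorm, lt_top_iff_ne_top, ne_eq, ENNReal.rpow_eq_top_iff_of_pos (by norm_num)]

theorem sobolevNorm_zero (P : DyadicPartition d) (r η lam : ℝ) :
    sobolevNorm P r η lam (0 : 𝓢'(Eucl d, ℂ)) < ⊤ := by
  have h0 : l2Norm (0 : 𝓢'(Eucl d, ℂ)) = 0 := by
    have h := map_zero (Lp.toTemperedDistributionCLM ℂ (volume : Measure (Eucl d)) 2)
    simp only [Lp.toTemperedDistributionCLM_apply] at h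
    rw [← h, l2Norm_coe, enorm_zero]
  rw [sobolevNorm_lt_top_iff]
  simp [weightedL2Norm, h0]

theorem sobolevNorm_add_lt_top (P : DyadicPartition d) (r η lam : ℝ) {f g : 𝓢'(Eucl d, ℂ)}
    (hf : sobolevNorm P r η lam f < ⊤) (hg : sobolevNorm P r η lam g < ⊤) :
    sobolevNorm P r η lam (f + g) < ⊤ := by
  rw [sobolevNorm_lt_top_iff] at hf hg ⊢
  refine ne_top_of_le_ne_top (ENNReal.add_ne_top.2
    ⟨ENNReal.mul_ne_top (by norm_num : (2 : ℝ≥0∞) ≠ ⊤) hf,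
      ENNReal.mul_ne_top (by norm_num : (2 : ℝ≥0∞) ≠ ⊤) hg⟩) ?_
  rw [← ENNReal.tsum_mul_left, ← ENNReal.tsum_mul_left, ← ENNReal.tsum_add]
  refine ENNReal.tsum_le_tsum fun n => ?_
  set w := ENNReal.ofReal ((2 : ℝ) ^ (((n : ℝ) - 1) * r))
  have h1 : weightedL2Norm η lam (P.block n (f + g)) ≤
      weightedL2Norm η lam (P.block n f) + weightedL2Norm η lam (P.block n g) := by
    unfold weightedL2Norm
    rw [map_add, map_add]
    exact l2Norm_add_le _ _
  have h2 : ∀ a b : ℝ≥0∞, (a + b) ^ 2 ≤ 2 * a ^ 2 + 2 * b ^ 2 := by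
    intro a b
    have h := ENNReal.rpow_add_le_mul_rpow_add_rpow a b (p := 2) (by norm_num)
    norm_num [mul_add] at h
    exact_mod_cast h
  calc (w * weightedL2Norm η lam (P.block n (f + g))) ^ 2
      ≤ (w * weightedL2Norm η lam (P.block n f) + w * weightedL2Norm η lam (P.block n g)) ^ 2 := by
        rw [← mul_add]
        gcongr
    _ ≤ _ := h2 _ _

theorem sobolevNorm_smul_lt_top (P : DyadicPartition d) (r η lam : ℝ) (c : ℂ)
    {f : 𝓢'(Eucl d, ℂ)} (hf : sobolevNorm P r η lam f < ⊤) :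
    sobolevNorm P r η lam (c • f) < ⊤ := by
  rw [sobolevNorm_lt_top_iff] at hf ⊢
  refine ne_top_of_le_ne_top
    (ENNReal.mul_ne_top (ENNReal.pow_ne_top (n := 2) (enorm_ne_top (x := c))) hf) ?_
  rw [← ENNReal.tsum_mul_left]
  refine ENNReal.tsum_le_tsum fun n => ?_
  have hn := ENNReal.ne_top_of_tsum_ne_top hf n
  have hw : ENNReal.ofReal ((2 : ℝ) ^ (((n : ℝ) - 1) * r)) ≠ 0 := by
    rw [ne_eq, ENNReal.ofReal_eq_zero, not_le]
    positivity
  set w := ENNReal.ofReal ((2 : ℝ) ^ (((n : ℝ) - 1) * r))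
  have hfin : weightedL2Norm η lam (P.block n f) < ⊤ := by
    rw [lt_top_iff_ne_top]
    intro h
    rw [h, ENNReal.mul_top hw] at hn
    simp at hn
  have h1 : weightedL2Norm η lam (P.block n (c • f)) ≤
      ‖c‖ₑ * weightedL2Norm η lam (P.block n f) := by
    unfold weightedL2Norm at hfin ⊢
    rw [map_smul, map_smul]
    exact l2Norm_smul_le _ _ hfin
  calc (w * weightedL2Norm η lam (P.block n (c • f))) ^ 2
      ≤ (w * (‖c‖ₑ * weightedL2Norm η lam (P.block n f))) ^ 2 := by gcongr
    _ = ‖c‖ₑ ^ 2 * (w * weightedL2Norm η lam (P.block n f)) ^ 2 := by ring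

/-- The weighted Sobolev space `H^r(⟨x⟩ ^ η)`, as a space of tempered distributions. -/
def Sobolev (P : DyadicPartition d) (r η : ℝ) : Submodule ℂ 𝓢'(Eucl d, ℂ) where
  carrier := {f | sobolevNorm P r η 1 f < ⊤}
  zero_mem' := sobolevNorm_zero P r η 1
  add_mem' := sobolevNorm_add_lt_top P r η 1
  smul_mem' := fun c _ hf => sobolevNorm_smul_lt_top P r η 1 c hf

/-- The operator norm, in `[0, ∞]`, of a linear map defined on `H^r(⟨x⟩ ^ η)` as a map into
`H^{r'}(⟨x⟩ ^ η')`. It is finite if and only if the map is bounded between these two spaces. -/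
def opNorm (P : DyadicPartition d) (r η r' η' : ℝ)
    (T : Sobolev P r η →ₗ[ℂ] 𝓢'(Eucl d, ℂ)) : ℝ≥0∞ :=
  sInf {C : ℝ≥0∞ | ∀ f : Sobolev P r η,
    sobolevNorm P r' η' 1 (T f) ≤ C * sobolevNorm P r η 1 (f : 𝓢'(Eucl d, ℂ))}

/-! ### Faddeev-type operators -/

/-- `r_{k,γ} = (k² + |γ|²) ^ (1/2)`. -/
def rad (k : ℝ) (γ : Eucl d) : ℝ := √(k ^ 2 + ‖γ‖ ^ 2)

/-- The symbol `m_{k,γ,τ}(ξ) = |ξ|² - k² - |γ|² + 2 i γ·ξ - i τ`. -/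
def symbol (k : ℝ) (γ : Eucl d) (τ : ℝ) (ξ : Eucl d) : ℂ :=
  (‖ξ‖ ^ 2 - k ^ 2 - ‖γ‖ ^ 2 : ℝ) + 2 * Complex.I * (⟪γ, ξ⟫ : ℝ) - Complex.I * (τ : ℝ)

/-- The differential operator `Δ + r_{k,γ}² - 2 γ·∇` on tempered distributions. -/
def faddeevDiff (k : ℝ) (γ : Eucl d) (u : 𝓢'(Eucl d, ℂ)) : 𝓢'(Eucl d, ℂ) :=
  Δ u + ((rad k γ ^ 2 : ℝ) : ℂ) • u - (2 : ℂ) • ∂_{γ} u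

/-- `T` extends the regularized operator `(-(Δ + r_{k,γ}² - 2 γ·∇ + i τ))⁻¹`, which is given on
Schwartz functions by duality as the Fourier multiplier with symbol `1 / m_{k,γ,τ}`. The symbol is
evaluated at `2 π ξ` since the Fourier transform is `∫ e^{-2πi ξ·x} f(x) dx`, so that `∇` is the
multiplication by `2 π i ξ`. -/
def ExtendsRegularized (P : DyadicPartition d) (k : ℝ) (γ : Eucl d) (τ r η : ℝ)
    (T : Sobolev P r η →ₗ[ℂ] 𝓢'(Eucl d, ℂ)) : Prop :=
  ∀ f : 𝓢(Eucl d, ℂ), ∃ hf : (f : 𝓢'(Eucl d, ℂ)) ∈ Sobolev P r η, ∀ g : 𝓢(Eucl d, ℂ),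
    Integrable (fun ξ : Eucl d => 𝓕 f ξ * 𝓕⁻ g ξ / symbol k γ τ ((2 * Real.pi) • ξ)) ∧
    T ⟨(f : 𝓢'(Eucl d, ℂ)), hf⟩ g =
      ∫ ξ : Eucl d, 𝓕 f ξ * 𝓕⁻ g ξ / symbol k γ τ ((2 * Real.pi) • ξ)

/-- `H` is the limit, in the operator norm from `H^r(⟨x⟩ ^ η)` to `H^{r+s}(⟨x⟩ ^ (-η))`, of the
(bounded extensions of the) regularized operators as `τ` tends to `0` along the filter `l`. With
`l = 𝓝[>] 0` this defines `H⁺_{k,γ}`, and with `l = 𝓝[<] 0` it defines `H⁻_{k,γ}`. -/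
def IsLimitOperator (P : DyadicPartition d) (l : Filter ℝ) (k : ℝ) (γ : Eucl d) (r s η : ℝ)
    (H : Sobolev P r η →ₗ[ℂ] 𝓢'(Eucl d, ℂ)) : Prop :=
  ∃ T : ℝ → (Sobolev P r η →ₗ[ℂ] 𝓢'(Eucl d, ℂ)),
    (∀ᶠ τ in l, ExtendsRegularized P k γ τ r η (T τ) ∧ opNorm P r η (r + s) (-η) (T τ) < ⊤) ∧
    opNorm P r η (r + s) (-η) H < ⊤ ∧
    Tendsto (fun τ => opNorm P r η (r + s) (-η) (T τ - H)) l (𝓝 0)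

end Faddeev

end

open SchwartzMap TemperedDistribution MeasureTheory Filter Topology Set
open scoped ENNReal FourierTransform LineDeriv Laplacian ContDiff RealInnerProductSpace

noncomputable section

namespace Faddeev

/-! ### One-dimensional Cauchy multipliers -/

/-! Everything reduces to the bilinear form `∫ 𝓕 f · 𝓕⁻ g / m_τ` on Schwartz functions. Two facts
about it are needed: a bound by norms of `L²(⟨x⟩ ^ η)`, `η > 1/2`, uniform in `τ` and explicit in
`r_{k,γ}`; and a Cauchy property as `τ` tends to zero from one side.

Uniform bound (`exists_enorm_integral_shell_le`). After rescaling by `2π` the symbol is `|ξ|² - ρ² +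
i (2 γ·ξ - τ)`. Where it is small, `|ξ|` is comparable to `ρ`, hence so is some coordinate `ξ_j`. As
a polynomial in `ξ_j` the symbol is `(ξ_j + i γ_j)² - A`, where `A` depends on the other coordinates
only and satisfies `|A| ≳ ρ²` in that region. Partial fractions produce two Cauchy kernels divided
by `2 √A`. A Cauchy kernel with a cutoff at scale `ρ` is a multiplier from `L¹` to `L^∞` in `x_j`,
with a bound that does not see the position of the pole (`norm_integral_fourier_mul_div_sub_le`);
`L¹` in `x_j` is controlled by the weighted `L²` norm because `⟨t⟩ ^ (-η)` is square integrable on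
the line; Plancherel treats the other variables. Away from the zeros `|m| ≳ ρ²`, and Plancherel
alone suffices. The resulting factor `ρ⁻¹ + ρ⁻²` is the origin of `1 / (min(r_{k,γ}, 1) r_{k,γ})`.

Cauchy property. For `γ ≠ 0` the zeros lie on a sphere intersected with a hyperplane, and
`|m|^(-9/8)` is locally integrable uniformly in `τ` (`exists_setLIntegral_shellSymbol_le`), so the
form is Hölder continuous of order `1/8` in `τ`. For `γ = 0` the `τ`-derivative contains `m⁻²`;
integration by parts along a field transversal to the sphere leads back to the uniform bound with
one more power of the weight (`exists_enorm_integral_div_sq_le`), so the form is Lipschitz on each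
side of zero. Both statements use strong weights. Splitting functions into a near and a far part in
space (`exists_enorm_le_of_interpolation`) combines them with the uniform bound at a slightly
smaller weight and gives the Cauchy property for every `η > 1/2`; the limit form is provided by
`exists_faddeevForm_limit`.

Passage to Sobolev spaces. The limit form extends by density to an operator from `L²(⟨x⟩ ^ η₀)` to
its dual that commutes with Fourier multipliers, so it acts block by block (`exists_lift`,
`exists_operator`). On blocks with `2 ^ j ≥ 2 r_{k,γ}`, apart from the two lowest, `|m| ≳ 4 ^ j`;
the gain `4 ^ (-j)` pays for `2 ^ (j s)` because `s ≤ 2`. On the remaining blocks `2 ^ (j - 1) ≤ 1 +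
r_{k,γ}`, which produces the factor `(1 + r_{k,γ}) ^ s`. The power `λ ^ (-2η)` comes from comparing
the rescaled weight with the unscaled one in the source and in the target. The inversion formulas
are the limit of the identity `m_0 = m_τ + i τ`. Uniqueness holds since on Schwartz functions every
limit is given by the same limit of integrals, and Schwartz functions are dense. -/

theorem exists_inv_sub_eq_setIntegral_exp {w : ℂ} (hw : w.im ≠ 0) :
    ∃ (S : Set ℝ) (c : ℂ), MeasurableSet S ∧ ‖c‖ = 2 * Real.pi ∧
      IntegrableOn (fun s : ℝ => Complex.exp (2 * Real.pi * Complex.I * w * s)) S ∧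
      (∀ s ∈ S, ‖Complex.exp (2 * Real.pi * Complex.I * w * s)‖ ≤ 1) ∧
      ∀ t : ℝ, ((t : ℂ) - w)⁻¹ = c * ∫ s in S,
        Complex.exp (2 * Real.pi * Complex.I * w * s) *
          Complex.exp (-(2 * Real.pi * Complex.I * t * s)) := by
  have hpi := Real.pi_pos
  have hne : ∀ t : ℝ, (t : ℂ) - w ≠ 0 := fun t h => hw (by
    have := congrArg Complex.im h
    simpa using this)
  have hexp : ∀ t s : ℝ, Complex.exp (2 * Real.pi * Complex.I * w * s) *
      Complex.exp (-(2 * Real.pi * Complex.I * t * s)) =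
        Complex.exp ((2 * Real.pi * Complex.I * (w - t)) * s) := fun t s => by
    rw [← Complex.exp_add]
    ring_nf
  have hnorm : ∀ s : ℝ, ‖Complex.exp (2 * Real.pi * Complex.I * w * s)‖ =
      Real.exp (-(2 * Real.pi * w.im * s)) := fun s => by
    rw [Complex.norm_exp]
    simp
  have hre : ∀ t : ℝ, (2 * Real.pi * Complex.I * (w - t)).re = -(2 * Real.pi * w.im) := fun t => by
    simp
  have hre0 : (2 * Real.pi * Complex.I * w).re = -(2 * Real.pi * w.im) := by
    simp
  -- The exponential decays on the half-line where `s` has the sign of `Im w`. On either half-line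
  -- it is bounded by one and the prefactor has modulus `2π`, whatever the distance of `w` from the
  -- real line.
  rcases lt_or_gt_of_ne hw with h | h
  · refine ⟨Iic 0, -(2 * Real.pi * Complex.I), measurableSet_Iic, ?_, ?_, ?_, ?_⟩
    · simp [abs_of_pos hpi]
    · exact integrableOn_exp_mul_complex_Iic (by rw [hre0]; nlinarith) 0
    · intro s hs
      rw [hnorm, Real.exp_le_one_iff]
      have hs' : s ≤ 0 := hs
      nlinarith [mul_nonneg_of_nonpos_of_nonpos h.le hs', mul_pos hpi hpi]
    · intro t
      simp_rw [hexp]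
      rw [integral_exp_mul_complex_Iic (by rw [hre]; nlinarith)]
      have h1 : (w - t) ≠ 0 := by
        rw [← neg_sub]; exact neg_ne_zero.2 (hne t)
      have := hne t
      have hpi' : (Real.pi : ℂ) ≠ 0 := by exact_mod_cast hpi.ne'
      field_simp
      simp
  · refine ⟨Ioi 0, 2 * Real.pi * Complex.I, measurableSet_Ioi, ?_, ?_, ?_, ?_⟩
    · simp [abs_of_pos hpi]
    · exact integrableOn_exp_mul_complex_Ioi (by rw [hre0]; nlinarith) 0
    · intro s hs
      rw [hnorm, Real.exp_le_one_iff]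
      have hs' : 0 < s := hs
      nlinarith [mul_pos h hs', mul_pos hpi (mul_pos h hs')]
    · intro t
      simp_rw [hexp]
      rw [integral_exp_mul_complex_Ioi (by rw [hre]; nlinarith)]
      have h1 : (w - t) ≠ 0 := by
        rw [← neg_sub]; exact neg_ne_zero.2 (hne t)
      have := hne t
      have hpi' : (Real.pi : ℂ) ≠ 0 := by exact_mod_cast hpi.ne'
      field_simp
      simp

theorem fourier_real_eq_integral_mul (f : ℝ → ℂ) (x : ℝ) :
    𝓕 f x = ∫ t : ℝ, Complex.exp (-(2 * Real.pi * Complex.I * t * x)) * f t := by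
  rw [Real.fourier_real_eq_integral_exp_smul]
  congr 1
  ext t
  rw [smul_eq_mul]
  congr 2
  push_cast
  ring

theorem fourierInv_real_eq_integral_mul (f : ℝ → ℂ) (x : ℝ) :
    𝓕⁻ f x = ∫ t : ℝ, Complex.exp (2 * Real.pi * Complex.I * t * x) * f t := by
  rw [Real.fourierInv_eq_fourier_neg, fourier_real_eq_integral_mul]
  congr 1
  ext t
  congr 2
  push_cast
  ring

theorem norm_exp_neg_two_pi_I_mul (t x : ℝ) :
    ‖Complex.exp (-(2 * Real.pi * Complex.I * t * x))‖ = 1 := by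
  rw [Complex.norm_exp]
  simp

/-- The Fourier transform of `V / (· - w)` is bounded by `2 π ‖𝓕 V‖_{L¹}`. -/
theorem norm_fourier_div_sub_le {V : ℝ → ℂ} (hV : Integrable V) (hFV : Integrable (𝓕 V)) {w : ℂ}
    (hw : w.im ≠ 0) (x : ℝ) :
    ‖𝓕 (fun t : ℝ => V t / ((t : ℂ) - w)) x‖ ≤ 2 * Real.pi * ∫ s, ‖𝓕 V s‖ := by
  obtain ⟨S, c, hS, hc, hint, hle, hinv⟩ := exists_inv_sub_eq_setIntegral_exp hw
  have hpi := Real.pi_pos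
  -- Fubini turns division by `t - w` into an average of translates of `𝓕 V` over a half-line, with
  -- weights of modulus at most one. Hence only the `L¹` norm of `𝓕 V` enters, not `w`.
  have h1 : 𝓕 (fun t : ℝ => V t / ((t : ℂ) - w)) x =
      c * ∫ s in S, Complex.exp (2 * Real.pi * Complex.I * w * s) * 𝓕 V (x + s) := by
    rw [fourier_real_eq_integral_mul]
    have h2 : ∀ t : ℝ, Complex.exp (-(2 * Real.pi * Complex.I * t * x)) * (V t / ((t : ℂ) - w)) =
        c * ∫ s in S, Complex.exp (2 * Real.pi * Complex.I * w * s) *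
          (Complex.exp (-(2 * Real.pi * Complex.I * t * (x + s : ℝ))) * V t) := by
      intro t
      rw [div_eq_mul_inv, hinv t, ← mul_assoc, mul_left_comm, ← integral_const_mul]
      congr 2
      ext s
      have : Complex.exp (-(2 * Real.pi * Complex.I * t * (x + s : ℝ))) =
          Complex.exp (-(2 * Real.pi * Complex.I * t * x)) *
            Complex.exp (-(2 * Real.pi * Complex.I * t * s)) := by
        rw [← Complex.exp_add]
        push_cast
        ring_nf
      rw [this]
      ring
    simp_rw [h2]
    rw [integral_const_mul]
    congr 1
    rw [integral_integral_swap]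
    · congr 1
      ext s
      rw [fourier_real_eq_integral_mul, ← integral_const_mul]
    · have h3 : Integrable (fun p : ℝ × ℝ => V p.1 *
          Complex.exp (2 * Real.pi * Complex.I * w * p.2)) (volume.prod (volume.restrict S)) :=
        hV.mul_prod hint
      refine (h3.bdd_mul (c := 1)
        (f := fun p : ℝ × ℝ => Complex.exp (-(2 * Real.pi * Complex.I * p.1 * (x + p.2 : ℝ)))) ?_
        (.of_forall fun p => (norm_exp_neg_two_pi_I_mul _ _).le)).congr
        (.of_forall fun p => ?_)
      · exact (by fun_prop : Continuous fun p : ℝ × ℝ =>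
          Complex.exp (-(2 * Real.pi * Complex.I * p.1 * (x + p.2 : ℝ)))).aestronglyMeasurable
      · simp only [Function.uncurry]
        ring
  rw [h1, norm_mul, hc]
  gcongr
  calc ‖∫ s in S, Complex.exp (2 * Real.pi * Complex.I * w * s) * 𝓕 V (x + s)‖
      ≤ ∫ s in S, ‖𝓕 V (x + s)‖ := by
        refine norm_integral_le_of_norm_le (hFV.comp_add_left x).norm.integrableOn ?_
        filter_upwards [ae_restrict_mem hS] with s hs
        rw [norm_mul]
        exact mul_le_of_le_one_left (norm_nonneg _) (hle s hs)
    _ ≤ ∫ s, ‖𝓕 V (x + s)‖ := setIntegral_le_integral (hFV.comp_add_left x).norm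
        (.of_forall fun _ => norm_nonneg _)
    _ = ∫ s, ‖𝓕 V s‖ := integral_add_left_eq_self (fun s => ‖𝓕 V s‖) x

/-- Unfolding both Fourier integrals rewrites the form as `∬ a(x) b(y) 𝓕 K(x - y)`, so only the
supremum of `𝓕 K` matters. -/
theorem norm_integral_fourier_mul_le {a b K : ℝ → ℂ} (ha : Integrable a) (hb : Integrable b)
    (hK : Integrable K) {C : ℝ} (hC : ∀ x, ‖𝓕 K x‖ ≤ C) :
    ‖∫ t, 𝓕 a t * 𝓕⁻ b t * K t‖ ≤ C * ((∫ x, ‖a x‖) * ∫ x, ‖b x‖) := by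
  have h1 : ∀ t : ℝ, 𝓕 a t * 𝓕⁻ b t * K t = ∫ p : ℝ × ℝ, a p.1 * b p.2 *
      (Complex.exp (-(2 * Real.pi * Complex.I * t * (p.1 - p.2 : ℝ))) * K t) := by
    intro t
    have h2 : ∀ p : ℝ × ℝ, a p.1 * b p.2 *
        (Complex.exp (-(2 * Real.pi * Complex.I * t * (p.1 - p.2 : ℝ))) * K t) =
        (Complex.exp (-(2 * Real.pi * Complex.I * p.1 * t)) * a p.1) *
          (Complex.exp (2 * Real.pi * Complex.I * p.2 * t) * b p.2) * K t := by
      intro p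
      have : Complex.exp (-(2 * Real.pi * Complex.I * t * (p.1 - p.2 : ℝ))) =
          Complex.exp (-(2 * Real.pi * Complex.I * p.1 * t)) *
            Complex.exp (2 * Real.pi * Complex.I * p.2 * t) := by
        rw [← Complex.exp_add]
        push_cast
        ring_nf
      rw [this]
      ring
    simp_rw [h2]
    rw [integral_mul_const, Measure.volume_eq_prod, integral_prod_mul
      (fun x : ℝ => Complex.exp (-(2 * Real.pi * Complex.I * x * t)) * a x)
      (fun y : ℝ => Complex.exp (2 * Real.pi * Complex.I * y * t) * b y),
      ← fourier_real_eq_integral_mul, ← fourierInv_real_eq_integral_mul]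
  have hab : Integrable (fun p : ℝ × ℝ => a p.1 * b p.2) := ha.mul_prod hb
  simp_rw [h1]
  rw [integral_integral_swap]
  · simp_rw [integral_const_mul]
    simp_rw [← fourier_real_eq_integral_mul]
    calc ‖∫ p : ℝ × ℝ, a p.1 * b p.2 * 𝓕 K (p.1 - p.2)‖
        ≤ ∫ p : ℝ × ℝ, C * (‖a p.1‖ * ‖b p.2‖) := by
          refine norm_integral_le_of_norm_le ((ha.norm.mul_prod hb.norm).const_mul C)
            (.of_forall fun p => ?_)
          rw [norm_mul, norm_mul, mul_comm C]
          gcongr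
          exact hC _
      _ = _ := by
          rw [integral_const_mul, Measure.volume_eq_prod,
            integral_prod_mul (fun x => ‖a x‖) (fun x => ‖b x‖)]
  · refine ((hK.mul_prod hab).bdd_mul (c := 1)
        (f := fun q : ℝ × (ℝ × ℝ) =>
          Complex.exp (-(2 * Real.pi * Complex.I * q.1 * (q.2.1 - q.2.2 : ℝ)))) ?_
        (.of_forall fun p => (norm_exp_neg_two_pi_I_mul _ _).le)).congr
        (.of_forall fun p => ?_)
    · exact (by fun_prop : Continuous fun q : ℝ × (ℝ × ℝ) =>
          Complex.exp (-(2 * Real.pi * Complex.I * q.1 * (q.2.1 - q.2.2 : ℝ)))).aestronglyMeasurable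
    · simp only [Function.uncurry]
      ring

theorem integrable_div_sub {V : ℝ → ℂ} (hV : Integrable V) {w : ℂ} (hw : w.im ≠ 0) :
    Integrable (fun t : ℝ => V t / ((t : ℂ) - w)) := by
  have hne : ∀ t : ℝ, (t : ℂ) - w ≠ 0 := fun t h => hw (by
    have := congrArg Complex.im h
    simpa using this)
  have h := hV.bdd_mul (c := |w.im|⁻¹) (f := fun t : ℝ => ((t : ℂ) - w)⁻¹)
    (Continuous.aestronglyMeasurable (by
      exact Continuous.inv₀ (by fun_prop) hne)) (.of_forall fun t => by
      rw [norm_inv]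
      gcongr
      simpa using Complex.abs_im_le_norm ((t : ℂ) - w))
  refine h.congr (.of_forall fun t => ?_)
  simp only
  rw [div_eq_mul_inv, mul_comm]

/-- Cauchy multipliers are bounded from `L¹` to `L^∞`, also for poles on the real line as long as
the integral converges. -/
theorem norm_integral_fourier_mul_div_sub_le {a b V : ℝ → ℂ} (ha : Integrable a)
    (hb : Integrable b) (hV : Integrable V) (hFV : Integrable (𝓕 V)) (w : ℂ)
    (hint : Integrable fun t : ℝ => 𝓕 a t * 𝓕⁻ b t * (V t / ((t : ℂ) - w))) :
    ‖∫ t : ℝ, 𝓕 a t * 𝓕⁻ b t * (V t / ((t : ℂ) - w))‖ ≤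
      2 * Real.pi * (∫ s, ‖𝓕 V s‖) * ((∫ x, ‖a x‖) * ∫ x, ‖b x‖) := by
  by_cases hw : w.im ≠ 0
  · exact norm_integral_fourier_mul_le ha hb (integrable_div_sub hV hw)
      fun x => norm_fourier_div_sub_le hV hFV hw x
  push Not at hw
  -- A real pole is approached from the upper half-plane. Moving it vertically only increases `|t -
  -- w|`, so the original integrand, integrable by assumption, dominates.
  set wn : ℕ → ℂ := fun n => w + Complex.I * ((1 / ((n : ℝ) + 1) : ℝ) : ℂ) with hwn
  have him : ∀ n, (wn n).im = 1 / ((n : ℝ) + 1) := fun n => by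
    simp only [hwn, Complex.add_im, hw, Complex.I_mul_im, Complex.ofReal_re, zero_add]
  have hwn0 : ∀ n, (wn n).im ≠ 0 := fun n => by rw [him]; positivity
  have hlim : Tendsto wn atTop (𝓝 w) := by
    have h0 : Tendsto (fun n : ℕ => ((1 / ((n : ℝ) + 1) : ℝ) : ℂ)) atTop (𝓝 ((0 : ℝ) : ℂ)) :=
      (Complex.continuous_ofReal.tendsto _).comp tendsto_one_div_add_atTop_nhds_zero_nat
    simpa [hwn] using (h0.const_mul Complex.I).const_add w
  have hT : Tendsto (fun n => ∫ t : ℝ, 𝓕 a t * 𝓕⁻ b t * (V t / ((t : ℂ) - wn n))) atTop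
      (𝓝 (∫ t : ℝ, 𝓕 a t * 𝓕⁻ b t * (V t / ((t : ℂ) - w)))) := by
    have hnull : ∀ᵐ t : ℝ, t ≠ w.re := by
      simp [ae_iff]
    refine tendsto_integral_of_dominated_convergence _ (fun n => ?_) hint.norm
      (fun n => ?_) ?_
    · have h1 := VectorFourier.fourierIntegral_continuous (L := innerₗ ℝ) (μ := volume)
        Real.continuous_fourierChar continuous_inner ha
      have h1 : Continuous (𝓕 a) := h1
      have h2 : Continuous (𝓕⁻ b) := by
        have h3 : Continuous (𝓕 b) := VectorFourier.fourierIntegral_continuous (L := innerₗ ℝ)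
          (μ := volume) Real.continuous_fourierChar continuous_inner hb
        have : 𝓕⁻ b = fun x => 𝓕 b (-x) := by
          ext x
          exact Real.fourierInv_eq_fourier_neg b x
        rw [this]
        fun_prop
      exact (h1.mul h2).aestronglyMeasurable.mul (integrable_div_sub hV (hwn0 n)).1
    · filter_upwards [hnull] with t ht
      rw [norm_mul, norm_mul (𝓕 a t * 𝓕⁻ b t), norm_div, norm_div]
      have h0 : 0 < ‖(t : ℂ) - w‖ := by
        rw [norm_pos_iff]
        intro h
        apply ht
        have := congrArg Complex.re h
        simp at this
        linarith
      gcongr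
      have h1 : (t : ℂ) - w = ((t - w.re : ℝ) : ℂ) := by
        apply Complex.ext <;> simp [hw]
      have h2 : ((t : ℂ) - wn n).re = t - w.re := by simp [hwn]
      rw [h1, Complex.norm_real, Real.norm_eq_abs, ← h2]
      exact Complex.abs_re_le_norm _
    · filter_upwards [hnull] with t ht
      have h0 : (t : ℂ) - w ≠ 0 := by
        intro h
        apply ht
        have := congrArg Complex.re h
        simp at this
        linarith
      exact (Tendsto.div tendsto_const_nhds (hlim.const_sub _) h0).const_mul _
  refine le_of_tendsto hT.norm (.of_forall fun n => ?_)
  exact norm_integral_fourier_mul_le ha hb (integrable_div_sub hV (hwn0 n))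
    fun x => norm_fourier_div_sub_le hV hFV (hwn0 n) x

/-! ### Splitting off one coordinate -/

variable {n : ℕ}

/-- The point of `ℝⁿ⁺¹` with `j`-th coordinate `t` and the other coordinates given by `y`. -/
def glue (j : Fin (n + 1)) (t : ℝ) (y : Eucl n) : Eucl (n + 1) :=
  WithLp.toLp 2 (j.insertNth t (WithLp.ofLp y) : Fin (n + 1) → ℝ)

@[simp] theorem glue_same (j : Fin (n + 1)) (t : ℝ) (y : Eucl n) : glue j t y j = t := by
  simp [glue]

@[simp] theorem glue_succAbove (j : Fin (n + 1)) (t : ℝ) (y : Eucl n) (i : Fin n) :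
    glue j t y (j.succAbove i) = y i := by
  simp [glue]

theorem inner_glue (j : Fin (n + 1)) (t s : ℝ) (y z : Eucl n) :
    ⟪glue j t y, glue j s z⟫ = t * s + ⟪y, z⟫ := by
  simp only [PiLp.inner_apply, Fin.sum_univ_succAbove _ j, glue_same, glue_succAbove]
  simp [mul_comm]

theorem inner_glue' (j : Fin (n + 1)) (γ : Eucl (n + 1)) (s : ℝ) (z : Eucl n) :
    ⟪γ, glue j s z⟫ = γ j * s + ∑ i, γ (j.succAbove i) * z i := by
  simp only [PiLp.inner_apply, Fin.sum_univ_succAbove _ j, glue_same, glue_succAbove]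
  simp [mul_comm]

theorem norm_glue_sq (j : Fin (n + 1)) (t : ℝ) (y : Eucl n) :
    ‖glue j t y‖ ^ 2 = t ^ 2 + ‖y‖ ^ 2 := by
  rw [← real_inner_self_eq_norm_sq, inner_glue, real_inner_self_eq_norm_sq]
  ring

theorem glue_neg (j : Fin (n + 1)) (t : ℝ) (y : Eucl n) :
    glue j (-t) (-y) = -glue j t y := by
  ext i
  rcases j.eq_self_or_eq_succAbove i with rfl | ⟨k, rfl⟩ <;> simp

theorem glue_add_eq (j : Fin (n + 1)) (t : ℝ) (y : Eucl n) :
    glue j t y = glue j 0 y + t • EuclideanSpace.single j (1 : ℝ) := by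
  ext i
  rcases j.eq_self_or_eq_succAbove i with rfl | ⟨k, rfl⟩ <;> simp

/-- The linear isometry `y ↦ (0, y)`. -/
def glueZero (j : Fin (n + 1)) : Eucl n →ₗᵢ[ℝ] Eucl (n + 1) where
  toFun y := glue j 0 y
  map_add' y z := by
    ext i
    rcases j.eq_self_or_eq_succAbove i with rfl | ⟨k, rfl⟩ <;> simp
  map_smul' c y := by
    ext i
    rcases j.eq_self_or_eq_succAbove i with rfl | ⟨k, rfl⟩ <;> simp
  norm_map' y := by
    have h := norm_glue_sq j 0 y
    rw [zero_pow two_ne_zero, zero_add] at h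
    exact (pow_left_inj₀ (norm_nonneg _) (norm_nonneg _) two_ne_zero).1 h

theorem glue_eq_glueZero_add (j : Fin (n + 1)) (t : ℝ) (y : Eucl n) :
    glue j t y = glueZero j y + t • EuclideanSpace.single j (1 : ℝ) := glue_add_eq j t y

theorem continuous_glue (j : Fin (n + 1)) :
    Continuous fun p : ℝ × Eucl n => glue j p.1 p.2 := by
  simp_rw [glue_eq_glueZero_add]
  exact ((glueZero j).continuous.comp continuous_snd).add (continuous_fst.smul continuous_const)

/-- `glue` as a measurable equivalence. -/
def glueEquiv (j : Fin (n + 1)) : ℝ × Eucl n ≃ᵐ Eucl (n + 1) :=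
  ((MeasurableEquiv.prodCongr (MeasurableEquiv.refl ℝ)
    (MeasurableEquiv.toLp 2 (Fin n → ℝ)).symm).trans
    (MeasurableEquiv.piFinSuccAbove (fun _ : Fin (n + 1) => ℝ) j).symm).trans
      (MeasurableEquiv.toLp 2 (Fin (n + 1) → ℝ))

theorem measurePreserving_glueEquiv (j : Fin (n + 1)) :
    MeasurePreserving (glueEquiv j) (volume.prod volume) volume := by
  have h1 : MeasurePreserving (MeasurableEquiv.prodCongr (MeasurableEquiv.refl ℝ)
      (MeasurableEquiv.toLp 2 (Fin n → ℝ)).symm) (volume.prod volume) (volume.prod volume) :=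
    (MeasurePreserving.id volume).prod
      (EuclideanSpace.volume_preserving_symm_measurableEquiv_toLp (Fin n))
  have h2 := (volume_preserving_piFinSuccAbove (fun _ : Fin (n + 1) => ℝ) j).symm
  have h3 := (EuclideanSpace.volume_preserving_symm_measurableEquiv_toLp (Fin (n + 1))).symm
  exact (h3.comp h2).comp h1

theorem lintegral_glue (j : Fin (n + 1)) {F : Eucl (n + 1) → ℝ≥0∞} (hF : AEMeasurable F) :
    ∫⁻ ξ, F ξ = ∫⁻ y : Eucl n, ∫⁻ t : ℝ, F (glue j t y) := by
  have h := measurePreserving_glueEquiv j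
  rw [← h.lintegral_comp_emb (glueEquiv j).measurableEmbedding, lintegral_prod_symm]
  · rfl
  · exact hF.comp_quasiMeasurePreserving h.quasiMeasurePreserving

theorem lintegral_glue' (j : Fin (n + 1)) {F : Eucl (n + 1) → ℝ≥0∞} (hF : AEMeasurable F) :
    ∫⁻ ξ, F ξ = ∫⁻ t : ℝ, ∫⁻ y : Eucl n, F (glue j t y) := by
  have h := measurePreserving_glueEquiv j
  rw [← h.lintegral_comp_emb (glueEquiv j).measurableEmbedding, lintegral_prod]
  · rfl
  · exact hF.comp_quasiMeasurePreserving h.quasiMeasurePreserving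

theorem integrable_glue (j : Fin (n + 1)) {F : Eucl (n + 1) → ℂ} (hF : Integrable F) :
    Integrable (fun p : ℝ × Eucl n => F (glue j p.1 p.2)) (volume.prod volume) :=
  (measurePreserving_glueEquiv j).integrable_comp_of_integrable hF

theorem integral_glue (j : Fin (n + 1)) {F : Eucl (n + 1) → ℂ} (hF : Integrable F) :
    ∫ ξ, F ξ = ∫ y : Eucl n, ∫ t : ℝ, F (glue j t y) := by
  have h := measurePreserving_glueEquiv j
  rw [← h.integral_comp (glueEquiv j).measurableEmbedding]
  exact integral_prod_symm _ (integrable_glue j hF)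

theorem integral_glue' (j : Fin (n + 1)) {F : Eucl (n + 1) → ℂ} (hF : Integrable F) :
    ∫ ξ, F ξ = ∫ t : ℝ, ∫ y : Eucl n, F (glue j t y) := by
  have h := measurePreserving_glueEquiv j
  rw [← h.integral_comp (glueEquiv j).measurableEmbedding]
  exact integral_prod _ (integrable_glue j hF)

theorem hasTemperateGrowth_glue (j : Fin (n + 1)) (t : ℝ) :
    (fun y : Eucl n => glue j t y).HasTemperateGrowth := by
  simp_rw [glue_eq_glueZero_add]
  exact ((glueZero j).toContinuousLinearMap.hasTemperateGrowth).add (.const _)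

theorem isometry_glue (j : Fin (n + 1)) (t : ℝ) : Isometry fun y : Eucl n => glue j t y := by
  simp_rw [glue_eq_glueZero_add]
  exact (IsometryEquiv.addRight (t • EuclideanSpace.single j (1 : ℝ))).isometry.comp
    (glueZero j).isometry

/-- The restriction of a Schwartz function to a hyperplane `{x_j = t}`. -/
def slice (j : Fin (n + 1)) (f : 𝓢(Eucl (n + 1), ℂ)) (t : ℝ) : 𝓢(Eucl n, ℂ) :=
  compCLMOfAntilipschitz ℂ (hasTemperateGrowth_glue j t) (isometry_glue j t).antilipschitz f

/-- The Fourier transform in all variables except the `j`-th one. -/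
def partialFourier (j : Fin (n + 1)) (f : 𝓢(Eucl (n + 1), ℂ)) (t : ℝ) (y : Eucl n) : ℂ :=
  𝓕 (slice j f t) y

theorem partialFourier_eq (j : Fin (n + 1)) (f : 𝓢(Eucl (n + 1), ℂ)) (t : ℝ) (y : Eucl n) :
    partialFourier j f t y =
      ∫ z : Eucl n, Complex.exp (↑(-2 * Real.pi * ⟪z, y⟫) * Complex.I) * f (glue j t z) := by
  rw [partialFourier, fourier_coe, Real.fourier_eq']
  rfl

theorem stronglyMeasurable_partialFourier (j : Fin (n + 1)) (f : 𝓢(Eucl (n + 1), ℂ)) :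
    StronglyMeasurable fun p : ℝ × Eucl n => partialFourier j f p.1 p.2 := by
  simp_rw [partialFourier_eq]
  refine StronglyMeasurable.integral_prod_right' (f := fun q : (ℝ × Eucl n) × Eucl n =>
    Complex.exp (↑(-2 * Real.pi * ⟪q.2, q.1.2⟫) * Complex.I) * f (glue j q.1.1 q.2)) ?_
  have h : Continuous fun q : (ℝ × Eucl n) × Eucl n => glue j q.1.1 q.2 :=
    (continuous_glue j).comp (by fun_prop : Continuous fun q : (ℝ × Eucl n) × Eucl n =>
      (q.1.1, q.2))
  exact (Continuous.mul (by fun_prop) (f.continuous.comp h)).stronglyMeasurable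

theorem integrable_partialFourier (j : Fin (n + 1)) (f : 𝓢(Eucl (n + 1), ℂ)) (y : Eucl n) :
    Integrable fun t => partialFourier j f t y := by
  refine (integrable_glue j f.integrable).integral_norm_prod_left.mono'
    ((stronglyMeasurable_partialFourier j f).comp_measurable
      (measurable_id.prodMk measurable_const)).aestronglyMeasurable (.of_forall fun t => ?_)
  rw [partialFourier_eq]
  refine (norm_integral_le_integral_norm _).trans_eq (integral_congr_ae (.of_forall fun z => ?_))
  simp only [norm_mul, Complex.norm_exp_ofReal_mul_I, one_mul]

theorem fourier_glue (j : Fin (n + 1)) (f : 𝓢(Eucl (n + 1), ℂ)) (s : ℝ) (y : Eucl n) :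
    𝓕 f (glue j s y) = 𝓕 (fun t => partialFourier j f t y) s := by
  rw [fourier_coe, Real.fourier_eq', integral_glue' j, fourier_real_eq_integral_mul]
  · congr 1
    ext t
    rw [partialFourier_eq, ← integral_const_mul]
    congr 1
    ext z
    rw [inner_glue, ← mul_assoc, ← Complex.exp_add, smul_eq_mul]
    congr 2
    push_cast
    ring
  · refine (f.integrable (μ := volume)).bdd_mul (c := 1) ?_ (.of_forall fun x => ?_)
    · exact (by fun_prop : Continuous fun x : Eucl (n + 1) =>
        Complex.exp (↑(-2 * Real.pi * ⟪x, glue j s y⟫) * Complex.I)).aestronglyMeasurable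
    · rw [Complex.norm_exp_ofReal_mul_I]

theorem fourierInv_glue (j : Fin (n + 1)) (f : 𝓢(Eucl (n + 1), ℂ)) (s : ℝ) (y : Eucl n) :
    𝓕⁻ f (glue j s y) = 𝓕⁻ (fun t => partialFourier j f t (-y)) s := by
  rw [fourierInv_coe, Real.fourierInv_eq_fourier_neg, Real.fourierInv_eq_fourier_neg, ← glue_neg,
    ← fourier_glue, fourier_coe]

/-- Plancherel on each hyperplane `x_j = t`. -/
theorem lintegral_partialFourier_sq (j : Fin (n + 1)) (f : 𝓢(Eucl (n + 1), ℂ)) (t : ℝ) :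
    ∫⁻ y, ‖partialFourier j f t y‖ₑ ^ 2 = ∫⁻ y, ‖f (glue j t y)‖ₑ ^ 2 := by
  have key : ∀ g : 𝓢(Eucl n, ℂ), ∫⁻ y, ‖g y‖ₑ ^ 2 = ENNReal.ofReal (∫ y, ‖g y‖ ^ 2) := fun g => by
    rw [ofReal_integral_eq_lintegral_ofReal]
    · simp_rw [ENNReal.ofReal_pow (norm_nonneg _), ofReal_norm]
    · exact (memLp_two_iff_integrable_sq_norm g.continuous.aestronglyMeasurable).1
        (g.memLp 2 volume)
    · exact .of_forall fun _ => by positivity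
  unfold partialFourier
  rw [key, integral_norm_sq_fourier, ← key]
  rfl

variable {n : ℕ}

/-! ### Weighted norms of Schwartz functions -/

section Weights

variable {d : ℕ}

theorem hasTemperateGrowth_weight_real (η lam : ℝ) :
    (fun x : Eucl d => weight η lam x).HasTemperateGrowth := by
  have h := (Function.hasTemperateGrowth_one_add_norm_sq_rpow (Eucl d) (η / 2)).comp
    (lam • ContinuousLinearMap.id ℝ (Eucl d)).hasTemperateGrowth
  exact h

theorem hasTemperateGrowth_weight (η lam : ℝ) :
    (fun x : Eucl d => (weight η lam x : ℂ)).HasTemperateGrowth :=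
  Function.Complex.hasTemperateGrowth_ofReal.comp (hasTemperateGrowth_weight_real η lam)

theorem weight_pos (η lam : ℝ) (x : Eucl d) : 0 < weight η lam x := by
  unfold weight
  positivity

theorem weight_one (η : ℝ) (x : Eucl d) : weight η 1 x = (1 + ‖x‖ ^ 2) ^ (η / 2) := by
  rw [weight, one_smul]

/-- Multiplication with the weight `⟨x⟩ ^ η`, from Schwartz functions to `L²`. -/
def wL2 (η : ℝ) : 𝓢(Eucl d, ℂ) →L[ℂ] Lp ℂ 2 (volume : Measure (Eucl d)) :=
  toLpCLM ℂ ℂ 2 volume ∘L SchwartzMap.smulLeftCLM ℂ (fun x => (weight η 1 x : ℂ))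

theorem wL2_apply (η : ℝ) (f : 𝓢(Eucl d, ℂ)) :
    wL2 η f = (SchwartzMap.smulLeftCLM ℂ (fun x => (weight η 1 x : ℂ)) f).toLp 2 volume := rfl

theorem enorm_toLp_two_sq (f : 𝓢(Eucl d, ℂ)) :
    ‖f.toLp 2 volume‖ₑ ^ 2 = ∫⁻ x, ‖f x‖ₑ ^ 2 := by
  rw [Lp.enorm_def, eLpNorm_congr_ae (coeFn_toLp f 2 volume),
    eLpNorm_eq_lintegral_rpow_enorm_toReal (by norm_num) (by norm_num), ← ENNReal.rpow_natCast,
    ← ENNReal.rpow_mul]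
  norm_num

theorem enorm_wL2_sq (η : ℝ) (f : 𝓢(Eucl d, ℂ)) :
    ‖wL2 η f‖ₑ ^ 2 = ∫⁻ x, ENNReal.ofReal ((1 + ‖x‖ ^ 2) ^ η) * ‖f x‖ₑ ^ 2 := by
  rw [wL2_apply, enorm_toLp_two_sq]
  refine lintegral_congr fun x => ?_
  rw [SchwartzMap.smulLeftCLM_apply_apply (hasTemperateGrowth_weight η 1), smul_eq_mul, enorm_mul,
    mul_pow, weight_one]
  congr 1
  rw [← ofReal_norm, Complex.norm_real, Real.norm_of_nonneg (by positivity),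
    ← ENNReal.ofReal_pow (by positivity), ← Real.rpow_natCast, ← Real.rpow_mul (by positivity)]
  norm_num

theorem enorm_toLp_le_wL2 {η : ℝ} (hη : 0 ≤ η) (f : 𝓢(Eucl d, ℂ)) :
    ‖f.toLp 2 volume‖ₑ ≤ ‖wL2 η f‖ₑ := by
  rw [← ENNReal.pow_le_pow_left_iff two_ne_zero, enorm_toLp_two_sq, enorm_wL2_sq]
  refine lintegral_mono fun x => ?_
  calc ‖f x‖ₑ ^ 2 = 1 * ‖f x‖ₑ ^ 2 := (one_mul _).symm
    _ ≤ _ := by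
      gcongr
      rw [ENNReal.one_le_ofReal]
      exact Real.one_le_rpow (by nlinarith [norm_nonneg x]) hη

end Weights

theorem lintegral_mul_sq_le {α : Type*} [MeasurableSpace α] {μ : Measure α} {f g : α → ℝ≥0∞}
    (hf : AEMeasurable f μ) (hg : AEMeasurable g μ) :
    (∫⁻ a, f a * g a ∂μ) ^ 2 ≤ (∫⁻ a, f a ^ 2 ∂μ) * ∫⁻ a, g a ^ 2 ∂μ := by
  have h := ENNReal.lintegral_mul_le_Lp_mul_Lq μ Real.HolderConjugate.two_two hf hg
  calc (∫⁻ a, f a * g a ∂μ) ^ 2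
      ≤ ((∫⁻ a, f a ^ (2 : ℝ) ∂μ) ^ (1 / 2 : ℝ) * (∫⁻ a, g a ^ (2 : ℝ) ∂μ) ^ (1 / 2 : ℝ)) ^ 2 := by
        gcongr
        exact h
    _ = _ := by
        rw [mul_pow, ← ENNReal.rpow_natCast, ← ENNReal.rpow_mul, ← ENNReal.rpow_natCast,
          ← ENNReal.rpow_mul]
        norm_num

/-- The constant `‖⟨t⟩ ^ (-η)‖²` in `L²(ℝ)`. -/
def traceConst (η : ℝ) : ℝ≥0∞ := ∫⁻ t : ℝ, ENNReal.ofReal ((1 + t ^ 2) ^ (-η))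

/-- The threshold `η > 1/2` of the whole theory is this one-dimensional integrability. -/
theorem traceConst_lt_top {η : ℝ} (hη : 1 / 2 < η) : traceConst η < ⊤ := by
  have h := integrable_rpow_neg_one_add_norm_sq (E := ℝ) (μ := volume) (r := 2 * η)
    (by simpa using by linarith)
  have h2 := h.lintegral_lt_top
  unfold traceConst
  convert h2 using 5 with t
  · simp
  · ring

/-- The `L¹` norm in `x_j` of the partial Fourier transform. -/
def mixedNorm (j : Fin (n + 1)) (f : 𝓢(Eucl (n + 1), ℂ)) (y : Eucl n) : ℝ≥0∞ :=
  ∫⁻ t, ‖partialFourier j f t y‖ₑ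

theorem measurable_mixedNorm (j : Fin (n + 1)) (f : 𝓢(Eucl (n + 1), ℂ)) :
    Measurable (mixedNorm j f) :=
  Measurable.lintegral_prod_left' (f := fun p : ℝ × Eucl n => ‖partialFourier j f p.1 p.2‖ₑ)
    (stronglyMeasurable_partialFourier j f).enorm

/-- Cauchy-Schwarz after writing `F = ⟨t⟩ ^ (-η) · ⟨t⟩ ^ η F`. -/
theorem sq_lintegral_le_traceConst_mul (η : ℝ) {F : ℝ → ℝ≥0∞} (hF : Measurable F) :
    (∫⁻ t, F t) ^ 2 ≤ traceConst η * ∫⁻ t, ENNReal.ofReal ((1 + t ^ 2) ^ η) * F t ^ 2 := by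
  have hw : ∀ e : ℝ, Measurable fun t : ℝ => ENNReal.ofReal ((1 + t ^ 2) ^ e) := fun e => by
    fun_prop
  have h := lintegral_mul_sq_le (μ := volume)
    (f := fun t : ℝ => ENNReal.ofReal ((1 + t ^ 2) ^ (-η / 2)))
    (g := fun t : ℝ => ENNReal.ofReal ((1 + t ^ 2) ^ (η / 2)) * F t)
    (hw _).aemeasurable ((hw _).mul hF).aemeasurable
  have e1 : ∀ (e t : ℝ), ENNReal.ofReal ((1 + t ^ 2) ^ (e / 2)) ^ 2 =
      ENNReal.ofReal ((1 + t ^ 2) ^ e) := fun e t => by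
    rw [← ENNReal.ofReal_pow (by positivity), ← Real.rpow_natCast,
      ← Real.rpow_mul (by positivity)]
    norm_num
  have e2 : ∀ t : ℝ, ENNReal.ofReal ((1 + t ^ 2) ^ (-η / 2)) *
      (ENNReal.ofReal ((1 + t ^ 2) ^ (η / 2)) * F t) = F t := fun t => by
    rw [← mul_assoc, ← ENNReal.ofReal_mul (by positivity), ← Real.rpow_add (by positivity)]
    simp [neg_div]
  simp_rw [e2, mul_pow, e1] at h
  exact h

theorem measurable_weight_mul_partialFourier (η : ℝ) (j : Fin (n + 1))
    (f : 𝓢(Eucl (n + 1), ℂ)) : Measurable fun p : ℝ × Eucl n =>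
      ENNReal.ofReal ((1 + p.1 ^ 2) ^ η) * ‖partialFourier j f p.1 p.2‖ₑ ^ 2 := by
  have hw : Measurable fun t : ℝ => ENNReal.ofReal ((1 + t ^ 2) ^ η) := by fun_prop
  exact (hw.comp measurable_fst).mul ((stronglyMeasurable_partialFourier j f).enorm.pow_const 2)

theorem lintegral_weight_mul_partialFourier_le {η : ℝ} (hη : 0 ≤ η) (j : Fin (n + 1))
    (f : 𝓢(Eucl (n + 1), ℂ)) :
    ∫⁻ y, ∫⁻ t, ENNReal.ofReal ((1 + t ^ 2) ^ η) * ‖partialFourier j f t y‖ₑ ^ 2 ≤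
      ‖wL2 η f‖ₑ ^ 2 := by
  have hsw := lintegral_lintegral_swap (μ := (volume : Measure (Eucl n)))
    (ν := (volume : Measure ℝ)) (f := fun y t => ENNReal.ofReal ((1 + t ^ 2) ^ η) *
      ‖partialFourier j f t y‖ₑ ^ 2) ((measurable_weight_mul_partialFourier η j f).comp
        measurable_swap).aemeasurable
  rw [hsw, enorm_wL2_sq, lintegral_glue' j]
  · refine lintegral_mono fun t => ?_
    simp only
    rw [lintegral_const_mul' _ _ ENNReal.ofReal_ne_top, lintegral_partialFourier_sq,
      ← lintegral_const_mul' _ _ ENNReal.ofReal_ne_top]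
    refine lintegral_mono fun y => ?_
    have h1 : 1 + t ^ 2 ≤ 1 + ‖glue j t y‖ ^ 2 := by
      rw [norm_glue_sq]
      nlinarith [sq_nonneg ‖y‖]
    exact mul_le_mul' (ENNReal.ofReal_le_ofReal
      (Real.rpow_le_rpow (by positivity) h1 hη)) le_rfl
  · have h1 : Continuous fun x : Eucl (n + 1) => (1 + ‖x‖ ^ 2) ^ η :=
      Continuous.rpow_const (by fun_prop) fun x => Or.inl (by positivity)
    exact (h1.measurable.ennreal_ofReal.mul
      (f.continuous.measurable.enorm.pow_const 2)).aemeasurable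

theorem lintegral_mixedNorm_sq_le {η : ℝ} (hη : 0 ≤ η) (j : Fin (n + 1))
    (f : 𝓢(Eucl (n + 1), ℂ)) :
    ∫⁻ y, mixedNorm j f y ^ 2 ≤ traceConst η * ‖wL2 η f‖ₑ ^ 2 := by
  have hm : ∀ y, Measurable fun t => ‖partialFourier j f t y‖ₑ := fun y =>
    ((stronglyMeasurable_partialFourier j f).comp_measurable
      (measurable_id.prodMk measurable_const)).enorm
  set G : Eucl n → ℝ≥0∞ := fun y => ∫⁻ t, ENNReal.ofReal ((1 + t ^ 2) ^ η) *
    ‖partialFourier j f t y‖ₑ ^ 2 with hG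
  have hGm : Measurable G := Measurable.lintegral_prod_left' (μ := (volume : Measure ℝ))
    (measurable_weight_mul_partialFourier η j f)
  have h1 : ∀ y, mixedNorm j f y ^ 2 ≤ traceConst η * G y := fun y =>
    sq_lintegral_le_traceConst_mul η (hm y)
  calc ∫⁻ y, mixedNorm j f y ^ 2 ≤ ∫⁻ y, traceConst η * G y := lintegral_mono h1
    _ = traceConst η * ∫⁻ y, G y := lintegral_const_mul _ hGm
    _ ≤ _ := by
        have := lintegral_weight_mul_partialFourier_le hη j f
        gcongr

/-- This is what remains of the bilinear form once the variable `x_j` has been estimated from `L¹`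
to `L^∞`. The reflection `-y` in the second factor comes from `𝓕⁻`, see `fourierInv_glue`. -/
theorem lintegral_mixedNorm_mul_le {η : ℝ} (hη : 0 ≤ η) (j : Fin (n + 1))
    (f g : 𝓢(Eucl (n + 1), ℂ)) :
    ∫⁻ y, mixedNorm j f y * mixedNorm j g (-y) ≤ traceConst η * (‖wL2 η f‖ₑ * ‖wL2 η g‖ₑ) := by
  rw [← ENNReal.pow_le_pow_left_iff two_ne_zero]
  refine (lintegral_mul_sq_le (measurable_mixedNorm j f).aemeasurable
    ((measurable_mixedNorm j g).comp measurable_neg).aemeasurable).trans ?_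
  have h : ∫⁻ y, mixedNorm j g (-y) ^ 2 = ∫⁻ y, mixedNorm j g y ^ 2 :=
    lintegral_neg_eq_self (fun y => mixedNorm j g y ^ 2)
  calc _ ≤ (traceConst η * ‖wL2 η f‖ₑ ^ 2) * (traceConst η * ‖wL2 η g‖ₑ ^ 2) := by
        simp only [Function.comp_def]
        rw [h]
        exact mul_le_mul' (lintegral_mixedNorm_sq_le hη j f) (lintegral_mixedNorm_sq_le hη j g)
    _ = _ := by ring

variable {n : ℕ}

/-! ### The uniform bound for the bilinear form -/

/-- A smooth cutoff, equal to `1` for `2 κ ≤ |s| ≤ 2` and supported in `κ ≤ |s| ≤ 3`. -/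
def annulusCutoff (κ : ℝ) (hκ : 0 < κ) (s : ℝ) : ℝ :=
  (⟨2, 3, by norm_num, by norm_num⟩ : ContDiffBump (0 : ℝ)) s -
    (⟨κ, 2 * κ, hκ, by linarith⟩ : ContDiffBump (0 : ℝ)) s

section AnnulusCutoff

variable {κ : ℝ} (hκ : 0 < κ)

theorem contDiff_annulusCutoff : ContDiff ℝ ∞ (annulusCutoff κ hκ) :=
  (ContDiffBump.contDiff _).sub (ContDiffBump.contDiff _)

theorem annulusCutoff_nonneg (hκ1 : κ < 1) (s : ℝ) : 0 ≤ annulusCutoff κ hκ s := by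
  unfold annulusCutoff
  rw [sub_nonneg]
  rcases le_or_gt |s| 2 with h | h
  · rw [ContDiffBump.one_of_mem_closedBall ⟨2, 3, by norm_num, by norm_num⟩
      (by simpa using h)]
    exact ContDiffBump.le_one _
  · rw [ContDiffBump.zero_of_le_dist ⟨κ, 2 * κ, hκ, by linarith⟩ (by simp; linarith)]
    exact ContDiffBump.nonneg _

theorem annulusCutoff_le_one (s : ℝ) : annulusCutoff κ hκ s ≤ 1 := by
  unfold annulusCutoff
  linarith [ContDiffBump.le_one (⟨2, 3, by norm_num, by norm_num⟩ : ContDiffBump (0 : ℝ)) (x := s),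
    ContDiffBump.nonneg (⟨κ, 2 * κ, hκ, by linarith⟩ : ContDiffBump (0 : ℝ)) (x := s)]

theorem annulusCutoff_eq_one {s : ℝ} (h1 : 2 * κ ≤ |s|) (h2 : |s| ≤ 2) :
    annulusCutoff κ hκ s = 1 := by
  unfold annulusCutoff
  rw [ContDiffBump.one_of_mem_closedBall ⟨2, 3, by norm_num, by norm_num⟩
      (by simpa using h2), ContDiffBump.zero_of_le_dist ⟨κ, 2 * κ, hκ, by linarith⟩
      (by simpa using h1)]
  simp

theorem le_abs_of_annulusCutoff_ne_zero (hκ1 : κ < 1) {s : ℝ} (h : annulusCutoff κ hκ s ≠ 0) :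
    κ ≤ |s| := by
  by_contra! hs
  apply h
  unfold annulusCutoff
  rw [ContDiffBump.one_of_mem_closedBall ⟨2, 3, by norm_num, by norm_num⟩
      (by simp; linarith), ContDiffBump.one_of_mem_closedBall ⟨κ, 2 * κ, hκ, by linarith⟩
      (by simp; linarith)]
  simp

theorem abs_le_of_annulusCutoff_ne_zero (hκ1 : κ < 1) {s : ℝ} (h : annulusCutoff κ hκ s ≠ 0) :
    |s| ≤ 3 := by
  by_contra! hs
  apply h
  unfold annulusCutoff
  rw [ContDiffBump.zero_of_le_dist ⟨2, 3, by norm_num, by norm_num⟩ (by simp; linarith),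
    ContDiffBump.zero_of_le_dist ⟨κ, 2 * κ, hκ, by linarith⟩ (by simp; linarith)]
  simp

theorem hasCompactSupport_annulusCutoff : HasCompactSupport (annulusCutoff κ hκ) :=
  (ContDiffBump.hasCompactSupport _).sub (ContDiffBump.hasCompactSupport _)

/-- The cutoff as a Schwartz function. -/
def annulusSchwartz : 𝓢(ℝ, ℂ) :=
  HasCompactSupport.toSchwartzMap (f := fun s => (annulusCutoff κ hκ s : ℂ))
    ((hasCompactSupport_annulusCutoff hκ).comp_left Complex.ofReal_zero)
    (Complex.ofRealCLM.contDiff.comp (contDiff_annulusCutoff hκ))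

theorem annulusSchwartz_apply (s : ℝ) : annulusSchwartz hκ s = (annulusCutoff κ hκ s : ℂ) := rfl

/-- The `L¹` norm of the Fourier transform of the cutoff. -/
def annulusConst : ℝ := ∫ s, ‖𝓕 (annulusSchwartz hκ) s‖

theorem annulusConst_nonneg : 0 ≤ annulusConst hκ := integral_nonneg fun _ => norm_nonneg _

theorem integrable_annulus_scaled {ρ : ℝ} (hρ : 0 < ρ) :
    Integrable fun t : ℝ => (annulusCutoff κ hκ (t / ρ) : ℂ) :=
  ((annulusSchwartz hκ).integrable (μ := volume)).comp_div hρ.ne'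

theorem fourier_annulus_scaled {ρ : ℝ} (hρ : 0 < ρ) (s : ℝ) :
    𝓕 (fun t : ℝ => (annulusCutoff κ hκ (t / ρ) : ℂ)) s = ρ * 𝓕 (annulusSchwartz hκ) (s * ρ) := by
  rw [fourier_coe, fourier_real_eq_integral_mul, fourier_real_eq_integral_mul]
  have h := Measure.integral_comp_div (fun u : ℝ =>
    Complex.exp (-(2 * Real.pi * Complex.I * u * (s * ρ : ℝ))) * annulusSchwartz hκ u) ρ
  rw [abs_of_pos hρ, Complex.real_smul] at h
  rw [← h]
  congr 1
  ext t
  rw [annulusSchwartz_apply]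
  congr 3
  push_cast
  have : (ρ : ℂ) ≠ 0 := by exact_mod_cast hρ.ne'
  field_simp

theorem integrable_fourier_annulus_scaled {ρ : ℝ} (hρ : 0 < ρ) :
    Integrable (𝓕 (fun t : ℝ => (annulusCutoff κ hκ (t / ρ) : ℂ))) := by
  have h : 𝓕 (fun t : ℝ => (annulusCutoff κ hκ (t / ρ) : ℂ)) =
      fun s => ρ * 𝓕 (annulusSchwartz hκ) (s * ρ) := funext fun s => fourier_annulus_scaled hκ hρ s
  rw [h]
  exact (((𝓕 (annulusSchwartz hκ)).integrable (μ := volume)).comp_mul_right' hρ.ne').const_mul _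

/-- The `L¹` norm of a Fourier transform is invariant under dilation of the function. So the Cauchy
estimate has no dependence on the radius; `ρ` will enter only through the discriminant. -/
theorem integral_norm_fourier_annulus_scaled {ρ : ℝ} (hρ : 0 < ρ) :
    ∫ s, ‖𝓕 (fun t : ℝ => (annulusCutoff κ hκ (t / ρ) : ℂ)) s‖ = annulusConst hκ := by
  simp_rw [fourier_annulus_scaled hκ hρ, norm_mul, Complex.norm_real, Real.norm_of_nonneg hρ.le]
  rw [integral_const_mul, Measure.integral_comp_mul_right
    (fun s => ‖𝓕 (annulusSchwartz hκ) s‖) ρ, abs_of_pos (by positivity), smul_eq_mul, annulusConst]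
  field_simp

end AnnulusCutoff

/-- The symbol `|ξ|² - ρ² + 2 i γ·ξ - i τ`. -/
def shellSymbol {d : ℕ} (ρ : ℝ) (γ : Eucl d) (τ : ℝ) (ξ : Eucl d) : ℂ :=
  ((‖ξ‖ ^ 2 - ρ ^ 2 : ℝ) : ℂ) + Complex.I * ((2 * ⟪γ, ξ⟫ - τ : ℝ) : ℂ)

theorem continuous_shellSymbol {d : ℕ} (ρ : ℝ) (γ : Eucl d) (τ : ℝ) :
    Continuous (shellSymbol ρ γ τ) := by
  unfold shellSymbol
  fun_prop

/-- The quadratic polynomial `t ↦ shellSymbol (t, y)` has the discriminant `shellDisc`. -/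
def shellDisc (j : Fin (n + 1)) (ρ : ℝ) (γ : Eucl (n + 1)) (τ : ℝ) (y : Eucl n) : ℂ :=
  ((ρ ^ 2 - γ j ^ 2 - ‖y‖ ^ 2 : ℝ) : ℂ) +
    Complex.I * ((τ - 2 * ∑ i, γ (j.succAbove i) * y i : ℝ) : ℂ)

/-- Completing the square absorbs the linear term `2 i γ_j t`; what is left over is independent of
`t`. -/
theorem shellSymbol_glue (j : Fin (n + 1)) (ρ : ℝ) (γ : Eucl (n + 1)) (τ : ℝ) (t : ℝ) (y : Eucl n) :
    shellSymbol ρ γ τ (glue j t y) =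
      ((t : ℂ) + Complex.I * (γ j : ℂ)) ^ 2 - shellDisc j ρ γ τ y := by
  rw [shellSymbol, shellDisc, norm_glue_sq, inner_glue']
  push_cast
  linear_combination (-(γ j : ℂ) ^ 2) * Complex.I_sq

/-- With `z² = A`, partial fractions split the kernel into two Cauchy kernels with poles `-v ± z`
and the prefactor `1 / (2 z)`, and `|z| ≥ δ`. Each Cauchy kernel obeys a bound independent of its
pole. The poles may be real, which is why integrability is assumed. -/
theorem norm_integral_slice_le {κ : ℝ} (hκ : 0 < κ) (hκ1 : κ < 1) {a b : ℝ → ℂ}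
    (ha : Integrable a) (hb : Integrable b) {ρ : ℝ} (hρ : 0 < ρ) {A v : ℂ} {δ : ℝ} (hδ : 0 < δ)
    (hA : δ ^ 2 ≤ ‖A‖)
    (hint : Integrable fun t : ℝ => 𝓕 a t * 𝓕⁻ b t *
      ((annulusCutoff κ hκ (t / ρ) : ℂ) / (((t : ℂ) + v) ^ 2 - A))) :
    ‖∫ t : ℝ, 𝓕 a t * 𝓕⁻ b t * ((annulusCutoff κ hκ (t / ρ) : ℂ) / (((t : ℂ) + v) ^ 2 - A))‖ ≤
      2 * Real.pi * annulusConst hκ / δ * ((∫ x, ‖a x‖) * ∫ x, ‖b x‖) := by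
  obtain ⟨z, hz⟩ := IsAlgClosed.exists_pow_nat_eq A two_pos
  set V : ℝ → ℂ := fun t => (annulusCutoff κ hκ (t / ρ) : ℂ) with hV
  set Φ : ℝ → ℂ := fun t => 𝓕 a t * 𝓕⁻ b t with hΦ
  have hzn : δ ≤ ‖z‖ := by
    rw [← hz, norm_pow] at hA
    exact le_of_sq_le_sq hA (norm_nonneg _)
  have hz0 : z ≠ 0 := by
    rw [← norm_pos_iff]
    linarith
  have hVint := integrable_annulus_scaled hκ hρ
  have hVF := integrable_fourier_annulus_scaled hκ hρ
  have hfac : ∀ t : ℝ, ((t : ℂ) + v) ^ 2 - A = ((t : ℂ) - (-v + z)) * ((t : ℂ) - (-v - z)) :=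
    fun t => by rw [← hz]; ring
  have hne : ∀ w : ℂ, ∀ᵐ t : ℝ, (t : ℂ) - w ≠ 0 := by
    intro w
    have hnull : ∀ᵐ t : ℝ, t ≠ w.re := by simp [ae_iff]
    filter_upwards [hnull] with t ht h
    apply ht
    have := congrArg Complex.re h
    simp at this
    linarith
  have hΦc : Continuous Φ := by
    have h1 : ∀ {c : ℝ → ℂ}, Integrable c → Continuous (𝓕 c) := fun hc =>
      VectorFourier.fourierIntegral_continuous (L := innerₗ ℝ) (μ := volume)
        Real.continuous_fourierChar continuous_inner hc
    have h2 : 𝓕⁻ b = fun x => 𝓕 b (-x) := by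
      ext x
      exact Real.fourierInv_eq_fourier_neg b x
    rw [hΦ, h2]
    exact (h1 ha).mul ((h1 hb).comp continuous_neg)
  have hVm : Measurable V := by
    have : Continuous V := by
      rw [hV]
      exact Complex.continuous_ofReal.comp
        ((contDiff_annulusCutoff hκ).continuous.comp (continuous_id.div_const ρ))
    exact this.measurable
  -- The cutoff confines `t` to `|t| ≤ 3 ρ`, where the other factor `t - w'` is bounded. Multiplying
  -- by it preserves integrability, so each single pole is integrable too.
  have key : ∀ w w' : ℂ, (∀ t : ℝ, ((t : ℂ) + v) ^ 2 - A = ((t : ℂ) - w) * ((t : ℂ) - w')) →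
      Integrable fun t : ℝ => Φ t * (V t / ((t : ℂ) - w)) := by
    intro w w' hw
    refine (hint.norm.const_mul (3 * ρ + ‖w'‖)).mono' ?_ ?_
    · exact (hΦc.measurable.mul (hVm.div
        ((Complex.measurable_ofReal).sub_const w))).aestronglyMeasurable
    · filter_upwards [hne w, hne w'] with t ht ht'
      rw [hw t]
      by_cases hVt : V t = 0
      · rw [hVt]
        simp
        positivity
      have h3 : |t / ρ| ≤ 3 := abs_le_of_annulusCutoff_ne_zero hκ hκ1 (fun h => hVt (by
        simp only [hV, h, Complex.ofReal_zero]))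
      have h4 : ‖(t : ℂ) - w'‖ ≤ 3 * ρ + ‖w'‖ := by
        refine (norm_sub_le _ _).trans ?_
        gcongr
        rw [Complex.norm_real, Real.norm_eq_abs]
        rwa [abs_div, abs_of_pos hρ, div_le_iff₀ hρ] at h3
      have h5 : Φ t * (V t / ((t : ℂ) - w)) =
          (Φ t * (V t / (((t : ℂ) - w) * ((t : ℂ) - w')))) * ((t : ℂ) - w') := by
        field_simp
      rw [h5, norm_mul, mul_comm]
      exact mul_le_mul_of_nonneg_right h4 (norm_nonneg _)
  have hi1 := key (-v + z) (-v - z) hfac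
  have hi2 := key (-v - z) (-v + z) fun t => by rw [hfac t, mul_comm]
  have b1 := norm_integral_fourier_mul_div_sub_le ha hb hVint hVF _ hi1
  have b2 := norm_integral_fourier_mul_div_sub_le ha hb hVint hVF _ hi2
  rw [integral_norm_fourier_annulus_scaled hκ hρ] at b1 b2
  have heq : ∫ t : ℝ, Φ t * (V t / (((t : ℂ) + v) ^ 2 - A)) =
      (2 * z)⁻¹ * ((∫ t : ℝ, Φ t * (V t / ((t : ℂ) - (-v + z)))) -
        ∫ t : ℝ, Φ t * (V t / ((t : ℂ) - (-v - z)))) := by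
    rw [← integral_sub hi1 hi2, ← integral_const_mul]
    refine integral_congr_ae ?_
    filter_upwards [hne (-v + z), hne (-v - z)] with t ht ht'
    rw [hfac t]
    field_simp
    ring
  rw [heq, norm_mul, norm_inv, norm_mul]
  simp only [Complex.norm_ofNat]
  set B := 2 * Real.pi * annulusConst hκ * ((∫ x, ‖a x‖) * ∫ x, ‖b x‖) with hB
  have hB0 : 0 ≤ B := by
    have := annulusConst_nonneg hκ
    have : 0 ≤ (∫ x, ‖a x‖) * ∫ x, ‖b x‖ := by positivity
    positivity
  calc (2 * ‖z‖)⁻¹ * ‖(∫ t : ℝ, Φ t * (V t / ((t : ℂ) - (-v + z)))) -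
        ∫ t : ℝ, Φ t * (V t / ((t : ℂ) - (-v - z)))‖
      ≤ (2 * δ)⁻¹ * (B + B) := by
        gcongr
        exact (norm_sub_le _ _).trans (add_le_add b1 b2)
    _ = 2 * Real.pi * annulusConst hκ / δ * ((∫ x, ‖a x‖) * ∫ x, ‖b x‖) := by
        rw [hB]
        field_simp
        ring

variable {n : ℕ}

theorem shellSymbol_eq_sq_sub {d : ℕ} (ρ : ℝ) (γ : Eucl d) (τ : ℝ) (ξ : Eucl d) :
    |‖ξ‖ ^ 2 - ρ ^ 2| ≤ ‖shellSymbol ρ γ τ ξ‖ := by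
  have h := Complex.abs_re_le_norm (shellSymbol ρ γ τ ξ)
  simpa [shellSymbol, ← Complex.ofReal_pow] using h

theorem lintegral_fourier_mul_fourierInv_le {d : ℕ} (f g : 𝓢(Eucl d, ℂ)) :
    ∫⁻ ξ, ‖𝓕 f ξ * 𝓕⁻ g ξ‖ₑ ≤ ‖f.toLp 2 volume‖ₑ * ‖g.toLp 2 volume‖ₑ := by
  rw [← ENNReal.pow_le_pow_left_iff two_ne_zero, mul_pow]
  simp_rw [enorm_mul]
  refine (lintegral_mul_sq_le (𝓕 f).continuous.measurable.enorm.aemeasurable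
    (𝓕⁻ g).continuous.measurable.enorm.aemeasurable).trans_eq ?_
  rw [← enorm_toLp_two_sq, ← enorm_toLp_two_sq]
  have h1 : ‖(𝓕 f).toLp 2 volume‖ₑ = ‖f.toLp 2 volume‖ₑ := by
    rw [← ofReal_norm, ← ofReal_norm, norm_fourier_toL2_eq]
  have h2 : ‖(𝓕⁻ g).toLp 2 volume‖ₑ = ‖g.toLp 2 volume‖ₑ := by
    rw [← ofReal_norm, ← ofReal_norm, ← norm_fourier_toL2_eq (𝓕⁻ g),
      FourierTransform.fourier_fourierInv_eq]
  rw [h1, h2]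

theorem mixedNorm_eq (j : Fin (n + 1)) (f : 𝓢(Eucl (n + 1), ℂ)) (y : Eucl n) :
    mixedNorm j f y = ENNReal.ofReal (∫ t, ‖partialFourier j f t y‖) := by
  rw [mixedNorm, ofReal_integral_norm_eq_lintegral_enorm (integrable_partialFourier j f y)]

/-- The part of the bilinear form in a region where `∂_j` of the symbol does not vanish. -/
theorem enorm_integral_piece_le {κ : ℝ} (hκ : 0 < κ) (hκ1 : κ < 1) {η : ℝ} (hη : 0 ≤ η)
    (j : Fin (n + 1)) {ρ : ℝ} (hρ : 0 < ρ) (γ : Eucl (n + 1)) (τ : ℝ) (f g : 𝓢(Eucl (n + 1), ℂ))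
    {δ : ℝ} (hδ : 0 < δ) (c : Eucl n → ℝ) (hc1 : ∀ y, |c y| ≤ 1)
    (hcδ : ∀ y, c y ≠ 0 → δ ^ 2 ≤ ‖shellDisc j ρ γ τ y‖) (p : Eucl (n + 1) → ℝ)
    (hp : ∀ t y, p (glue j t y) = annulusCutoff κ hκ (t / ρ) * c y)
    (hint : Integrable fun ξ => (p ξ : ℂ) * (𝓕 f ξ * 𝓕⁻ g ξ / shellSymbol ρ γ τ ξ)) :
    ‖∫ ξ, (p ξ : ℂ) * (𝓕 f ξ * 𝓕⁻ g ξ / shellSymbol ρ γ τ ξ)‖ₑ ≤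
      ENNReal.ofReal (2 * Real.pi * annulusConst hκ / δ) *
        (traceConst η * (‖wL2 η f‖ₑ * ‖wL2 η g‖ₑ)) := by
  set K := 2 * Real.pi * annulusConst hκ / δ with hK
  have hK0 : 0 ≤ K := by
    have := annulusConst_nonneg hκ
    positivity
  rw [integral_glue j hint]
  have hslice := (integrable_glue j hint).prod_left_ae
  calc _ ≤ ∫⁻ y, ‖∫ t : ℝ, (p (glue j t y) : ℂ) * (𝓕 f (glue j t y) * 𝓕⁻ g (glue j t y) /
          shellSymbol ρ γ τ (glue j t y))‖ₑ := enorm_integral_le_lintegral_enorm _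
    _ ≤ ∫⁻ y, ENNReal.ofReal K * (mixedNorm j f y * mixedNorm j g (-y)) := by
        refine lintegral_mono_ae ?_
        filter_upwards [hslice] with y hy
        by_cases hcy : c y = 0
        · simp [hp, hcy]
        -- For fixed `y` the piece is a constant times the one-dimensional form of
        -- `norm_integral_slice_le`; this uses that the cutoff `p` is a product of a function of `t`
        -- and one of `y`.
        have h1 : ∀ t : ℝ, (p (glue j t y) : ℂ) * (𝓕 f (glue j t y) * 𝓕⁻ g (glue j t y) /
            shellSymbol ρ γ τ (glue j t y)) = (c y : ℂ) *
            (𝓕 (fun t => partialFourier j f t y) t * 𝓕⁻ (fun t => partialFourier j g t (-y)) t *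
            ((annulusCutoff κ hκ (t / ρ) : ℂ) /
              (((t : ℂ) + Complex.I * (γ j : ℂ)) ^ 2 - shellDisc j ρ γ τ y))) := by
          intro t
          rw [hp, shellSymbol_glue, fourier_glue, fourierInv_glue]
          push_cast
          ring
        simp_rw [h1] at hy ⊢
        have hcy' : (c y : ℂ) ≠ 0 := by exact_mod_cast hcy
        have hy' := (integrable_const_mul_iff (IsUnit.mk0 _ hcy') _).1 hy
        rw [integral_const_mul, enorm_mul, mixedNorm_eq, mixedNorm_eq,
          ← ENNReal.ofReal_mul (by positivity), ← ENNReal.ofReal_mul hK0]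
        have h2 := norm_integral_slice_le hκ hκ1 (integrable_partialFourier j f y)
          (integrable_partialFourier j g (-y)) hρ hδ (hcδ y hcy) hy'
        refine (mul_le_mul' (?_ : _ ≤ (1 : ℝ≥0∞)) le_rfl).trans ?_
        · rw [← ofReal_norm, Complex.norm_real, Real.norm_eq_abs]
          exact ENNReal.ofReal_le_one.2 (hc1 y)
        · rw [one_mul, ← ofReal_norm]
          exact ENNReal.ofReal_le_ofReal h2
    _ = ENNReal.ofReal K * ∫⁻ y, mixedNorm j f y * mixedNorm j g (-y) := by
        rw [lintegral_const_mul' _ _ ENNReal.ofReal_ne_top]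
    _ ≤ _ := by
        gcongr
        exact lintegral_mixedNorm_mul_le hη j f g

/-! ### Partition of unity by large coordinates -/

theorem exists_le_sq_coord (ξ : Eucl (n + 1)) : ∃ i, ‖ξ‖ ^ 2 ≤ (n + 1) * ξ i ^ 2 := by
  by_contra! h
  have h1 : ∑ i : Fin (n + 1), ((n : ℝ) + 1) * ξ i ^ 2 < ∑ _i : Fin (n + 1), ‖ξ‖ ^ 2 :=
    Finset.sum_lt_sum_of_nonempty Finset.univ_nonempty fun i _ => h i
  rw [← Finset.mul_sum, Finset.sum_const, Finset.card_univ, Fintype.card_fin, nsmul_eq_mul,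
    EuclideanSpace.real_norm_sq_eq] at h1
  push_cast at h1
  linarith

theorem sq_coord_le (ξ : Eucl (n + 1)) (i : Fin (n + 1)) : ξ i ^ 2 ≤ ‖ξ‖ ^ 2 := by
  rw [EuclideanSpace.real_norm_sq_eq]
  exact Finset.single_le_sum (f := fun i => ξ i ^ 2) (fun i _ => sq_nonneg _) (Finset.mem_univ i)

/-- The partition of unity, without restriction to the region of large discriminant. -/
def dirCutoff (κ : ℝ) (hκ : 0 < κ) (ρ : ℝ) (j : Fin (n + 1)) (ξ : Eucl (n + 1)) : ℝ :=
  annulusCutoff κ hκ (ξ j / ρ) * ∏ i with i < j, (1 - annulusCutoff κ hκ (ξ i / ρ))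

section DirCutoff

variable {κ : ℝ} (hκ : 0 < κ) (hκ1 : κ < 1) (ρ : ℝ)

/-- The ordered product is chosen for this telescoping identity: the sum equals one as soon as a
single coordinate cutoff equals one, and every summand still factors into a function of `ξ_j` and a
function of the other coordinates. -/
theorem sum_dirCutoff (ξ : Eucl (n + 1)) :
    ∑ j, dirCutoff κ hκ ρ j ξ = 1 - ∏ i, (1 - annulusCutoff κ hκ (ξ i / ρ)) := by
  have h := Finset.prod_one_sub_ordered Finset.univ fun i => annulusCutoff κ hκ (ξ i / ρ)
  rw [h]
  simp [dirCutoff]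

theorem prod_one_sub_mem (hκ1 : κ < 1) {ι : Type*} (s : Finset ι) (x : ι → ℝ) :
    0 ≤ ∏ i ∈ s, (1 - annulusCutoff κ hκ (x i)) ∧
      ∏ i ∈ s, (1 - annulusCutoff κ hκ (x i)) ≤ 1 := by
  have h0 : ∀ i ∈ s, 0 ≤ 1 - annulusCutoff κ hκ (x i) := fun i _ => by
    linarith [annulusCutoff_le_one hκ (x i)]
  exact ⟨Finset.prod_nonneg h0,
    Finset.prod_le_one h0 fun i _ => by linarith [annulusCutoff_nonneg hκ hκ1 (x i)]⟩

theorem dirCutoff_nonneg (hκ1 : κ < 1) (j : Fin (n + 1)) (ξ : Eucl (n + 1)) :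
    0 ≤ dirCutoff κ hκ ρ j ξ :=
  mul_nonneg (annulusCutoff_nonneg hκ hκ1 _) (prod_one_sub_mem hκ hκ1 _ _).1

theorem continuous_dirCutoff (j : Fin (n + 1)) :
    Continuous (dirCutoff κ hκ ρ j : Eucl (n + 1) → ℝ) := by
  have h : Continuous (annulusCutoff κ hκ) := (contDiff_annulusCutoff hκ).continuous
  unfold dirCutoff
  fun_prop

/-- The factor of `dirCutoff` that does not depend on the `j`-th coordinate. -/
def dirCutoffRest (κ : ℝ) (hκ : 0 < κ) (ρ : ℝ) (j : Fin (n + 1)) (y : Eucl n) : ℝ :=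
  ∏ i with i < j, (1 - annulusCutoff κ hκ (glue j 0 y i / ρ))

theorem dirCutoff_glue (j : Fin (n + 1)) (t : ℝ) (y : Eucl n) :
    dirCutoff κ hκ ρ j (glue j t y) = annulusCutoff κ hκ (t / ρ) * dirCutoffRest κ hκ ρ j y := by
  rw [dirCutoff, dirCutoffRest, glue_same]
  congr 1
  refine Finset.prod_congr rfl fun i hi => ?_
  have hij : i ≠ j := (Finset.mem_filter.1 hi).2.ne
  obtain ⟨k, rfl⟩ := Fin.exists_succAbove_eq hij
  simp

/-- Here `ρ²/2 ≤ |ξ|² ≤ 3ρ²/2`. The largest coordinate satisfies `ξ_i² ≥ ρ² / (2 (n + 1))`, and the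
normalisation of `κ` makes the right side equal to `(2 κ ρ)²`; the upper bound keeps `|ξ_i|` below
`2 ρ`. -/
theorem exists_annulusCutoff_eq_one (hκn : 8 * (n + 1) * κ ^ 2 = 1) (hρ : 0 < ρ)
    {ξ : Eucl (n + 1)} (hξ : |‖ξ‖ ^ 2 - ρ ^ 2| ≤ ρ ^ 2 / 2) :
    ∃ i, annulusCutoff κ hκ (ξ i / ρ) = 1 := by
  obtain ⟨i, hi⟩ := exists_le_sq_coord ξ
  have h1 := sq_coord_le ξ i
  rw [abs_le] at hξ
  refine ⟨i, annulusCutoff_eq_one hκ ?_ ?_⟩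
  · rw [abs_div, abs_of_pos hρ, le_div_iff₀ hρ]
    refine abs_le_of_sq_le_sq' ?_ (abs_nonneg _) |>.2
    rw [sq_abs]
    have hn : (0 : ℝ) < n + 1 := by positivity
    have h2 : ρ ^ 2 / 2 ≤ (n + 1) * ξ i ^ 2 := by linarith
    have h3 : ((n : ℝ) + 1) * (2 * κ * ρ) ^ 2 = ρ ^ 2 / 2 := by
      linear_combination (ρ ^ 2 / 2) * hκn
    exact le_of_mul_le_mul_left (by linarith) hn
  · rw [abs_div, abs_of_pos hρ, div_le_iff₀ hρ]
    refine abs_le_of_sq_le_sq' ?_ (by positivity) |>.2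
    rw [sq_abs]
    nlinarith

end DirCutoff

variable {n : ℕ}

section Bound

variable {κ : ℝ} (hκ : 0 < κ)

open Classical in
/-- `dirCutoff` restricted to the region of large discriminant. -/
def pieceCutoff (κ : ℝ) (hκ : 0 < κ) (ρ : ℝ) (γ : Eucl (n + 1)) (τ : ℝ) (j : Fin (n + 1))
    (ξ : Eucl (n + 1)) : ℝ :=
  if κ ^ 2 * ρ ^ 2 / 2 ≤ ‖((ξ j : ℂ) + Complex.I * (γ j : ℂ)) ^ 2 - shellSymbol ρ γ τ ξ‖ then
    dirCutoff κ hκ ρ j ξ else 0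

variable (ρ : ℝ) (γ : Eucl (n + 1)) (τ : ℝ)

theorem measurable_pieceCutoff (j : Fin (n + 1)) : Measurable (pieceCutoff κ hκ ρ γ τ j) := by
  classical
  have h : Continuous (fun ξ : Eucl (n + 1) =>
      ‖((ξ j : ℂ) + Complex.I * (γ j : ℂ)) ^ 2 - shellSymbol ρ γ τ ξ‖) := by
    have := continuous_shellSymbol ρ γ τ
    fun_prop
  exact Measurable.ite (measurableSet_le measurable_const h.measurable)
    (continuous_dirCutoff hκ ρ j).measurable measurable_const

theorem pieceCutoff_nonneg (hκ1 : κ < 1) (j : Fin (n + 1)) (ξ : Eucl (n + 1)) :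
    0 ≤ pieceCutoff κ hκ ρ γ τ j ξ := by
  unfold pieceCutoff
  split_ifs
  · exact dirCutoff_nonneg hκ ρ hκ1 j ξ
  · exact le_rfl

theorem pieceCutoff_le (hκ1 : κ < 1) (j : Fin (n + 1)) (ξ : Eucl (n + 1)) :
    pieceCutoff κ hκ ρ γ τ j ξ ≤ dirCutoff κ hκ ρ j ξ := by
  unfold pieceCutoff
  split_ifs
  · exact le_rfl
  · exact dirCutoff_nonneg hκ ρ hκ1 j ξ

theorem sum_pieceCutoff_le_one (hκ1 : κ < 1) (ξ : Eucl (n + 1)) :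
    ∑ j, pieceCutoff κ hκ ρ γ τ j ξ ≤ 1 := by
  refine (Finset.sum_le_sum fun j _ => pieceCutoff_le hκ ρ γ τ hκ1 j ξ).trans ?_
  rw [sum_dirCutoff]
  linarith [(prod_one_sub_mem hκ hκ1 Finset.univ fun i => ξ i / ρ).1]

/-- The restriction to large discriminants removes nothing where the symbol is small: on the support
of the `j`-th cutoff `|ξ_j + i γ_j|² ≥ ξ_j² ≥ κ² ρ²`, and the discriminant is `(ξ_j + i γ_j)²` minus
the symbol. The imaginary part `γ_j` can only help. -/
theorem sum_pieceCutoff_eq_one (hκ1 : κ < 1) (hκn : 8 * (n + 1) * κ ^ 2 = 1) (hρ : 0 < ρ)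
    {ξ : Eucl (n + 1)} (hξ : ‖shellSymbol ρ γ τ ξ‖ < κ ^ 2 * ρ ^ 2 / 2) :
    ∑ j, pieceCutoff κ hκ ρ γ τ j ξ = 1 := by
  have h1 : ∀ j, pieceCutoff κ hκ ρ γ τ j ξ = dirCutoff κ hκ ρ j ξ := by
    intro j
    unfold pieceCutoff
    split_ifs with h
    · rfl
    · by_contra hne
      have h2 : annulusCutoff κ hκ (ξ j / ρ) ≠ 0 := fun h0 => hne (by rw [dirCutoff, h0, zero_mul])
      have h3 := le_abs_of_annulusCutoff_ne_zero hκ hκ1 h2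
      rw [abs_div, abs_of_pos hρ, le_div_iff₀ hρ] at h3
      apply h
      have h4 : κ ^ 2 * ρ ^ 2 ≤ ‖((ξ j : ℂ) + Complex.I * (γ j : ℂ)) ^ 2‖ := by
        rw [norm_pow, Complex.sq_norm, Complex.normSq_apply]
        simp only [Complex.add_re, Complex.ofReal_re, Complex.mul_re, Complex.I_re, zero_mul,
          Complex.I_im, Complex.ofReal_im, mul_zero, sub_zero, add_zero, Complex.add_im,
          Complex.mul_im, one_mul, zero_add]
        have h5 : (κ * ρ) ^ 2 ≤ |ξ j| ^ 2 := pow_le_pow_left₀ (by positivity) h3 2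
        rw [sq_abs] at h5
        nlinarith [sq_nonneg (γ j)]
      have h6 := norm_sub_norm_le (((ξ j : ℂ) + Complex.I * (γ j : ℂ)) ^ 2) (shellSymbol ρ γ τ ξ)
      linarith
  simp_rw [h1]
  rw [sum_dirCutoff]
  have h7 : κ ^ 2 * ρ ^ 2 / 2 ≤ ρ ^ 2 / 2 := by
    have : κ ^ 2 ≤ 1 := by nlinarith
    nlinarith [sq_nonneg ρ]
  obtain ⟨i, hi⟩ := exists_annulusCutoff_eq_one hκ ρ hκn hρ
    ((shellSymbol_eq_sq_sub ρ γ τ ξ).trans (hξ.le.trans h7))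
  rw [Finset.prod_eq_zero (Finset.mem_univ i) (by rw [hi, sub_self]), sub_zero]

open Classical in
-- The restriction is phrased through the discriminant because this does not depend on `t`; hence
-- the product structure survives.
theorem pieceCutoff_glue (j : Fin (n + 1)) (t : ℝ) (y : Eucl n) :
    pieceCutoff κ hκ ρ γ τ j (glue j t y) = annulusCutoff κ hκ (t / ρ) *
      (if κ ^ 2 * ρ ^ 2 / 2 ≤ ‖shellDisc j ρ γ τ y‖ then dirCutoffRest κ hκ ρ j y else 0) := by
  have h : ((glue j t y j : ℂ) + Complex.I * (γ j : ℂ)) ^ 2 - shellSymbol ρ γ τ (glue j t y) =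
      shellDisc j ρ γ τ y := by
    rw [shellSymbol_glue, glue_same]
    ring
  rw [pieceCutoff, h, dirCutoff_glue]
  split_ifs <;> simp

end Bound

/-- The uniform bound for the bilinear form with symbol `1 / shellSymbol`. -/
theorem exists_enorm_integral_shell_le (n : ℕ) {η : ℝ} (hη : 1 / 2 < η) :
    ∃ C : ℝ, 0 < C ∧ ∀ (ρ : ℝ) (_ : 0 < ρ) (γ : Eucl (n + 1)) (τ : ℝ) (f g : 𝓢(Eucl (n + 1), ℂ)),
      Integrable (fun ξ => 𝓕 f ξ * 𝓕⁻ g ξ / shellSymbol ρ γ τ ξ) →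
      ‖∫ ξ, 𝓕 f ξ * 𝓕⁻ g ξ / shellSymbol ρ γ τ ξ‖ₑ ≤
        ENNReal.ofReal (C * (ρ⁻¹ + (ρ ^ 2)⁻¹)) * (‖wL2 η f‖ₑ * ‖wL2 η g‖ₑ) := by
  classical
  set κ : ℝ := √(1 / (8 * (n + 1))) with hκdef
  have hκ : 0 < κ := by rw [hκdef]; positivity
  have hκsq : κ ^ 2 = 1 / (8 * (n + 1)) := Real.sq_sqrt (by positivity)
  have hκn : 8 * ((n : ℝ) + 1) * κ ^ 2 = 1 := by
    rw [hκsq]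
    field_simp
  have hκ1 : κ < 1 := by
    have : κ ^ 2 < 1 ^ 2 := by
      rw [hκsq, one_pow, div_lt_one (by positivity)]
      have : (0 : ℝ) ≤ n := by positivity
      linarith
    exact lt_of_pow_lt_pow_left₀ 2 zero_le_one this
  have hη0 : 0 ≤ η := by linarith
  set L := annulusConst hκ with hL
  have hL0 : 0 ≤ L := annulusConst_nonneg hκ
  set S := (traceConst η).toReal with hS
  have hS0 : 0 ≤ S := ENNReal.toReal_nonneg
  have hST : traceConst η = ENNReal.ofReal S :=
    (ENNReal.ofReal_toReal (traceConst_lt_top hη).ne).symm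
  -- There are `n + 1` directional pieces, each bounded by `2π L S / δ` with `δ = κ ρ / 2`, and a
  -- remainder bounded by `2 / (κ² ρ²)`.
  refine ⟨(n + 1) * (4 * Real.pi * L / κ * S) + 2 / κ ^ 2, by positivity, ?_⟩
  intro ρ hρ γ τ f g hint
  set F : Eucl (n + 1) → ℂ := fun ξ => 𝓕 f ξ * 𝓕⁻ g ξ / shellSymbol ρ γ τ ξ with hF
  set p := pieceCutoff κ hκ ρ γ τ with hp
  have hpm := measurable_pieceCutoff hκ ρ γ τ
  have hp0 : ∀ j ξ, 0 ≤ p j ξ := pieceCutoff_nonneg hκ ρ γ τ hκ1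
  have hps : ∀ ξ, ∑ j, p j ξ ≤ 1 := sum_pieceCutoff_le_one hκ ρ γ τ hκ1
  have hp1 : ∀ j ξ, p j ξ ≤ 1 := fun j ξ =>
    (Finset.single_le_sum (fun i _ => hp0 i ξ) (Finset.mem_univ j)).trans (hps ξ)
  have hpi : ∀ j, Integrable fun ξ => (p j ξ : ℂ) * F ξ := fun j =>
    hint.bdd_mul (c := 1) (Complex.measurable_ofReal.comp (hpm j)).aestronglyMeasurable
      (.of_forall fun ξ => by
        rw [Complex.norm_real, Real.norm_of_nonneg (hp0 j ξ)]
        exact hp1 j ξ)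
  have hsplit : ∫ ξ, F ξ = (∑ j, ∫ ξ, (p j ξ : ℂ) * F ξ) +
      ∫ ξ, ((1 - ∑ j, p j ξ : ℝ) : ℂ) * F ξ := by
    rw [← integral_finsetSum _ fun j _ => hpi j, ← integral_add]
    · congr 1
      ext ξ
      push_cast
      rw [← Finset.sum_mul]
      ring
    · exact integrable_finsetSum _ fun j _ => hpi j
    · have := hint.sub (integrable_finsetSum Finset.univ fun j _ => hpi j)
      refine this.congr (.of_forall fun ξ => ?_)
      simp only [Pi.sub_apply]
      push_cast
      rw [← Finset.sum_mul, hF]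
      ring
  set X := ‖wL2 η f‖ₑ * ‖wL2 η g‖ₑ with hX
  have hpiece : ∀ j, ‖∫ ξ, (p j ξ : ℂ) * F ξ‖ₑ ≤
      ENNReal.ofReal (4 * Real.pi * L / κ * S * ρ⁻¹) * X := by
    intro j
    -- On a piece the discriminant is at least `κ² ρ² / 2`, which exceeds `δ² = κ² ρ² / 4`.
    have hδ : 0 < κ * ρ / 2 := by positivity
    have h := enorm_integral_piece_le hκ hκ1 hη0 j hρ γ τ f g hδ
      (fun y => if κ ^ 2 * ρ ^ 2 / 2 ≤ ‖shellDisc j ρ γ τ y‖ then dirCutoffRest κ hκ ρ j y else 0)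
      (fun y => by
        split_ifs
        · have := prod_one_sub_mem hκ hκ1 {i | i < j} fun i => glue j 0 y i / ρ
          exact abs_le.2 ⟨by linarith [show 0 ≤ dirCutoffRest κ hκ ρ j y from this.1], this.2⟩
        · simp)
      (fun y hy => by
        simp only [ne_eq, ite_eq_right_iff, Classical.not_imp] at hy
        nlinarith [hy.1, sq_nonneg (κ * ρ)])
      (p j) (pieceCutoff_glue hκ ρ γ τ j) (hpi j)
    refine h.trans_eq ?_
    rw [hST, ← mul_assoc, ← ENNReal.ofReal_mul (by positivity)]
    congr 2
    field_simp
    ring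
  -- The remainder lives where the symbol has modulus at least `κ² ρ² / 2`, so Plancherel suffices
  -- and no weight is needed.
  have hrest : ‖∫ ξ, ((1 - ∑ j, p j ξ : ℝ) : ℂ) * F ξ‖ₑ ≤
      ENNReal.ofReal (2 / κ ^ 2 * (ρ ^ 2)⁻¹) * X := by
    have h1 : ∀ ξ, ‖((1 - ∑ j, p j ξ : ℝ) : ℂ) * F ξ‖ₑ ≤
        ENNReal.ofReal (2 / κ ^ 2 * (ρ ^ 2)⁻¹) * ‖𝓕 f ξ * 𝓕⁻ g ξ‖ₑ := by
      intro ξ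
      rw [← ofReal_norm, ← ofReal_norm, ← ENNReal.ofReal_mul (by positivity)]
      refine ENNReal.ofReal_le_ofReal ?_
      rcases lt_or_ge ‖shellSymbol ρ γ τ ξ‖ (κ ^ 2 * ρ ^ 2 / 2) with h | h
      · rw [sum_pieceCutoff_eq_one hκ ρ γ τ hκ1 hκn hρ h]
        simp only [sub_self, Complex.ofReal_zero, zero_mul, norm_zero]
        positivity
      · have h3 : 0 < κ ^ 2 * ρ ^ 2 / 2 := by positivity
        rw [norm_mul, Complex.norm_real, Real.norm_of_nonneg (by linarith [hps ξ])]
        calc _ ≤ 1 * ‖F ξ‖ := by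
              gcongr
              linarith [Finset.sum_nonneg fun j (_ : j ∈ Finset.univ) => hp0 j ξ]
          _ = ‖𝓕 f ξ * 𝓕⁻ g ξ‖ / ‖shellSymbol ρ γ τ ξ‖ := by rw [one_mul, hF, norm_div]
          _ ≤ ‖𝓕 f ξ * 𝓕⁻ g ξ‖ / (κ ^ 2 * ρ ^ 2 / 2) := by gcongr
          _ = _ := by field_simp
    refine (enorm_integral_le_lintegral_enorm _).trans ((lintegral_mono h1).trans ?_)
    rw [lintegral_const_mul' _ _ ENNReal.ofReal_ne_top]
    gcongr
    refine (lintegral_fourier_mul_fourierInv_le f g).trans ?_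
    exact mul_le_mul' (enorm_toLp_le_wL2 hη0 f) (enorm_toLp_le_wL2 hη0 g)
  rw [hsplit]
  calc _ ≤ (∑ j, ‖∫ ξ, (p j ξ : ℂ) * F ξ‖ₑ) + ‖∫ ξ, ((1 - ∑ j, p j ξ : ℝ) : ℂ) * F ξ‖ₑ := by
        refine (enorm_add_le _ _).trans ?_
        gcongr
        exact enorm_sum_le _ _
    _ ≤ (∑ _j : Fin (n + 1), ENNReal.ofReal (4 * Real.pi * L / κ * S * ρ⁻¹) * X) +
          ENNReal.ofReal (2 / κ ^ 2 * (ρ ^ 2)⁻¹) * X := by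
        gcongr with j
        exact hpiece j
    _ = ENNReal.ofReal ((n + 1) * (4 * Real.pi * L / κ * S * ρ⁻¹) + 2 / κ ^ 2 * (ρ ^ 2)⁻¹) * X := by
        rw [Finset.sum_const, Finset.card_univ, Fintype.card_fin, nsmul_eq_mul, ← mul_assoc,
          ← add_mul, ENNReal.ofReal_add (by positivity) (by positivity),
          ENNReal.ofReal_mul (p := (n : ℝ) + 1) (by positivity), ← Nat.cast_succ,
          ENNReal.ofReal_natCast]
    _ ≤ _ := by
        gcongr
        have hr : 0 ≤ ρ⁻¹ := by positivity
        have hr2 : 0 ≤ (ρ ^ 2)⁻¹ := by positivity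
        have h1 : 0 ≤ ((n : ℝ) + 1) * (4 * Real.pi * L / κ * S) := by positivity
        have h2 : 0 ≤ 2 / κ ^ 2 := by positivity
        nlinarith [mul_nonneg h1 hr2, mul_nonneg h2 hr]

/-! ### Local integrability of the reciprocal of the symbol -/

theorem enorm_rpow_antitone {e : ℝ} (he : 0 ≤ e) {x y : ℝ≥0∞} (h : x ≤ y) :
    y ^ (-e) ≤ x ^ (-e) := by
  rw [ENNReal.rpow_neg, ENNReal.rpow_neg, ENNReal.inv_le_inv]
  exact ENNReal.rpow_le_rpow h he

theorem lintegral_rpow_neg_ball_lt_top {e : ℝ} (he : e < 1) :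
    ∫⁻ u in Icc (-1 : ℝ) 1, ‖u‖ₑ ^ (-e) < ⊤ := by
  have h1 : ∫⁻ u in Ioc (0 : ℝ) 1, ‖u‖ₑ ^ (-e) < ⊤ := by
    have h := (intervalIntegral.intervalIntegrable_rpow' (a := 0) (b := 1) (r := -e)
      (by linarith)).1.lintegral_lt_top
    refine lt_of_le_of_lt (lintegral_mono_ae ?_) h
    filter_upwards [ae_restrict_mem measurableSet_Ioc] with u hu
    rw [← ofReal_norm, Real.norm_of_nonneg hu.1.le, ENNReal.ofReal_rpow_of_pos hu.1]
  have h2 : ∫⁻ u in Ico (-1 : ℝ) 0, ‖u‖ₑ ^ (-e) < ⊤ := by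
    have hmp : MeasurePreserving (fun x : ℝ => -x) volume volume :=
      Measure.measurePreserving_neg volume
    have h3 := hmp.setLIntegral_comp_preimage_emb (MeasurableEquiv.neg ℝ).measurableEmbedding
      (fun u => ‖u‖ₑ ^ (-e)) (Ioc (0 : ℝ) 1)
    simp only [enorm_neg] at h3
    have h4 : (fun x : ℝ => -x) ⁻¹' Ioc (0 : ℝ) 1 = Ico (-1) 0 := by
      ext x
      simp only [mem_preimage, mem_Ioc, mem_Ico]
      constructor <;> rintro ⟨h, h'⟩ <;> constructor <;> linarith
    rw [h4] at h3
    rw [h3]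
    exact h1
  have hsub : Icc (-1 : ℝ) 1 ⊆ Ico (-1) 0 ∪ {0} ∪ Ioc 0 1 := by
    intro x hx
    rcases lt_trichotomy x 0 with h | h | h
    · exact Or.inl (Or.inl ⟨hx.1, h⟩)
    · exact Or.inl (Or.inr h)
    · exact Or.inr ⟨h, hx.2⟩
  refine (lintegral_mono_set hsub).trans_lt ((lintegral_union_le _ _ _).trans_lt ?_)
  refine ENNReal.add_lt_top.2 ⟨(lintegral_union_le _ _ _).trans_lt
    (ENNReal.add_lt_top.2 ⟨h2, ?_⟩), h1⟩
  simp

theorem enorm_rpow_neg_le {e : ℝ} (he : 0 ≤ e) (u : ℝ) :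
    ‖u‖ₑ ^ (-e) ≤ 1 + (Icc (-1 : ℝ) 1).indicator (fun u => ‖u‖ₑ ^ (-e)) u := by
  by_cases h : u ∈ Icc (-1 : ℝ) 1
  · rw [indicator_of_mem h]
    exact le_add_self
  · rw [indicator_of_notMem h, add_zero]
    have h1 : 1 ≤ ‖u‖ₑ := by
      rw [← ofReal_norm, ENNReal.one_le_ofReal, Real.norm_eq_abs]
      by_contra! h'
      exact h (abs_le.1 h'.le)
    simpa using enorm_rpow_antitone he h1

/-- The integrals of `|t - b| ^ (-e)` over bounded intervals are uniformly bounded. -/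
theorem setLIntegral_sub_rpow_neg_le {e : ℝ} (he : 0 ≤ e) (M b : ℝ) :
    ∫⁻ t in Icc (-M) M, ‖t - b‖ₑ ^ (-e) ≤
      ENNReal.ofReal (2 * M) + ∫⁻ u in Icc (-1 : ℝ) 1, ‖u‖ₑ ^ (-e) := by
  calc ∫⁻ t in Icc (-M) M, ‖t - b‖ₑ ^ (-e)
      ≤ ∫⁻ t in Icc (-M) M, (1 + (Icc (-1 : ℝ) 1).indicator (fun u => ‖u‖ₑ ^ (-e)) (t - b)) :=
        lintegral_mono fun t => enorm_rpow_neg_le he (t - b)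
    _ = (∫⁻ t in Icc (-M) M, 1) +
          ∫⁻ t in Icc (-M) M, (Icc (-1 : ℝ) 1).indicator (fun u => ‖u‖ₑ ^ (-e)) (t - b) :=
        lintegral_add_left measurable_const _
    _ ≤ ENNReal.ofReal (2 * M) +
          ∫⁻ t, (Icc (-1 : ℝ) 1).indicator (fun u => ‖u‖ₑ ^ (-e)) (t - b) := by
        gcongr
        · rw [lintegral_one, Measure.restrict_apply_univ, Real.volume_Icc]
          exact ENNReal.ofReal_le_ofReal (by linarith)
        · exact Measure.restrict_le_self
    _ = _ := by
        rw [lintegral_sub_right_eq_self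
          (fun u => (Icc (-1 : ℝ) 1).indicator (fun u => ‖u‖ₑ ^ (-e)) u) b,
          lintegral_indicator measurableSet_Icc]

/-- The inequality `(|t| - √c)² ≤ |t² - c|`, valid for negative `c` as well since the real square
root is then zero, reduces the exponent `1/4` to the exponent `1/2` at the two points `±√c`. The
bound does not see whether they collide. -/
theorem exists_setLIntegral_sq_sub_rpow_neg_le (M : ℝ) :
    ∃ C : ℝ≥0∞, C < ⊤ ∧ ∀ c : ℝ, ∫⁻ t in Icc (-M) M, ‖t ^ 2 - c‖ₑ ^ (-(1 / 4) : ℝ) ≤ C := by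
  set B := ENNReal.ofReal (2 * M) + ∫⁻ u in Icc (-1 : ℝ) 1, ‖u‖ₑ ^ (-(1 / 2) : ℝ) with hB
  refine ⟨B + B, ?_, fun c => ?_⟩
  · have : B < ⊤ := ENNReal.add_lt_top.2
      ⟨ENNReal.ofReal_lt_top, lintegral_rpow_neg_ball_lt_top (by norm_num)⟩
    exact ENNReal.add_lt_top.2 ⟨this, this⟩
  set b := √c with hb
  have hb0 : 0 ≤ b := Real.sqrt_nonneg c
  have hkey : ∀ t : ℝ, (|t| - b) ^ 2 ≤ |t ^ 2 - c| := by
    intro t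
    rcases le_total 0 c with hc | hc
    · have hc' : c = b ^ 2 := (Real.sq_sqrt hc).symm
      rw [hc', ← sq_abs t, sq_sub_sq, abs_mul, ← sq_abs (|t| - b), sq]
      refine mul_le_mul_of_nonneg_right ?_ (abs_nonneg _)
      rw [abs_of_nonneg (by positivity : 0 ≤ |t| + b), abs_le]
      constructor <;> linarith [abs_nonneg t]
    · have : b = 0 := Real.sqrt_eq_zero_of_nonpos hc
      rw [this, sub_zero, sq_abs]
      exact (by linarith : t ^ 2 ≤ t ^ 2 - c).trans (le_abs_self _)
  have hpt : ∀ t : ℝ, ‖t ^ 2 - c‖ₑ ^ (-(1 / 4) : ℝ) ≤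
      ‖t - b‖ₑ ^ (-(1 / 2) : ℝ) + ‖t - (-b)‖ₑ ^ (-(1 / 2) : ℝ) := by
    intro t
    have h1 : ‖t ^ 2 - c‖ₑ ^ (-(1 / 4) : ℝ) ≤ ‖|t| - b‖ₑ ^ (-(1 / 2) : ℝ) := by
      have : ‖|t| - b‖ₑ ^ (-(1 / 2) : ℝ) = (‖|t| - b‖ₑ ^ 2) ^ (-(1 / 4) : ℝ) := by
        rw [← ENNReal.rpow_natCast, ← ENNReal.rpow_mul]
        norm_num
      rw [this]
      refine enorm_rpow_antitone (by norm_num) ?_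
      rw [← ofReal_norm, ← ofReal_norm, ← ENNReal.ofReal_pow (norm_nonneg _), Real.norm_eq_abs,
        Real.norm_eq_abs, sq_abs]
      exact ENNReal.ofReal_le_ofReal (hkey t)
    refine h1.trans ?_
    rcases le_total 0 t with ht | ht
    · rw [abs_of_nonneg ht]
      exact le_self_add
    · rw [abs_of_nonpos ht, ← enorm_neg (-t - b), show -(-t - b) = t - (-b) by ring]
      exact le_add_self
  have hm : Measurable fun t : ℝ => ‖t - b‖ₑ ^ (-(1 / 2) : ℝ) := by fun_prop
  calc _ ≤ ∫⁻ t in Icc (-M) M, (‖t - b‖ₑ ^ (-(1 / 2) : ℝ) + ‖t - (-b)‖ₑ ^ (-(1 / 2) : ℝ)) :=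
        lintegral_mono hpt
    _ = _ := lintegral_add_left hm _
    _ ≤ B + B := add_le_add (setLIntegral_sub_rpow_neg_le (by norm_num) M b)
        (setLIntegral_sub_rpow_neg_le (by norm_num) M (-b))

theorem exists_setLIntegral_affine_rpow_neg_le (M : ℝ) {a : ℝ} (ha : 0 < a) :
    ∃ C : ℝ≥0∞, C < ⊤ ∧ ∀ τ : ℝ, ∫⁻ t in Icc (-M) M, ‖a * t - τ‖ₑ ^ (-(7 / 8) : ℝ) ≤ C := by
  have hB : ENNReal.ofReal (2 * M) + ∫⁻ u in Icc (-1 : ℝ) 1, ‖u‖ₑ ^ (-(7 / 8) : ℝ) < ⊤ :=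
    ENNReal.add_lt_top.2 ⟨ENNReal.ofReal_lt_top, lintegral_rpow_neg_ball_lt_top (by norm_num)⟩
  have ha' : ‖a‖ₑ ^ (-(7 / 8) : ℝ) ≠ ⊤ := by
    refine ENNReal.rpow_ne_top_of_ne_zero ?_ enorm_ne_top
    simpa using ha.ne'
  refine ⟨_, ENNReal.mul_lt_top ha'.lt_top hB, fun τ => ?_⟩
  have h1 : ∀ t : ℝ, ‖a * t - τ‖ₑ ^ (-(7 / 8) : ℝ) =
      ‖a‖ₑ ^ (-(7 / 8) : ℝ) * ‖t - τ / a‖ₑ ^ (-(7 / 8) : ℝ) := by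
    intro t
    have h2 : a * t - τ = a * (t - τ / a) := by field_simp
    rw [h2, enorm_mul, ENNReal.mul_rpow_of_ne_top enorm_ne_top enorm_ne_top]
  simp_rw [h1]
  rw [lintegral_const_mul' _ _ ha']
  gcongr
  exact setLIntegral_sub_rpow_neg_le (by norm_num) M (τ / a)

variable {n : ℕ}

theorem le_norm_of_glue (j : Fin (n + 1)) {t M : ℝ} {y : Eucl n} (h : ‖glue j t y‖ ≤ M) :
    t ∈ Icc (-M) M ∧ ‖y‖ ≤ M := by
  have h0 : 0 ≤ M := (norm_nonneg _).trans h
  have h1 : t ^ 2 + ‖y‖ ^ 2 ≤ M ^ 2 := by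
    rw [← norm_glue_sq j]
    gcongr
  refine ⟨abs_le.1 ?_, ?_⟩
  · exact abs_le_of_sq_le_sq (by nlinarith [sq_nonneg ‖y‖]) h0
  · exact le_of_sq_le_sq (by nlinarith [sq_nonneg t]) h0

theorem exists_orthonormalBasis_zero {γ : Eucl (n + 1)} (hγ : γ ≠ 0) :
    ∃ b : OrthonormalBasis (Fin (n + 1)) ℝ (Eucl (n + 1)), ‖γ‖ • b 0 = γ := by
  have hγ' : ‖γ‖ ≠ 0 := norm_ne_zero_iff.2 hγ
  have h1 : Orthonormal ℝ (({0} : Set (Fin (n + 1))).domRestrict fun _ => ‖γ‖⁻¹ • γ) := by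
    refine ⟨fun i => ?_, fun i j hij => (hij (Subsingleton.elim i j)).elim⟩
    change ‖‖γ‖⁻¹ • γ‖ = 1
    rw [norm_smul, norm_inv, norm_norm, inv_mul_cancel₀ hγ']
  obtain ⟨b, hb⟩ := h1.exists_orthonormalBasis_extension_of_card_eq (by simp)
  refine ⟨b, ?_⟩
  rw [hb 0 rfl, smul_smul, mul_inv_cancel₀ hγ', one_smul]

/-- Real and imaginary part both bound the symbol from below, and `9/8 = 1/4 + 7/8` distributes the
exponent: `||ξ|² - ρ²|^(-1/4) |2 γ·ξ - τ|^(-7/8)`. In an orthonormal basis starting with `γ / |γ|`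
the second factor involves the coordinate `0` only, so the last coordinate integrates the first
factor and coordinate `0` the second. Two distinct coordinates are required, hence dimension at
least two. An exponent above one is what gives Hölder continuity in `τ` later. -/
theorem exists_setLIntegral_shellSymbol_le {γ : Eucl (n + 2)} (hγ : γ ≠ 0) (ρ M : ℝ) :
    ∃ C : ℝ≥0∞, C < ⊤ ∧ ∀ τ : ℝ,
      ∫⁻ ξ in Metric.closedBall 0 M, ‖shellSymbol ρ γ τ ξ‖ₑ ^ (-(9 / 8) : ℝ) ≤ C := by
  obtain ⟨b, hb⟩ := exists_orthonormalBasis_zero hγ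
  obtain ⟨C₁, hC₁, h₁⟩ := exists_setLIntegral_sq_sub_rpow_neg_le M
  obtain ⟨C₂, hC₂, h₂⟩ := exists_setLIntegral_affine_rpow_neg_le M
    (by positivity : 0 < 2 * ‖γ‖)
  have hvol : volume (Metric.closedBall (0 : Eucl n) M) < ⊤ := measure_closedBall_lt_top
  refine ⟨C₁ * (C₂ * volume (Metric.closedBall (0 : Eucl n) M)),
    ENNReal.mul_lt_top hC₁ (ENNReal.mul_lt_top hC₂ hvol), fun τ => ?_⟩
  -- the integrand in the adapted coordinates
  set X : Eucl (n + 2) → ℝ≥0∞ := fun ζ => ‖‖ζ‖ ^ 2 - ρ ^ 2‖ₑ ^ (-(1 / 4) : ℝ) *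
    ‖2 * ‖γ‖ * ζ 0 - τ‖ₑ ^ (-(7 / 8) : ℝ) with hX
  set G : Eucl (n + 2) → ℝ≥0∞ := (Metric.closedBall 0 M).indicator X with hG
  have hXm : Measurable X := by
    have h1 : Measurable fun ζ : Eucl (n + 2) => ζ 0 :=
      (by fun_prop : Continuous fun ζ : Eucl (n + 2) => ζ 0).measurable
    fun_prop
  have hGm : Measurable G := hXm.indicator Metric.isClosed_closedBall.measurableSet
  have hle : ∀ ξ, (Metric.closedBall 0 M).indicator
      (fun ξ => ‖shellSymbol ρ γ τ ξ‖ₑ ^ (-(9 / 8) : ℝ)) ξ ≤ G (b.repr ξ) := by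
    intro ξ
    by_cases hξ : ξ ∈ Metric.closedBall (0 : Eucl (n + 2)) M
    · have hξ' : b.repr ξ ∈ Metric.closedBall (0 : Eucl (n + 2)) M := by simpa using hξ
      rw [hG, indicator_of_mem hξ, indicator_of_mem hξ']
      have hin : ⟪γ, ξ⟫ = ‖γ‖ * b.repr ξ 0 := by
        conv_lhs => rw [← hb]
        rw [real_inner_smul_left, b.repr_apply_apply]
      simp only [hX]
      have hsum : (-(9 / 8) : ℝ) = -(1 / 4) + -(7 / 8) := by norm_num
      have e1 : ‖‖b.repr ξ‖ ^ 2 - ρ ^ 2‖ₑ ≤ ‖shellSymbol ρ γ τ ξ‖ₑ := by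
        rw [← ofReal_norm, ← ofReal_norm, LinearIsometryEquiv.norm_map]
        exact ENNReal.ofReal_le_ofReal (shellSymbol_eq_sq_sub ρ γ τ ξ)
      have e2 : ‖2 * ‖γ‖ * b.repr ξ 0 - τ‖ₑ ≤ ‖shellSymbol ρ γ τ ξ‖ₑ := by
        rw [← ofReal_norm, ← ofReal_norm, mul_assoc, ← hin]
        refine ENNReal.ofReal_le_ofReal ?_
        have h := Complex.abs_im_le_norm (shellSymbol ρ γ τ ξ)
        simpa [shellSymbol, ← Complex.ofReal_pow] using h
      have e3 : ‖shellSymbol ρ γ τ ξ‖ₑ ^ (-(9 / 8) : ℝ) =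
          ‖shellSymbol ρ γ τ ξ‖ₑ ^ (-(1 / 4) : ℝ) * ‖shellSymbol ρ γ τ ξ‖ₑ ^ (-(7 / 8) : ℝ) := by
        by_cases h0 : ‖shellSymbol ρ γ τ ξ‖ₑ = 0
        · rw [h0, ENNReal.zero_rpow_of_neg (by norm_num), ENNReal.zero_rpow_of_neg (by norm_num),
            ENNReal.zero_rpow_of_neg (by norm_num), ENNReal.top_mul_top]
        · rw [hsum, ENNReal.rpow_add _ _ h0 enorm_ne_top]
      rw [e3]
      exact mul_le_mul' (enorm_rpow_antitone (by norm_num) e1)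
        (enorm_rpow_antitone (by norm_num) e2)
    · rw [indicator_of_notMem hξ]
      exact zero_le
  rw [← lintegral_indicator Metric.isClosed_closedBall.measurableSet]
  -- In the last coordinate the real part is `t² - (ρ² - |y|²)`; the bound `h₁` is uniform in this
  -- constant, so no care is needed where it changes sign.
  have hswap : ∀ y : Eucl (n + 1), ∫⁻ t : ℝ, G (glue (Fin.last (n + 1)) t y) ≤
      C₁ * (Metric.closedBall (0 : Eucl (n + 1)) M).indicator
        (fun y => ‖2 * ‖γ‖ * y 0 - τ‖ₑ ^ (-(7 / 8) : ℝ)) y := by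
    intro y
    by_cases hy : y ∈ Metric.closedBall (0 : Eucl (n + 1)) M
    · rw [indicator_of_mem hy]
      have h0 : ∀ t, glue (Fin.last (n + 1)) t y 0 = y 0 := fun t => by
        have h := glue_succAbove (Fin.last (n + 1)) t y 0
        rwa [Fin.succAbove_last, Fin.castSucc_zero] at h
      calc _ ≤ ∫⁻ t in Icc (-M) M, ‖t ^ 2 - (ρ ^ 2 - ‖y‖ ^ 2)‖ₑ ^ (-(1 / 4) : ℝ) *
            ‖2 * ‖γ‖ * y 0 - τ‖ₑ ^ (-(7 / 8) : ℝ) := by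
            rw [← lintegral_indicator measurableSet_Icc]
            refine lintegral_mono fun t => ?_
            by_cases ht : glue (Fin.last (n + 1)) t y ∈ Metric.closedBall (0 : Eucl (n + 2)) M
            · rw [hG, indicator_of_mem ht, indicator_of_mem
                (le_norm_of_glue _ (by simpa using ht)).1]
              simp only [hX]
              rw [h0, norm_glue_sq]
              refine le_of_eq ?_
              congr 3
              ring
            · rw [hG, indicator_of_notMem ht]
              exact zero_le
        _ = (∫⁻ t in Icc (-M) M, ‖t ^ 2 - (ρ ^ 2 - ‖y‖ ^ 2)‖ₑ ^ (-(1 / 4) : ℝ)) *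
            ‖2 * ‖γ‖ * y 0 - τ‖ₑ ^ (-(7 / 8) : ℝ) := lintegral_mul_const _ (by fun_prop)
        _ ≤ _ := by
            gcongr
            exact h₁ _
    · refine le_of_eq_of_le ?_ zero_le
      have h0 : ∀ t, G (glue (Fin.last (n + 1)) t y) = 0 := fun t =>
        indicator_of_notMem (fun h =>
          hy (by simpa using (le_norm_of_glue _ (by simpa using h)).2)) _
      simp [h0]
  have hY : ∫⁻ y : Eucl (n + 1), (Metric.closedBall (0 : Eucl (n + 1)) M).indicator
        (fun y => ‖2 * ‖γ‖ * y 0 - τ‖ₑ ^ (-(7 / 8) : ℝ)) y ≤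
      C₂ * volume (Metric.closedBall (0 : Eucl n) M) := by
    have hm : Measurable fun y : Eucl (n + 1) => ‖2 * ‖γ‖ * y 0 - τ‖ₑ ^ (-(7 / 8) : ℝ) := by
      have h1 : Measurable fun ζ : Eucl (n + 1) => ζ 0 :=
        (by fun_prop : Continuous fun ζ : Eucl (n + 1) => ζ 0).measurable
      fun_prop
    rw [lintegral_glue 0 (hm.indicator Metric.isClosed_closedBall.measurableSet).aemeasurable]
    calc _ ≤ ∫⁻ z : Eucl n, (Metric.closedBall (0 : Eucl n) M).indicator (fun _ => C₂) z := by
          refine lintegral_mono fun z => ?_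
          by_cases hz : z ∈ Metric.closedBall (0 : Eucl n) M
          · rw [indicator_of_mem hz]
            refine le_trans ?_ (h₂ τ)
            rw [← lintegral_indicator measurableSet_Icc]
            refine lintegral_mono fun t => ?_
            by_cases ht : glue 0 t z ∈ Metric.closedBall (0 : Eucl (n + 1)) M
            · rw [indicator_of_mem ht, indicator_of_mem
                (le_norm_of_glue _ (by simpa using ht)).1, glue_same]
            · rw [indicator_of_notMem ht]
              exact zero_le
          · refine le_of_eq_of_le ?_ zero_le
            have : ∀ t : ℝ, (Metric.closedBall (0 : Eucl (n + 1)) M).indicator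
                (fun y => ‖2 * ‖γ‖ * y 0 - τ‖ₑ ^ (-(7 / 8) : ℝ)) (glue 0 t z) = 0 := fun t =>
              indicator_of_notMem (fun h => hz
                (by simpa using (le_norm_of_glue _ (by simpa using h)).2)) _
            simp [this]
      _ = _ := by
          rw [lintegral_indicator Metric.isClosed_closedBall.measurableSet, setLIntegral_const]
  calc _ ≤ ∫⁻ ξ, G (b.repr ξ) := lintegral_mono hle
    _ = ∫⁻ ζ, G ζ := b.measurePreserving_repr.lintegral_comp hGm
    _ = ∫⁻ y : Eucl (n + 1), ∫⁻ t : ℝ, G (glue (Fin.last (n + 1)) t y) :=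
        lintegral_glue _ hGm.aemeasurable
    _ ≤ _ := lintegral_mono hswap
    _ = _ := lintegral_const_mul' _ _ hC₁.ne
    _ ≤ _ := by gcongr

/-! ### The bilinear form and its dependence on the regularization -/

/-- The bilinear form of the Fourier multiplier with symbol `1 / shellSymbol ρ γ τ`. -/
def shellForm {d : ℕ} (ρ : ℝ) (γ : Eucl d) (τ : ℝ) (f g : 𝓢(Eucl d, ℂ)) : ℂ :=
  ∫ ξ, 𝓕 f ξ * 𝓕⁻ g ξ / shellSymbol ρ γ τ ξ

theorem enorm_fourier_le {d : ℕ} (f : 𝓢(Eucl d, ℂ)) (ξ : Eucl d) :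
    ‖𝓕 f ξ‖ₑ ≤ ∫⁻ x, ‖f x‖ₑ := by
  rw [SchwartzMap.fourier_coe, Real.fourier_eq]
  refine (enorm_integral_le_lintegral_enorm _).trans_eq (lintegral_congr fun x => ?_)
  rw [← ofReal_norm, ← ofReal_norm, Circle.norm_smul]

theorem enorm_fourierInv_le {d : ℕ} (f : 𝓢(Eucl d, ℂ)) (ξ : Eucl d) :
    ‖𝓕⁻ f ξ‖ₑ ≤ ∫⁻ x, ‖f x‖ₑ := by
  rw [SchwartzMap.fourierInv_coe, Real.fourierInv_eq]
  refine (enorm_integral_le_lintegral_enorm _).trans_eq (lintegral_congr fun x => ?_)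
  rw [← ofReal_norm, ← ofReal_norm, Circle.norm_smul]

/-- Cauchy-Schwarz with a weight of ample strength. The wasteful exponent `d + 1` is harmless: it is
only used on the strong side of the interpolation. -/
theorem exists_lintegral_enorm_le_wL2 (d : ℕ) :
    ∃ c : ℝ≥0∞, c < ⊤ ∧ ∀ f : 𝓢(Eucl d, ℂ), ∫⁻ x, ‖f x‖ₑ ≤ c * ‖wL2 ((d : ℝ) + 1) f‖ₑ := by
  have hI : ∫⁻ x : Eucl d, ENNReal.ofReal ((1 + ‖x‖ ^ 2) ^ (-((d : ℝ) + 1))) < ⊤ := by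
    have h := (integrable_rpow_neg_one_add_norm_sq (E := Eucl d) (μ := volume)
      (r := 2 * ((d : ℝ) + 1)) (by simp; linarith)).lintegral_lt_top
    convert h using 5
    ring
  set I := ∫⁻ x : Eucl d, ENNReal.ofReal ((1 + ‖x‖ ^ 2) ^ (-((d : ℝ) + 1)))
  refine ⟨I ^ (1 / 2 : ℝ), ENNReal.rpow_lt_top_of_nonneg (by norm_num) hI.ne, fun f => ?_⟩
  have hw : ∀ e : ℝ, Measurable fun x : Eucl d => ENNReal.ofReal ((1 + ‖x‖ ^ 2) ^ e) :=
    fun e => by fun_prop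
  rw [← ENNReal.pow_le_pow_left_iff two_ne_zero, mul_pow, enorm_wL2_sq,
    ← ENNReal.rpow_natCast (I ^ _),
    ← ENNReal.rpow_mul]
  norm_num only [one_div, Nat.cast_ofNat, ENNReal.rpow_one]
  have hsq : ∀ (x : Eucl d) (e : ℝ), ENNReal.ofReal ((1 + ‖x‖ ^ 2) ^ (e / 2)) ^ 2 =
      ENNReal.ofReal ((1 + ‖x‖ ^ 2) ^ e) := fun x e => by
    rw [← ENNReal.ofReal_pow (by positivity), ← Real.rpow_natCast, ← Real.rpow_mul (by positivity)]
    congr 2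
    push_cast
    ring
  have h := lintegral_mul_sq_le (μ := (volume : Measure (Eucl d)))
    (f := fun x => ENNReal.ofReal ((1 + ‖x‖ ^ 2) ^ (-((d : ℝ) + 1) / 2)))
    (g := fun x => ENNReal.ofReal ((1 + ‖x‖ ^ 2) ^ (((d : ℝ) + 1) / 2)) * ‖f x‖ₑ)
    (hw _).aemeasurable ((hw _).mul f.continuous.measurable.enorm).aemeasurable
  simp_rw [mul_pow, hsq] at h
  refine le_trans (le_of_eq ?_) h
  congr 1
  refine lintegral_congr fun x => ?_
  rw [← mul_assoc, ← ENNReal.ofReal_mul (by positivity), ← Real.rpow_add (by positivity), neg_div,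
    neg_add_cancel, Real.rpow_zero, ENNReal.ofReal_one, one_mul]

/-- For `|a| ≤ |b|` one has `|a - b| ≤ 2 |b|`. Spending `7/8` of the power of `|a - b|` on this
leaves `|a - b|^(1/8) |a|⁻¹ |b|^(-1/8)`, and `|b|^(-1/8) ≤ |a|^(-1/8)`. -/
theorem enorm_inv_sub_inv_le (a b : ℂ) :
    ‖a⁻¹ - b⁻¹‖ₑ ≤ 2 * ‖a - b‖ₑ ^ (1 / 8 : ℝ) *
      (‖a‖ₑ ^ (-(9 / 8) : ℝ) + ‖b‖ₑ ^ (-(9 / 8) : ℝ)) := by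
  wlog hab : ‖a‖ ≤ ‖b‖ generalizing a b
  · have h := this b a (le_of_not_ge hab)
    rwa [← enorm_neg, neg_sub, ← enorm_neg (b - a), neg_sub, add_comm] at h
  rcases eq_or_ne a b with rfl | hne
  · simp
  have hpos : 0 < ‖a - b‖ := norm_pos_iff.2 (sub_ne_zero.2 hne)
  -- At `a = 0` the convention `0⁻¹ = 0` is harmless, since the right side is infinite.
  rcases eq_or_ne a 0 with rfl | ha
  · rw [enorm_zero, ENNReal.zero_rpow_of_neg (by norm_num), top_add, ENNReal.mul_top]
    · exact le_top
    · refine mul_ne_zero two_ne_zero ?_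
      rw [ne_eq, ENNReal.rpow_eq_zero_iff]
      simp only [zero_sub, enorm_neg, not_or, not_and, not_lt]
      exact ⟨fun h => absurd h (by simpa using hne.symm), fun h => absurd h enorm_ne_top⟩
  have ha' : 0 < ‖a‖ := norm_pos_iff.2 ha
  have hb' : 0 < ‖b‖ := ha'.trans_le hab
  have hb : b ≠ 0 := norm_pos_iff.1 hb'
  have key : ‖a⁻¹ - b⁻¹‖ ≤ 2 * ‖a - b‖ ^ (1 / 8 : ℝ) * ‖a‖ ^ (-(9 / 8) : ℝ) := by
    have h1 : ‖a⁻¹ - b⁻¹‖ = ‖a - b‖ ^ (1 / 8 : ℝ) * ‖a - b‖ ^ (7 / 8 : ℝ) * (‖a‖⁻¹ * ‖b‖⁻¹) := by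
      rw [inv_sub_inv ha hb, norm_div, norm_mul, ← Real.rpow_add hpos, ← norm_neg, neg_sub]
      norm_num
      ring
    have h2 : ‖a - b‖ ^ (7 / 8 : ℝ) ≤ 2 * ‖b‖ ^ (7 / 8 : ℝ) := by
      calc ‖a - b‖ ^ (7 / 8 : ℝ) ≤ (2 * ‖b‖) ^ (7 / 8 : ℝ) := by
            gcongr
            linarith [norm_sub_le a b]
        _ = (2 : ℝ) ^ (7 / 8 : ℝ) * ‖b‖ ^ (7 / 8 : ℝ) := Real.mul_rpow (by norm_num) hb'.le
        _ ≤ _ := by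
            gcongr
            calc (2 : ℝ) ^ (7 / 8 : ℝ) ≤ 2 ^ (1 : ℝ) :=
                  Real.rpow_le_rpow_of_exponent_le (by norm_num) (by norm_num)
              _ = 2 := Real.rpow_one _
    have h3 : ‖b‖ ^ (7 / 8 : ℝ) * ‖b‖⁻¹ ≤ ‖a‖ ^ (-(1 / 8) : ℝ) := by
      rw [← Real.rpow_neg_one ‖b‖, ← Real.rpow_add hb']
      norm_num only
      exact Real.rpow_le_rpow_of_nonpos ha' hab (by norm_num)
    rw [h1]
    calc _ ≤ ‖a - b‖ ^ (1 / 8 : ℝ) * (2 * ‖b‖ ^ (7 / 8 : ℝ)) * (‖a‖⁻¹ * ‖b‖⁻¹) := by gcongr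
      _ = 2 * ‖a - b‖ ^ (1 / 8 : ℝ) * ((‖b‖ ^ (7 / 8 : ℝ) * ‖b‖⁻¹) * ‖a‖⁻¹) := by ring
      _ ≤ 2 * ‖a - b‖ ^ (1 / 8 : ℝ) * (‖a‖ ^ (-(1 / 8) : ℝ) * ‖a‖⁻¹) := by gcongr
      _ = _ := by
          rw [← Real.rpow_neg_one ‖a‖, ← Real.rpow_add ha']
          norm_num
  refine le_trans ?_ (mul_le_mul' le_rfl le_self_add)
  rw [← ofReal_norm, ← ofReal_norm, ← ofReal_norm, ENNReal.ofReal_rpow_of_pos hpos,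
    ENNReal.ofReal_rpow_of_pos ha', ← ENNReal.ofReal_ofNat 2, ← ENNReal.ofReal_mul (by norm_num),
    ← ENNReal.ofReal_mul (by positivity)]
  exact ENNReal.ofReal_le_ofReal key

theorem one_le_norm_shellSymbol {d : ℕ} {ρ : ℝ} {γ : Eucl d} {τ : ℝ} {ξ : Eucl d}
    (h : ξ ∉ Metric.closedBall (0 : Eucl d) (|ρ| + 1)) : 1 ≤ ‖shellSymbol ρ γ τ ξ‖ := by
  refine le_trans ?_ (shellSymbol_eq_sq_sub ρ γ τ ξ)
  have h1 : |ρ| + 1 < ‖ξ‖ := by simpa using h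
  refine le_trans ?_ (le_abs_self _)
  rw [← sq_abs ρ]
  nlinarith [abs_nonneg ρ]

theorem enorm_inv_le_one_add (a : ℂ) : ‖a⁻¹‖ₑ ≤ 1 + ‖a‖ₑ ^ (-(9 / 8) : ℝ) := by
  rcases eq_or_ne a 0 with rfl | ha
  · simp
  have ha' : 0 < ‖a‖ := norm_pos_iff.2 ha
  rw [← ofReal_norm, ← ofReal_norm, ENNReal.ofReal_rpow_of_pos ha', norm_inv, ← ENNReal.ofReal_one,
    ← ENNReal.ofReal_add zero_le_one (by positivity)]
  refine ENNReal.ofReal_le_ofReal ?_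
  rcases le_total 1 ‖a‖ with h | h
  · have := Real.rpow_nonneg ha'.le (-(9 / 8))
    linarith [inv_le_one_of_one_le₀ h]
  · rw [← Real.rpow_neg_one]
    have := Real.rpow_le_rpow_of_exponent_ge ha' h (by norm_num : (-(9 / 8) : ℝ) ≤ -1)
    linarith

variable {n : ℕ}

/-- For `γ = 0` the symbol has modulus at least `|τ|`. For `γ ≠ 0` it may have zeros for every `τ`,
and the reciprocal is integrable near them only by virtue of `exists_setLIntegral_shellSymbol_le`.
-/
theorem integrable_div_shellSymbol {ρ : ℝ} {γ : Eucl (n + 2)} {τ : ℝ} (hτ : τ ≠ 0)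
    {F : Eucl (n + 2) → ℂ} (hF : Integrable F) {B : ℝ≥0∞} (hB : B < ⊤) (hFB : ∀ ξ, ‖F ξ‖ₑ ≤ B) :
    Integrable fun ξ => F ξ / shellSymbol ρ γ τ ξ := by
  have hm : Measurable fun ξ => (shellSymbol ρ γ τ ξ)⁻¹ :=
    (continuous_shellSymbol ρ γ τ).measurable.inv
  have hmeas : AEStronglyMeasurable (fun ξ => F ξ / shellSymbol ρ γ τ ξ) volume := by
    simp_rw [div_eq_mul_inv]
    exact hF.1.mul hm.aestronglyMeasurable
  rcases eq_or_ne γ 0 with rfl | hγ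
  · refine (hF.norm.const_mul |τ|⁻¹).mono' hmeas (.of_forall fun ξ => ?_)
    have h1 : |τ| ≤ ‖shellSymbol ρ 0 τ ξ‖ := by
      have h := Complex.abs_im_le_norm (shellSymbol ρ 0 τ ξ)
      simpa [shellSymbol, ← Complex.ofReal_pow] using h
    rw [norm_div, div_eq_inv_mul]
    gcongr
  refine ⟨hmeas, ?_⟩
  obtain ⟨C, hC, hCτ⟩ := exists_setLIntegral_shellSymbol_le hγ ρ (|ρ| + 1)
  set S := Metric.closedBall (0 : Eucl (n + 2)) (|ρ| + 1) with hS
  have hvol : volume S < ⊤ := measure_closedBall_lt_top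
  have hpt : ∀ ξ, ‖F ξ / shellSymbol ρ γ τ ξ‖ₑ ≤
      S.indicator (fun ξ => B * (1 + ‖shellSymbol ρ γ τ ξ‖ₑ ^ (-(9 / 8) : ℝ))) ξ + ‖F ξ‖ₑ := by
    intro ξ
    rw [div_eq_mul_inv, enorm_mul]
    by_cases h : ξ ∈ S
    · rw [indicator_of_mem h]
      exact (mul_le_mul' (hFB ξ) (enorm_inv_le_one_add _)).trans le_self_add
    · rw [indicator_of_notMem h, zero_add]
      refine (mul_le_mul' le_rfl ?_).trans_eq (mul_one _)
      rw [← ofReal_norm, ENNReal.ofReal_le_one, norm_inv]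
      exact inv_le_one_of_one_le₀ (one_le_norm_shellSymbol h)
  rw [hasFiniteIntegral_iff_enorm]
  refine (lintegral_mono hpt).trans_lt ?_
  have hm2 : Measurable fun ξ => ‖shellSymbol ρ γ τ ξ‖ₑ ^ (-(9 / 8) : ℝ) :=
    (continuous_shellSymbol ρ γ τ).measurable.enorm.pow_const _
  have hm3 : Measurable (S.indicator fun ξ =>
      B * (1 + ‖shellSymbol ρ γ τ ξ‖ₑ ^ (-(9 / 8) : ℝ))) :=
    (measurable_const.mul (measurable_const.add hm2)).indicator
      Metric.isClosed_closedBall.measurableSet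
  rw [lintegral_add_left hm3, lintegral_indicator Metric.isClosed_closedBall.measurableSet,
    lintegral_const_mul' _ _ hB.ne, lintegral_add_left measurable_const]
  refine ENNReal.add_lt_top.2 ⟨ENNReal.mul_lt_top hB (ENNReal.add_lt_top.2 ⟨?_, ?_⟩), hF.2⟩
  · simpa using hvol
  · exact (hCτ τ).trans_lt hC

theorem integrable_fourier_mul_fourierInv {d : ℕ} (f g : 𝓢(Eucl d, ℂ)) :
    Integrable fun ξ => 𝓕 f ξ * 𝓕⁻ g ξ := by
  refine ⟨((𝓕 f).continuous.mul (𝓕⁻ g).continuous).aestronglyMeasurable, ?_⟩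
  rw [hasFiniteIntegral_iff_enorm]
  exact (lintegral_fourier_mul_fourierInv_le f g).trans_lt
    (ENNReal.mul_lt_top enorm_lt_top enorm_lt_top)

theorem enorm_fourier_mul_fourierInv_le {d : ℕ} (f g : 𝓢(Eucl d, ℂ)) (ξ : Eucl d) :
    ‖𝓕 f ξ * 𝓕⁻ g ξ‖ₑ ≤ (∫⁻ x, ‖f x‖ₑ) * ∫⁻ x, ‖g x‖ₑ := by
  rw [enorm_mul]
  exact mul_le_mul' (enorm_fourier_le f ξ) (enorm_fourierInv_le g ξ)

theorem lintegral_enorm_schwartz_lt_top {d : ℕ} (f : 𝓢(Eucl d, ℂ)) : ∫⁻ x, ‖f x‖ₑ < ⊤ :=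
  f.integrable.2

theorem integrable_shellForm (ρ : ℝ) (γ : Eucl (n + 2)) {τ : ℝ} (hτ : τ ≠ 0)
    (f g : 𝓢(Eucl (n + 2), ℂ)) :
    Integrable fun ξ => 𝓕 f ξ * 𝓕⁻ g ξ / shellSymbol ρ γ τ ξ :=
  integrable_div_shellSymbol hτ (integrable_fourier_mul_fourierInv f g)
    (ENNReal.mul_lt_top (lintegral_enorm_schwartz_lt_top f) (lintegral_enorm_schwartz_lt_top g))
    (enorm_fourier_mul_fourierInv_le f g)

theorem shellSymbol_sub {d : ℕ} (ρ : ℝ) (γ : Eucl d) (τ τ' : ℝ) (ξ : Eucl d) :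
    shellSymbol ρ γ τ ξ - shellSymbol ρ γ τ' ξ = Complex.I * ((τ' - τ : ℝ) : ℂ) := by
  simp only [shellSymbol]
  push_cast
  ring

theorem enorm_shellSymbol_sub {d : ℕ} (ρ : ℝ) (γ : Eucl d) (τ τ' : ℝ) (ξ : Eucl d) :
    ‖shellSymbol ρ γ τ ξ - shellSymbol ρ γ τ' ξ‖ₑ = ‖τ' - τ‖ₑ := by
  rw [shellSymbol_sub, enorm_mul, ← ofReal_norm, ← ofReal_norm, Complex.norm_I, Complex.norm_real,
    ofReal_norm]
  simp

/-- For `γ ≠ 0` the bilinear form is Hölder continuous in `τ`. -/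
theorem exists_enorm_shellForm_sub_le_of_ne_zero {γ : Eucl (n + 2)} (hγ : γ ≠ 0) (ρ : ℝ) :
    ∃ C : ℝ≥0∞, C < ⊤ ∧ ∀ τ τ' : ℝ, τ ≠ 0 → τ' ≠ 0 → ∀ f g : 𝓢(Eucl (n + 2), ℂ),
      ‖shellForm ρ γ τ f g - shellForm ρ γ τ' f g‖ₑ ≤
        C * (‖τ' - τ‖ₑ ^ (1 / 8 : ℝ) + ‖τ' - τ‖ₑ) *
          (‖wL2 (((n + 2 : ℕ) : ℝ) + 1) f‖ₑ * ‖wL2 (((n + 2 : ℕ) : ℝ) + 1) g‖ₑ) := by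
  obtain ⟨C, hC, hCτ⟩ := exists_setLIntegral_shellSymbol_le hγ ρ (|ρ| + 1)
  obtain ⟨c, hc, hcf⟩ := exists_lintegral_enorm_le_wL2 (n + 2)
  set S := Metric.closedBall (0 : Eucl (n + 2)) (|ρ| + 1) with hS
  refine ⟨c * c * (2 * (C + C)) + 1, ENNReal.add_lt_top.2 ⟨ENNReal.mul_lt_top
    (ENNReal.mul_lt_top hc hc) (ENNReal.mul_lt_top (by norm_num) (ENNReal.add_lt_top.2 ⟨hC, hC⟩)),
    by norm_num⟩, fun τ τ' hτ hτ' f g => ?_⟩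
  set e := ‖τ' - τ‖ₑ with he
  set F := fun ξ => 𝓕 f ξ * 𝓕⁻ g ξ with hF
  set N := ‖wL2 (((n + 2 : ℕ) : ℝ) + 1) f‖ₑ * ‖wL2 (((n + 2 : ℕ) : ℝ) + 1) g‖ₑ with hN
  have hFB : ∀ ξ, ‖F ξ‖ₑ ≤ c * c * N := fun ξ => by
    refine (enorm_fourier_mul_fourierInv_le f g ξ).trans ((mul_le_mul' (hcf f) (hcf g)).trans_eq ?_)
    rw [hN]
    ring
  have hFI : ∫⁻ ξ, ‖F ξ‖ₑ ≤ N :=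
    (lintegral_fourier_mul_fourierInv_le f g).trans
      (mul_le_mul' (enorm_toLp_le_wL2 (by positivity) f) (enorm_toLp_le_wL2 (by positivity) g))
  -- Inside the ball the difference of reciprocals is Hölder of order `1/8` with integrable
  -- constant; outside both symbols have modulus at least one and the difference is Lipschitz. This
  -- explains the two powers of `|τ' - τ|`.
  have hpt : ∀ ξ, ‖F ξ / shellSymbol ρ γ τ ξ - F ξ / shellSymbol ρ γ τ' ξ‖ₑ ≤
      S.indicator (fun ξ => (c * c * N * (2 * e ^ (1 / 8 : ℝ))) *
        (‖shellSymbol ρ γ τ ξ‖ₑ ^ (-(9 / 8) : ℝ) + ‖shellSymbol ρ γ τ' ξ‖ₑ ^ (-(9 / 8) : ℝ))) ξ +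
        e * ‖F ξ‖ₑ := by
    intro ξ
    rw [div_eq_mul_inv, div_eq_mul_inv, ← mul_sub, enorm_mul]
    by_cases h : ξ ∈ S
    · rw [indicator_of_mem h, mul_assoc]
      refine (mul_le_mul' (hFB ξ) ?_).trans le_self_add
      rw [he, ← enorm_shellSymbol_sub ρ γ τ τ' ξ]
      exact enorm_inv_sub_inv_le _ _
    · rw [indicator_of_notMem h, zero_add, mul_comm]
      refine mul_le_mul' ?_ le_rfl
      have h1 := one_le_norm_shellSymbol (γ := γ) (τ := τ) h
      have h2 := one_le_norm_shellSymbol (γ := γ) (τ := τ') h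
      rw [inv_sub_inv (norm_pos_iff.1 (by linarith)) (norm_pos_iff.1 (by linarith)), he,
        ← enorm_shellSymbol_sub ρ γ τ τ' ξ, ← ofReal_norm, ← ofReal_norm]
      refine ENNReal.ofReal_le_ofReal ?_
      rw [norm_div, ← norm_neg, neg_sub, norm_mul]
      exact div_le_self (norm_nonneg _) (one_le_mul_of_one_le_of_one_le h1 h2)
  have hm2 : ∀ τ, Measurable fun ξ => ‖shellSymbol ρ γ τ ξ‖ₑ ^ (-(9 / 8) : ℝ) := fun τ =>
    (continuous_shellSymbol ρ γ τ).measurable.enorm.pow_const _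
  rw [shellForm, shellForm,
    ← integral_sub (integrable_shellForm ρ γ hτ f g) (integrable_shellForm ρ γ hτ' f g)]
  have hN1 : N < ⊤ := ENNReal.mul_lt_top enorm_lt_top enorm_lt_top
  have he1 : e ^ (1 / 8 : ℝ) < ⊤ := ENNReal.rpow_lt_top_of_nonneg (by norm_num) enorm_ne_top
  have hK : c * c * N * (2 * e ^ (1 / 8 : ℝ)) < ⊤ :=
    ENNReal.mul_lt_top (ENNReal.mul_lt_top (ENNReal.mul_lt_top hc hc) hN1)
      (ENNReal.mul_lt_top (by norm_num) he1)
  refine (enorm_integral_le_lintegral_enorm _).trans ((lintegral_mono hpt).trans ?_)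
  have hm3 : Measurable (S.indicator fun ξ => c * c * N * (2 * e ^ (1 / 8 : ℝ)) *
      (‖shellSymbol ρ γ τ ξ‖ₑ ^ (-(9 / 8) : ℝ) + ‖shellSymbol ρ γ τ' ξ‖ₑ ^ (-(9 / 8) : ℝ))) :=
    (measurable_const.mul ((hm2 τ).add (hm2 τ'))).indicator
      Metric.isClosed_closedBall.measurableSet
  rw [lintegral_add_left hm3,
    lintegral_indicator Metric.isClosed_closedBall.measurableSet, lintegral_const_mul' _ _ hK.ne,
    lintegral_add_left (hm2 τ), lintegral_const_mul' _ _ enorm_ne_top]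
  calc _ ≤ (c * c * N * (2 * e ^ (1 / 8 : ℝ))) * (C + C) + e * N := by
        gcongr
        · exact hCτ τ
        · exact hCτ τ'
    _ = (c * c * (2 * (C + C))) * e ^ (1 / 8 : ℝ) * N + 1 * e * N := by ring
    _ ≤ (c * c * (2 * (C + C)) + 1) * e ^ (1 / 8 : ℝ) * N +
          (c * c * (2 * (C + C)) + 1) * e * N := by
        gcongr
        · exact le_self_add
        · exact le_add_self
    _ = _ := by ring

/-! ### Fourier multipliers on weighted spaces -/

section multipliers

variable {d : ℕ}

/-- The transpose of the Fourier multiplier with symbol `ψ`. -/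
def transposeMultiplier (ψ : Eucl d → ℂ) : 𝓢(Eucl d, ℂ) →L[ℂ] 𝓢(Eucl d, ℂ) :=
  FourierTransform.fourierCLM ℂ 𝓢(Eucl d, ℂ) ∘L SchwartzMap.smulLeftCLM ℂ ψ ∘L
    FourierTransform.fourierInvCLM ℂ 𝓢(Eucl d, ℂ)

theorem transposeMultiplier_apply (ψ : Eucl d → ℂ) (f : 𝓢(Eucl d, ℂ)) :
    transposeMultiplier ψ f = 𝓕 (SchwartzMap.smulLeftCLM ℂ ψ (𝓕⁻ f)) := rfl

theorem transposeMultiplier_eq {ψ : Eucl d → ℂ} (hψ : ψ.HasTemperateGrowth)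
    (f : 𝓢(Eucl d, ℂ)) :
    transposeMultiplier ψ f = SchwartzMap.fourierMultiplierCLM ℂ (fun ξ => ψ (-ξ)) f := by
  have hψ' : (fun ξ => ψ (-ξ)).HasTemperateGrowth :=
    hψ.comp (-ContinuousLinearMap.id ℝ (Eucl d)).hasTemperateGrowth
  ext x
  rw [transposeMultiplier_apply, SchwartzMap.fourierMultiplierCLM_apply, SchwartzMap.fourier_coe,
    SchwartzMap.fourierInv_coe, Real.fourierInv_eq_fourier_comp_neg]
  refine congrArg (fun h : Eucl d → ℂ => 𝓕 h x) (funext fun ξ => ?_)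
  rw [SchwartzMap.smulLeftCLM_apply_apply hψ, SchwartzMap.smulLeftCLM_apply_apply hψ', neg_neg,
    SchwartzMap.fourierInv_coe, SchwartzMap.fourier_coe, Real.fourierInv_eq_fourier_neg]

theorem one_add_norm_sq_le (x y : Eucl d) :
    1 + ‖x + y‖ ^ 2 ≤ 2 * (1 + ‖x‖ ^ 2) * (1 + ‖y‖ ^ 2) := by
  have h := norm_add_le x y
  have : ‖x + y‖ ^ 2 ≤ (‖x‖ + ‖y‖) ^ 2 := by gcongr
  nlinarith [sq_nonneg (‖x‖ - ‖y‖), mul_nonneg (sq_nonneg ‖x‖) (sq_nonneg ‖y‖)]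

/-- Peetre's inequality. -/
theorem one_add_norm_sq_rpow_le (η : ℝ) (x y : Eucl d) :
    (1 + ‖x + y‖ ^ 2) ^ η ≤ (2 * (1 + ‖x‖ ^ 2)) ^ |η| * (1 + ‖y‖ ^ 2) ^ η := by
  rcases le_total 0 η with h | h
  · rw [abs_of_nonneg h, ← Real.mul_rpow (by positivity) (by positivity)]
    exact Real.rpow_le_rpow (by positivity) (one_add_norm_sq_le x y) h
  · rw [abs_of_nonpos h, Real.rpow_neg (by positivity), ← div_eq_inv_mul,
      le_div_iff₀ (by positivity), ← Real.mul_rpow (by positivity) (by positivity)]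
    refine Real.rpow_le_rpow_of_nonpos (by positivity) ?_ h
    have := one_add_norm_sq_le (-x) (x + y)
    rw [neg_add_cancel_left, norm_neg] at this
    linarith

/-- The weighted `L¹` norm that controls a convolution on the weighted `L²` spaces. -/
def kernelNorm (η : ℝ) (K : 𝓢(Eucl d, ℂ)) : ℝ≥0∞ :=
  ∫⁻ t, ‖K t‖ₑ * ENNReal.ofReal ((2 * (1 + ‖t‖ ^ 2)) ^ (|η| / 2))

theorem kernelNorm_lt_top (η : ℝ) (K : 𝓢(Eucl d, ℂ)) : kernelNorm η K < ⊤ := by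
  have hg : (fun t : Eucl d =>
      (((2 : ℝ) ^ (|η| / 2) * weight |η| 1 t : ℝ) : ℂ)).HasTemperateGrowth :=
    Function.Complex.hasTemperateGrowth_ofReal.comp
      ((Function.HasTemperateGrowth.const _).mul (hasTemperateGrowth_weight_real _ _))
  have h := (SchwartzMap.smulLeftCLM ℂ
    (fun t : Eucl d => (((2 : ℝ) ^ (|η| / 2) * weight |η| 1 t : ℝ) : ℂ)) K).integrable
      (μ := volume) |>.2
  rw [hasFiniteIntegral_iff_enorm] at h
  refine lt_of_le_of_lt (lintegral_mono fun t => ?_) h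
  rw [SchwartzMap.smulLeftCLM_apply_apply hg, smul_eq_mul, enorm_mul, mul_comm, weight_one,
    ← Real.mul_rpow (by norm_num) (by positivity)]
  refine mul_le_mul' (le_of_eq ?_) le_rfl
  rw [← ofReal_norm, Complex.norm_real, Real.norm_of_nonneg (by positivity)]

/-- Young's inequality for `L¹ * L²`, after Peetre's inequality has moved the growth of the weight
onto the kernel. The sign of `η` plays no role, so the same bound serves the dual weights. -/
theorem enorm_wL2_convolution_le (η : ℝ) (K f : 𝓢(Eucl d, ℂ)) :
    ‖wL2 η (SchwartzMap.convolution (ContinuousLinearMap.mul ℂ ℂ) K f)‖ₑ ≤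
      kernelNorm η K * ‖wL2 η f‖ₑ := by
  set A : Eucl d → ℝ≥0∞ := fun t =>
    ‖K t‖ₑ * ENNReal.ofReal ((2 * (1 + ‖t‖ ^ 2)) ^ (|η| / 2)) with hA
  set G : Eucl d → ℝ≥0∞ := fun x => ENNReal.ofReal ((1 + ‖x‖ ^ 2) ^ (η / 2)) * ‖f x‖ₑ with hG
  have hAm : Measurable A := by
    have := K.continuous.measurable
    fun_prop
  have hGm : Measurable G := by
    have := f.continuous.measurable
    fun_prop
  have hG2 : ∀ x, G x ^ 2 = ENNReal.ofReal ((1 + ‖x‖ ^ 2) ^ η) * ‖f x‖ₑ ^ 2 := fun x => by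
    rw [hG, mul_pow, ← ENNReal.ofReal_pow (by positivity), ← Real.rpow_natCast,
      ← Real.rpow_mul (by positivity)]
    norm_num
  have hpt : ∀ x, ENNReal.ofReal ((1 + ‖x‖ ^ 2) ^ η) *
      ‖SchwartzMap.convolution (ContinuousLinearMap.mul ℂ ℂ) K f x‖ₑ ^ 2 ≤
        (∫⁻ t, A t) * ∫⁻ t, A t * G (x - t) ^ 2 := by
    intro x
    have h1 : ENNReal.ofReal ((1 + ‖x‖ ^ 2) ^ (η / 2)) *
        ‖SchwartzMap.convolution (ContinuousLinearMap.mul ℂ ℂ) K f x‖ₑ ≤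
          ∫⁻ t, A t * G (x - t) := by
      rw [SchwartzMap.convolution_apply, MeasureTheory.convolution]
      refine (mul_le_mul' le_rfl (enorm_integral_le_lintegral_enorm _)).trans ?_
      rw [← lintegral_const_mul' _ _ ENNReal.ofReal_ne_top]
      refine lintegral_mono fun t => ?_
      rw [ContinuousLinearMap.mul_apply', enorm_mul]
      have h2 := one_add_norm_sq_rpow_le (η / 2) t (x - t)
      rw [add_sub_cancel, abs_div, abs_two] at h2
      calc _ ≤ ENNReal.ofReal ((2 * (1 + ‖t‖ ^ 2)) ^ (|η| / 2) * (1 + ‖x - t‖ ^ 2) ^ (η / 2)) *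
            (‖K t‖ₑ * ‖f (x - t)‖ₑ) := by gcongr
        _ = _ := by
          rw [ENNReal.ofReal_mul (by positivity)]
          simp only [hA, hG]
          ring
    -- Cauchy-Schwarz for the functions `1` and `G (x - ·)` with respect to the finite measure `A
    -- dt`.
    have h3 : (∫⁻ t, A t * G (x - t)) ^ 2 ≤ (∫⁻ t, A t) * ∫⁻ t, A t * G (x - t) ^ 2 := by
      have hGx : Measurable fun t => G (x - t) := hGm.comp (measurable_const.sub measurable_id)
      have h4 := lintegral_mul_sq_le (μ := volume.withDensity A) (f := fun _ => 1)
        (g := fun t => G (x - t)) aemeasurable_const hGx.aemeasurable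
      simp only [one_mul, one_pow] at h4
      rw [lintegral_withDensity_eq_lintegral_mul _ hAm hGx,
        lintegral_withDensity_eq_lintegral_mul _ hAm (hGx.pow_const 2),
        lintegral_withDensity_eq_lintegral_mul _ hAm measurable_const] at h4
      simpa using h4
    refine le_trans ?_ h3
    refine le_trans (le_of_eq ?_) (pow_le_pow_left' h1 2)
    rw [mul_pow, ← ENNReal.ofReal_pow (by positivity), ← Real.rpow_mul_natCast (by positivity)]
    norm_num
  rw [← ENNReal.pow_le_pow_left_iff two_ne_zero, mul_pow, enorm_wL2_sq, enorm_wL2_sq]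
  refine (lintegral_mono hpt).trans ?_
  have hF : (∫⁻ t, A t) ≠ ⊤ := (kernelNorm_lt_top η K).ne
  rw [lintegral_const_mul' _ _ hF, lintegral_lintegral_swap]
  · have h5 : ∀ t, ∫⁻ x, A t * G (x - t) ^ 2 = A t * ∫⁻ x, G x ^ 2 := fun t => by
      rw [lintegral_const_mul _ (by fun_prop), lintegral_sub_right_eq_self (fun x => G x ^ 2) t]
    simp_rw [h5]
    rw [lintegral_mul_const _ hAm, ← mul_assoc, ← sq]
    simp_rw [hG2]
    rfl
  · have : Measurable fun p : Eucl d × Eucl d => A p.2 * G (p.1 - p.2) ^ 2 := by fun_prop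
    exact this.aemeasurable

theorem fourierMultiplierCLM_eq_convolution (ψ f : 𝓢(Eucl d, ℂ)) :
    SchwartzMap.fourierMultiplierCLM ℂ (fun ξ => ψ ξ) f =
      SchwartzMap.convolution (ContinuousLinearMap.mul ℂ ℂ) (𝓕⁻ ψ) f := by
  have h : 𝓕 (SchwartzMap.convolution (ContinuousLinearMap.mul ℂ ℂ) (𝓕⁻ ψ) f) =
      SchwartzMap.smulLeftCLM ℂ (fun ξ => ψ ξ) (𝓕 f) := by
    rw [SchwartzMap.fourier_convolution, FourierTransform.fourier_fourierInv_eq]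
    ext ξ
    rw [SchwartzMap.pairing_apply_apply, SchwartzMap.smulLeftCLM_apply_apply ψ.hasTemperateGrowth]
    rfl
  rw [SchwartzMap.fourierMultiplierCLM_apply, ← h, FourierTransform.fourierInv_fourier_eq]

/-- The Schwartz function `ξ ↦ ψ (a ξ)`. -/
def dilate (a : ℝ) (ha : a ≠ 0) : 𝓢(Eucl d, ℂ) →L[ℂ] 𝓢(Eucl d, ℂ) :=
  SchwartzMap.compCLMOfContinuousLinearEquiv ℂ
    (ContinuousLinearEquiv.smulLeft (Units.mk0 a ha))

theorem dilate_apply (a : ℝ) (ha : a ≠ 0) (ψ : 𝓢(Eucl d, ℂ)) (ξ : Eucl d) :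
    dilate a ha ψ ξ = ψ (a • ξ) := rfl

theorem fourierInv_dilate (a : ℝ) (ha : a ≠ 0) (ψ : 𝓢(Eucl d, ℂ)) (x : Eucl d) :
    𝓕⁻ (dilate a ha ψ) x = |(a ^ d)⁻¹| • 𝓕⁻ ψ (a⁻¹ • x) := by
  rw [SchwartzMap.fourierInv_coe, SchwartzMap.fourierInv_coe, Real.fourierInv_eq,
    Real.fourierInv_eq]
  have h := Measure.integral_comp_smul (μ := (volume : Measure (Eucl d)))
    (fun v => Real.fourierChar (⟪v, a⁻¹ • x⟫) • ψ v) a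
  rw [finrank_euclideanSpace_fin] at h
  rw [← h]
  congr 1
  ext v
  rw [dilate_apply, inner_smul_left, inner_smul_right]
  simp [ha]

/-- The kernel of `ψ(a D)` is `a ^ (-d) K(x / a)`. For `a ≤ 1` it is more concentrated near the
origin than `K`, where the weight is smaller. Large dilations would fail. -/
theorem kernelNorm_dilate_le (η : ℝ) {a : ℝ} (ha : a ∈ Ioc (0 : ℝ) 1) (ψ : 𝓢(Eucl d, ℂ)) :
    kernelNorm η (𝓕⁻ (dilate a ha.1.ne' ψ)) ≤ kernelNorm η (𝓕⁻ ψ) := by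
  have ha0 := ha.1
  set G : Eucl d → ℝ≥0∞ := fun t => ‖𝓕⁻ ψ (a⁻¹ • t)‖ₑ *
    ENNReal.ofReal ((2 * (1 + ‖t‖ ^ 2)) ^ (|η| / 2)) with hG
  have hGm : Measurable G := by
    have := (𝓕⁻ ψ).continuous.measurable
    fun_prop
  have h1 : ∫⁻ t, G (a • t) = ENNReal.ofReal |(a ^ d)⁻¹| * ∫⁻ t, G t := by
    have h := lintegral_map (μ := (volume : Measure (Eucl d))) hGm (measurable_const_smul a)
    rw [Measure.map_addHaar_smul volume ha0.ne', finrank_euclideanSpace_fin,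
      lintegral_smul_measure] at h
    rw [← h, smul_eq_mul]
  calc kernelNorm η (𝓕⁻ (dilate a ha.1.ne' ψ)) = ENNReal.ofReal |(a ^ d)⁻¹| * ∫⁻ t, G t := by
        rw [← lintegral_const_mul' _ _ ENNReal.ofReal_ne_top]
        refine lintegral_congr fun t => ?_
        rw [fourierInv_dilate, enorm_smul, hG, mul_assoc]
        congr 1
        rw [← ofReal_norm, Real.norm_eq_abs, abs_abs]
    _ = ∫⁻ t, G (a • t) := h1.symm
    _ ≤ _ := by
        refine lintegral_mono fun t => ?_
        simp only [hG]
        rw [smul_smul, inv_mul_cancel₀ ha0.ne', one_smul, norm_smul, Real.norm_of_nonneg ha0.le]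
        gcongr
        exact mul_le_of_le_one_left (norm_nonneg _) ha.2

/-- The multipliers with symbols `ψ (a ξ)`, `a ≤ 1`, are uniformly bounded on weighted spaces. -/
theorem enorm_wL2_fourierMultiplierCLM_le (η : ℝ) (ψ : 𝓢(Eucl d, ℂ)) {a : ℝ}
    (ha : a ∈ Ioc (0 : ℝ) 1) (f : 𝓢(Eucl d, ℂ)) :
    ‖wL2 η (SchwartzMap.fourierMultiplierCLM ℂ (fun ξ => ψ (a • ξ)) f)‖ₑ ≤
      kernelNorm η (𝓕⁻ ψ) * ‖wL2 η f‖ₑ := by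
  have h := fourierMultiplierCLM_eq_convolution (dilate a ha.1.ne' ψ) f
  simp_rw [dilate_apply] at h
  rw [h]
  exact (enorm_wL2_convolution_le η _ f).trans
    (mul_le_mul' (kernelNorm_dilate_le η ha ψ) le_rfl)

end multipliers

/-! ### Dependence on the regularization in the case `γ = 0` -/

section zeroDirection

variable {d : ℕ}

theorem hasTemperateGrowth_inner_left (v : Eucl d) :
    (fun x : Eucl d => (⟪x, v⟫ : ℝ)).HasTemperateGrowth :=
  ((innerSL ℝ).flip v).hasTemperateGrowth

theorem enorm_wL2_smulLeftCLM_inner_le (η : ℝ) (v : Eucl d) (hv : ‖v‖ ≤ 1) (f : 𝓢(Eucl d, ℂ)) :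
    ‖wL2 η (SchwartzMap.smulLeftCLM ℂ (fun x : Eucl d => (⟪x, v⟫ : ℝ)) f)‖ₑ ≤
      ‖wL2 (η + 1) f‖ₑ := by
  rw [← ENNReal.pow_le_pow_left_iff two_ne_zero, enorm_wL2_sq, enorm_wL2_sq]
  refine lintegral_mono fun x => ?_
  rw [SchwartzMap.smulLeftCLM_apply_apply (hasTemperateGrowth_inner_left v), enorm_smul, mul_pow,
    ← mul_assoc, Real.rpow_add (by positivity), Real.rpow_one, ENNReal.ofReal_mul (by positivity)]
  gcongr
  rw [← ofReal_norm, ← ENNReal.ofReal_pow (norm_nonneg _)]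
  refine ENNReal.ofReal_le_ofReal ?_
  have h : ‖⟪x, v⟫‖ ≤ ‖x‖ :=
    (norm_inner_le_norm x v).trans (mul_le_of_le_one_right (norm_nonneg _) hv)
  have : ‖⟪x, v⟫‖ ^ 2 ≤ ‖x‖ ^ 2 := by gcongr
  linarith

/-- A smooth cutoff, equal to one near `ρ ^ 2` and supported away from zero. -/
def shellBump (ρ : ℝ) (hρ : 0 < ρ) : ContDiffBump (ρ ^ 2) where
  rIn := ρ ^ 2 / 2
  rOut := 3 * ρ ^ 2 / 4
  rIn_pos := by positivity
  rIn_lt_rOut := by nlinarith [pow_pos hρ 2]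

theorem abs_sub_le_of_shellBump_ne_zero {ρ : ℝ} (hρ : 0 < ρ) {s : ℝ} (h : shellBump ρ hρ s ≠ 0) :
    |s - ρ ^ 2| < 3 * ρ ^ 2 / 4 := by
  have h1 : s ∈ Function.support (shellBump ρ hρ) := h
  rw [(shellBump ρ hρ).support_eq] at h1
  exact h1

theorem contDiff_shellBump_div {ρ : ℝ} (hρ : 0 < ρ) :
    ContDiff ℝ ∞ fun s => shellBump ρ hρ s / (2 * s) := by
  rw [contDiff_iff_contDiffAt]
  intro s
  have hρ2 : 0 < ρ ^ 2 := by positivity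
  rcases eq_or_ne s 0 with rfl | hs
  · have h : (fun s => shellBump ρ hρ s / (2 * s)) =ᶠ[𝓝 0] fun _ => 0 := by
      filter_upwards [Iio_mem_nhds (show (0 : ℝ) < ρ ^ 2 / 4 by positivity)] with s hs
      by_contra hne
      have := (abs_lt.1 (abs_sub_le_of_shellBump_ne_zero hρ (left_ne_zero_of_mul hne))).1
      have hs' : s < ρ ^ 2 / 4 := hs
      linarith
    exact contDiffAt_const.congr_of_eventuallyEq h
  · exact (shellBump ρ hρ).contDiff.contDiffAt.div (by fun_prop) (by simpa using hs)

/-- The symbol `ξ ↦ ⟪ξ, v⟫ h(|ξ|²) / (2 |ξ|²)`, with a cutoff `h` near the sphere. -/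
def shellFieldFun (ρ : ℝ) (hρ : 0 < ρ) (v ξ : Eucl d) : ℂ :=
  ((⟪ξ, v⟫ * (shellBump ρ hρ (‖ξ‖ ^ 2) / (2 * ‖ξ‖ ^ 2)) : ℝ) : ℂ)

theorem contDiff_shellFieldFun {ρ : ℝ} (hρ : 0 < ρ) (v : Eucl d) :
    ContDiff ℝ ∞ (shellFieldFun ρ hρ v) :=
  Complex.ofRealCLM.contDiff.comp
    ((contDiff_id.inner ℝ contDiff_const).mul
      ((contDiff_shellBump_div hρ).comp (contDiff_norm_sq ℝ)))

theorem hasCompactSupport_shellFieldFun {ρ : ℝ} (hρ : 0 < ρ) (v : Eucl d) :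
    HasCompactSupport (shellFieldFun ρ hρ v) := by
  refine HasCompactSupport.intro (isCompact_closedBall (0 : Eucl d) (2 * ρ)) fun ξ hξ => ?_
  by_contra hne
  have h0 : shellBump ρ hρ (‖ξ‖ ^ 2) ≠ 0 := fun h => hne (by simp [shellFieldFun, h])
  have h1 := (abs_lt.1 (abs_sub_le_of_shellBump_ne_zero hρ h0)).2
  have h2 : 2 * ρ < ‖ξ‖ := by simpa using hξ
  nlinarith

/-- `shellFieldFun` as a Schwartz function. -/
def shellField (ρ : ℝ) (hρ : 0 < ρ) (v : Eucl d) : 𝓢(Eucl d, ℂ) :=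
  (hasCompactSupport_shellFieldFun hρ v).toSchwartzMap (contDiff_shellFieldFun hρ v)

theorem shellField_apply (ρ : ℝ) (hρ : 0 < ρ) (v ξ : Eucl d) :
    shellField ρ hρ v ξ = shellFieldFun ρ hρ v ξ := rfl

/-- The field is built so that its pairing with the gradient `2 ξ` of `|ξ|²` is the cutoff `h`.
Consequently `h / m²` is minus the derivative of `1 / m` along the field, which prepares an
integration by parts. -/
theorem sum_inner_mul_shellField (b : OrthonormalBasis (Fin d) ℝ (Eucl d)) {ρ : ℝ} (hρ : 0 < ρ)
    (ξ : Eucl d) :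
    ∑ j, (2 * ⟪ξ, b j⟫ : ℂ) * shellField ρ hρ (b j) ξ = (shellBump ρ hρ (‖ξ‖ ^ 2) : ℂ) := by
  have h : ∑ j, 2 * ⟪ξ, b j⟫ * (⟪ξ, b j⟫ * (shellBump ρ hρ (‖ξ‖ ^ 2) / (2 * ‖ξ‖ ^ 2))) =
      shellBump ρ hρ (‖ξ‖ ^ 2) := by
    have h1 : ∀ j, 2 * ⟪ξ, b j⟫ * (⟪ξ, b j⟫ * (shellBump ρ hρ (‖ξ‖ ^ 2) / (2 * ‖ξ‖ ^ 2))) =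
        ⟪ξ, b j⟫ ^ 2 * (shellBump ρ hρ (‖ξ‖ ^ 2) / ‖ξ‖ ^ 2) := fun j => by
      rw [mul_comm 2 (‖ξ‖ ^ 2), ← div_div]
      ring
    simp_rw [h1]
    rw [← Finset.sum_mul, b.sum_sq_inner_left]
    rcases eq_or_ne ξ 0 with rfl | hξ
    · have h0 : shellBump ρ hρ 0 = 0 := by
        by_contra hne
        have := (abs_lt.1 (abs_sub_le_of_shellBump_ne_zero hρ hne)).1
        have hρ2 : 0 < ρ ^ 2 := by positivity
        linarith
      simp [h0]
    · have : ‖ξ‖ ≠ 0 := norm_ne_zero_iff.2 hξ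
      field_simp
  rw [← h]
  simp only [shellField_apply, shellFieldFun]
  push_cast
  rfl

theorem abs_le_norm_shellSymbol (ρ τ : ℝ) (ξ : Eucl d) : |τ| ≤ ‖shellSymbol ρ 0 τ ξ‖ := by
  have h := Complex.abs_im_le_norm (shellSymbol ρ 0 τ ξ)
  simpa [shellSymbol, ← Complex.ofReal_pow] using h

theorem shellSymbol_zero_ne_zero {ρ τ : ℝ} (hτ : τ ≠ 0) (ξ : Eucl d) :
    shellSymbol ρ 0 τ ξ ≠ 0 :=
  norm_pos_iff.1 ((abs_pos.2 hτ).trans_le (abs_le_norm_shellSymbol ρ τ ξ))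

theorem hasLineDerivAt_inv_shellSymbol {ρ τ : ℝ} (hτ : τ ≠ 0) (ξ v : Eucl d) :
    HasLineDerivAt ℝ (fun ξ => (shellSymbol ρ 0 τ ξ)⁻¹)
      (-(2 * ⟪ξ, v⟫ : ℂ) / shellSymbol ρ 0 τ ξ ^ 2) ξ v := by
  unfold HasLineDerivAt
  have h1 : ∀ t : ℝ, shellSymbol ρ 0 τ (ξ + t • v) =
      shellSymbol ρ 0 τ ξ + ((2 * ⟪ξ, v⟫ * t + ‖v‖ ^ 2 * t ^ 2 : ℝ) : ℂ) := fun t => by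
    have h2 : ‖ξ + t • v‖ ^ 2 = ‖ξ‖ ^ 2 + (2 * ⟪ξ, v⟫ * t + ‖v‖ ^ 2 * t ^ 2) := by
      rw [norm_add_sq_real, inner_smul_right, norm_smul, mul_pow, Real.norm_eq_abs, sq_abs]
      ring
    simp only [shellSymbol, inner_zero_left]
    rw [h2]
    push_cast
    ring
  have h2 : HasDerivAt (fun t : ℝ => (2 * ⟪ξ, v⟫ * t + ‖v‖ ^ 2 * t ^ 2 : ℝ)) (2 * ⟪ξ, v⟫) 0 := by
    have := ((hasDerivAt_id (0 : ℝ)).const_mul (2 * ⟪ξ, v⟫)).add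
      (((hasDerivAt_id (0 : ℝ)).pow 2).const_mul (‖v‖ ^ 2))
    have e : 2 * ⟪ξ, v⟫ * 1 + ‖v‖ ^ 2 * ((2 : ℕ) * id (0 : ℝ) ^ (2 - 1) * 1) = 2 * ⟪ξ, v⟫ := by simp
    rw [e] at this
    exact this
  have h3 := (h2.ofReal_comp.const_add (shellSymbol ρ 0 τ ξ)).inv
    (by simpa using shellSymbol_zero_ne_zero hτ ξ)
  have h4 : (fun t : ℝ => (shellSymbol ρ 0 τ (ξ + t • v))⁻¹) =
      (fun t : ℝ => shellSymbol ρ 0 τ ξ + ((2 * ⟪ξ, v⟫ * t + ‖v‖ ^ 2 * t ^ 2 : ℝ) : ℂ))⁻¹ := by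
    ext t
    rw [h1, Pi.inv_apply]
  rw [h4]
  have e : shellSymbol ρ 0 τ ξ + ((2 * ⟪ξ, v⟫ * (0 : ℝ) + ‖v‖ ^ 2 * (0 : ℝ) ^ 2 : ℝ) : ℂ) =
      shellSymbol ρ 0 τ ξ := by simp
  rw [e] at h3
  simpa using h3

theorem lineDeriv_eq_fderiv (f : 𝓢(Eucl d, ℂ)) (x v : Eucl d) :
    HasFDerivAt f (fderiv ℝ f x) x ∧ fderiv ℝ f x v = ∂_{v} f x :=
  ⟨f.differentiableAt.hasFDerivAt, (SchwartzMap.lineDerivOp_apply_eq_fderiv v f x).symm⟩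

/-- The left side contains `∂_v (1 / m)`. After integration by parts the derivative falls on `𝓕 f`
or `𝓕⁻ g`, where it becomes multiplication by `∓2πi ⟪x, v⟫` in space: one power of `1 / m` is traded
for one power of the weight. -/
theorem integral_mul_inv_shellSymbol_sq {ρ τ : ℝ} (hτ : τ ≠ 0) (f g : 𝓢(Eucl d, ℂ))
    (v : Eucl d)
    (hi : ∀ f g : 𝓢(Eucl d, ℂ), Integrable fun ξ => 𝓕 f ξ * 𝓕⁻ g ξ / shellSymbol ρ 0 τ ξ)
    (hi' : Integrable fun ξ => 𝓕 f ξ * 𝓕⁻ g ξ *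
      (-(2 * ⟪ξ, v⟫ : ℂ) / shellSymbol ρ 0 τ ξ ^ 2)) :
    ∫ ξ, 𝓕 f ξ * 𝓕⁻ g ξ * (-(2 * ⟪ξ, v⟫ : ℂ) / shellSymbol ρ 0 τ ξ ^ 2) =
      -(shellForm ρ 0 τ (-(2 * Real.pi * Complex.I) •
          SchwartzMap.smulLeftCLM ℂ (fun x : Eucl d => (⟪x, v⟫ : ℝ)) f) g +
        shellForm ρ 0 τ f ((2 * Real.pi * Complex.I) •
          SchwartzMap.smulLeftCLM ℂ (fun x : Eucl d => (⟪x, v⟫ : ℝ)) g)) := by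
  set f₁ := -(2 * Real.pi * Complex.I) •
    SchwartzMap.smulLeftCLM ℂ (fun x : Eucl d => (⟪x, v⟫ : ℝ)) f with hf₁
  set g₁ := (2 * Real.pi * Complex.I) •
    SchwartzMap.smulLeftCLM ℂ (fun x : Eucl d => (⟪x, v⟫ : ℝ)) g with hg₁
  have hf : ∂_{v} (𝓕 f) = 𝓕 f₁ := SchwartzMap.lineDerivOp_fourier_eq f v
  have hg : ∂_{v} (𝓕⁻ g) = 𝓕⁻ g₁ := SchwartzMap.lineDerivOp_fourierInv_eq g v
  have hprod : ∀ ξ, HasLineDerivAt ℝ (fun ξ => 𝓕 f ξ * 𝓕⁻ g ξ)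
      (𝓕 f₁ ξ * 𝓕⁻ g ξ + 𝓕 f ξ * 𝓕⁻ g₁ ξ) ξ v := fun ξ => by
    have h := ((lineDeriv_eq_fderiv (𝓕 f) ξ v).1.mul
      (lineDeriv_eq_fderiv (𝓕⁻ g) ξ v).1).hasLineDerivAt v
    have e : ((𝓕 f) ξ • fderiv ℝ (𝓕⁻ g : 𝓢(Eucl d, ℂ)) ξ +
        (𝓕⁻ g) ξ • fderiv ℝ (𝓕 f : 𝓢(Eucl d, ℂ)) ξ) v =
        𝓕 f₁ ξ * 𝓕⁻ g ξ + 𝓕 f ξ * 𝓕⁻ g₁ ξ := by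
      rw [add_apply, smul_apply, smul_apply, (lineDeriv_eq_fderiv (𝓕 f) ξ v).2,
        (lineDeriv_eq_fderiv (𝓕⁻ g) ξ v).2, hf, hg, smul_eq_mul, smul_eq_mul]
      ring
    rw [e] at h
    exact h
  have h1 := hi f₁ g
  have h2 := hi f g₁
  have key := integral_bilinear_hasLineDerivAt_right_eq_neg_left_of_integrable
    (μ := (volume : Measure (Eucl d))) (B := ContinuousLinearMap.mul ℝ ℂ)
    (f := fun ξ => 𝓕 f ξ * 𝓕⁻ g ξ) (f' := fun ξ => 𝓕 f₁ ξ * 𝓕⁻ g ξ + 𝓕 f ξ * 𝓕⁻ g₁ ξ)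
    (g := fun ξ => (shellSymbol ρ 0 τ ξ)⁻¹)
    (g' := fun ξ => -(2 * ⟪ξ, v⟫ : ℂ) / shellSymbol ρ 0 τ ξ ^ 2) (v := v)
    (by
      simp only [ContinuousLinearMap.mul_apply', ← div_eq_mul_inv, add_div]
      exact h1.add h2)
    (by simpa only [ContinuousLinearMap.mul_apply'] using hi')
    (by simpa only [ContinuousLinearMap.mul_apply', ← div_eq_mul_inv] using hi f g)
    (fun ξ _ => hprod ξ) (fun ξ _ => hasLineDerivAt_inv_shellSymbol hτ ξ v)
  simp only [ContinuousLinearMap.mul_apply', ← div_eq_mul_inv, add_div] at key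
  rw [key, integral_add h1 h2]
  rfl

end zeroDirection

theorem enorm_wL2_mono {d : ℕ} {η η' : ℝ} (h : η ≤ η') (f : 𝓢(Eucl d, ℂ)) :
    ‖wL2 η f‖ₑ ≤ ‖wL2 η' f‖ₑ := by
  rw [← ENNReal.pow_le_pow_left_iff two_ne_zero, enorm_wL2_sq, enorm_wL2_sq]
  refine lintegral_mono fun x => ?_
  gcongr
  nlinarith [sq_nonneg ‖x‖]

/-! ### The `τ`-derivative of the form for `γ = 0` -/

theorem integrable_mul_div_shellSymbol_sq {d : ℕ} {ρ τ : ℝ} (hτ : τ ≠ 0) (a b : 𝓢(Eucl d, ℂ)) :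
    Integrable fun ξ => a ξ * b ξ / shellSymbol ρ 0 τ ξ ^ 2 := by
  have h : Integrable fun ξ => a ξ * b ξ :=
    (SchwartzMap.pairing (ContinuousLinearMap.mul ℂ ℂ) a b).integrable
  have hm : AEStronglyMeasurable (fun ξ => a ξ * b ξ / shellSymbol ρ 0 τ ξ ^ 2) volume := by
    refine Continuous.aestronglyMeasurable ?_
    exact (a.continuous.mul b.continuous).div ((continuous_shellSymbol ρ 0 τ).pow 2)
      fun ξ => pow_ne_zero 2 (shellSymbol_zero_ne_zero hτ ξ)
  refine (h.norm.const_mul (τ ^ 2)⁻¹).mono' hm (.of_forall fun ξ => ?_)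
  rw [norm_div, norm_pow, div_eq_inv_mul]
  have h1 := abs_le_norm_shellSymbol ρ τ ξ
  have h2 : 0 < |τ| := abs_pos.2 hτ
  have h3 : τ ^ 2 ≤ ‖shellSymbol ρ 0 τ ξ‖ ^ 2 := by
    rw [← sq_abs]
    gcongr
  have h4 : 0 < τ ^ 2 := by positivity
  gcongr

variable {n : ℕ}

theorem exists_enorm_shellForm_le (n : ℕ) {η : ℝ} (hη : 1 / 2 < η) :
    ∃ C : ℝ, 0 < C ∧ ∀ (ρ : ℝ), 0 < ρ → ∀ (γ : Eucl (n + 2)) (τ : ℝ), τ ≠ 0 →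
      ∀ f g : 𝓢(Eucl (n + 2), ℂ), ‖shellForm ρ γ τ f g‖ₑ ≤
        ENNReal.ofReal (C * (ρ⁻¹ + (ρ ^ 2)⁻¹)) * (‖wL2 η f‖ₑ * ‖wL2 η g‖ₑ) := by
  obtain ⟨C, hC, h⟩ := exists_enorm_integral_shell_le (n + 1) hη
  exact ⟨C, hC, fun ρ hρ γ τ hτ f g => h ρ hρ γ τ f g (integrable_shellForm ρ γ hτ f g)⟩

theorem enorm_shellForm_lineDeriv_le {d : ℕ} {ρ τ : ℝ} (A : ℝ≥0∞)
    (hA : ∀ f g : 𝓢(Eucl d, ℂ), ‖shellForm ρ 0 τ f g‖ₑ ≤ A * (‖wL2 1 f‖ₑ * ‖wL2 1 g‖ₑ))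
    (v : Eucl d) (hv : ‖v‖ ≤ 1) (f g : 𝓢(Eucl d, ℂ)) :
    ‖shellForm ρ 0 τ (-(2 * Real.pi * Complex.I) •
          SchwartzMap.smulLeftCLM ℂ (fun x : Eucl d => (⟪x, v⟫ : ℝ)) f) g +
        shellForm ρ 0 τ f ((2 * Real.pi * Complex.I) •
          SchwartzMap.smulLeftCLM ℂ (fun x : Eucl d => (⟪x, v⟫ : ℝ)) g)‖ₑ ≤
      (A * ‖(2 * Real.pi * Complex.I : ℂ)‖ₑ + A * ‖(2 * Real.pi * Complex.I : ℂ)‖ₑ) *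
        (‖wL2 2 f‖ₑ * ‖wL2 2 g‖ₑ) := by
  have h2 : (1 : ℝ) + 1 = 2 := by norm_num
  have hX : ∀ f : 𝓢(Eucl d, ℂ), ‖wL2 1 (SchwartzMap.smulLeftCLM ℂ
      (fun x : Eucl d => (⟪x, v⟫ : ℝ)) f)‖ₑ ≤ ‖wL2 2 f‖ₑ := fun f => by
    have h3 := enorm_wL2_smulLeftCLM_inner_le 1 v hv f
    rwa [h2] at h3
  have h12 : ∀ f : 𝓢(Eucl d, ℂ), ‖wL2 1 f‖ₑ ≤ ‖wL2 2 f‖ₑ := fun f =>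
    enorm_wL2_mono (by norm_num) f
  have e1 : ∀ f g : 𝓢(Eucl d, ℂ), ∀ c : ℂ, ‖shellForm ρ 0 τ (c •
      SchwartzMap.smulLeftCLM ℂ (fun x : Eucl d => (⟪x, v⟫ : ℝ)) f) g‖ₑ ≤
        A * ‖c‖ₑ * (‖wL2 2 f‖ₑ * ‖wL2 2 g‖ₑ) := fun f g c => by
    refine (hA _ g).trans ?_
    rw [map_smul, enorm_smul, mul_assoc A, ← mul_assoc ‖c‖ₑ]
    exact mul_le_mul' le_rfl (mul_le_mul' (mul_le_mul' le_rfl (hX f)) (h12 g))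
  have e2 : ∀ f g : 𝓢(Eucl d, ℂ), ∀ c : ℂ, ‖shellForm ρ 0 τ f (c •
      SchwartzMap.smulLeftCLM ℂ (fun x : Eucl d => (⟪x, v⟫ : ℝ)) g)‖ₑ ≤
        A * ‖c‖ₑ * (‖wL2 2 f‖ₑ * ‖wL2 2 g‖ₑ) := fun f g c => by
    refine (hA f _).trans ?_
    rw [map_smul, enorm_smul, mul_assoc A, mul_left_comm ‖c‖ₑ]
    exact mul_le_mul' le_rfl (mul_le_mul' (h12 f) (mul_le_mul' le_rfl (hX g)))
  refine (enorm_add_le _ _).trans ?_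
  rw [add_mul]
  refine add_le_add ((e1 f g _).trans_eq ?_) (e2 f g _)
  rw [enorm_neg]

-- The trivial bound would be of size `τ⁻²`. Uniformity comes from writing `1 = h + (1 - h)` with
-- the cutoff `h` near the sphere: the `h` part is integrated by parts and falls under the uniform
-- bound with weight `1`, which becomes weight `2`; on the support of `1 - h` the symbol has modulus
-- at least `ρ² / 2`.
set_option maxHeartbeats 1000000 in
theorem exists_enorm_integral_div_sq_le (n : ℕ) {ρ : ℝ} (hρ : 0 < ρ) :
    ∃ C : ℝ≥0∞, C < ⊤ ∧ ∀ τ : ℝ, τ ≠ 0 → ∀ f g : 𝓢(Eucl (n + 2), ℂ),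
      ‖∫ ξ, 𝓕 f ξ * 𝓕⁻ g ξ / shellSymbol ρ 0 τ ξ ^ 2‖ₑ ≤ C * (‖wL2 2 f‖ₑ * ‖wL2 2 g‖ₑ) := by
  obtain ⟨C₁, hC₁, hform⟩ := exists_enorm_shellForm_le n (η := 1) (by norm_num)
  set A := ENNReal.ofReal (C₁ * (ρ⁻¹ + (ρ ^ 2)⁻¹)) with hA
  set b : OrthonormalBasis (Fin (n + 2)) ℝ (Eucl (n + 2)) := EuclideanSpace.basisFun _ ℝ with hb
  set κ : Fin (n + 2) → ℝ≥0∞ := fun j => kernelNorm 2 (𝓕⁻ (shellField ρ hρ (b j))) with hκ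
  set T := ‖(2 * Real.pi * Complex.I : ℂ)‖ₑ with hT
  have hAt : A < ⊤ := ENNReal.ofReal_lt_top
  have hTt : T < ⊤ := enorm_lt_top
  have hκt : ∀ j, κ j < ⊤ := fun j => kernelNorm_lt_top _ _
  refine ⟨∑ j, (A * (T * κ j) + A * (T * κ j)) + ENNReal.ofReal (4 / ρ ^ 4),
    ENNReal.add_lt_top.2 ⟨ENNReal.sum_lt_top.2 fun j _ => ENNReal.add_lt_top.2 ?_,
      ENNReal.ofReal_lt_top⟩, fun τ hτ f g => ?_⟩
  · have := ENNReal.mul_lt_top hAt (ENNReal.mul_lt_top hTt (hκt j))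
    exact ⟨this, this⟩
  set N := ‖wL2 2 f‖ₑ * ‖wL2 2 g‖ₑ with hN
  set fj : Fin (n + 2) → 𝓢(Eucl (n + 2), ℂ) := fun j =>
    SchwartzMap.fourierMultiplierCLM ℂ (fun ξ => shellField ρ hρ (b j) ξ) f with hfj
  have hfj2 : ∀ j, ‖wL2 2 (fj j)‖ₑ ≤ κ j * ‖wL2 2 f‖ₑ := fun j => by
    have := enorm_wL2_fourierMultiplierCLM_le 2 (shellField ρ hρ (b j))
      (a := 1) ⟨one_pos, le_rfl⟩ f
    simpa only [one_smul] using this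
  have hFj : ∀ j ξ, 𝓕 (fj j) ξ = shellField ρ hρ (b j) ξ * 𝓕 f ξ := fun j ξ => by
    simp only [hfj]
    rw [SchwartzMap.fourierMultiplierCLM_apply, FourierTransform.fourier_fourierInv_eq,
      SchwartzMap.smulLeftCLM_apply_apply (shellField ρ hρ (b j)).hasTemperateGrowth, smul_eq_mul]
  have hij : ∀ j, Integrable fun ξ => 𝓕 (fj j) ξ * 𝓕⁻ g ξ *
      (-(2 * ⟪ξ, b j⟫ : ℂ) / shellSymbol ρ 0 τ ξ ^ 2) := fun j => by
    have h := (integrable_mul_div_shellSymbol_sq (ρ := ρ) hτ (𝓕 (fj j))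
      (SchwartzMap.smulLeftCLM ℂ (fun x : Eucl (n + 2) => (⟪x, b j⟫ : ℝ)) (𝓕⁻ g))).const_mul (-2)
    refine h.congr (.of_forall fun ξ => ?_)
    simp only [SchwartzMap.smulLeftCLM_apply_apply (hasTemperateGrowth_inner_left (b j)),
      Complex.real_smul]
    ring
  have hpiece : ∀ j, ‖∫ ξ, 𝓕 (fj j) ξ * 𝓕⁻ g ξ *
      (-(2 * ⟪ξ, b j⟫ : ℂ) / shellSymbol ρ 0 τ ξ ^ 2)‖ₑ ≤
        (A * (T * κ j) + A * (T * κ j)) * N := fun j => by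
    rw [integral_mul_inv_shellSymbol_sq hτ (fj j) g (b j)
      (fun f g => integrable_shellForm ρ 0 hτ f g) (hij j), enorm_neg]
    refine (enorm_shellForm_lineDeriv_le A (hform ρ hρ 0 τ hτ) (b j) (b.norm_eq_one j).le
      (fj j) g).trans ?_
    calc _ ≤ (A * T + A * T) * (κ j * ‖wL2 2 f‖ₑ * ‖wL2 2 g‖ₑ) := by
          gcongr
          exact hfj2 j
      _ = _ := by rw [hN]; ring
  have hI0 := integrable_mul_div_shellSymbol_sq (ρ := ρ) hτ (𝓕 f) (𝓕⁻ g)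
  have hsplit : ∀ ξ, 𝓕 f ξ * 𝓕⁻ g ξ / shellSymbol ρ 0 τ ξ ^ 2 =
      -(∑ j, 𝓕 (fj j) ξ * 𝓕⁻ g ξ * (-(2 * ⟪ξ, b j⟫ : ℂ) / shellSymbol ρ 0 τ ξ ^ 2)) +
        ((1 - shellBump ρ hρ (‖ξ‖ ^ 2) : ℝ) : ℂ) *
          (𝓕 f ξ * 𝓕⁻ g ξ / shellSymbol ρ 0 τ ξ ^ 2) := fun ξ => by
    have h1 : -(∑ j, 𝓕 (fj j) ξ * 𝓕⁻ g ξ * (-(2 * ⟪ξ, b j⟫ : ℂ) / shellSymbol ρ 0 τ ξ ^ 2)) =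
        (∑ j, (2 * ⟪ξ, b j⟫ : ℂ) * shellField ρ hρ (b j) ξ) *
          (𝓕 f ξ * 𝓕⁻ g ξ / shellSymbol ρ 0 τ ξ ^ 2) := by
      rw [← Finset.sum_neg_distrib, Finset.sum_mul]
      refine Finset.sum_congr rfl fun j _ => ?_
      rw [hFj]
      ring
    rw [h1, sum_inner_mul_shellField]
    push_cast
    ring
  have hrest : ∀ ξ, ‖((1 - shellBump ρ hρ (‖ξ‖ ^ 2) : ℝ) : ℂ) *
      (𝓕 f ξ * 𝓕⁻ g ξ / shellSymbol ρ 0 τ ξ ^ 2)‖ₑ ≤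
        ENNReal.ofReal (4 / ρ ^ 4) * ‖𝓕 f ξ * 𝓕⁻ g ξ‖ₑ := fun ξ => by
    rw [← ofReal_norm, ← ofReal_norm, ← ENNReal.ofReal_mul (by positivity)]
    refine ENNReal.ofReal_le_ofReal ?_
    have h0 := (shellBump ρ hρ).nonneg (x := ‖ξ‖ ^ 2)
    have h1 := (shellBump ρ hρ).le_one (x := ‖ξ‖ ^ 2)
    by_cases h : ‖ξ‖ ^ 2 ∈ Metric.closedBall (ρ ^ 2) (ρ ^ 2 / 2)
    · have h2 : shellBump ρ hρ (‖ξ‖ ^ 2) = 1 := (shellBump ρ hρ).one_of_mem_closedBall h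
      rw [h2]
      simp only [sub_self, Complex.ofReal_zero, zero_mul, norm_zero]
      positivity
    · have h2 : ρ ^ 2 / 2 ≤ ‖shellSymbol ρ 0 τ ξ‖ := by
        refine le_trans ?_ (shellSymbol_eq_sq_sub ρ 0 τ ξ)
        rw [Metric.mem_closedBall, Real.dist_eq, not_le] at h
        exact h.le
      rw [norm_mul, Complex.norm_real, Real.norm_of_nonneg (by linarith), norm_div, norm_pow]
      calc _ ≤ 1 * (‖𝓕 f ξ * 𝓕⁻ g ξ‖ / (ρ ^ 2 / 2) ^ 2) := by
            gcongr
            linarith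
        _ = _ := by field_simp; norm_num
  have hIrest : Integrable fun ξ => ((1 - shellBump ρ hρ (‖ξ‖ ^ 2) : ℝ) : ℂ) *
      (𝓕 f ξ * 𝓕⁻ g ξ / shellSymbol ρ 0 τ ξ ^ 2) := by
    refine ((hI0.add (integrable_finsetSum Finset.univ fun j _ => hij j)).congr
      (.of_forall fun ξ => ?_))
    have := hsplit ξ
    simp only [Pi.add_apply]
    rw [eq_comm, ← sub_eq_iff_eq_add]
    rw [eq_comm, neg_add_eq_iff_eq_add] at this
    rw [this]
    ring
  rw [integral_congr_ae (.of_forall hsplit)]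
  have hIsum : Integrable fun ξ => -∑ j, 𝓕 (fj j) ξ * 𝓕⁻ g ξ *
      (-(2 * ⟪ξ, b j⟫ : ℂ) / shellSymbol ρ 0 τ ξ ^ 2) :=
    (integrable_finsetSum Finset.univ fun j _ => hij j).neg
  rw [integral_add hIsum hIrest, integral_neg,
    integral_finsetSum _ fun j _ => hij j]
  refine (enorm_add_le _ _).trans ?_
  rw [enorm_neg, add_mul, Finset.sum_mul]
  refine add_le_add ((enorm_sum_le _ _).trans (Finset.sum_le_sum fun j _ => hpiece j)) ?_
  refine (enorm_integral_le_lintegral_enorm _).trans ((lintegral_mono hrest).trans ?_)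
  rw [lintegral_const_mul' _ _ ENNReal.ofReal_ne_top]
  gcongr
  exact (lintegral_fourier_mul_fourierInv_le f g).trans
    (mul_le_mul' (enorm_toLp_le_wL2 (by norm_num) f) (enorm_toLp_le_wL2 (by norm_num) g))

/-- Differentiation under the integral: for `γ = 0` and parameters within `|τ| / 2` of `τ` the
symbol stays bounded below by `|τ| / 2`. -/
theorem hasDerivAt_shellForm {ρ τ : ℝ} (hτ : τ ≠ 0) (f g : 𝓢(Eucl (n + 2), ℂ)) :
    HasDerivAt (fun τ => shellForm ρ 0 τ f g)
      (Complex.I * ∫ ξ, 𝓕 f ξ * 𝓕⁻ g ξ / shellSymbol ρ 0 τ ξ ^ 2) τ := by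
  have hτ' : 0 < |τ| := abs_pos.2 hτ
  have hball : ∀ s ∈ Metric.ball τ (|τ| / 2), |τ| / 2 ≤ |s| := fun s hs => by
    rw [Metric.mem_ball, Real.dist_eq] at hs
    have := abs_sub_abs_le_abs_sub τ s
    rw [abs_sub_comm] at this
    linarith
  have hne : ∀ s ∈ Metric.ball τ (|τ| / 2), s ≠ 0 := fun s hs h => by
    have := hball s hs
    rw [h, abs_zero] at this
    linarith
  have h := hasDerivAt_integral_of_dominated_loc_of_deriv_le
    (μ := (volume : Measure (Eucl (n + 2))))
    (F := fun τ ξ => 𝓕 f ξ * 𝓕⁻ g ξ / shellSymbol ρ 0 τ ξ)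
    (F' := fun τ ξ => Complex.I * (𝓕 f ξ * 𝓕⁻ g ξ / shellSymbol ρ 0 τ ξ ^ 2)) (x₀ := τ)
    (bound := fun ξ => ((|τ| / 2) ^ 2)⁻¹ * ‖𝓕 f ξ * 𝓕⁻ g ξ‖)
    (Metric.ball_mem_nhds τ (by positivity : 0 < |τ| / 2)) ?_
    (integrable_shellForm ρ 0 hτ f g) ?_ ?_
    ((integrable_fourier_mul_fourierInv f g).norm.const_mul _) ?_
  · rw [← integral_const_mul]
    exact h.2
  · filter_upwards [Metric.ball_mem_nhds τ (by positivity : 0 < |τ| / 2)] with s hs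
    exact (integrable_shellForm ρ 0 (hne s hs) f g).1
  · exact ((integrable_mul_div_shellSymbol_sq hτ (𝓕 f) (𝓕⁻ g)).const_mul _).1
  · refine .of_forall fun ξ s hs => ?_
    rw [norm_mul, Complex.norm_I, one_mul, norm_div, norm_pow, div_eq_inv_mul]
    gcongr
    exact (hball s hs).trans (abs_le_norm_shellSymbol ρ s ξ)
  · refine .of_forall fun ξ s hs => ?_
    have h1 : HasDerivAt (fun s : ℝ => shellSymbol ρ 0 s ξ) (-Complex.I) s := by
      have h2 := ((hasDerivAt_id s).ofReal_comp.const_mul Complex.I).const_sub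
        ((‖ξ‖ ^ 2 - ρ ^ 2 : ℝ) : ℂ)
      have h3 : (fun s : ℝ => shellSymbol ρ 0 s ξ) =
          fun s : ℝ => ((‖ξ‖ ^ 2 - ρ ^ 2 : ℝ) : ℂ) - Complex.I * ((id s : ℝ) : ℂ) := by
        ext s
        simp [shellSymbol, sub_eq_add_neg]
      rw [h3]
      simpa using h2
    have h2 := (h1.inv (shellSymbol_zero_ne_zero (hne s hs) ξ)).const_mul (𝓕 f ξ * 𝓕⁻ g ξ)
    have e : 𝓕 f ξ * 𝓕⁻ g ξ * (- -Complex.I / shellSymbol ρ 0 s ξ ^ 2) =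
        Complex.I * (𝓕 f ξ * 𝓕⁻ g ξ / shellSymbol ρ 0 s ξ ^ 2) := by ring
    rw [e] at h2
    exact h2

/-- On each side of zero the bilinear form is Hölder continuous in `τ`, with respect to a stronger
weighted norm. -/
theorem exists_enorm_shellForm_sub_le {ρ : ℝ} (hρ : 0 < ρ) (γ : Eucl (n + 2)) :
    ∃ C : ℝ≥0∞, C < ⊤ ∧ ∀ τ τ' : ℝ, 0 < τ * τ' → ∀ f g : 𝓢(Eucl (n + 2), ℂ),
      ‖shellForm ρ γ τ f g - shellForm ρ γ τ' f g‖ₑ ≤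
        C * (‖τ' - τ‖ₑ ^ (1 / 8 : ℝ) + ‖τ' - τ‖ₑ) *
          (‖wL2 (((n + 2 : ℕ) : ℝ) + 1) f‖ₑ * ‖wL2 (((n + 2 : ℕ) : ℝ) + 1) g‖ₑ) := by
  rcases ne_or_eq γ 0 with hγ | rfl
  · obtain ⟨C, hC, h⟩ := exists_enorm_shellForm_sub_le_of_ne_zero hγ ρ
    exact ⟨C, hC, fun τ τ' hττ' f g =>
      h τ τ' (left_ne_zero_of_mul hττ'.ne') (right_ne_zero_of_mul hττ'.ne') f g⟩
  obtain ⟨C, hC, h⟩ := exists_enorm_integral_div_sq_le n hρ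
  refine ⟨C, hC, fun τ τ' hττ' f g => ?_⟩
  have hn : (2 : ℝ) ≤ ((n + 2 : ℕ) : ℝ) + 1 := by
    push_cast
    have : (0 : ℝ) ≤ n := n.cast_nonneg
    linarith
  set N := ‖wL2 2 f‖ₑ * ‖wL2 2 g‖ₑ with hN
  have hNt : C * N ≠ ⊤ := (ENNReal.mul_lt_top hC (ENNReal.mul_lt_top enorm_lt_top enorm_lt_top)).ne
  have hbound : ∀ s : ℝ, s ≠ 0 →
      ‖Complex.I * ∫ ξ, 𝓕 f ξ * 𝓕⁻ g ξ / shellSymbol ρ 0 s ξ ^ 2‖ ≤ (C * N).toReal := fun s hs => by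
    rw [norm_mul, Complex.norm_I, one_mul, ← toReal_enorm]
    exact ENNReal.toReal_mono hNt (h s hs f g)
  have hlip : ‖shellForm ρ 0 τ f g - shellForm ρ 0 τ' f g‖ ≤ (C * N).toReal * ‖τ - τ'‖ := by
    -- The mean value inequality is applied on an open half-line, so that the segment from `τ` to
    -- `τ'` never meets the excluded value zero.
    rcases pos_and_pos_or_neg_and_neg_of_mul_pos hττ' with ⟨h1, h2⟩ | ⟨h1, h2⟩
    · exact (convex_Ioi (0 : ℝ)).norm_image_sub_le_of_norm_hasDerivWithin_le
        (fun s hs => (hasDerivAt_shellForm (ne_of_gt hs) f g).hasDerivWithinAt)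
        (fun s hs => hbound s (ne_of_gt hs)) h2 h1
    · exact (convex_Iio (0 : ℝ)).norm_image_sub_le_of_norm_hasDerivWithin_le
        (fun s hs => (hasDerivAt_shellForm (ne_of_lt hs) f g).hasDerivWithinAt)
        (fun s hs => hbound s (ne_of_lt hs)) h2 h1
  calc _ ≤ C * N * ‖τ' - τ‖ₑ := by
        rw [← ofReal_norm, ← ofReal_norm, ← ENNReal.ofReal_toReal hNt,
          ← ENNReal.ofReal_mul ENNReal.toReal_nonneg, norm_sub_rev τ']
        exact ENNReal.ofReal_le_ofReal hlip
    _ = C * ‖τ' - τ‖ₑ * N := by ring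
    _ ≤ _ := by
        rw [hN]
        gcongr
        · exact le_add_self
        · exact enorm_wL2_mono hn f
        · exact enorm_wL2_mono hn g

/-! ### Limiting absorption for the bilinear form -/

section limitForm

variable {d : ℕ}

theorem enorm_wL2_smulLeftCLM_le {η η' c : ℝ} (hc : 0 ≤ c) {θ : Eucl d → ℂ}
    (hθ : θ.HasTemperateGrowth)
    (h : ∀ x, (1 + ‖x‖ ^ 2) ^ η' * ‖θ x‖ ^ 2 ≤ c ^ 2 * (1 + ‖x‖ ^ 2) ^ η) (f : 𝓢(Eucl d, ℂ)) :
    ‖wL2 η' (SchwartzMap.smulLeftCLM ℂ θ f)‖ₑ ≤ ENNReal.ofReal c * ‖wL2 η f‖ₑ := by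
  rw [← ENNReal.pow_le_pow_left_iff two_ne_zero, mul_pow, enorm_wL2_sq, enorm_wL2_sq,
    ← ENNReal.ofReal_pow hc, ← lintegral_const_mul' _ _ ENNReal.ofReal_ne_top]
  refine lintegral_mono fun x => ?_
  rw [SchwartzMap.smulLeftCLM_apply_apply hθ, smul_eq_mul, enorm_mul, mul_pow, ← mul_assoc,
    ← mul_assoc]
  refine mul_le_mul' ?_ le_rfl
  rw [← ofReal_norm, ← ENNReal.ofReal_pow (norm_nonneg _), ← ENNReal.ofReal_mul (by positivity),
    ← ENNReal.ofReal_mul (by positivity)]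
  exact ENNReal.ofReal_le_ofReal (h x)

/-- A smooth cutoff in space at a large radius `N`. On the far part the gap `η - η' > 0` gives a
small factor; on the near part all weights are comparable, at the price of a constant `K` that
depends on `N`. -/
theorem exists_decomposition {η η' : ℝ} (h : η' < η) (σ : ℝ) {ε : ℝ} (hε : 0 < ε) :
    ∃ K : ℝ, 0 ≤ K ∧ ∀ f : 𝓢(Eucl d, ℂ), ∃ f₁ f₂ : 𝓢(Eucl d, ℂ), f = f₁ + f₂ ∧
      ‖wL2 η' f₁‖ₑ ≤ ‖wL2 η f‖ₑ ∧ ‖wL2 σ f₁‖ₑ ≤ ENNReal.ofReal K * ‖wL2 η f‖ₑ ∧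
        ‖wL2 η' f₂‖ₑ ≤ ENNReal.ofReal ε * ‖wL2 η f‖ₑ := by
  obtain ⟨N, hN1, hN⟩ : ∃ N : ℝ, 1 ≤ N ∧ (1 + N ^ 2) ^ (-(η - η')) ≤ ε ^ 2 := by
    have h1 : Tendsto (fun N : ℝ => (1 + N ^ 2) ^ (-(η - η'))) atTop (𝓝 0) :=
      (tendsto_rpow_neg_atTop (sub_pos.2 h)).comp
        (tendsto_atTop_add_const_left _ _ (tendsto_pow_atTop two_ne_zero))
    obtain ⟨N, hN⟩ := ((eventually_ge_atTop 1).and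
      (h1.eventually_le_const (by positivity : 0 < ε ^ 2))).exists
    exact ⟨N, hN.1, hN.2⟩
  set θ : ContDiffBump (0 : Eucl d) := ⟨N, N + 1, by linarith, by linarith⟩ with hθdef
  have hθc : HasCompactSupport fun x : Eucl d => (θ x : ℂ) :=
    θ.hasCompactSupport.comp_left (g := fun t : ℝ => (t : ℂ)) rfl
  have hθs : ContDiff ℝ ∞ fun x : Eucl d => (θ x : ℂ) :=
    Complex.ofRealCLM.contDiff.comp θ.contDiff
  have hθ : (fun x : Eucl d => (θ x : ℂ)).HasTemperateGrowth := hθc.hasTemperateGrowth hθs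
  have hθ' : (fun x : Eucl d => (1 - θ x : ℂ)).HasTemperateGrowth :=
    (Function.HasTemperateGrowth.const _).sub hθ
  have hn : ∀ x, ‖(θ x : ℂ)‖ ≤ 1 := fun x => by
    rw [Complex.norm_real, Real.norm_of_nonneg θ.nonneg]
    exact θ.le_one
  have hn' : ∀ x, ‖(1 - θ x : ℂ)‖ ≤ 1 := fun x => by
    rw [← Complex.ofReal_one, ← Complex.ofReal_sub, Complex.norm_real, Real.norm_of_nonneg]
    · linarith [θ.nonneg (x := x)]
    · linarith [θ.le_one (x := x)]
  set M := 1 + (N + 1) ^ 2 with hM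
  have hM1 : 1 ≤ M := by nlinarith
  refine ⟨M ^ (|σ - η| / 2), by positivity, fun f =>
    ⟨SchwartzMap.smulLeftCLM ℂ (fun x => (θ x : ℂ)) f,
      SchwartzMap.smulLeftCLM ℂ (fun x => (1 - θ x : ℂ)) f, ?_, ?_, ?_, ?_⟩⟩
  · ext x
    rw [_root_.add_apply, SchwartzMap.smulLeftCLM_apply_apply hθ,
      SchwartzMap.smulLeftCLM_apply_apply hθ', smul_eq_mul, smul_eq_mul]
    ring
  · have h2 := enorm_wL2_smulLeftCLM_le (η := η) (η' := η') zero_le_one hθ (fun x => by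
      have h3 : ‖(θ x : ℂ)‖ ^ 2 ≤ 1 := pow_le_one₀ (norm_nonneg _) (hn x)
      have h4 : (1 + ‖x‖ ^ 2) ^ η' ≤ (1 + ‖x‖ ^ 2) ^ η :=
        Real.rpow_le_rpow_of_exponent_le (by nlinarith [sq_nonneg ‖x‖]) h.le
      calc _ ≤ (1 + ‖x‖ ^ 2) ^ η' * 1 := by gcongr
        _ ≤ _ := by simpa using h4) f
    simpa using h2
  · refine enorm_wL2_smulLeftCLM_le (by positivity) hθ (fun x => ?_) f
    rw [← Real.rpow_natCast (M ^ _), ← Real.rpow_mul (by positivity)]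
    norm_num only [Nat.cast_ofNat, div_mul_cancel₀, ne_eq, OfNat.ofNat_ne_zero, not_false_eq_true]
    by_cases hx : x ∈ Metric.ball (0 : Eucl d) (N + 1)
    · have hx' : ‖x‖ < N + 1 := by simpa using hx
      have h3 : ‖(θ x : ℂ)‖ ^ 2 ≤ 1 := pow_le_one₀ (norm_nonneg _) (hn x)
      have h5 : 1 ≤ 1 + ‖x‖ ^ 2 := by nlinarith [sq_nonneg ‖x‖]
      have h6 : 1 + ‖x‖ ^ 2 ≤ M := by
        rw [hM]
        gcongr
      calc _ ≤ (1 + ‖x‖ ^ 2) ^ σ * 1 := by gcongr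
        _ = (1 + ‖x‖ ^ 2) ^ (σ - η) * (1 + ‖x‖ ^ 2) ^ η := by
          rw [mul_one, ← Real.rpow_add (by positivity), sub_add_cancel]
        _ ≤ _ := by
          gcongr
          calc (1 + ‖x‖ ^ 2) ^ (σ - η) ≤ (1 + ‖x‖ ^ 2) ^ |σ - η| :=
                Real.rpow_le_rpow_of_exponent_le h5 (le_abs_self _)
            _ ≤ _ := Real.rpow_le_rpow (by positivity) h6 (abs_nonneg _)
    · have : θ x = 0 := by
        by_contra hne
        have h7 : x ∈ Function.support θ := hne
        rw [θ.support_eq] at h7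
        exact hx h7
      rw [this]
      rw [Complex.ofReal_zero, norm_zero, zero_pow two_ne_zero, mul_zero]
      positivity
  · refine enorm_wL2_smulLeftCLM_le hε.le hθ' (fun x => ?_) f
    by_cases hx : x ∈ Metric.closedBall (0 : Eucl d) N
    · rw [θ.one_of_mem_closedBall hx]
      rw [Complex.ofReal_one, sub_self, norm_zero, zero_pow two_ne_zero, mul_zero]
      positivity
    · have hx' : N < ‖x‖ := by simpa using hx
      have h3 : ‖(1 - θ x : ℂ)‖ ^ 2 ≤ 1 := pow_le_one₀ (norm_nonneg _) (hn' x)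
      calc _ ≤ (1 + ‖x‖ ^ 2) ^ η' * 1 := by gcongr
        _ = (1 + ‖x‖ ^ 2) ^ (-(η - η')) * (1 + ‖x‖ ^ 2) ^ η := by
          rw [mul_one, ← Real.rpow_add (by positivity)]
          congr 1
          ring
        _ ≤ (1 + N ^ 2) ^ (-(η - η')) * (1 + ‖x‖ ^ 2) ^ η := by
          gcongr ?_ * _
          exact Real.rpow_le_rpow_of_nonpos (by positivity) (by gcongr) (by linarith)
        _ ≤ _ := by gcongr

/-- Interpolation of a bound with a weak weight and a small bound with a strong weight. -/
theorem exists_enorm_le_of_interpolation {η η' : ℝ} (h : η' < η) (σ : ℝ) (A : ℝ) {ε : ℝ}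
    (hε : 0 < ε) :
    ∃ δ : ℝ, 0 < δ ∧ ∀ Φ : 𝓢(Eucl d, ℂ) →ₗ[ℂ] 𝓢(Eucl d, ℂ) →ₗ[ℂ] ℂ,
      (∀ f g, ‖Φ f g‖ₑ ≤ ENNReal.ofReal A * (‖wL2 η' f‖ₑ * ‖wL2 η' g‖ₑ)) →
      (∀ f g, ‖Φ f g‖ₑ ≤ ENNReal.ofReal δ * (‖wL2 σ f‖ₑ * ‖wL2 σ g‖ₑ)) →
      ∀ f g, ‖Φ f g‖ₑ ≤ ENNReal.ofReal ε * (‖wL2 η f‖ₑ * ‖wL2 η g‖ₑ) := by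
  set A' := |A| + 1 with hA'
  have hA0 : 0 < A' := by positivity
  obtain ⟨K, hK, hdec⟩ := exists_decomposition (d := d) h σ (ε := ε / (4 * A')) (by positivity)
  -- The order of choices matters: the cutoff radius, and with it `K`, is fixed by `ε` and `A`; only
  -- then is `δ` taken small enough that `δ K² ≤ ε / 2`. The two terms with a far part contribute `ε
  -- / 4` each.
  refine ⟨ε / (2 * (K ^ 2 + 1)), by positivity, fun Φ h1 h2 f g => ?_⟩
  set δ := ε / (2 * (K ^ 2 + 1)) with hδ
  have hδ0 : 0 < δ := by positivity
  obtain ⟨f₁, f₂, hf, hf1, hf2, hf3⟩ := hdec f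
  obtain ⟨g₁, g₂, hg, hg1, hg2, hg3⟩ := hdec g
  set X := ‖wL2 η f‖ₑ
  set Y := ‖wL2 η g‖ₑ
  have h1' : ∀ f g, ‖Φ f g‖ₑ ≤ ENNReal.ofReal A' * (‖wL2 η' f‖ₑ * ‖wL2 η' g‖ₑ) := fun f g => by
    refine (h1 f g).trans (mul_le_mul' (ENNReal.ofReal_le_ofReal ?_) le_rfl)
    linarith [le_abs_self A]
  have e1 : ‖Φ f₁ g₁‖ₑ ≤ ENNReal.ofReal (ε / 2) * (X * Y) := by
    calc _ ≤ ENNReal.ofReal δ * ((ENNReal.ofReal K * X) * (ENNReal.ofReal K * Y)) :=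
          (h2 _ _).trans (mul_le_mul' le_rfl (mul_le_mul' hf2 hg2))
      _ = ENNReal.ofReal (δ * (K * K)) * (X * Y) := by
          rw [ENNReal.ofReal_mul hδ0.le, ENNReal.ofReal_mul hK]
          ring
      _ ≤ _ := by
          gcongr
          rw [hδ, div_mul_eq_mul_div, div_le_div_iff₀ (by positivity) (by norm_num)]
          nlinarith
  have e2 : ‖Φ f₁ g₂‖ₑ ≤ ENNReal.ofReal (ε / 4) * (X * Y) := by
    calc _ ≤ ENNReal.ofReal A' * (X * (ENNReal.ofReal (ε / (4 * A')) * Y)) :=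
          (h1' _ _).trans (mul_le_mul' le_rfl (mul_le_mul' hf1 hg3))
      _ = ENNReal.ofReal (A' * (ε / (4 * A'))) * (X * Y) := by
          rw [ENNReal.ofReal_mul hA0.le]
          ring
      _ = _ := by
          congr 2
          field_simp
  have hgη : ‖wL2 η' g‖ₑ ≤ Y := enorm_wL2_mono h.le g
  have e3 : ‖Φ f₂ g‖ₑ ≤ ENNReal.ofReal (ε / 4) * (X * Y) := by
    calc _ ≤ ENNReal.ofReal A' * ((ENNReal.ofReal (ε / (4 * A')) * X) * Y) :=
          (h1' _ _).trans (mul_le_mul' le_rfl (mul_le_mul' hf3 hgη))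
      _ = ENNReal.ofReal (A' * (ε / (4 * A'))) * (X * Y) := by
          rw [ENNReal.ofReal_mul hA0.le]
          ring
      _ = _ := by
          congr 2
          field_simp
  have hsum : Φ f g = Φ f₁ g₁ + Φ f₁ g₂ + Φ f₂ g := by
    rw [← map_add, ← hg, ← LinearMap.add_apply, ← map_add, ← hf]
  rw [hsum]
  calc _ ≤ ENNReal.ofReal (ε / 2) * (X * Y) + ENNReal.ofReal (ε / 4) * (X * Y) +
        ENNReal.ofReal (ε / 4) * (X * Y) :=
        (enorm_add_le _ _).trans (add_le_add ((enorm_add_le _ _).trans (add_le_add e1 e2)) e3)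
    _ = _ := by
        rw [← add_mul, ← add_mul, ← ENNReal.ofReal_add (by positivity) (by positivity),
          ← ENNReal.ofReal_add (by positivity) (by positivity)]
        congr 2
        ring

/-- A family of bilinear forms that is Cauchy with respect to a weighted norm has a limit. -/
theorem exists_limit_bilinear {η : ℝ} {l : Filter ℝ} [l.NeBot]
    (Φ : ℝ → 𝓢(Eucl d, ℂ) →ₗ[ℂ] 𝓢(Eucl d, ℂ) →ₗ[ℂ] ℂ)
    (hΦ : ∀ ε > 0, ∃ s ∈ l, ∀ τ ∈ s, ∀ τ' ∈ s, ∀ f g,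
      ‖Φ τ f g - Φ τ' f g‖ₑ ≤ ENNReal.ofReal ε * (‖wL2 η f‖ₑ * ‖wL2 η g‖ₑ)) :
    ∃ B : 𝓢(Eucl d, ℂ) →ₗ[ℂ] 𝓢(Eucl d, ℂ) →ₗ[ℂ] ℂ,
      (∀ f g, Tendsto (fun τ => Φ τ f g) l (𝓝 (B f g))) ∧
      ∀ ε > 0, ∀ᶠ τ in l, ∀ f g,
        ‖Φ τ f g - B f g‖ₑ ≤ ENNReal.ofReal ε * (‖wL2 η f‖ₑ * ‖wL2 η g‖ₑ) := by
  have hlim : ∀ f g, ∃ z : ℂ, Tendsto (fun τ => Φ τ f g) l (𝓝 z) := fun f g => by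
    have hc : Cauchy (map (fun τ => Φ τ f g) l) := by
      rw [Metric.cauchy_iff]
      refine ⟨inferInstance, fun ε hε => ?_⟩
      set N := ‖wL2 η f‖ * ‖wL2 η g‖ with hN
      obtain ⟨s, hs, h⟩ := hΦ (ε / (2 * (N + 1))) (by positivity)
      refine ⟨_, image_mem_map hs, ?_⟩
      rintro _ ⟨τ, hτ, rfl⟩ _ ⟨τ', hτ', rfl⟩
      have h1 := h τ hτ τ' hτ' f g
      rw [← ofReal_norm, ← ofReal_norm, ← ofReal_norm, ← ENNReal.ofReal_mul (norm_nonneg _),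
        ← ENNReal.ofReal_mul (by positivity), ENNReal.ofReal_le_ofReal_iff (by positivity)] at h1
      rw [dist_eq_norm]
      refine h1.trans_lt ?_
      rw [← hN, div_mul_eq_mul_div, div_lt_iff₀ (by positivity)]
      have : 0 ≤ N := by positivity
      nlinarith
    exact CompleteSpace.complete hc
  choose z hz using hlim
  refine ⟨LinearMap.mk₂ ℂ z
    (fun f f' g => tendsto_nhds_unique (hz (f + f') g) (by
      simpa only [map_add, LinearMap.add_apply] using (hz f g).add (hz f' g)))
    (fun c f g => tendsto_nhds_unique (hz (c • f) g) (by
      simpa only [map_smul, LinearMap.smul_apply, smul_eq_mul] using (hz f g).const_mul c))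
    (fun f g g' => tendsto_nhds_unique (hz f (g + g')) (by
      simpa only [map_add] using (hz f g).add (hz f g')))
    (fun c f g => tendsto_nhds_unique (hz f (c • g)) (by
      simpa only [map_smul, smul_eq_mul] using (hz f g).const_mul c)), fun f g => hz f g, ?_⟩
  intro ε hε
  obtain ⟨s, hs, h⟩ := hΦ ε hε
  filter_upwards [hs] with τ hτ f g
  have h1 : Tendsto (fun τ' => ‖Φ τ f g - Φ τ' f g‖ₑ) l (𝓝 ‖Φ τ f g - z f g‖ₑ) :=
    ((hz f g).const_sub _).enorm
  refine le_of_tendsto h1 ?_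
  filter_upwards [hs] with τ' hτ'
  exact h τ hτ τ' hτ' f g

end limitForm

/-! ### The bilinear form of the regularized Faddeev operator -/

section faddeevForm

variable {d n : ℕ}

theorem rad_sq (k : ℝ) (γ : Eucl d) : rad k γ ^ 2 = k ^ 2 + ‖γ‖ ^ 2 :=
  Real.sq_sqrt (by positivity)

theorem rad_pos {k : ℝ} (hk : 0 < k) (γ : Eucl d) : 0 < rad k γ :=
  Real.sqrt_pos.2 (by positivity)

/-- The normalisation of the Fourier transform amounts to rescaling the radius, the direction and
the regularization parameter. -/
theorem symbol_two_pi_smul (k : ℝ) (γ : Eucl d) (τ : ℝ) (ξ : Eucl d) :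
    symbol k γ τ ((2 * Real.pi) • ξ) = ((4 * Real.pi ^ 2 : ℝ) : ℂ) *
      shellSymbol (rad k γ / (2 * Real.pi)) ((2 * Real.pi)⁻¹ • γ) (τ / (4 * Real.pi ^ 2)) ξ := by
  have hpi : Real.pi ≠ 0 := Real.pi_ne_zero
  have hpi' : (Real.pi : ℂ) ≠ 0 := by exact_mod_cast hpi
  rw [symbol, shellSymbol, norm_smul, inner_smul_left, inner_smul_right, Real.norm_of_nonneg
    (by positivity), div_pow, rad_sq]
  simp only [conj_trivial]
  push_cast
  field_simp
  ring

theorem symbol_eq_sub (k : ℝ) (γ : Eucl d) (τ : ℝ) (ξ : Eucl d) :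
    symbol k γ τ ξ = symbol k γ 0 ξ - Complex.I * τ := by
  simp [symbol]

theorem sub_rad_sq_le_norm_symbol (k : ℝ) (γ : Eucl d) (τ : ℝ) (ξ : Eucl d) :
    ‖ξ‖ ^ 2 - rad k γ ^ 2 ≤ ‖symbol k γ τ ξ‖ := by
  have h := (le_abs_self _).trans (Complex.abs_re_le_norm (symbol k γ τ ξ))
  rw [rad_sq]
  simpa [symbol, ← Complex.ofReal_pow, sub_sub] using h

theorem hasTemperateGrowth_symbol (k : ℝ) (γ : Eucl d) (τ : ℝ) :
    (fun ξ : Eucl d => symbol k γ τ ((2 * Real.pi) • ξ)).HasTemperateGrowth := by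
  have h1 : (fun ξ : Eucl d => (2 * Real.pi) • ξ).HasTemperateGrowth :=
    ((2 * Real.pi) • ContinuousLinearMap.id ℝ (Eucl d)).hasTemperateGrowth
  have h2 : (fun ξ : Eucl d => symbol k γ τ ξ).HasTemperateGrowth := by
    unfold symbol
    have h3 : (fun ξ : Eucl d => ‖ξ‖ ^ 2).HasTemperateGrowth := by fun_prop
    have h4 : (fun ξ : Eucl d => ((⟪γ, ξ⟫ : ℝ) : ℂ)).HasTemperateGrowth :=
      Function.Complex.hasTemperateGrowth_ofReal.comp ((innerSL ℝ γ).hasTemperateGrowth)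
    have h5 : (fun ξ : Eucl d => ((‖ξ‖ ^ 2 - k ^ 2 - ‖γ‖ ^ 2 : ℝ) : ℂ)).HasTemperateGrowth :=
      Function.Complex.hasTemperateGrowth_ofReal.comp
        ((h3.sub (Function.HasTemperateGrowth.const _)).sub (Function.HasTemperateGrowth.const _))
    exact (h5.add ((Function.HasTemperateGrowth.const _).mul h4)).sub
      (Function.HasTemperateGrowth.const _)
  exact h2.comp h1

theorem integrable_div_symbol (k : ℝ) (γ : Eucl (n + 2)) {τ : ℝ} (hτ : τ ≠ 0)
    (f g : 𝓢(Eucl (n + 2), ℂ)) :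
    Integrable fun ξ => 𝓕 f ξ * 𝓕⁻ g ξ / symbol k γ τ ((2 * Real.pi) • ξ) := by
  have h := (integrable_shellForm (rad k γ / (2 * Real.pi)) ((2 * Real.pi)⁻¹ • γ)
    (div_ne_zero hτ (by positivity : 4 * Real.pi ^ 2 ≠ 0)) f g).div_const
      ((4 * Real.pi ^ 2 : ℝ) : ℂ)
  refine h.congr (.of_forall fun ξ => ?_)
  simp only [symbol_two_pi_smul]
  rw [div_div, mul_comm (shellSymbol _ _ _ _)]

/-- The bilinear form of the regularized operator. -/
def faddeevForm (k : ℝ) (γ : Eucl (n + 2)) (τ : ℝ) :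
    𝓢(Eucl (n + 2), ℂ) →ₗ[ℂ] 𝓢(Eucl (n + 2), ℂ) →ₗ[ℂ] ℂ :=
  -- The default value zero keeps the uniform bounds and the commutation with multipliers true for
  -- every `τ`, including `τ = 0`, where integrability is not available.
  if hτ : τ = 0 then 0 else
    LinearMap.mk₂ ℂ (fun f g => ∫ ξ, 𝓕 f ξ * 𝓕⁻ g ξ / symbol k γ τ ((2 * Real.pi) • ξ))
      (fun f f' g => by
        rw [← integral_add (integrable_div_symbol k γ hτ f g) (integrable_div_symbol k γ hτ f' g)]
        refine integral_congr_ae (.of_forall fun ξ => ?_)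
        simp only [FourierTransform.fourier_add, _root_.add_apply]
        ring)
      (fun c f g => by
        rw [smul_eq_mul, ← integral_const_mul]
        refine integral_congr_ae (.of_forall fun ξ => ?_)
        simp only [FourierTransform.fourier_smul, _root_.smul_apply, smul_eq_mul]
        ring)
      (fun f g g' => by
        rw [← integral_add (integrable_div_symbol k γ hτ f g) (integrable_div_symbol k γ hτ f g')]
        refine integral_congr_ae (.of_forall fun ξ => ?_)
        simp only [FourierTransform.fourierInv_add, _root_.add_apply]
        ring)
      (fun c f g => by
        rw [smul_eq_mul, ← integral_const_mul]
        refine integral_congr_ae (.of_forall fun ξ => ?_)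
        simp only [FourierTransform.fourierInv_smul, _root_.smul_apply, smul_eq_mul]
        ring)

theorem faddeevForm_zero (k : ℝ) (γ : Eucl (n + 2)) : faddeevForm k γ 0 = 0 := by
  simp [faddeevForm]

theorem faddeevForm_apply (k : ℝ) (γ : Eucl (n + 2)) {τ : ℝ} (hτ : τ ≠ 0)
    (f g : 𝓢(Eucl (n + 2), ℂ)) :
    faddeevForm k γ τ f g = ∫ ξ, 𝓕 f ξ * 𝓕⁻ g ξ / symbol k γ τ ((2 * Real.pi) • ξ) := by
  rw [faddeevForm, dif_neg hτ, LinearMap.mk₂_apply]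

theorem faddeevForm_eq_shellForm (k : ℝ) (γ : Eucl (n + 2)) {τ : ℝ} (hτ : τ ≠ 0)
    (f g : 𝓢(Eucl (n + 2), ℂ)) :
    faddeevForm k γ τ f g = ((4 * Real.pi ^ 2 : ℝ) : ℂ)⁻¹ *
      shellForm (rad k γ / (2 * Real.pi)) ((2 * Real.pi)⁻¹ • γ) (τ / (4 * Real.pi ^ 2)) f g := by
  rw [faddeevForm_apply k γ hτ, shellForm, ← integral_const_mul]
  refine integral_congr_ae (.of_forall fun ξ => ?_)
  simp only [symbol_two_pi_smul]
  rw [div_mul_eq_div_div_swap, div_eq_inv_mul]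

theorem enorm_inv_four_pi_sq_le : ‖((4 * Real.pi ^ 2 : ℝ) : ℂ)⁻¹‖ₑ ≤ 1 := by
  rw [← ofReal_norm, ENNReal.ofReal_le_one, norm_inv, Complex.norm_real,
    Real.norm_of_nonneg (by positivity)]
  refine inv_le_one_of_one_le₀ ?_
  nlinarith [Real.pi_gt_three]

/-- With `ρ = r_{k,γ} / (2π)`, both `ρ⁻¹` and `ρ⁻²` are at most a numerical multiple of `1 /
(min(r_{k,γ}, 1) r_{k,γ})`: use `min ≤ 1` for the first and `min ≤ r_{k,γ}` for the second. -/
theorem exists_enorm_faddeevForm_le (n : ℕ) {η : ℝ} (hη : 1 / 2 < η) :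
    ∃ C : ℝ, 0 < C ∧ ∀ (k : ℝ), 0 < k → ∀ (γ : Eucl (n + 2)) (τ : ℝ) (f g : 𝓢(Eucl (n + 2), ℂ)),
      ‖faddeevForm k γ τ f g‖ₑ ≤
        ENNReal.ofReal (C / (min (rad k γ) 1 * rad k γ)) * (‖wL2 η f‖ₑ * ‖wL2 η g‖ₑ) := by
  obtain ⟨C, hC, h⟩ := exists_enorm_shellForm_le n hη
  refine ⟨C * (2 * Real.pi + 4 * Real.pi ^ 2), by positivity, fun k hk γ τ f g => ?_⟩
  rcases eq_or_ne τ 0 with rfl | hτ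
  · simp [faddeevForm_zero]
  have hR := rad_pos hk γ
  set R := rad k γ
  rw [faddeevForm_eq_shellForm k γ hτ, enorm_mul]
  refine (mul_le_mul' enorm_inv_four_pi_sq_le (h (R / (2 * Real.pi)) (by positivity) _ _
    (div_ne_zero hτ (by positivity : 4 * Real.pi ^ 2 ≠ 0)) f g)).trans ?_
  rw [one_mul]
  refine mul_le_mul' (ENNReal.ofReal_le_ofReal ?_) le_rfl
  rw [mul_div_assoc]
  refine mul_le_mul_of_nonneg_left ?_ hC.le
  have hm : 0 < min R 1 := lt_min hR one_pos
  have h1 : (R / (2 * Real.pi))⁻¹ ≤ 2 * Real.pi / (min R 1 * R) := by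
    rw [inv_div]
    gcongr
    exact mul_le_of_le_one_left hR.le (min_le_right _ _)
  have h2 : ((R / (2 * Real.pi)) ^ 2)⁻¹ ≤ 4 * Real.pi ^ 2 / (min R 1 * R) := by
    rw [div_pow, inv_div, mul_pow, sq R]
    norm_num only
    gcongr
    exact min_le_left _ _
  rw [add_div]
  exact add_le_add h1 h2

theorem exists_faddeevForm_sub_le {η : ℝ} (hη : 1 / 2 < η) {k : ℝ} (hk : 0 < k)
    (γ : Eucl (n + 2)) {ε : ℝ} (hε : 0 < ε) :
    ∃ δ : ℝ, 0 < δ ∧ ∀ τ τ' : ℝ, 0 < τ * τ' → |τ| < δ → |τ'| < δ → ∀ f g : 𝓢(Eucl (n + 2), ℂ),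
      ‖faddeevForm k γ τ f g - faddeevForm k γ τ' f g‖ₑ ≤
        ENNReal.ofReal ε * (‖wL2 η f‖ₑ * ‖wL2 η g‖ₑ) := by
  -- The uniform bound is used at an intermediate weight that is still above `1/2`; the gap to `η`
  -- is the room that the interpolation with the Hölder bound in the weight `d + 1` consumes.
  obtain ⟨η', hη1, hη2⟩ := exists_between hη
  obtain ⟨C, hC, hb⟩ := exists_enorm_faddeevForm_le n hη1
  have hR := rad_pos hk γ
  obtain ⟨δ₀, hδ₀, hint⟩ := exists_enorm_le_of_interpolation (d := n + 2) hη2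
    (((n + 2 : ℕ) : ℝ) + 1) (2 * (C / (min (rad k γ) 1 * rad k γ))) hε
  obtain ⟨K, hK, hKb⟩ := exists_enorm_shellForm_sub_le (n := n)
    (ρ := rad k γ / (2 * Real.pi)) (by positivity) ((2 * Real.pi)⁻¹ • γ)
  have hcont : Tendsto (fun t : ℝ => K * (ENNReal.ofReal t ^ (1 / 8 : ℝ) + ENNReal.ofReal t))
      (𝓝 0) (𝓝 0) := by
    have h1 : Tendsto (fun t : ℝ => ENNReal.ofReal t) (𝓝 0) (𝓝 0) := by
      simpa using (ENNReal.continuous_ofReal.tendsto 0)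
    have h2 : Tendsto (fun t : ℝ => ENNReal.ofReal t ^ (1 / 8 : ℝ)) (𝓝 0) (𝓝 0) := by
      have h := (ENNReal.continuous_rpow_const (y := 1 / 8)).tendsto 0
      rw [ENNReal.zero_rpow_of_pos (by norm_num)] at h
      exact h.comp h1
    have h3 := ENNReal.Tendsto.const_mul (a := K) (h2.add h1) (Or.inr hK.ne)
    simpa using h3
  obtain ⟨t, ht, ht0⟩ := (((hcont.eventually_le_const
    (ENNReal.ofReal_pos.2 hδ₀)).filter_mono nhdsWithin_le_nhds).and
      (self_mem_nhdsWithin (a := (0 : ℝ)) (s := Ioi 0))).exists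
  have ht0' : 0 < t := ht0
  refine ⟨t / 2, by positivity, fun τ τ' hττ' h1 h2 => ?_⟩
  have hτ := left_ne_zero_of_mul hττ'.ne'
  have hτ' := right_ne_zero_of_mul hττ'.ne'
  refine hint (faddeevForm k γ τ - faddeevForm k γ τ') (fun f g => ?_) (fun f g => ?_)
  · rw [LinearMap.sub_apply, LinearMap.sub_apply, two_mul, ENNReal.ofReal_add (by positivity)
      (by positivity), add_mul]
    exact (enorm_sub_le).trans (add_le_add (hb k hk γ τ f g) (hb k hk γ τ' f g))
  · rw [LinearMap.sub_apply, LinearMap.sub_apply, faddeevForm_eq_shellForm k γ hτ,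
      faddeevForm_eq_shellForm k γ hτ', ← mul_sub, enorm_mul]
    have hpi : (0 : ℝ) < 4 * Real.pi ^ 2 := by positivity
    have hpi1 : (1 : ℝ) ≤ 4 * Real.pi ^ 2 := by nlinarith [Real.pi_gt_three]
    have h3 : 0 < τ / (4 * Real.pi ^ 2) * (τ' / (4 * Real.pi ^ 2)) := by
      rw [div_mul_div_comm]
      positivity
    refine (mul_le_mul' enorm_inv_four_pi_sq_le (hKb _ _ h3 f g)).trans ?_
    rw [one_mul]
    refine mul_le_mul' (le_trans ?_ ht) le_rfl
    have h4 : ‖τ' / (4 * Real.pi ^ 2) - τ / (4 * Real.pi ^ 2)‖ₑ ≤ ENNReal.ofReal t := by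
      rw [← ofReal_norm, ← sub_div, Real.norm_eq_abs, abs_div, abs_of_pos hpi]
      refine ENNReal.ofReal_le_ofReal ((div_le_self (abs_nonneg _) hpi1).trans ?_)
      linarith [abs_sub τ' τ]
    gcongr

/-- The limiting absorption principle for the bilinear forms. -/
theorem exists_faddeevForm_limit {l : Filter ℝ} (hl : l = 𝓝[>] 0 ∨ l = 𝓝[<] 0) {k : ℝ}
    (hk : 0 < k) (γ : Eucl (n + 2)) :
    ∃ B : 𝓢(Eucl (n + 2), ℂ) →ₗ[ℂ] 𝓢(Eucl (n + 2), ℂ) →ₗ[ℂ] ℂ,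
      (∀ f g, Tendsto (fun τ => faddeevForm k γ τ f g) l (𝓝 (B f g))) ∧
      ∀ η : ℝ, 1 / 2 < η → ∀ ε > 0, ∀ᶠ τ in l, ∀ f g,
        ‖faddeevForm k γ τ f g - B f g‖ₑ ≤ ENNReal.ofReal ε * (‖wL2 η f‖ₑ * ‖wL2 η g‖ₑ) := by
  have hne : l.NeBot := by
    rcases hl with rfl | rfl <;> infer_instance
  have hcauchy : ∀ η : ℝ, 1 / 2 < η → ∀ ε > 0, ∃ s ∈ l, ∀ τ ∈ s, ∀ τ' ∈ s, ∀ f g,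
      ‖faddeevForm k γ τ f g - faddeevForm k γ τ' f g‖ₑ ≤
        ENNReal.ofReal ε * (‖wL2 η f‖ₑ * ‖wL2 η g‖ₑ) := fun η hη ε hε => by
    obtain ⟨δ, hδ, h⟩ := exists_faddeevForm_sub_le hη hk γ hε
    rcases hl with rfl | rfl
    · refine ⟨Ioo 0 δ, Ioo_mem_nhdsGT hδ, fun τ hτ τ' hτ' => h τ τ' (mul_pos hτ.1 hτ'.1) ?_ ?_⟩
      · rw [abs_of_pos hτ.1]; exact hτ.2
      · rw [abs_of_pos hτ'.1]; exact hτ'.2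
    · refine ⟨Ioo (-δ) 0, Ioo_mem_nhdsLT (neg_lt_zero.2 hδ), fun τ hτ τ' hτ' =>
        h τ τ' (mul_pos_of_neg_of_neg hτ.2 hτ'.2) ?_ ?_⟩
      · rw [abs_of_neg hτ.2]; linarith [hτ.1]
      · rw [abs_of_neg hτ'.2]; linarith [hτ'.1]
  -- The weight `1` is an arbitrary admissible choice. Pointwise limits are unique, so the same form
  -- `B` is the limit with respect to every admissible weight.
  obtain ⟨B, hB, -⟩ := exists_limit_bilinear (faddeevForm k γ) (hcauchy 1 (by norm_num))
  refine ⟨B, hB, fun η hη => ?_⟩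
  obtain ⟨B', hB', h⟩ := exists_limit_bilinear (faddeevForm k γ) (hcauchy η hη)
  have : B' = B := by
    ext f g
    exact tendsto_nhds_unique (hB' f g) (hB f g)
  rwa [this] at h

/-! Algebraic properties of the form -/

theorem fourier_fourierMultiplierCLM_apply {ψ : Eucl d → ℂ} (hψ : ψ.HasTemperateGrowth)
    (f : 𝓢(Eucl d, ℂ)) (ξ : Eucl d) :
    𝓕 (SchwartzMap.fourierMultiplierCLM ℂ ψ f) ξ = ψ ξ * 𝓕 f ξ := by
  rw [SchwartzMap.fourierMultiplierCLM_apply, FourierTransform.fourier_fourierInv_eq,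
    SchwartzMap.smulLeftCLM_apply_apply hψ, smul_eq_mul]

theorem fourierInv_transposeMultiplier_apply {ψ : Eucl d → ℂ} (hψ : ψ.HasTemperateGrowth)
    (g : 𝓢(Eucl d, ℂ)) (ξ : Eucl d) :
    𝓕⁻ (transposeMultiplier ψ g) ξ = ψ ξ * 𝓕⁻ g ξ := by
  rw [transposeMultiplier_apply, FourierTransform.fourierInv_fourier_eq,
    SchwartzMap.smulLeftCLM_apply_apply hψ, smul_eq_mul]

theorem faddeevForm_fourierMultiplierCLM {ψ : Eucl (n + 2) → ℂ} (hψ : ψ.HasTemperateGrowth)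
    (k : ℝ) (γ : Eucl (n + 2)) (τ : ℝ) (f g : 𝓢(Eucl (n + 2), ℂ)) :
    faddeevForm k γ τ (SchwartzMap.fourierMultiplierCLM ℂ ψ f) g =
      faddeevForm k γ τ f (transposeMultiplier ψ g) := by
  rcases eq_or_ne τ 0 with rfl | hτ
  · simp [faddeevForm_zero]
  rw [faddeevForm_apply k γ hτ, faddeevForm_apply k γ hτ]
  refine integral_congr_ae (.of_forall fun ξ => ?_)
  simp only [fourier_fourierMultiplierCLM_apply hψ, fourierInv_transposeMultiplier_apply hψ]
  ring

theorem integral_fourier_mul_fourierInv_eq (f g : 𝓢(Eucl d, ℂ)) :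
    ∫ ξ, 𝓕 f ξ * 𝓕⁻ g ξ = ∫ x, f x * g x := by
  have h := SchwartzMap.integral_fourier_mul_eq f (𝓕⁻ g)
  rw [h]
  simp [FourierTransform.fourier_fourierInv_eq]

/-- For `γ ≠ 0` finiteness of the local integral of `|m|^(-9/8)` forces the zero set to be null,
since the integrand is infinite there. -/
theorem symbol_ne_zero_ae (k : ℝ) (γ : Eucl (n + 2)) {τ : ℝ} (hτ : τ ≠ 0) :
    ∀ᵐ ξ : Eucl (n + 2), symbol k γ τ ((2 * Real.pi) • ξ) ≠ 0 := by
  have hτ' := div_ne_zero hτ (by positivity : 4 * Real.pi ^ 2 ≠ 0)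
  have hpi : ((4 * Real.pi ^ 2 : ℝ) : ℂ) ≠ 0 := by
    exact_mod_cast (by positivity : 4 * Real.pi ^ 2 ≠ 0)
  simp_rw [symbol_two_pi_smul]
  rcases eq_or_ne γ 0 with rfl | hγ
  · refine .of_forall fun ξ => mul_ne_zero hpi ?_
    rw [smul_zero]
    exact shellSymbol_zero_ne_zero hτ' ξ
  have hγ' : (2 * Real.pi)⁻¹ • γ ≠ 0 := smul_ne_zero (by positivity) hγ
  set ρ := rad k γ / (2 * Real.pi)
  obtain ⟨C, hC, h⟩ := exists_setLIntegral_shellSymbol_le hγ' ρ (|ρ| + 1)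
  have h1 := ae_lt_top ((continuous_shellSymbol ρ ((2 * Real.pi)⁻¹ • γ)
    (τ / (4 * Real.pi ^ 2))).measurable.enorm.pow_const (-(9 / 8) : ℝ)) ((h _).trans_lt hC).ne
  rw [ae_restrict_iff' Metric.isClosed_closedBall.measurableSet] at h1
  filter_upwards [h1] with ξ hξ
  refine mul_ne_zero hpi fun h0 => ?_
  by_cases hmem : ξ ∈ Metric.closedBall (0 : Eucl (n + 2)) (|ρ| + 1)
  · have h2 := hξ hmem
    rw [h0, enorm_zero, ENNReal.zero_rpow_of_neg (by norm_num)] at h2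
    exact lt_irrefl _ h2
  · have h2 := one_le_norm_shellSymbol (γ := (2 * Real.pi)⁻¹ • γ) (τ := τ / (4 * Real.pi ^ 2)) hmem
    rw [h0, norm_zero] at h2
    linarith

/-- Insert `m_0 = m_τ + i τ`. The second term disappears as `τ` tends to zero, and the inversion
formula for the limit remains. -/
theorem faddeevForm_symbol (k : ℝ) (γ : Eucl (n + 2)) {τ : ℝ} (hτ : τ ≠ 0)
    (f g : 𝓢(Eucl (n + 2), ℂ)) :
    faddeevForm k γ τ f (transposeMultiplier (fun ξ => symbol k γ 0 ((2 * Real.pi) • ξ)) g) =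
      (∫ x, f x * g x) + Complex.I * τ * faddeevForm k γ τ f g := by
  rw [faddeevForm_apply k γ hτ, faddeevForm_apply k γ hτ, ← integral_fourier_mul_fourierInv_eq,
    ← integral_const_mul, ← integral_add (integrable_fourier_mul_fourierInv f g)
      ((integrable_div_symbol k γ hτ f g).const_mul _)]
  refine integral_congr_ae ?_
  filter_upwards [symbol_ne_zero_ae k γ hτ] with ξ hξ
  rw [fourierInv_transposeMultiplier_apply (hasTemperateGrowth_symbol k γ 0)]
  have h : symbol k γ 0 ((2 * Real.pi) • ξ) =
      symbol k γ τ ((2 * Real.pi) • ξ) + Complex.I * τ := by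
    rw [symbol_eq_sub k γ τ]
    ring
  rw [h]
  field_simp

/-! High frequencies -/

/-- When `ψ / m` is bounded, Plancherel gives an unweighted bound. It is applied at high
frequencies, where the constant carries the gain of two derivatives. -/
theorem enorm_faddeevForm_fourierMultiplierCLM_le {ψ : Eucl (n + 2) → ℂ}
    (hψ : ψ.HasTemperateGrowth) (k : ℝ) (γ : Eucl (n + 2)) (τ : ℝ) {c : ℝ} (hc : 0 ≤ c)
    (h : ∀ ξ, ‖ψ ξ‖ ≤ c * ‖symbol k γ τ ((2 * Real.pi) • ξ)‖) (f g : 𝓢(Eucl (n + 2), ℂ)) :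
    ‖faddeevForm k γ τ (SchwartzMap.fourierMultiplierCLM ℂ ψ f) g‖ₑ ≤
      ENNReal.ofReal c * (‖f.toLp 2 volume‖ₑ * ‖g.toLp 2 volume‖ₑ) := by
  rcases eq_or_ne τ 0 with rfl | hτ
  · simp [faddeevForm_zero]
  rw [faddeevForm_apply k γ hτ]
  refine (enorm_integral_le_lintegral_enorm _).trans ?_
  refine le_trans ?_ (mul_le_mul' le_rfl (lintegral_fourier_mul_fourierInv_le f g))
  rw [← lintegral_const_mul' _ _ ENNReal.ofReal_ne_top]
  refine lintegral_mono fun ξ => ?_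
  rw [← ofReal_norm, ← ofReal_norm, ← ENNReal.ofReal_mul hc]
  refine ENNReal.ofReal_le_ofReal ?_
  rw [fourier_fourierMultiplierCLM_apply hψ, norm_div, mul_assoc, norm_mul]
  rcases eq_or_ne (symbol k γ τ ((2 * Real.pi) • ξ)) 0 with h0 | h0
  · rw [h0, norm_zero, div_zero]
    positivity
  have h1 : 0 < ‖symbol k γ τ ((2 * Real.pi) • ξ)‖ := norm_pos_iff.2 h0
  rw [div_le_iff₀ h1]
  calc _ ≤ c * ‖symbol k γ τ ((2 * Real.pi) • ξ)‖ * ‖𝓕 f ξ * 𝓕⁻ g ξ‖ := by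
        gcongr
        exact h ξ
    _ = _ := by ring

/-- The difference `1/m_τ - 1/m_τ'` equals `i (τ - τ') / (m_τ m_τ')`, so at high frequencies the
dependence on `τ` is Lipschitz with a gain of four derivatives. -/
theorem enorm_faddeevForm_sub_fourierMultiplierCLM_le {ψ : Eucl (n + 2) → ℂ}
    (hψ : ψ.HasTemperateGrowth) (k : ℝ) (γ : Eucl (n + 2)) {τ τ' : ℝ} (hτ : τ ≠ 0) (hτ' : τ' ≠ 0)
    {c : ℝ} (hc : 0 ≤ c)
    (h : ∀ ξ, ‖ψ ξ‖ ≤ c * (‖symbol k γ τ ((2 * Real.pi) • ξ)‖ *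
      ‖symbol k γ τ' ((2 * Real.pi) • ξ)‖)) (f g : 𝓢(Eucl (n + 2), ℂ)) :
    ‖faddeevForm k γ τ (SchwartzMap.fourierMultiplierCLM ℂ ψ f) g -
      faddeevForm k γ τ' (SchwartzMap.fourierMultiplierCLM ℂ ψ f) g‖ₑ ≤
      ENNReal.ofReal (c * |τ - τ'|) * (‖f.toLp 2 volume‖ₑ * ‖g.toLp 2 volume‖ₑ) := by
  rw [faddeevForm_apply k γ hτ, faddeevForm_apply k γ hτ',
    ← integral_sub (integrable_div_symbol k γ hτ _ g) (integrable_div_symbol k γ hτ' _ g)]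
  refine (enorm_integral_le_lintegral_enorm _).trans ?_
  refine le_trans ?_ (mul_le_mul' le_rfl (lintegral_fourier_mul_fourierInv_le f g))
  rw [← lintegral_const_mul' _ _ ENNReal.ofReal_ne_top]
  refine lintegral_mono_ae ?_
  filter_upwards [symbol_ne_zero_ae k γ hτ, symbol_ne_zero_ae k γ hτ'] with ξ h0 h0'
  rw [← ofReal_norm, ← ofReal_norm, ← ENNReal.ofReal_mul (by positivity)]
  refine ENNReal.ofReal_le_ofReal ?_
  have h1 : 0 < ‖symbol k γ τ ((2 * Real.pi) • ξ)‖ := norm_pos_iff.2 h0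
  have h1' : 0 < ‖symbol k γ τ' ((2 * Real.pi) • ξ)‖ := norm_pos_iff.2 h0'
  have hsub : ‖symbol k γ τ' ((2 * Real.pi) • ξ) - symbol k γ τ ((2 * Real.pi) • ξ)‖ =
      |τ - τ'| := by
    rw [symbol_eq_sub k γ τ, symbol_eq_sub k γ τ', sub_sub_sub_cancel_left, ← mul_sub, norm_mul,
      Complex.norm_I, one_mul, ← Complex.ofReal_sub, Complex.norm_real, Real.norm_eq_abs]
  rw [fourier_fourierMultiplierCLM_apply hψ, div_sub_div _ _ h0 h0', mul_comm _ (ψ ξ * _ * _),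
    ← mul_sub, norm_div, norm_mul, hsub, mul_assoc, norm_mul, norm_mul (symbol _ _ _ _),
    div_le_iff₀ (by positivity)]
  calc _ ≤ c * (‖symbol k γ τ ((2 * Real.pi) • ξ)‖ * ‖symbol k γ τ' ((2 * Real.pi) • ξ)‖) *
        ‖𝓕 f ξ * 𝓕⁻ g ξ‖ * |τ - τ'| := by
        gcongr
        exact h ξ
    _ = _ := by ring

end faddeevForm

/-! ### Duality for weighted norms of tempered distributions -/

section Duality

variable {d : ℕ}

theorem coe_apply_eq_inner (a : Lp ℂ 2 (volume : Measure (Eucl d))) (g : 𝓢(Eucl d, ℂ)) :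
    (a : 𝓢'(Eucl d, ℂ)) g = inner ℂ (star a) (g.toLp 2 volume) := by
  rw [Lp.toTemperedDistribution_apply, L2.inner_def]
  refine integral_congr_ae ?_
  filter_upwards [Lp.coeFn_star a, g.coeFn_toLp 2 volume] with x h1 h2
  rw [h1, h2]
  simp [mul_comm]

theorem norm_star_Lp (a : Lp ℂ 2 (volume : Measure (Eucl d))) : ‖star a‖ = ‖a‖ := by
  rw [Lp.norm_def, Lp.norm_def]
  congr 1
  refine eLpNorm_congr_norm_ae ?_
  filter_upwards [Lp.coeFn_star a] with x hx
  rw [hx, Pi.star_apply, norm_star]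

theorem enorm_coe_apply_le (a : Lp ℂ 2 (volume : Measure (Eucl d))) (g : 𝓢(Eucl d, ℂ)) :
    ‖(a : 𝓢'(Eucl d, ℂ)) g‖ₑ ≤ ‖a‖ₑ * ‖g.toLp 2 volume‖ₑ := by
  rw [coe_apply_eq_inner]
  have h := norm_inner_le_norm (𝕜 := ℂ) (star a) (g.toLp 2 volume)
  rw [norm_star_Lp] at h
  rw [← ofReal_norm, ← ofReal_norm, ← ofReal_norm, ← ENNReal.ofReal_mul (norm_nonneg _)]
  exact ENNReal.ofReal_le_ofReal h

/-- Riesz representation for the extension of `u` from the dense subspace of Schwartz functions. The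
conjugation compensates for the pairing of distributions being bilinear and the inner product
sesquilinear. -/
theorem l2Norm_le_of_forall {u : 𝓢'(Eucl d, ℂ)} {C : ℝ} (hC : 0 ≤ C)
    (h : ∀ g : 𝓢(Eucl d, ℂ), ‖u g‖ ≤ C * ‖g.toLp 2 volume‖) : l2Norm u ≤ ENNReal.ofReal C := by
  have hd : DenseRange (toLpCLM ℂ ℂ 2 (volume : Measure (Eucl d))).toLinearMap :=
    denseRange_toLpCLM ENNReal.ofNat_ne_top
  set F := LinearMap.extendOfNorm u.toLinearMap
    (toLpCLM ℂ ℂ 2 (volume : Measure (Eucl d))).toLinearMap with hF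
  have hFn : ‖F‖ ≤ C := LinearMap.opNorm_extendOfNorm_le hd hC h
  set b := (InnerProductSpace.toDual ℂ (Lp ℂ 2 (volume : Measure (Eucl d)))).symm F with hb
  have hu : ((star b : Lp ℂ 2 (volume : Measure (Eucl d))) : 𝓢'(Eucl d, ℂ)) = u := by
    ext g
    rw [coe_apply_eq_inner, star_star, hb, InnerProductSpace.toDual_symm_apply]
    exact LinearMap.extendOfNorm_eq hd ⟨C, h⟩ g
  rw [← hu, l2Norm_coe, ← ofReal_norm, norm_star_Lp]
  refine ENNReal.ofReal_le_ofReal ?_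
  rw [hb, LinearIsometryEquiv.norm_map]
  exact hFn

/-- This duality, which also covers infinite values, turns every estimate of a norm of a
distribution into an estimate of its pairings with Schwartz functions. -/
theorem l2Norm_le_iff {u : 𝓢'(Eucl d, ℂ)} {C : ℝ≥0∞} :
    l2Norm u ≤ C ↔ ∀ g : 𝓢(Eucl d, ℂ), ‖u g‖ₑ ≤ C * ‖g.toLp 2 volume‖ₑ := by
  refine ⟨fun h g => ?_, fun h => ?_⟩
  · rcases eq_or_ne (l2Norm u) ⊤ with hu | hu
    · rw [hu, top_le_iff] at h
      rcases eq_or_ne g 0 with rfl | hg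
      · simp
      · have : g.toLp 2 (volume : Measure (Eucl d)) ≠ 0 := fun h0 => hg
          (injective_toLp 2 volume (h0.trans (map_zero (toLpCLM ℂ ℂ 2 volume)).symm))
        rw [h, ENNReal.top_mul (by simpa using this)]
        exact le_top
    · obtain ⟨a, rfl⟩ := exists_of_l2Norm_lt_top hu.lt_top
      rw [l2Norm_coe] at h
      exact (enorm_coe_apply_le a g).trans (by gcongr)
  · rcases eq_or_ne C ⊤ with rfl | hC
    · exact le_top
    rw [← ENNReal.ofReal_toReal hC]
    refine l2Norm_le_of_forall ENNReal.toReal_nonneg fun g => ?_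
    have h1 := h g
    rw [← ENNReal.ofReal_toReal hC, ← ofReal_norm, ← ofReal_norm,
      ← ENNReal.ofReal_mul ENNReal.toReal_nonneg] at h1
    exact (ENNReal.ofReal_le_ofReal_iff (by positivity)).1 h1

theorem weightedL2Norm_le_iff {η lam : ℝ} {u : 𝓢'(Eucl d, ℂ)} {C : ℝ≥0∞} :
    weightedL2Norm η lam u ≤ C ↔ ∀ g : 𝓢(Eucl d, ℂ),
      ‖u (SchwartzMap.smulLeftCLM ℂ (fun x => (weight η lam x : ℂ)) g)‖ₑ ≤
        C * ‖g.toLp 2 volume‖ₑ :=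
  l2Norm_le_iff

theorem weight_mul_weight_neg (η lam : ℝ) (x : Eucl d) :
    weight η lam x * weight (-η) lam x = 1 := by
  unfold weight
  rw [← Real.rpow_add (by positivity)]
  simp [neg_div]

theorem smulLeftCLM_weight_smulLeftCLM_weight_neg (η lam : ℝ) (g : 𝓢(Eucl d, ℂ)) :
    SchwartzMap.smulLeftCLM ℂ (fun x => (weight η lam x : ℂ))
      (SchwartzMap.smulLeftCLM ℂ (fun x => (weight (-η) lam x : ℂ)) g) = g := by
  ext x
  rw [SchwartzMap.smulLeftCLM_apply_apply (hasTemperateGrowth_weight η lam),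
    SchwartzMap.smulLeftCLM_apply_apply (hasTemperateGrowth_weight (-η) lam), smul_smul,
    ← Complex.ofReal_mul, weight_mul_weight_neg]
  simp

theorem enorm_apply_le_weightedL2Norm (η lam : ℝ) (u : 𝓢'(Eucl d, ℂ)) (g : 𝓢(Eucl d, ℂ)) :
    ‖u g‖ₑ ≤ weightedL2Norm η lam u *
      ‖(SchwartzMap.smulLeftCLM ℂ (fun x => (weight (-η) lam x : ℂ)) g).toLp 2 volume‖ₑ := by
  have h := weightedL2Norm_le_iff.1 (le_refl (weightedL2Norm η lam u))
    (SchwartzMap.smulLeftCLM ℂ (fun x => (weight (-η) lam x : ℂ)) g)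
  rwa [smulLeftCLM_weight_smulLeftCLM_weight_neg] at h

theorem enorm_apply_le_wL2 (η : ℝ) (u : 𝓢'(Eucl d, ℂ)) (g : 𝓢(Eucl d, ℂ)) :
    ‖u g‖ₑ ≤ weightedL2Norm η 1 u * ‖wL2 (-η) g‖ₑ :=
  enorm_apply_le_weightedL2Norm η 1 u g

theorem smulLeftCLM_coe (g : Eucl d → ℂ) (hg : g.HasTemperateGrowth) (f : 𝓢(Eucl d, ℂ)) :
    TemperedDistribution.smulLeftCLM ℂ g (f : 𝓢'(Eucl d, ℂ)) =
      (SchwartzMap.smulLeftCLM ℂ g f : 𝓢(Eucl d, ℂ)) := by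
  ext h
  rw [TemperedDistribution.smulLeftCLM_apply_apply, SchwartzMap.coe_apply, SchwartzMap.coe_apply]
  refine integral_congr_ae (.of_forall fun x => ?_)
  simp only [SchwartzMap.smulLeftCLM_apply_apply hg, smul_eq_mul]
  ring

theorem l2Norm_coe_schwartz (f : 𝓢(Eucl d, ℂ)) :
    l2Norm (f : 𝓢'(Eucl d, ℂ)) = ‖f.toLp 2 volume‖ₑ := by
  rw [← Lp.toTemperedDistribution_toLp_eq (p := 2), l2Norm_coe]

theorem weightedL2Norm_coe (η : ℝ) (f : 𝓢(Eucl d, ℂ)) :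
    weightedL2Norm η 1 (f : 𝓢'(Eucl d, ℂ)) = ‖wL2 η f‖ₑ := by
  rw [weightedL2Norm, smulLeftCLM_coe _ (hasTemperateGrowth_weight η 1), l2Norm_coe_schwartz,
    wL2_apply]

theorem weightedL2Norm_add_le (η lam : ℝ) (u v : 𝓢'(Eucl d, ℂ)) :
    weightedL2Norm η lam (u + v) ≤ weightedL2Norm η lam u + weightedL2Norm η lam v := by
  unfold weightedL2Norm
  rw [map_add]
  exact l2Norm_add_le _ _

theorem weightedL2Norm_smul_le (η lam : ℝ) (c : ℂ) (u : 𝓢'(Eucl d, ℂ)) :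
    weightedL2Norm η lam (c • u) ≤ ‖c‖ₑ * weightedL2Norm η lam u := by
  rw [weightedL2Norm_le_iff]
  intro g
  have h := weightedL2Norm_le_iff.1 (le_refl (weightedL2Norm η lam u)) g
  rw [show ∀ h, (c • u) h = c * u h from fun _ => rfl, enorm_mul, mul_assoc]
  gcongr

theorem weightedL2Norm_zero (η lam : ℝ) : weightedL2Norm η lam (0 : 𝓢'(Eucl d, ℂ)) = 0 := by
  have h := weightedL2Norm_smul_le η lam (0 : ℂ) (0 : 𝓢'(Eucl d, ℂ))
  rwa [zero_smul ℂ (0 : 𝓢'(Eucl d, ℂ)), enorm_zero, zero_mul, nonpos_iff_eq_zero] at h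

theorem weightedL2Norm_sub_le (η lam : ℝ) (u v : 𝓢'(Eucl d, ℂ)) :
    weightedL2Norm η lam (u - v) ≤ weightedL2Norm η lam u + weightedL2Norm η lam v := by
  have h := weightedL2Norm_smul_le η lam (-1 : ℂ) v
  rw [enorm_neg, enorm_one, one_mul, neg_one_smul ℂ v] at h
  rw [sub_eq_add_neg]
  exact (weightedL2Norm_add_le _ _ _ _).trans (by gcongr)

/-! ### Weighted `L²` spaces and density of Schwartz functions -/

/-- The weighted space `L²(⟨x⟩ ^ η)` as a space of tempered distributions. -/
def WeightedL2 (d : ℕ) (η : ℝ) : Submodule ℂ 𝓢'(Eucl d, ℂ) where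
  carrier := {v | weightedL2Norm η 1 v < ⊤}
  zero_mem' := by
    simp [weightedL2Norm_zero]
  add_mem' := fun hu hv => (weightedL2Norm_add_le _ _ _ _).trans_lt (ENNReal.add_lt_top.2 ⟨hu, hv⟩)
  smul_mem' := fun c _ hv => (weightedL2Norm_smul_le _ _ c _).trans_lt
    (ENNReal.mul_lt_top enorm_lt_top hv)

theorem mem_weightedL2 {η : ℝ} {v : 𝓢'(Eucl d, ℂ)} :
    v ∈ WeightedL2 d η ↔ weightedL2Norm η 1 v < ⊤ := Iff.rfl

theorem coe_mem_weightedL2 (η : ℝ) (f : 𝓢(Eucl d, ℂ)) :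
    (f : 𝓢'(Eucl d, ℂ)) ∈ WeightedL2 d η := by
  rw [mem_weightedL2, weightedL2Norm_coe]
  exact enorm_lt_top

theorem injective_coe_Lp :
    Function.Injective (Lp.toTemperedDistributionCLM ℂ (volume : Measure (Eucl d)) 2) :=
  LinearMap.ker_eq_bot.1 Lp.ker_toTemperedDistributionCLM_eq_bot

/-- The square integrable function that represents `⟨x⟩ ^ η v`. -/
def weightedRep (η : ℝ) : WeightedL2 d η →ₗ[ℂ] Lp ℂ 2 (volume : Measure (Eucl d)) where
  toFun v := Classical.choose (exists_of_l2Norm_lt_top v.2)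
  map_add' u v := by
    apply injective_coe_Lp
    rw [map_add]
    simp only [Lp.toTemperedDistributionCLM_apply]
    rw [Classical.choose_spec (exists_of_l2Norm_lt_top u.2),
      Classical.choose_spec (exists_of_l2Norm_lt_top v.2),
      Classical.choose_spec (exists_of_l2Norm_lt_top (u + v).2), Submodule.coe_add, map_add]
  map_smul' c v := by
    apply injective_coe_Lp
    rw [RingHom.id_apply, map_smul]
    simp only [Lp.toTemperedDistributionCLM_apply]
    rw [Classical.choose_spec (exists_of_l2Norm_lt_top v.2),
      Classical.choose_spec (exists_of_l2Norm_lt_top (c • v).2), Submodule.coe_smul, map_smul]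

theorem coe_weightedRep {η : ℝ} (v : WeightedL2 d η) :
    (weightedRep η v : 𝓢'(Eucl d, ℂ)) =
      TemperedDistribution.smulLeftCLM ℂ (fun x => (weight η 1 x : ℂ)) v :=
  Classical.choose_spec (exists_of_l2Norm_lt_top v.2)

theorem enorm_weightedRep {η : ℝ} (v : WeightedL2 d η) :
    ‖weightedRep η v‖ₑ = weightedL2Norm η 1 (v : 𝓢'(Eucl d, ℂ)) := by
  rw [← l2Norm_coe, coe_weightedRep]
  rfl

theorem weightedRep_coe (η : ℝ) (f : 𝓢(Eucl d, ℂ)) :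
    weightedRep η ⟨(f : 𝓢'(Eucl d, ℂ)), coe_mem_weightedL2 η f⟩ = wL2 η f := by
  apply injective_coe_Lp
  simp only [Lp.toTemperedDistributionCLM_apply]
  rw [coe_weightedRep, wL2_apply, Lp.toTemperedDistribution_toLp_eq]
  exact smulLeftCLM_coe _ (hasTemperateGrowth_weight η 1) f

theorem denseRange_wL2 (η : ℝ) : DenseRange (wL2 (d := d) η) := by
  have h1 : DenseRange (toLpCLM ℂ ℂ 2 (volume : Measure (Eucl d))) :=
    denseRange_toLpCLM ENNReal.ofNat_ne_top
  have h2 : DenseRange (SchwartzMap.smulLeftCLM ℂ (fun x : Eucl d => (weight η 1 x : ℂ))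
      : 𝓢(Eucl d, ℂ) →L[ℂ] 𝓢(Eucl d, ℂ)) :=
    Function.Surjective.denseRange fun g => ⟨_, smulLeftCLM_weight_smulLeftCLM_weight_neg η 1 g⟩
  exact h1.comp h2 (toLpCLM ℂ ℂ 2 volume).continuous

theorem exists_schwartz_weightedL2Norm_sub_lt {η : ℝ} {v : 𝓢'(Eucl d, ℂ)}
    (hv : v ∈ WeightedL2 d η) {ε : ℝ≥0∞} (hε : 0 < ε) :
    ∃ f : 𝓢(Eucl d, ℂ), weightedL2Norm η 1 (v - (f : 𝓢'(Eucl d, ℂ))) < ε := by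
  obtain ⟨f, hf⟩ := (denseRange_wL2 (d := d) η).exists_mem_open
    (Metric.isOpen_eball (x := weightedRep η ⟨v, hv⟩) (ε := ε)) ⟨_, Metric.mem_eball_self hε⟩
  refine ⟨f, ?_⟩
  have h := enorm_weightedRep
    (⟨v, hv⟩ - ⟨(f : 𝓢'(Eucl d, ℂ)), coe_mem_weightedL2 η f⟩ : WeightedL2 d η)
  rw [Submodule.coe_sub] at h
  rw [← h, map_sub, weightedRep_coe, ← edist_eq_enorm_sub, edist_comm]
  exact hf

/-- A bounded functional on `L²(⟨x⟩ ^ η)` inherits its bound from Schwartz functions. -/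
theorem enorm_le_of_forall_schwartz {η : ℝ} (Φ : WeightedL2 d η →ₗ[ℂ] ℂ) {C c : ℝ≥0∞} (hC : C ≠ ⊤)
    (hΦ : ∀ v, ‖Φ v‖ₑ ≤ C * weightedL2Norm η 1 (v : 𝓢'(Eucl d, ℂ))) (hc : c ≠ ⊤)
    (h : ∀ f : 𝓢(Eucl d, ℂ), ‖Φ ⟨f, coe_mem_weightedL2 η f⟩‖ₑ ≤ c * ‖wL2 η f‖ₑ)
    (v : WeightedL2 d η) : ‖Φ v‖ₑ ≤ c * weightedL2Norm η 1 (v : 𝓢'(Eucl d, ℂ)) := by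
  refine ENNReal.le_of_forall_pos_le_add fun ε hε _ => ?_
  have hD : C + c + 1 ≠ ⊤ := by simp [hC, hc]
  -- The a priori constant `C` only multiplies the approximation error and vanishes in the end. The
  -- summand `1` avoids division by zero.
  obtain ⟨f, hf⟩ := exists_schwartz_weightedL2Norm_sub_lt v.2
    (ε := (ε : ℝ≥0∞) / (C + c + 1)) (ENNReal.div_pos (by simpa using hε.ne') hD)
  set f' : WeightedL2 d η := ⟨f, coe_mem_weightedL2 η f⟩ with hf'
  have e : Φ v = Φ (v - f') + Φ f' := by rw [map_sub]; ring
  have h1 : ‖wL2 η f‖ₑ ≤ weightedL2Norm η 1 (v : 𝓢'(Eucl d, ℂ)) +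
      weightedL2Norm η 1 ((v : 𝓢'(Eucl d, ℂ)) - (f : 𝓢'(Eucl d, ℂ))) := by
    rw [← weightedL2Norm_coe]
    have := weightedL2Norm_sub_le η 1 (v : 𝓢'(Eucl d, ℂ))
      ((v : 𝓢'(Eucl d, ℂ)) - (f : 𝓢'(Eucl d, ℂ)))
    rwa [sub_sub_cancel] at this
  calc ‖Φ v‖ₑ ≤ ‖Φ (v - f')‖ₑ + ‖Φ f'‖ₑ := by
        rw [e]
        exact enorm_add_le _ _
    _ ≤ C * weightedL2Norm η 1 ((v : 𝓢'(Eucl d, ℂ)) - (f : 𝓢'(Eucl d, ℂ))) +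
        c * (weightedL2Norm η 1 (v : 𝓢'(Eucl d, ℂ)) +
          weightedL2Norm η 1 ((v : 𝓢'(Eucl d, ℂ)) - (f : 𝓢'(Eucl d, ℂ)))) :=
        add_le_add (hΦ _) ((h f).trans (by gcongr))
    _ = c * weightedL2Norm η 1 (v : 𝓢'(Eucl d, ℂ)) +
        (C + c) * weightedL2Norm η 1 ((v : 𝓢'(Eucl d, ℂ)) - (f : 𝓢'(Eucl d, ℂ))) := by ring
    _ ≤ c * weightedL2Norm η 1 (v : 𝓢'(Eucl d, ℂ)) +
        (C + c + 1) * (ε / (C + c + 1)) := by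
        exact add_le_add le_rfl (mul_le_mul' le_self_add hf.le)
    _ = _ := by
        rw [ENNReal.mul_div_cancel (by simp) hD]

theorem eq_zero_of_forall_schwartz {η : ℝ} (Φ : WeightedL2 d η →ₗ[ℂ] ℂ) {C : ℝ≥0∞} (hC : C ≠ ⊤)
    (hΦ : ∀ v, ‖Φ v‖ₑ ≤ C * weightedL2Norm η 1 (v : 𝓢'(Eucl d, ℂ)))
    (h : ∀ f : 𝓢(Eucl d, ℂ), Φ ⟨f, coe_mem_weightedL2 η f⟩ = 0) (v : WeightedL2 d η) :
    Φ v = 0 := by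
  have := enorm_le_of_forall_schwartz Φ hC hΦ (c := 0) (by simp) (fun f => by simp [h f]) v
  simpa using this

/-! Fourier multipliers on weighted spaces -/

/-- A bound for the multipliers `ψ(a D)`, `0 < a ≤ 1`, and their transposes on `L²(⟨x⟩ ^ η)` -/
def multiplierNorm (η : ℝ) (ψ : 𝓢(Eucl d, ℂ)) : ℝ≥0∞ :=
  kernelNorm η (𝓕⁻ (dilate (-1) (by norm_num) ψ))

theorem multiplierNorm_lt_top (η : ℝ) (ψ : 𝓢(Eucl d, ℂ)) : multiplierNorm η ψ < ⊤ :=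
  kernelNorm_lt_top _ _

theorem hasTemperateGrowth_dilate (ψ : 𝓢(Eucl d, ℂ)) (a : ℝ) :
    (fun ξ => ψ (a • ξ)).HasTemperateGrowth :=
  ψ.hasTemperateGrowth.comp (a • ContinuousLinearMap.id ℝ (Eucl d)).hasTemperateGrowth

/-- Transposition reflects the symbol, which explains the dilation by `-1` in `multiplierNorm`. -/
theorem enorm_wL2_transposeMultiplier_le (η : ℝ) (ψ : 𝓢(Eucl d, ℂ)) {a : ℝ}
    (ha : a ∈ Ioc (0 : ℝ) 1) (f : 𝓢(Eucl d, ℂ)) :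
    ‖wL2 η (transposeMultiplier (fun ξ => ψ (a • ξ)) f)‖ₑ ≤ multiplierNorm η ψ * ‖wL2 η f‖ₑ := by
  rw [transposeMultiplier_eq (hasTemperateGrowth_dilate ψ a)]
  have h := enorm_wL2_fourierMultiplierCLM_le η (dilate (-1) (by norm_num) ψ) ha f
  simp_rw [dilate_apply, smul_smul, neg_one_mul] at h
  simp_rw [smul_neg, ← neg_smul]
  exact h

theorem weightedL2Norm_fourierMultiplierCLM_le (η : ℝ) (ψ : 𝓢(Eucl d, ℂ)) {a : ℝ}
    (ha : a ∈ Ioc (0 : ℝ) 1) (u : 𝓢'(Eucl d, ℂ)) :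
    weightedL2Norm η 1 (TemperedDistribution.fourierMultiplierCLM ℂ (fun ξ => ψ (a • ξ)) u) ≤
      multiplierNorm (-η) ψ * weightedL2Norm η 1 u := by
  rw [weightedL2Norm_le_iff]
  intro g
  have h1 := enorm_apply_le_wL2 η u (transposeMultiplier (fun ξ => ψ (a • ξ))
    (SchwartzMap.smulLeftCLM ℂ (fun x => (weight η 1 x : ℂ)) g))
  have h2 := enorm_wL2_transposeMultiplier_le (-η) ψ ha
    (SchwartzMap.smulLeftCLM ℂ (fun x => (weight η 1 x : ℂ)) g)
  have h3 : wL2 (-η) (SchwartzMap.smulLeftCLM ℂ (fun x => (weight η 1 x : ℂ)) g) =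
      g.toLp 2 volume := by
    have := smulLeftCLM_weight_smulLeftCLM_weight_neg (-η) 1 g
    rw [neg_neg] at this
    rw [wL2_apply, this]
  rw [h3] at h2
  calc _ ≤ weightedL2Norm η 1 u * (multiplierNorm (-η) ψ * ‖g.toLp 2 volume‖ₑ) :=
        h1.trans (by gcongr)
    _ = _ := by ring

end Duality

/-! ### Extension of bounded bilinear forms to weighted spaces -/

section Extension

variable {d : ℕ} {η : ℝ}

theorem norm_le_of_enorm_le {E F : Type*} [NormedAddCommGroup E] [NormedAddCommGroup F] {x : E}
    {y : F} {C : ℝ≥0∞} (hC : C ≠ ⊤) (h : ‖x‖ₑ ≤ C * ‖y‖ₑ) : ‖x‖ ≤ C.toReal * ‖y‖ := by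
  rw [← ENNReal.ofReal_toReal hC, ← ofReal_norm, ← ofReal_norm,
    ← ENNReal.ofReal_mul ENNReal.toReal_nonneg] at h
  exact (ENNReal.ofReal_le_ofReal_iff (by positivity)).1 h

theorem enorm_le_of_norm_le {E F : Type*} [NormedAddCommGroup E] [NormedAddCommGroup F] {x : E}
    {y : F} {C : ℝ≥0∞} (hC : C ≠ ⊤) (h : ‖x‖ ≤ C.toReal * ‖y‖) : ‖x‖ₑ ≤ C * ‖y‖ₑ := by
  rw [← ENNReal.ofReal_toReal hC, ← ofReal_norm, ← ofReal_norm,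
    ← ENNReal.ofReal_mul ENNReal.toReal_nonneg]
  exact ENNReal.ofReal_le_ofReal h

/-- A linear functional on Schwartz functions that is bounded by the norm of a continuous linear
map is a tempered distribution. -/
theorem exists_temperedDistribution {E : Type*} [NormedAddCommGroup E] [NormedSpace ℂ E]
    (ℓ : 𝓢(Eucl d, ℂ) →ₗ[ℂ] ℂ) (Q : 𝓢(Eucl d, ℂ) →L[ℂ] E) {C : ℝ≥0∞} (hC : C ≠ ⊤)
    (h : ∀ g, ‖ℓ g‖ₑ ≤ C * ‖Q g‖ₑ) : ∃ u : 𝓢'(Eucl d, ℂ), ∀ g, u g = ℓ g := by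
  have hc : Continuous ℓ := by
    refine continuous_of_continuousAt_zero ℓ ?_
    rw [ContinuousAt, map_zero]
    refine squeeze_zero_norm (fun g => norm_le_of_enorm_le hC (h g)) ?_
    have : Continuous fun g => C.toReal * ‖Q g‖ := by fun_prop
    simpa using this.tendsto 0
  exact ⟨ContinuousLinearMap.toPointwiseConvergenceCLM _ _ _ _ ⟨ℓ, hc⟩, fun g => rfl⟩

/-- Evaluation of tempered distributions at a Schwartz function -/
def evalLinear (g : 𝓢(Eucl d, ℂ)) : 𝓢'(Eucl d, ℂ) →ₗ[ℂ] ℂ where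
  toFun u := u g
  map_add' _ _ := rfl
  map_smul' _ _ := rfl

theorem evalLinear_apply (g : 𝓢(Eucl d, ℂ)) (u : 𝓢'(Eucl d, ℂ)) : evalLinear g u = u g := rfl

/-- For fixed `g` the functional `B · g` extends from the dense range of `wL2 η` to `L²`. Uniqueness
of the extension makes it linear in `g`, and the bound makes it continuous in `g`, hence a tempered
distribution. -/
theorem exists_weighted_extension (B : 𝓢(Eucl d, ℂ) →ₗ[ℂ] 𝓢(Eucl d, ℂ) →ₗ[ℂ] ℂ) {A : ℝ≥0∞}
    (hA : A ≠ ⊤) (hB : ∀ f g, ‖B f g‖ₑ ≤ A * (‖wL2 η f‖ₑ * ‖wL2 η g‖ₑ)) :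
    ∃ L : WeightedL2 d η →ₗ[ℂ] 𝓢'(Eucl d, ℂ),
      (∀ f g : 𝓢(Eucl d, ℂ), L ⟨(f : 𝓢'(Eucl d, ℂ)), coe_mem_weightedL2 η f⟩ g = B f g) ∧
      ∀ v g, ‖L v g‖ₑ ≤ A * (weightedL2Norm η 1 (v : 𝓢'(Eucl d, ℂ)) * ‖wL2 η g‖ₑ) := by
  have hfin : ∀ g : 𝓢(Eucl d, ℂ), A * ‖wL2 η g‖ₑ ≠ ⊤ := fun g =>
    ENNReal.mul_ne_top hA enorm_ne_top
  have hn : ∀ g f, ‖B.flip g f‖ ≤ (A * ‖wL2 η g‖ₑ).toReal * ‖(wL2 η).toLinearMap f‖ := fun g f =>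
    norm_le_of_enorm_le (hfin g) ((hB f g).trans (le_of_eq (by
      rw [ContinuousLinearMap.coe_coe]
      ring)))
  have hd : DenseRange (wL2 (d := d) η).toLinearMap := denseRange_wL2 η
  set e : 𝓢(Eucl d, ℂ) → Lp ℂ 2 (volume : Measure (Eucl d)) →L[ℂ] ℂ := fun g =>
    LinearMap.extendOfNorm (B.flip g) (wL2 η).toLinearMap with he
  have hev : ∀ g f, e g (wL2 η f) = B f g := fun g f =>
    LinearMap.extendOfNorm_eq hd ⟨_, hn g⟩ f
  have heb : ∀ g a, ‖e g a‖ₑ ≤ (A * ‖wL2 η g‖ₑ) * ‖a‖ₑ := fun g a =>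
    enorm_le_of_norm_le (hfin g) (LinearMap.norm_extendOfNorm_apply_le hd _ (hn g) a)
  have hadd : ∀ g h, e (g + h) = e g + e h := fun g h => by
    refine LinearMap.extendOfNorm_unique hd _ (hn _) _ ?_
    ext f
    simp [hev, LinearMap.flip_apply]
  have hsmul : ∀ (c : ℂ) g, e (c • g) = c • e g := fun c g => by
    refine LinearMap.extendOfNorm_unique hd _ (hn _) _ ?_
    ext f
    simp [hev, LinearMap.flip_apply]
  have hex : ∀ v : WeightedL2 d η, ∃ u : 𝓢'(Eucl d, ℂ), ∀ g, u g = e g (weightedRep η v) :=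
    fun v => exists_temperedDistribution
      { toFun := fun g => e g (weightedRep η v)
        map_add' := fun g h => by rw [hadd]; rfl
        map_smul' := fun c g => by rw [hsmul]; rfl } (wL2 η)
      (C := A * ‖weightedRep η v‖ₑ) (ENNReal.mul_ne_top hA enorm_ne_top)
      fun g => (heb g _).trans (le_of_eq (by ring))
  choose u hu using hex
  refine ⟨{ toFun := u
            map_add' := fun v w => ?_
            map_smul' := fun c v => ?_ }, fun f g => ?_, fun v g => ?_⟩
  · ext g
    rw [show (u v + u w) g = u v g + u w g from rfl, hu, hu, hu, map_add, map_add]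
  · ext g
    rw [RingHom.id_apply, show (c • u v) g = c * u v g from rfl, hu, hu, map_smul, map_smul,
      smul_eq_mul]
  · exact (hu _ g).trans (by rw [weightedRep_coe, hev])
  · refine (le_of_eq (congrArg _ (hu v g))).trans ((heb g _).trans (le_of_eq ?_))
    rw [enorm_weightedRep]
    ring

theorem fourierMultiplierCLM_mem_weightedL2 (η : ℝ) (ψ : 𝓢(Eucl d, ℂ)) {v : 𝓢'(Eucl d, ℂ)}
    (hv : v ∈ WeightedL2 d η) :
    TemperedDistribution.fourierMultiplierCLM ℂ (fun ξ => ψ ξ) v ∈ WeightedL2 d η := by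
  have h := weightedL2Norm_fourierMultiplierCLM_le η ψ (a := 1) (by norm_num) v
  simp_rw [one_smul] at h
  exact h.trans_lt (ENNReal.mul_lt_top (multiplierNorm_lt_top _ _) hv)

/-- The Fourier multiplier with a Schwartz symbol on `L²(⟨x⟩ ^ η)` -/
def weightedMultiplier (η : ℝ) (ψ : 𝓢(Eucl d, ℂ)) : WeightedL2 d η →ₗ[ℂ] WeightedL2 d η :=
  (TemperedDistribution.fourierMultiplierCLM ℂ (fun ξ => ψ ξ)).toLinearMap.restrict
    fun _ hv => fourierMultiplierCLM_mem_weightedL2 η ψ hv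

theorem coe_weightedMultiplier (ψ : 𝓢(Eucl d, ℂ)) (v : WeightedL2 d η) :
    (weightedMultiplier η ψ v : 𝓢'(Eucl d, ℂ)) =
      TemperedDistribution.fourierMultiplierCLM ℂ (fun ξ => ψ ξ) v := rfl

theorem weightedMultiplier_coe (ψ f : 𝓢(Eucl d, ℂ)) :
    weightedMultiplier η ψ ⟨(f : 𝓢'(Eucl d, ℂ)), coe_mem_weightedL2 η f⟩ =
      ⟨(SchwartzMap.fourierMultiplierCLM ℂ (fun ξ => ψ ξ) f : 𝓢(Eucl d, ℂ)),
        coe_mem_weightedL2 η _⟩ := by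
  ext1
  rw [coe_weightedMultiplier]
  exact fourierMultiplierCLM_toTemperedDistributionCLM_eq ψ.hasTemperateGrowth f

theorem weightedL2Norm_weightedMultiplier_le (ψ : 𝓢(Eucl d, ℂ)) (v : WeightedL2 d η) :
    weightedL2Norm η 1 (weightedMultiplier η ψ v : 𝓢'(Eucl d, ℂ)) ≤
      multiplierNorm (-η) ψ * weightedL2Norm η 1 (v : 𝓢'(Eucl d, ℂ)) := by
  have h := weightedL2Norm_fourierMultiplierCLM_le η ψ (a := 1) (by norm_num)
    (v : 𝓢'(Eucl d, ℂ))
  simp_rw [one_smul] at h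
  exact h

theorem enorm_extension_multiplier_le {L : WeightedL2 d η →ₗ[ℂ] 𝓢'(Eucl d, ℂ)} {A : ℝ≥0∞}
    (hA : A ≠ ⊤)
    (hL : ∀ v g, ‖L v g‖ₑ ≤ A * (weightedL2Norm η 1 (v : 𝓢'(Eucl d, ℂ)) * ‖wL2 η g‖ₑ))
    (ψ : 𝓢(Eucl d, ℂ)) {c : ℝ≥0∞} (hc : c ≠ ⊤)
    (h : ∀ f g, ‖L ⟨(SchwartzMap.fourierMultiplierCLM ℂ (fun ξ => ψ ξ) f : 𝓢(Eucl d, ℂ)),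
      coe_mem_weightedL2 η _⟩ g‖ₑ ≤ c * (‖wL2 η f‖ₑ * ‖wL2 η g‖ₑ)) (v : WeightedL2 d η)
    (g : 𝓢(Eucl d, ℂ)) :
    ‖L (weightedMultiplier η ψ v) g‖ₑ ≤
      c * (weightedL2Norm η 1 (v : 𝓢'(Eucl d, ℂ)) * ‖wL2 η g‖ₑ) := by
  have h1 := enorm_le_of_forall_schwartz (evalLinear g ∘ₗ L ∘ₗ weightedMultiplier η ψ)
    (C := A * multiplierNorm (-η) ψ * ‖wL2 η g‖ₑ) (c := c * ‖wL2 η g‖ₑ)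
    (ENNReal.mul_ne_top (ENNReal.mul_ne_top hA (multiplierNorm_lt_top _ _).ne) enorm_ne_top)
    (fun v => ((hL _ g).trans (mul_le_mul_right (mul_le_mul_left
      (weightedL2Norm_weightedMultiplier_le ψ v) _) _)).trans (le_of_eq (by ring)))
    (ENNReal.mul_ne_top hc enorm_ne_top)
    (fun f => by
      rw [LinearMap.comp_apply, LinearMap.comp_apply, weightedMultiplier_coe, evalLinear_apply]
      exact (h f g).trans (le_of_eq (by ring))) v
  exact h1.trans (le_of_eq (by ring))

/-- For fixed `g` both sides are bounded functionals of `v` on the weighted space, so agreement on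
Schwartz functions is enough. -/
theorem extension_multiplier_apply {L : WeightedL2 d η →ₗ[ℂ] 𝓢'(Eucl d, ℂ)} {A : ℝ≥0∞}
    (hA : A ≠ ⊤)
    (hL : ∀ v g, ‖L v g‖ₑ ≤ A * (weightedL2Norm η 1 (v : 𝓢'(Eucl d, ℂ)) * ‖wL2 η g‖ₑ))
    (ψ : 𝓢(Eucl d, ℂ))
    (h : ∀ f g, L ⟨(SchwartzMap.fourierMultiplierCLM ℂ (fun ξ => ψ ξ) f : 𝓢(Eucl d, ℂ)),
      coe_mem_weightedL2 η _⟩ g =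
        L ⟨(f : 𝓢'(Eucl d, ℂ)), coe_mem_weightedL2 η f⟩ (transposeMultiplier ψ g))
    (v : WeightedL2 d η) (g : 𝓢(Eucl d, ℂ)) :
    L (weightedMultiplier η ψ v) g = L v (transposeMultiplier ψ g) := by
  have h1 := eq_zero_of_forall_schwartz (evalLinear g ∘ₗ L ∘ₗ weightedMultiplier η ψ -
      evalLinear (transposeMultiplier ψ g) ∘ₗ L)
    (C := A * multiplierNorm (-η) ψ * ‖wL2 η g‖ₑ + A * ‖wL2 η (transposeMultiplier ψ g)‖ₑ)
    (ENNReal.add_ne_top.2 ⟨ENNReal.mul_ne_top (ENNReal.mul_ne_top hA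
      (multiplierNorm_lt_top _ _).ne) enorm_ne_top, ENNReal.mul_ne_top hA enorm_ne_top⟩)
    (fun v => by
      rw [LinearMap.sub_apply, add_mul]
      refine enorm_sub_le.trans (add_le_add ?_ ?_)
      · exact ((hL _ g).trans (mul_le_mul_right (mul_le_mul_left
          (weightedL2Norm_weightedMultiplier_le ψ v) _) _)).trans (le_of_eq (by ring))
      · exact (hL _ _).trans (le_of_eq (by ring)))
    (fun f => by
      rw [LinearMap.sub_apply, LinearMap.comp_apply, LinearMap.comp_apply, LinearMap.comp_apply,
        weightedMultiplier_coe, evalLinear_apply, evalLinear_apply, h, sub_self]) v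
  exact sub_eq_zero.1 h1

theorem extension_apply_eq {L : WeightedL2 d η →ₗ[ℂ] 𝓢'(Eucl d, ℂ)} {A : ℝ≥0∞}
    (hA : A ≠ ⊤)
    (hL : ∀ v g, ‖L v g‖ₑ ≤ A * (weightedL2Norm η 1 (v : 𝓢'(Eucl d, ℂ)) * ‖wL2 η g‖ₑ))
    {g g' : 𝓢(Eucl d, ℂ)}
    (h : ∀ f : 𝓢(Eucl d, ℂ), L ⟨(f : 𝓢'(Eucl d, ℂ)), coe_mem_weightedL2 η f⟩ g' =
      (f : 𝓢'(Eucl d, ℂ)) g)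
    (v : WeightedL2 d η) : L v g' = (v : 𝓢'(Eucl d, ℂ)) g := by
  have h1 := eq_zero_of_forall_schwartz (evalLinear g' ∘ₗ L -
      evalLinear g ∘ₗ (WeightedL2 d η).subtype)
    (C := A * ‖wL2 η g'‖ₑ + ‖wL2 (-η) g‖ₑ)
    (ENNReal.add_ne_top.2 ⟨ENNReal.mul_ne_top hA enorm_ne_top, enorm_ne_top⟩)
    (fun v => by
      rw [LinearMap.sub_apply, add_mul]
      refine enorm_sub_le.trans (add_le_add ?_ ?_)
      · exact (hL _ _).trans (le_of_eq (by ring))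
      · exact (enorm_apply_le_wL2 η _ g).trans (le_of_eq (mul_comm _ _)))
    (fun f => by
      rw [LinearMap.sub_apply, LinearMap.comp_apply, LinearMap.comp_apply, evalLinear_apply,
        evalLinear_apply, h, Submodule.subtype_apply, sub_self]) v
  exact sub_eq_zero.1 h1

end Extension

/-! ### Dyadic partitions -/

section Partition

variable {d : ℕ}

theorem norm_iteratedFDeriv_dilate_sub_one_le (ρ : 𝓢(Eucl d, ℂ)) {a : ℝ} (ha : a ∈ Ioc (0 : ℝ) 1)
    (i : ℕ) (x : Eucl d) :
    ‖iteratedFDeriv ℝ i (fun ξ => ρ (a • ξ) - 1) x‖ ≤ SchwartzMap.seminorm ℝ 0 i ρ + 1 := by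
  have hs : ContDiff ℝ i (fun ξ => ρ (a • ξ)) := (ρ.smooth i).comp (contDiff_const_smul a)
  have h1 : iteratedFDeriv ℝ i (fun ξ => ρ (a • ξ) - 1) x =
      iteratedFDeriv ℝ i (fun ξ => ρ (a • ξ)) x - iteratedFDeriv ℝ i (fun _ => (1 : ℂ)) x :=
    iteratedFDeriv_sub_apply hs.contDiffAt contDiff_const.contDiffAt
  rw [h1, iteratedFDeriv_comp_const_smul a (ρ.smooth i)]
  refine (norm_sub_le _ _).trans (add_le_add ?_ ?_)
  · rw [norm_smul, norm_pow, Real.norm_of_nonneg ha.1.le]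
    have h2 := SchwartzMap.le_seminorm ℝ 0 i ρ (a • x)
    rw [pow_zero, one_mul] at h2
    calc a ^ i * ‖iteratedFDeriv ℝ i ρ (a • x)‖ ≤ 1 * ‖iteratedFDeriv ℝ i ρ (a • x)‖ := by
          gcongr
          exact pow_le_one₀ ha.1.le ha.2
      _ ≤ _ := by rwa [one_mul]
  · rcases Nat.eq_zero_or_pos i with rfl | hi
    · rw [norm_iteratedFDeriv_zero]
      simp
    · rw [iteratedFDeriv_const_of_ne hi.ne']
      simp

/-- The factor `ρ(a ξ) - 1` lives where `|ξ| ≥ 3 / (4 a)`, that is, where `1 ≤ (4/3) a |ξ|`. One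
additional power of `|ξ|` in the seminorm of `h` therefore buys a factor `a`. -/
theorem seminorm_dilate_sub_le (ρ h : 𝓢(Eucl d, ℂ)) (hρ : ∀ ξ, ‖ξ‖ < 3 / 4 → ρ ξ = 1) (k n : ℕ)
    {a : ℝ} (ha : a ∈ Ioc (0 : ℝ) 1) :
    SchwartzMap.seminorm ℝ k n (SchwartzMap.smulLeftCLM ℂ (fun ξ => ρ (a • ξ)) h - h) ≤
      a * (4 / 3 * ∑ i ∈ Finset.range (n + 1), (n.choose i : ℝ) *
        (SchwartzMap.seminorm ℝ 0 i ρ + 1) * SchwartzMap.seminorm ℝ (k + 1) (n - i) h) := by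
  have ha0 := ha.1
  set S := ∑ i ∈ Finset.range (n + 1), (n.choose i : ℝ) *
        (SchwartzMap.seminorm ℝ 0 i ρ + 1) * SchwartzMap.seminorm ℝ (k + 1) (n - i) h with hS
  have hS0 : 0 ≤ S := Finset.sum_nonneg fun i _ => by positivity
  have hfun : ((SchwartzMap.smulLeftCLM ℂ (fun ξ => ρ (a • ξ)) h - h : 𝓢(Eucl d, ℂ)) :
      Eucl d → ℂ) = fun ξ => (ρ (a • ξ) - 1) * h ξ := by
    ext ξ
    rw [_root_.sub_apply,
      SchwartzMap.smulLeftCLM_apply_apply (hasTemperateGrowth_dilate ρ a), smul_eq_mul]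
    ring
  refine SchwartzMap.seminorm_le_bound ℝ k n _ (by positivity) fun x => ?_
  rw [hfun]
  rcases lt_or_ge ‖a • x‖ (3 / 4) with hx | hx
  · have hz : iteratedFDeriv ℝ n (fun ξ => (ρ (a • ξ) - 1) * h ξ) x = 0 := by
      have hev : (fun ξ => (ρ (a • ξ) - 1) * h ξ) =ᶠ[𝓝 x] fun _ => 0 := by
        have hc : Continuous fun ξ : Eucl d => ‖a • ξ‖ := by fun_prop
        filter_upwards [hc.continuousAt.eventually_lt_const hx] with ξ hξ
        rw [hρ _ hξ, sub_self, zero_mul]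
      rw [hev.iteratedFDeriv ℝ n |>.eq_of_nhds]
      simp
    rw [hz]
    simp only [norm_zero, mul_zero]
    positivity
  · have hx1 : 1 ≤ a * (4 / 3) * ‖x‖ := by
      rw [norm_smul, Real.norm_of_nonneg ha0.le] at hx
      linarith
    have hs : ContDiff ℝ n (fun ξ => ρ (a • ξ) - 1) :=
      ((ρ.smooth n).comp (contDiff_const_smul a)).sub contDiff_const
    have hle := norm_iteratedFDeriv_mul_le hs (h.smooth n) x le_rfl
    calc ‖x‖ ^ k * ‖iteratedFDeriv ℝ n (fun ξ => (ρ (a • ξ) - 1) * h ξ) x‖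
        ≤ ‖x‖ ^ k * ∑ i ∈ Finset.range (n + 1), (n.choose i : ℝ) *
          (SchwartzMap.seminorm ℝ 0 i ρ + 1) * ‖iteratedFDeriv ℝ (n - i) h x‖ := by
          gcongr
          refine hle.trans (Finset.sum_le_sum fun i _ => ?_)
          gcongr
          exact norm_iteratedFDeriv_dilate_sub_one_le ρ ha i x
      _ = 1 * ∑ i ∈ Finset.range (n + 1), (n.choose i : ℝ) *
          (SchwartzMap.seminorm ℝ 0 i ρ + 1) * (‖x‖ ^ k * ‖iteratedFDeriv ℝ (n - i) h x‖) := by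
          rw [one_mul, Finset.mul_sum]
          exact Finset.sum_congr rfl fun i _ => by ring
      _ ≤ (a * (4 / 3) * ‖x‖) * ∑ i ∈ Finset.range (n + 1), (n.choose i : ℝ) *
          (SchwartzMap.seminorm ℝ 0 i ρ + 1) * (‖x‖ ^ k * ‖iteratedFDeriv ℝ (n - i) h x‖) := by
          gcongr
      _ = a * (4 / 3 * ∑ i ∈ Finset.range (n + 1), (n.choose i : ℝ) *
          (SchwartzMap.seminorm ℝ 0 i ρ + 1) *
            (‖x‖ ^ (k + 1) * ‖iteratedFDeriv ℝ (n - i) h x‖)) := by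
          rw [Finset.mul_sum, Finset.mul_sum, Finset.mul_sum]
          exact Finset.sum_congr rfl fun i _ => by ring
      _ ≤ a * (4 / 3 * S) := by
          rw [hS]
          gcongr with i _
          exact SchwartzMap.le_seminorm ℝ (k + 1) (n - i) h x

theorem tendsto_smulLeftCLM_dilate (ρ h : 𝓢(Eucl d, ℂ)) (hρ : ∀ ξ, ‖ξ‖ < 3 / 4 → ρ ξ = 1) :
    Tendsto (fun N : ℕ => SchwartzMap.smulLeftCLM ℂ (fun ξ => ρ (((2 : ℝ) ^ N)⁻¹ • ξ)) h) atTop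
      (𝓝 h) := by
  rw [(schwartz_withSeminorms ℝ (Eucl d) ℂ).tendsto_nhds]
  rintro ⟨k, n⟩ ε hε
  set K := 4 / 3 * ∑ i ∈ Finset.range (n + 1), (n.choose i : ℝ) *
        (SchwartzMap.seminorm ℝ 0 i ρ + 1) * SchwartzMap.seminorm ℝ (k + 1) (n - i) h with hK
  have h0 : Tendsto (fun N : ℕ => ((2 : ℝ) ^ N)⁻¹ * K) atTop (𝓝 (0 * K)) := by
    refine Tendsto.mul_const _ ?_
    simp_rw [← inv_pow]
    exact tendsto_pow_atTop_nhds_zero_of_lt_one (by norm_num) (by norm_num)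
  rw [zero_mul] at h0
  filter_upwards [h0.eventually_lt_const hε] with N hN
  refine lt_of_le_of_lt (seminorm_dilate_sub_le ρ h hρ k n ⟨by positivity, ?_⟩) hN
  exact inv_le_one_of_one_le₀ (one_le_pow₀ (by norm_num))

namespace DyadicPartition

variable (P : DyadicPartition d)

theorem φ_eq_zero_of_lt {ξ : Eucl d} (h : ‖ξ‖ < 3 / 4) : P.φ ξ = 0 :=
  image_eq_zero_of_notMem_tsupport fun hm => h.not_ge (P.tsupport_φ hm).1

theorem φ_eq_zero_of_gt {ξ : Eucl d} (h : 8 / 3 < ‖ξ‖) : P.φ ξ = 0 :=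
  image_eq_zero_of_notMem_tsupport fun hm => h.not_ge (P.tsupport_φ hm).2

theorem χ_eq_zero_of_gt {ξ : Eucl d} (h : 4 / 3 < ‖ξ‖) : P.χ ξ = 0 :=
  image_eq_zero_of_notMem_tsupport fun hm => h.not_ge (P.tsupport_χ hm)

theorem inv_two_pow_mem (n : ℕ) : ((2 : ℝ) ^ n)⁻¹ ∈ Ioc (0 : ℝ) 1 :=
  ⟨by positivity, inv_le_one_of_one_le₀ (one_le_pow₀ (by norm_num))⟩

theorem norm_inv_two_pow_smul (n : ℕ) (ξ : Eucl d) : ‖((2 : ℝ) ^ n)⁻¹ • ξ‖ = ‖ξ‖ / 2 ^ n := by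
  rw [norm_smul, Real.norm_of_nonneg (by positivity), inv_mul_eq_div]

theorem χ_eq_one {ξ : Eucl d} (h : ‖ξ‖ < 3 / 4) : P.χ ξ = 1 := by
  have h1 := P.hasSum_eq ξ
  have h2 : (fun n : ℕ => P.φ (((2 : ℝ) ^ n)⁻¹ • ξ)) = fun _ => 0 := by
    ext n
    refine P.φ_eq_zero_of_lt (lt_of_le_of_lt ?_ h)
    rw [norm_inv_two_pow_smul]
    exact div_le_self (norm_nonneg _) (one_le_pow₀ (by norm_num))
  rw [h2] at h1
  linarith [h1.unique hasSum_zero]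

theorem cutoff_eq_zero_of_gt {n : ℕ} {ξ : Eucl d} (h : 4 / 3 * 2 ^ n < ‖ξ‖) :
    P.cutoff n ξ = 0 := by
  cases n with
  | zero => exact P.χ_eq_zero_of_gt (by simpa using h)
  | succ m =>
    refine P.φ_eq_zero_of_gt ?_
    rw [norm_inv_two_pow_smul, lt_div_iff₀ (by positivity)]
    rw [pow_succ] at h
    linarith

theorem cutoff_succ_eq_zero_of_lt {n : ℕ} {ξ : Eucl d} (h : ‖ξ‖ < 3 / 4 * 2 ^ n) :
    P.cutoff (n + 1) ξ = 0 := by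
  refine P.φ_eq_zero_of_lt ?_
  rwa [norm_inv_two_pow_smul, div_lt_iff₀ (by positivity)]

theorem cutoff_mul_cutoff_eq_zero {i j : ℕ} (hij : i + 2 ≤ j) (ξ : Eucl d) :
    P.cutoff i ξ * P.cutoff j ξ = 0 := by
  obtain ⟨j, rfl⟩ := Nat.exists_eq_succ_of_ne_zero (by omega : j ≠ 0)
  rcases lt_or_ge ‖ξ‖ (3 / 4 * 2 ^ j) with h | h
  · rw [P.cutoff_succ_eq_zero_of_lt h, mul_zero]
  · rw [P.cutoff_eq_zero_of_gt, zero_mul]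
    have h1 : (2 : ℝ) ^ (i + 1) ≤ 2 ^ j := pow_le_pow_right₀ (by norm_num) (by omega)
    rw [pow_succ] at h1
    have : (0 : ℝ) < 2 ^ i := by positivity
    linarith

/-- Subtract the partition identity at `2 ^ (-N) ξ` from the one at `ξ`: the tails coincide, and
partial sums are dilates of `χ`. -/
theorem sum_range_cutoff (N : ℕ) (ξ : Eucl d) :
    ∑ n ∈ Finset.range (N + 1), P.cutoff n ξ = P.χ (((2 : ℝ) ^ N)⁻¹ • ξ) := by
  have h1 := P.hasSum_eq ξ
  have h2 := P.hasSum_eq (((2 : ℝ) ^ N)⁻¹ • ξ)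
  have h3 := (hasSum_nat_add_iff' N).2 h1
  have h4 : (fun n : ℕ => P.φ (((2 : ℝ) ^ n)⁻¹ • ((2 : ℝ) ^ N)⁻¹ • ξ)) =
      fun n => P.φ (((2 : ℝ) ^ (n + N))⁻¹ • ξ) := by
    ext n
    rw [smul_smul, ← mul_inv, ← pow_add]
  rw [h4] at h2
  have h5 := h2.unique h3
  rw [Finset.sum_range_succ']
  simp only [cutoff]
  linarith

theorem hasCompactSupport_χ : HasCompactSupport P.χ :=
  (ProperSpace.isCompact_closedBall (0 : Eucl d) (4 / 3)).of_isClosed_subset (isClosed_tsupport _)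
    fun ξ hξ => by simpa using P.tsupport_χ hξ

theorem hasCompactSupport_φ : HasCompactSupport P.φ :=
  (ProperSpace.isCompact_closedBall (0 : Eucl d) (8 / 3)).of_isClosed_subset (isClosed_tsupport _)
    fun ξ hξ => by simpa using (P.tsupport_φ hξ).2

/-- `χ` as a Schwartz function -/
def schwartzχ : 𝓢(Eucl d, ℂ) :=
  HasCompactSupport.toSchwartzMap (f := fun ξ => (P.χ ξ : ℂ))
    (P.hasCompactSupport_χ.comp_left (g := fun t : ℝ => (t : ℂ)) Complex.ofReal_zero)
    (Complex.ofRealCLM.contDiff.comp P.contDiff_χ)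

theorem schwartzχ_apply (ξ : Eucl d) : P.schwartzχ ξ = P.χ ξ := rfl

/-- `φ` as a Schwartz function -/
def schwartzφ : 𝓢(Eucl d, ℂ) :=
  HasCompactSupport.toSchwartzMap (f := fun ξ => (P.φ ξ : ℂ))
    (P.hasCompactSupport_φ.comp_left (g := fun t : ℝ => (t : ℂ)) Complex.ofReal_zero)
    (Complex.ofRealCLM.contDiff.comp P.contDiff_φ)

theorem schwartzφ_apply (ξ : Eucl d) : P.schwartzφ ξ = P.φ ξ := rfl

/-- `φ(ξ) |ξ|^{-2M}` as a Schwartz function -/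
def schwartzφDiv (M : ℕ) : 𝓢(Eucl d, ℂ) :=
  HasCompactSupport.toSchwartzMap (f := fun ξ => ((P.φ ξ * ((‖ξ‖ ^ 2) ^ M)⁻¹ : ℝ) : ℂ))
    ((P.hasCompactSupport_φ.mul_right (f' := fun ξ => ((‖ξ‖ ^ 2) ^ M)⁻¹)).comp_left
        (g := fun t : ℝ => (t : ℂ)) Complex.ofReal_zero)
    (Complex.ofRealCLM.contDiff.comp (by
      rw [contDiff_iff_contDiffAt]
      intro ξ
      rcases eq_or_ne ξ 0 with rfl | hξ
      · refine (contDiffAt_const (c := (0 : ℝ))).congr_of_eventuallyEq ?_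
        filter_upwards [Metric.ball_mem_nhds (0 : Eucl d) (by norm_num : (0 : ℝ) < 3 / 4)] with x hx
        rw [P.φ_eq_zero_of_lt (by simpa using hx)]
        exact zero_mul _
      · refine P.contDiff_φ.contDiffAt.mul (ContDiffAt.inv ?_ (by positivity))
        exact ((contDiff_norm_sq ℝ).pow M).contDiffAt))

theorem schwartzφDiv_apply (M : ℕ) (ξ : Eucl d) :
    P.schwartzφDiv M ξ = ((P.φ ξ * ((‖ξ‖ ^ 2) ^ M)⁻¹ : ℝ) : ℂ) := rfl

end DyadicPartition

end Partition

/-! ### Littlewood-Paley blocks of Schwartz functions and distributions -/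

section Blocks

variable {d : ℕ}

theorem fourierMultiplierCLM_apply_eq (ψ : Eucl d → ℂ) (u : 𝓢'(Eucl d, ℂ)) (g : 𝓢(Eucl d, ℂ)) :
    TemperedDistribution.fourierMultiplierCLM ℂ ψ u g = u (transposeMultiplier ψ g) := rfl

theorem fourierMultiplierCLM_comp {ψ₁ ψ₂ : Eucl d → ℂ} (h₁ : ψ₁.HasTemperateGrowth)
    (h₂ : ψ₂.HasTemperateGrowth) (u : 𝓢'(Eucl d, ℂ)) :
    TemperedDistribution.fourierMultiplierCLM ℂ ψ₂
      (TemperedDistribution.fourierMultiplierCLM ℂ ψ₁ u) =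
      TemperedDistribution.fourierMultiplierCLM ℂ (fun ξ => ψ₁ ξ * ψ₂ ξ) u :=
  TemperedDistribution.fourierMultiplierCLM_fourierMultiplierCLM_apply h₁ h₂ u

theorem transposeMultiplier_comp {ψ₁ ψ₂ : Eucl d → ℂ} (h₁ : ψ₁.HasTemperateGrowth)
    (h₂ : ψ₂.HasTemperateGrowth) (g : 𝓢(Eucl d, ℂ)) :
    transposeMultiplier ψ₁ (transposeMultiplier ψ₂ g) =
      transposeMultiplier (fun ξ => ψ₁ ξ * ψ₂ ξ) g := by
  rw [transposeMultiplier_apply, transposeMultiplier_apply, transposeMultiplier_apply,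
    FourierTransform.fourierInv_fourier_eq, SchwartzMap.smulLeftCLM_smulLeftCLM_apply h₁ h₂]
  rfl

theorem transposeMultiplier_sum {ι : Type*} {s : Finset ι} {ψ : ι → Eucl d → ℂ}
    (h : ∀ i ∈ s, (ψ i).HasTemperateGrowth) (g : 𝓢(Eucl d, ℂ)) :
    transposeMultiplier (fun ξ => ∑ i ∈ s, ψ i ξ) g = ∑ i ∈ s, transposeMultiplier (ψ i) g := by
  simp only [transposeMultiplier_apply, SchwartzMap.smulLeftCLM_sum h]
  rw [sum_apply]
  exact map_sum (FourierTransform.fourierCLM ℂ 𝓢(Eucl d, ℂ)) _ _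

theorem transposeMultiplier_const_mul {ψ : Eucl d → ℂ} (h : ψ.HasTemperateGrowth) (c : ℂ)
    (g : 𝓢(Eucl d, ℂ)) :
    transposeMultiplier (fun ξ => c * ψ ξ) g = c • transposeMultiplier ψ g := by
  have h1 : (fun ξ => c * ψ ξ) = c • ψ := rfl
  rw [transposeMultiplier_apply, transposeMultiplier_apply, h1, SchwartzMap.smulLeftCLM_smul h]
  exact map_smul (FourierTransform.fourierCLM ℂ 𝓢(Eucl d, ℂ)) _ _

namespace DyadicPartition

variable (P : DyadicPartition d)

/-- The dyadic cutoffs as Schwartz functions -/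
def schwartzCutoff : ℕ → 𝓢(Eucl d, ℂ)
  | 0 => P.schwartzχ
  | m + 1 => dilate ((2 : ℝ) ^ m)⁻¹ (inv_two_pow_mem m).1.ne' P.schwartzφ

theorem schwartzCutoff_apply (n : ℕ) (ξ : Eucl d) : P.schwartzCutoff n ξ = (P.cutoff n ξ : ℂ) := by
  cases n <;> rfl

theorem schwartzCutoff_succ_apply (m : ℕ) (ξ : Eucl d) :
    P.schwartzCutoff (m + 1) ξ = P.schwartzφ (((2 : ℝ) ^ m)⁻¹ • ξ) := rfl

theorem block_eq (n : ℕ) (u : 𝓢'(Eucl d, ℂ)) : P.block n u =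
    TemperedDistribution.fourierMultiplierCLM ℂ (fun ξ => P.schwartzCutoff n ξ) u := by
  simp_rw [schwartzCutoff_apply]
  rfl

theorem block_apply (n : ℕ) (u : 𝓢'(Eucl d, ℂ)) (g : 𝓢(Eucl d, ℂ)) :
    P.block n u g = u (transposeMultiplier (fun ξ => P.schwartzCutoff n ξ) g) := by
  rw [block_eq, fourierMultiplierCLM_apply_eq]

/-- A bound for the Littlewood-Paley operators on `L²(⟨x⟩ ^ η)` -/
def multiplierBound (η : ℝ) : ℝ≥0∞ :=
  max (multiplierNorm η P.schwartzχ) (multiplierNorm η P.schwartzφ)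

theorem multiplierBound_ne_top (η : ℝ) : P.multiplierBound η ≠ ⊤ :=
  (max_lt (multiplierNorm_lt_top _ _) (multiplierNorm_lt_top _ _)).ne

theorem enorm_wL2_transposeMultiplier_cutoff_le (η : ℝ) (n : ℕ) (g : 𝓢(Eucl d, ℂ)) :
    ‖wL2 η (transposeMultiplier (fun ξ => P.schwartzCutoff n ξ) g)‖ₑ ≤
      P.multiplierBound η * ‖wL2 η g‖ₑ := by
  cases n with
  | zero =>
    have h := enorm_wL2_transposeMultiplier_le η P.schwartzχ (a := 1) (by norm_num) g
    simp_rw [one_smul] at h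
    exact h.trans (mul_le_mul_left (le_max_left _ _) _)
  | succ m =>
    exact (enorm_wL2_transposeMultiplier_le η P.schwartzφ (inv_two_pow_mem m) g).trans
      (mul_le_mul_left (le_max_right _ _) _)

theorem weightedL2Norm_block_le (η : ℝ) (n : ℕ) (u : 𝓢'(Eucl d, ℂ)) :
    weightedL2Norm η 1 (P.block n u) ≤ P.multiplierBound (-η) * weightedL2Norm η 1 u := by
  rw [block_eq]
  cases n with
  | zero =>
    have h := weightedL2Norm_fourierMultiplierCLM_le η P.schwartzχ (a := 1) (by norm_num) u
    simp_rw [one_smul] at h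
    exact h.trans (mul_le_mul_left (le_max_left _ _) _)
  | succ m =>
    exact (weightedL2Norm_fourierMultiplierCLM_le η P.schwartzφ (inv_two_pow_mem m) u).trans
      (mul_le_mul_left (le_max_right _ _) _)

/-- The low frequency part up to `2 ^ N` -/
def lowPass (N : ℕ) : 𝓢(Eucl d, ℂ) := dilate ((2 : ℝ) ^ N)⁻¹ (inv_two_pow_mem N).1.ne' P.schwartzχ

theorem lowPass_apply (N : ℕ) (ξ : Eucl d) :
    P.lowPass N ξ = P.schwartzχ (((2 : ℝ) ^ N)⁻¹ • ξ) := rfl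

theorem sum_range_schwartzCutoff (N : ℕ) (ξ : Eucl d) :
    ∑ n ∈ Finset.range (N + 1), P.schwartzCutoff n ξ = P.lowPass N ξ := by
  simp_rw [schwartzCutoff_apply, lowPass_apply, schwartzχ_apply]
  rw [← P.sum_range_cutoff]
  push_cast
  rfl

theorem lowPass_eq_one {N : ℕ} {ξ : Eucl d} (h : ‖ξ‖ < 3 / 4 * 2 ^ N) : P.lowPass N ξ = 1 := by
  rw [lowPass_apply, schwartzχ_apply, P.χ_eq_one, Complex.ofReal_one]
  rwa [norm_inv_two_pow_smul, div_lt_iff₀ (by positivity)]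

theorem lowPass_eq_zero {N : ℕ} {ξ : Eucl d} (h : 4 / 3 * 2 ^ N < ‖ξ‖) : P.lowPass N ξ = 0 := by
  rw [lowPass_apply, schwartzχ_apply, P.χ_eq_zero_of_gt, Complex.ofReal_zero]
  rwa [norm_inv_two_pow_smul, lt_div_iff₀ (by positivity)]

theorem tendsto_transposeMultiplier_lowPass (g : 𝓢(Eucl d, ℂ)) :
    Tendsto (fun N => transposeMultiplier (fun ξ => P.lowPass N ξ) g) atTop (𝓝 g) := by
  have h := tendsto_smulLeftCLM_dilate P.schwartzχ (𝓕⁻ g) fun ξ hξ => by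
    rw [schwartzχ_apply, P.χ_eq_one hξ, Complex.ofReal_one]
  have h2 := ((FourierTransform.fourierCLM ℂ 𝓢(Eucl d, ℂ)).continuous.tendsto (𝓕⁻ g)).comp h
  have e : (FourierTransform.fourierCLM ℂ 𝓢(Eucl d, ℂ)) (𝓕⁻ g) = 𝓕 (𝓕⁻ g) := rfl
  rw [e, FourierTransform.fourier_fourierInv_eq g] at h2
  exact h2

theorem transposeMultiplier_lowPass (N : ℕ) (g : 𝓢(Eucl d, ℂ)) :
    transposeMultiplier (fun ξ => P.lowPass N ξ) g =
      ∑ n ∈ Finset.range (N + 1), transposeMultiplier (fun ξ => P.schwartzCutoff n ξ) g := by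
  rw [← transposeMultiplier_sum fun i _ => (P.schwartzCutoff i).hasTemperateGrowth]
  simp_rw [sum_range_schwartzCutoff]

/-- Tempered distributions with the same Littlewood-Paley blocks agree. -/
theorem eq_of_block_eq {u v : 𝓢'(Eucl d, ℂ)} (h : ∀ n, P.block n u = P.block n v) : u = v := by
  ext g
  have ht := P.tendsto_transposeMultiplier_lowPass g
  have hu := ((map_continuous u).tendsto g).comp ht
  have hv := ((map_continuous v).tendsto g).comp ht
  have e : (u ∘ fun N => transposeMultiplier (fun ξ => P.lowPass N ξ) g) =
      (v ∘ fun N => transposeMultiplier (fun ξ => P.lowPass N ξ) g) := by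
    ext N
    simp only [Function.comp_apply]
    rw [transposeMultiplier_lowPass, map_sum, map_sum]
    exact Finset.sum_congr rfl fun n _ => by rw [← block_apply, ← block_apply, h]
  rw [e] at hu
  exact tendsto_nhds_unique hu hv

/-- A cutoff that equals one on the support of the `n`-th dyadic cutoff -/
def fatCutoff (n : ℕ) : 𝓢(Eucl d, ℂ) :=
  -- Subtraction of natural numbers truncates, so for `n = 0` the window consists of the indices `0`
  -- and `1`.
  ∑ j ∈ Finset.Icc (n - 1) (n + 1), P.schwartzCutoff j

theorem fatCutoff_apply (n : ℕ) (ξ : Eucl d) :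
    P.fatCutoff n ξ = ∑ j ∈ Finset.Icc (n - 1) (n + 1), P.schwartzCutoff j ξ := by
  rw [fatCutoff]
  exact _root_.sum_apply _ _ _

theorem schwartzCutoff_mul_eq_zero {i j : ℕ} (h : i ∉ Finset.Icc (j - 1) (j + 1)) (ξ : Eucl d) :
    P.schwartzCutoff i ξ * P.schwartzCutoff j ξ = 0 := by
  rw [schwartzCutoff_apply, schwartzCutoff_apply, ← Complex.ofReal_mul, Complex.ofReal_eq_zero]
  rw [Finset.mem_Icc, not_and_or] at h
  rcases h with h | h
  · exact P.cutoff_mul_cutoff_eq_zero (by omega) ξ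
  · rw [mul_comm]
    exact P.cutoff_mul_cutoff_eq_zero (by omega) ξ

/-- The full sum up to `n + 1` equals one on the support of the `n`-th cutoff, and cutoffs outside
the window do not overlap with it. -/
theorem fatCutoff_mul (n : ℕ) (ξ : Eucl d) :
    P.fatCutoff n ξ * P.schwartzCutoff n ξ = P.schwartzCutoff n ξ := by
  have h1 : P.lowPass (n + 1) ξ * P.schwartzCutoff n ξ = P.schwartzCutoff n ξ := by
    rcases le_or_gt ‖ξ‖ (4 / 3 * 2 ^ n) with h | h
    · rw [P.lowPass_eq_one, one_mul]
      rw [pow_succ]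
      have : (0 : ℝ) < 2 ^ n := by positivity
      linarith
    · rw [schwartzCutoff_apply, P.cutoff_eq_zero_of_gt h]
      simp
  rw [← sum_range_schwartzCutoff, Finset.sum_mul] at h1
  rw [fatCutoff_apply, Finset.sum_mul]
  refine (Finset.sum_subset (fun j hj => ?_) fun j _ hj => ?_).trans h1
  · rw [Finset.mem_Icc] at hj
    rw [Finset.mem_range]
    omega
  · exact P.schwartzCutoff_mul_eq_zero hj ξ

theorem fatCutoff_eq_zero {n : ℕ} {ξ : Eucl d} (h : ‖ξ‖ < 3 / 4 * 2 ^ n) :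
    P.fatCutoff (n + 2) ξ = 0 := by
  rw [fatCutoff_apply]
  refine Finset.sum_eq_zero fun j hj => ?_
  rw [Finset.mem_Icc] at hj
  obtain ⟨i, rfl⟩ : ∃ i, j = i + 1 := ⟨j - 1, by omega⟩
  rw [schwartzCutoff_apply, P.cutoff_succ_eq_zero_of_lt, Complex.ofReal_zero]
  refine h.trans_le ?_
  have : (2 : ℝ) ^ n ≤ 2 ^ i := pow_le_pow_right₀ (by norm_num) (by omega)
  linarith

/-- A bound for the fat cutoffs -/
def fatBound : ℝ :=
  3 * (SchwartzMap.seminorm ℝ 0 0 P.schwartzχ + SchwartzMap.seminorm ℝ 0 0 P.schwartzφ)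

theorem fatBound_nonneg : 0 ≤ P.fatBound := by
  unfold fatBound
  positivity

theorem norm_schwartzCutoff_le (n : ℕ) (ξ : Eucl d) : ‖P.schwartzCutoff n ξ‖ ≤
    SchwartzMap.seminorm ℝ 0 0 P.schwartzχ + SchwartzMap.seminorm ℝ 0 0 P.schwartzφ := by
  cases n with
  | zero =>
    exact (SchwartzMap.norm_le_seminorm ℝ P.schwartzχ ξ).trans
      (le_add_of_nonneg_right (by positivity))
  | succ m =>
    exact (SchwartzMap.norm_le_seminorm ℝ P.schwartzφ _).trans
      (le_add_of_nonneg_left (by positivity))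

theorem norm_fatCutoff_le (n : ℕ) (ξ : Eucl d) : ‖P.fatCutoff n ξ‖ ≤ P.fatBound := by
  rw [fatCutoff_apply]
  refine (norm_sum_le_of_le _ fun j _ => P.norm_schwartzCutoff_le j ξ).trans ?_
  rw [Finset.sum_const, nsmul_eq_mul, fatBound]
  gcongr
  have : (Finset.Icc (n - 1) (n + 1)).card ≤ 3 := by
    rw [Nat.card_Icc]
    omega
  exact_mod_cast this

theorem enorm_wL2_transposeMultiplier_fatCutoff_le (η : ℝ) (n : ℕ) (g : 𝓢(Eucl d, ℂ)) :
    ‖wL2 η (transposeMultiplier (fun ξ => P.fatCutoff n ξ) g)‖ₑ ≤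
      3 * P.multiplierBound η * ‖wL2 η g‖ₑ := by
  simp_rw [fatCutoff_apply]
  rw [transposeMultiplier_sum fun i _ => (P.schwartzCutoff i).hasTemperateGrowth, map_sum]
  refine (enorm_sum_le _ _).trans ?_
  refine (Finset.sum_le_sum fun j _ => P.enorm_wL2_transposeMultiplier_cutoff_le η j g).trans ?_
  rw [Finset.sum_const, nsmul_eq_mul, mul_assoc]
  gcongr
  have : (Finset.Icc (n - 1) (n + 1)).card ≤ 3 := by
    rw [Nat.card_Icc]
    omega
  exact_mod_cast this

theorem block_block (i j : ℕ) (u : 𝓢'(Eucl d, ℂ)) : P.block i (P.block j u) =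
    TemperedDistribution.fourierMultiplierCLM ℂ
      (fun ξ => P.schwartzCutoff j ξ * P.schwartzCutoff i ξ) u := by
  rw [block_eq, block_eq]
  exact fourierMultiplierCLM_comp (P.schwartzCutoff j).hasTemperateGrowth
    (P.schwartzCutoff i).hasTemperateGrowth u

theorem fourierMultiplierCLM_zero_apply (u : 𝓢'(Eucl d, ℂ)) :
    TemperedDistribution.fourierMultiplierCLM ℂ (fun _ => 0) u = 0 := by
  rw [TemperedDistribution.fourierMultiplierCLM_const]
  exact zero_smul ℂ u

theorem block_comm (i j : ℕ) (u : 𝓢'(Eucl d, ℂ)) :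
    P.block i (P.block j u) = P.block j (P.block i u) := by
  rw [block_block, block_block]
  simp_rw [mul_comm]

theorem block_block_eq_zero {i j : ℕ} (h : i ∉ Finset.Icc (j - 1) (j + 1)) (u : 𝓢'(Eucl d, ℂ)) :
    P.block i (P.block j u) = 0 := by
  rw [block_comm, block_block]
  simp_rw [P.schwartzCutoff_mul_eq_zero h]
  exact fourierMultiplierCLM_zero_apply u

theorem fourierMultiplierCLM_fatCutoff_block (n : ℕ) (u : 𝓢'(Eucl d, ℂ)) :
    TemperedDistribution.fourierMultiplierCLM ℂ (fun ξ => P.fatCutoff n ξ) (P.block n u) =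
      P.block n u := by
  rw [block_eq, fourierMultiplierCLM_comp (P.schwartzCutoff n).hasTemperateGrowth
    (P.fatCutoff n).hasTemperateGrowth]
  simp_rw [mul_comm _ (P.fatCutoff n _), fatCutoff_mul]

theorem sum_block_block (n : ℕ) (u : 𝓢'(Eucl d, ℂ)) :
    ∑ j ∈ Finset.Icc (n - 1) (n + 1), P.block j (P.block n u) = P.block n u := by
  conv_rhs => rw [← P.fourierMultiplierCLM_fatCutoff_block n u]
  simp_rw [fatCutoff_apply]
  rw [TemperedDistribution.fourierMultiplierCLM_sum ℂ
    fun i _ => (P.schwartzCutoff i).hasTemperateGrowth, sum_apply]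
  exact Finset.sum_congr rfl fun j _ => P.block_eq j _

theorem hasTemperateGrowth_norm_sq_pow (M : ℕ) :
    (fun ξ : Eucl d => (((‖ξ‖ ^ 2) ^ M : ℝ) : ℂ)).HasTemperateGrowth := by fun_prop

/-- Since `φ` vanishes near the origin, any power of `|ξ|²` can be divided out of it. The power `|ξ|
^ (2M)` is then charged to the smooth function on which the block acts, and `4 ^ (-m M)` is gained.
-/
theorem schwartzCutoff_succ_eq (M m : ℕ) (ξ : Eucl d) :
    P.schwartzCutoff (m + 1) ξ = P.schwartzφDiv M (((2 : ℝ) ^ m)⁻¹ • ξ) *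
      (((((((2 : ℝ) ^ m)⁻¹ ^ 2) ^ M : ℝ) : ℂ)) * (((‖ξ‖ ^ 2) ^ M : ℝ) : ℂ)) := by
  set a := ((2 : ℝ) ^ m)⁻¹ with ha
  have ha' : a ∈ Ioc (0 : ℝ) 1 := inv_two_pow_mem m
  rw [schwartzCutoff_succ_apply, schwartzφDiv_apply, schwartzφ_apply, ← ha, ← Complex.ofReal_mul,
    ← Complex.ofReal_mul, norm_smul, Real.norm_of_nonneg ha'.1.le]
  congr 1
  rcases eq_or_ne ξ 0 with rfl | hξ
  · rw [smul_zero, P.φ_eq_zero_of_lt (by simp)]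
    simp
  · have : ‖ξ‖ ≠ 0 := by simpa using hξ
    have := ha'.1.ne'
    field_simp
    rw [mul_pow]
    ring

theorem enorm_ofReal_of_nonneg {x : ℝ} (hx : 0 ≤ x) : ‖(x : ℂ)‖ₑ = ENNReal.ofReal x := by
  rw [← ofReal_norm, Complex.norm_real, Real.norm_of_nonneg hx]

theorem enorm_wL2_transposeMultiplier_cutoff_succ_le (η : ℝ) (M m : ℕ) (g : 𝓢(Eucl d, ℂ)) :
    ‖wL2 η (transposeMultiplier (fun ξ => P.schwartzCutoff (m + 1) ξ) g)‖ₑ ≤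
      multiplierNorm η (P.schwartzφDiv M) * (ENNReal.ofReal ((((2 : ℝ) ^ m)⁻¹ ^ 2) ^ M) *
        ‖wL2 η (transposeMultiplier (fun ξ => (((‖ξ‖ ^ 2) ^ M : ℝ) : ℂ)) g)‖ₑ) := by
  simp_rw [P.schwartzCutoff_succ_eq M m]
  set a := ((2 : ℝ) ^ m)⁻¹ with ha
  have ha' : a ∈ Ioc (0 : ℝ) 1 := inv_two_pow_mem m
  have ht := hasTemperateGrowth_norm_sq_pow (d := d) M
  have hc : (fun ξ : Eucl d => ((((a ^ 2) ^ M : ℝ) : ℂ)) *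
      (((‖ξ‖ ^ 2) ^ M : ℝ) : ℂ)).HasTemperateGrowth :=
    (Function.HasTemperateGrowth.const _).mul ht
  rw [← transposeMultiplier_comp (hasTemperateGrowth_dilate _ a) hc]
  refine (enorm_wL2_transposeMultiplier_le η _ ha' _).trans (le_of_eq ?_)
  rw [transposeMultiplier_const_mul ht, map_smul, enorm_smul,
    enorm_ofReal_of_nonneg (by positivity)]

theorem weightedL2Norm_block_succ_le (η : ℝ) (M m : ℕ) (u : 𝓢'(Eucl d, ℂ)) :
    weightedL2Norm η 1 (P.block (m + 1) u) ≤
      multiplierNorm (-η) (P.schwartzφDiv M) * (ENNReal.ofReal ((((2 : ℝ) ^ m)⁻¹ ^ 2) ^ M) *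
        weightedL2Norm η 1 (TemperedDistribution.fourierMultiplierCLM ℂ
          (fun ξ => (((‖ξ‖ ^ 2) ^ M : ℝ) : ℂ)) u)) := by
  rw [block_eq]
  simp_rw [P.schwartzCutoff_succ_eq M m]
  set a := ((2 : ℝ) ^ m)⁻¹ with ha
  have ha' : a ∈ Ioc (0 : ℝ) 1 := inv_two_pow_mem m
  have ht := hasTemperateGrowth_norm_sq_pow (d := d) M
  have hc : (fun ξ : Eucl d => ((((a ^ 2) ^ M : ℝ) : ℂ)) *
      (((‖ξ‖ ^ 2) ^ M : ℝ) : ℂ)).HasTemperateGrowth :=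
    (Function.HasTemperateGrowth.const _).mul ht
  simp_rw [mul_comm (P.schwartzφDiv M _)]
  rw [← fourierMultiplierCLM_comp hc (hasTemperateGrowth_dilate _ a)]
  refine (weightedL2Norm_fourierMultiplierCLM_le η _ ha' _).trans (mul_le_mul_right ?_ _)
  have e : (fun ξ : Eucl d => ((((a ^ 2) ^ M : ℝ) : ℂ)) * (((‖ξ‖ ^ 2) ^ M : ℝ) : ℂ)) =
      ((((a ^ 2) ^ M : ℝ) : ℂ)) • (fun ξ : Eucl d => (((‖ξ‖ ^ 2) ^ M : ℝ) : ℂ)) := rfl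
  rw [e, TemperedDistribution.fourierMultiplierCLM_smul ht]
  refine (weightedL2Norm_smul_le η 1 _ _).trans (le_of_eq ?_)
  rw [enorm_ofReal_of_nonneg (by positivity)]
  rfl

end DyadicPartition

end Blocks

/-! ### From weighted `L²` spaces to weighted Sobolev spaces -/

section Lift

variable {d : ℕ}

/-- For `λ ≤ 1` one has `1 + λ² |x|² ≥ λ² (1 + |x|²)`. This is the source of `λ ^ (-η)`; it is used
once for the source space and once for the target. Only `η₀ ≤ η` enters, so operator bounds at `η₀`
serve all larger `η`. -/
theorem weight_mul_weight_neg_le {η₀ η lam : ℝ} (h0 : 0 ≤ η₀) (h : η₀ ≤ η)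
    (hlam : lam ∈ Ioc (0 : ℝ) 1) (x : Eucl d) :
    weight η₀ 1 x * weight (-η) lam x ≤ lam ^ (-η) := by
  have hl := hlam.1
  have h1 : weight η₀ 1 x ≤ (1 + ‖x‖ ^ 2) ^ (η / 2) := by
    rw [weight_one]
    exact Real.rpow_le_rpow_of_exponent_le (by nlinarith [sq_nonneg ‖x‖]) (by linarith)
  have h2 : weight (-η) lam x ≤ lam ^ (-η) * (1 + ‖x‖ ^ 2) ^ (-(η / 2)) := by
    have h3 : lam ^ (-η) = (lam ^ 2) ^ (-(η / 2)) := by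
      rw [← Real.rpow_natCast, ← Real.rpow_mul hl.le]
      congr 1
      push_cast
      ring
    rw [h3, ← Real.mul_rpow (by positivity) (by positivity), weight, neg_div]
    refine Real.rpow_le_rpow_of_nonpos (by positivity) ?_ (by linarith)
    rw [norm_smul, Real.norm_of_nonneg hl.le]
    nlinarith [hlam.2, sq_nonneg ‖x‖]
  calc weight η₀ 1 x * weight (-η) lam x
      ≤ (1 + ‖x‖ ^ 2) ^ (η / 2) * (lam ^ (-η) * (1 + ‖x‖ ^ 2) ^ (-(η / 2))) :=
        mul_le_mul h1 h2 (weight_pos _ _ _).le (by positivity)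
    _ = lam ^ (-η) * ((1 + ‖x‖ ^ 2) ^ (η / 2) * (1 + ‖x‖ ^ 2) ^ (-(η / 2))) := by ring
    _ = lam ^ (-η) := by
        rw [← Real.rpow_add (by positivity), add_neg_cancel, Real.rpow_zero, mul_one]

theorem enorm_toLp_smulLeftCLM_le {θ : Eucl d → ℂ} (hθ : θ.HasTemperateGrowth) {c : ℝ}
    (hc : 0 ≤ c) (h : ∀ x, ‖θ x‖ ≤ c) (f : 𝓢(Eucl d, ℂ)) :
    ‖(SchwartzMap.smulLeftCLM ℂ θ f).toLp 2 volume‖ₑ ≤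
      ENNReal.ofReal c * ‖f.toLp 2 volume‖ₑ := by
  have h0 : ∀ f : 𝓢(Eucl d, ℂ), wL2 0 f = f.toLp 2 volume := fun f => by
    rw [wL2_apply]
    congr 1
    ext x
    rw [SchwartzMap.smulLeftCLM_apply_apply (hasTemperateGrowth_weight 0 1)]
    simp [weight]
  rw [← h0, ← h0]
  refine enorm_wL2_smulLeftCLM_le hc hθ (fun x => ?_) f
  rw [Real.rpow_zero, one_mul, mul_one]
  exact pow_le_pow_left₀ (norm_nonneg _) (h x) 2

theorem enorm_wL2_smulLeftCLM_weight_le {η₀ η lam : ℝ} (h0 : 0 ≤ η₀) (h : η₀ ≤ η)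
    (hlam : lam ∈ Ioc (0 : ℝ) 1) (g : 𝓢(Eucl d, ℂ)) :
    ‖wL2 η₀ (SchwartzMap.smulLeftCLM ℂ (fun x => (weight (-η) lam x : ℂ)) g)‖ₑ ≤
      ENNReal.ofReal (lam ^ (-η)) * ‖g.toLp 2 volume‖ₑ := by
  rw [wL2_apply, SchwartzMap.smulLeftCLM_smulLeftCLM_apply (hasTemperateGrowth_weight η₀ 1)
    (hasTemperateGrowth_weight (-η) lam)]
  refine enorm_toLp_smulLeftCLM_le ((hasTemperateGrowth_weight η₀ 1).mul
    (hasTemperateGrowth_weight (-η) lam)) (Real.rpow_nonneg hlam.1.le _) (fun x => ?_) g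
  rw [Pi.mul_apply, ← Complex.ofReal_mul, Complex.norm_real, Real.norm_of_nonneg
    (mul_nonneg (weight_pos _ _ _).le (weight_pos _ _ _).le)]
  exact weight_mul_weight_neg_le h0 h hlam x

theorem weightedL2Norm_le_rescaled {η₀ η lam : ℝ} (h0 : 0 ≤ η₀) (h : η₀ ≤ η)
    (hlam : lam ∈ Ioc (0 : ℝ) 1) (u : 𝓢'(Eucl d, ℂ)) :
    weightedL2Norm η₀ 1 u ≤ ENNReal.ofReal (lam ^ (-η)) * weightedL2Norm η lam u := by
  rw [weightedL2Norm_le_iff]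
  intro g
  have h1 := enorm_apply_le_weightedL2Norm η lam u
    (SchwartzMap.smulLeftCLM ℂ (fun x => (weight η₀ 1 x : ℂ)) g)
  have h2 := enorm_wL2_smulLeftCLM_weight_le h0 h hlam g
  rw [wL2_apply, SchwartzMap.smulLeftCLM_smulLeftCLM_apply (hasTemperateGrowth_weight η₀ 1)
    (hasTemperateGrowth_weight (-η) lam), mul_comm, ← SchwartzMap.smulLeftCLM_smulLeftCLM_apply
    (hasTemperateGrowth_weight (-η) lam) (hasTemperateGrowth_weight η₀ 1)] at h2
  calc _ ≤ _ := h1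
    _ ≤ weightedL2Norm η lam u * (ENNReal.ofReal (lam ^ (-η)) * ‖g.toLp 2 volume‖ₑ) := by gcongr
    _ = _ := by ring

theorem weightedL2Norm_neg_le {η₀ η lam : ℝ} (h0 : 0 ≤ η₀) (h : η₀ ≤ η)
    (hlam : lam ∈ Ioc (0 : ℝ) 1) {u : 𝓢'(Eucl d, ℂ)} {C : ℝ≥0∞}
    (hu : ∀ g, ‖u g‖ₑ ≤ C * ‖wL2 η₀ g‖ₑ) :
    weightedL2Norm (-η) lam u ≤ ENNReal.ofReal (lam ^ (-η)) * C := by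
  rw [weightedL2Norm_le_iff]
  intro g
  calc _ ≤ _ := hu _
    _ ≤ C * (ENNReal.ofReal (lam ^ (-η)) * ‖g.toLp 2 volume‖ₑ) :=
      mul_le_mul_right (enorm_wL2_smulLeftCLM_weight_le h0 h hlam g) _
    _ = _ := by ring

namespace DyadicPartition

variable (P : DyadicPartition d) {r η η₀ : ℝ}

theorem mul_weightedL2Norm_block_le (r η lam : ℝ) (n : ℕ) (u : 𝓢'(Eucl d, ℂ)) :
    ENNReal.ofReal ((2 : ℝ) ^ (((n : ℝ) - 1) * r)) * weightedL2Norm η lam (P.block n u) ≤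
      sobolevNorm P r η lam u := by
  have h := ENNReal.le_tsum (f := fun n : ℕ => (ENNReal.ofReal ((2 : ℝ) ^ (((n : ℝ) - 1) * r)) *
    weightedL2Norm η lam (P.block n u)) ^ 2) n
  have h2 := ENNReal.rpow_le_rpow h (by norm_num : (0 : ℝ) ≤ 1 / 2)
  refine le_trans (le_of_eq ?_) h2
  rw [← ENNReal.rpow_natCast, ← ENNReal.rpow_mul]
  norm_num

theorem weightedL2Norm_block_le_sobolevNorm (r η lam : ℝ) (n : ℕ) (u : 𝓢'(Eucl d, ℂ)) :
    weightedL2Norm η lam (P.block n u) ≤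
      ENNReal.ofReal ((2 : ℝ) ^ (-(((n : ℝ) - 1) * r))) * sobolevNorm P r η lam u := by
  have h := mul_le_mul_right (P.mul_weightedL2Norm_block_le r η lam n u)
    (ENNReal.ofReal ((2 : ℝ) ^ (-(((n : ℝ) - 1) * r))))
  rw [← mul_assoc, ← ENNReal.ofReal_mul (by positivity), ← Real.rpow_add (by norm_num),
    neg_add_cancel, Real.rpow_zero, ENNReal.ofReal_one, one_mul] at h
  exact h

theorem weightedL2Norm_block_le_sobolevNorm' (h0 : 0 ≤ η₀) (h : η₀ ≤ η) (n : ℕ)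
    (u : 𝓢'(Eucl d, ℂ)) :
    weightedL2Norm η₀ 1 (P.block n u) ≤
      ENNReal.ofReal ((2 : ℝ) ^ (-(((n : ℝ) - 1) * r))) * sobolevNorm P r η 1 u := by
  have h1 := weightedL2Norm_le_rescaled h0 h (lam := 1) (by norm_num) (P.block n u)
  rw [Real.one_rpow, ENNReal.ofReal_one, one_mul] at h1
  exact h1.trans (P.weightedL2Norm_block_le_sobolevNorm r η 1 n u)

/-- The Littlewood-Paley blocks of elements of `H^r(⟨x⟩ ^ η)` as elements of `L²(⟨x⟩ ^ η₀)` -/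
def blockMap (h0 : 0 ≤ η₀) (h : η₀ ≤ η) (n : ℕ) : Sobolev P r η →ₗ[ℂ] WeightedL2 d η₀ :=
  (P.block n).toLinearMap.restrict fun u hu => mem_weightedL2.2
    ((P.weightedL2Norm_block_le_sobolevNorm' (r := r) h0 h n u).trans_lt
      (ENNReal.mul_lt_top ENNReal.ofReal_lt_top hu))

theorem coe_blockMap (h0 : 0 ≤ η₀) (h : η₀ ≤ η) (n : ℕ) (u : Sobolev P r η) :
    (P.blockMap h0 h n u : 𝓢'(Eucl d, ℂ)) = P.block n u := rfl

theorem weightedMultiplier_schwartzCutoff (n : ℕ) (v : WeightedL2 d η) :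
    (weightedMultiplier η (P.schwartzCutoff n) v : 𝓢'(Eucl d, ℂ)) = P.block n v := by
  rw [coe_weightedMultiplier, block_eq]

theorem weightedMultiplier_fatCutoff_blockMap (h0 : 0 ≤ η₀) (h : η₀ ≤ η) (n : ℕ)
    (u : Sobolev P r η) :
    weightedMultiplier η₀ (P.fatCutoff n) (P.blockMap h0 h n u) = P.blockMap h0 h n u := by
  ext1
  rw [coe_weightedMultiplier]
  exact P.fourierMultiplierCLM_fatCutoff_block n u

/-- Frequency localised pieces of a test function decay faster than any power of `2 ^ n`, measured
by one continuous map to a normed space. This permits summation over blocks of distributions of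
negative regularity. -/
theorem exists_enorm_fatCutoff_le (η : ℝ) (M : ℕ) : ∃ K : ℝ≥0∞, K ≠ ⊤ ∧ ∀ n g,
    ‖wL2 η (transposeMultiplier (fun ξ => P.fatCutoff n ξ) g)‖ₑ ≤
      K * (ENNReal.ofReal ((((2 : ℝ) ^ n)⁻¹) ^ M) * ‖((wL2 η).prod (wL2 η ∘L
        transposeMultiplier (fun ξ : Eucl d => (((‖ξ‖ ^ 2) ^ M : ℝ) : ℂ)))) g‖ₑ) := by
  set Q := (wL2 η).prod (wL2 η ∘L
        transposeMultiplier (fun ξ : Eucl d => (((‖ξ‖ ^ 2) ^ M : ℝ) : ℂ))) with hQ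
  have hQ1 : ∀ g, ‖wL2 η g‖ₑ ≤ ‖Q g‖ₑ := fun g => by
    rw [← ofReal_norm, ← ofReal_norm]
    exact ENNReal.ofReal_le_ofReal (norm_fst_le (Q g))
  have hQ2 : ∀ g, ‖wL2 η (transposeMultiplier (fun ξ : Eucl d => (((‖ξ‖ ^ 2) ^ M : ℝ) : ℂ)) g)‖ₑ ≤
      ‖Q g‖ₑ := fun g => by
    rw [← ofReal_norm, ← ofReal_norm]
    exact ENNReal.ofReal_le_ofReal (norm_snd_le (Q g))
  set K₁ := 3 * P.multiplierBound η * ENNReal.ofReal (2 ^ M) with hK₁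
  set K₂ := 3 * (multiplierNorm η (P.schwartzφDiv M) * ENNReal.ofReal (4 ^ M)) with hK₂
  refine ⟨K₁ + K₂, ENNReal.add_ne_top.2 ⟨?_, ?_⟩, fun n g => ?_⟩
  · exact ENNReal.mul_ne_top (ENNReal.mul_ne_top (by norm_num) (P.multiplierBound_ne_top η))
      ENNReal.ofReal_ne_top
  · exact ENNReal.mul_ne_top (by norm_num) (ENNReal.mul_ne_top (multiplierNorm_lt_top _ _).ne
      ENNReal.ofReal_ne_top)
  -- For `n < 2` the window contains `χ`, from which no power of `|ξ|` can be divided out; there `2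
  -- ^ (-n M)` is absorbed by the constant `2 ^ M`.
  rcases lt_or_ge n 2 with hn | hn
  · have hle : (1 : ℝ) ≤ 2 ^ M * (((2 : ℝ) ^ n)⁻¹) ^ M := by
      rw [← mul_pow]
      refine one_le_pow₀ ?_
      have : (2 : ℝ) ^ n ≤ 2 ^ 1 := pow_le_pow_right₀ (by norm_num) (by omega)
      rw [← div_eq_mul_inv, le_div_iff₀ (by positivity)]
      linarith
    calc _ ≤ 3 * P.multiplierBound η * 1 * ‖Q g‖ₑ := by
          rw [mul_one]
          exact (P.enorm_wL2_transposeMultiplier_fatCutoff_le η n g).trans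
            (mul_le_mul_right (hQ1 g) _)
      _ ≤ 3 * P.multiplierBound η * ENNReal.ofReal (2 ^ M * (((2 : ℝ) ^ n)⁻¹) ^ M) * ‖Q g‖ₑ := by
          gcongr
          exact ENNReal.one_le_ofReal.2 hle
      _ = K₁ * (ENNReal.ofReal ((((2 : ℝ) ^ n)⁻¹) ^ M) * ‖Q g‖ₑ) := by
          rw [hK₁, ENNReal.ofReal_mul (by positivity)]
          ring
      _ ≤ _ := mul_le_mul_left le_self_add _
  · have h1 : ∀ j ∈ Finset.Icc (n - 1) (n + 1),
        ‖wL2 η (transposeMultiplier (fun ξ => P.schwartzCutoff j ξ) g)‖ₑ ≤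
          multiplierNorm η (P.schwartzφDiv M) * (ENNReal.ofReal (4 ^ M * (((2 : ℝ) ^ n)⁻¹) ^ M) *
            ‖Q g‖ₑ) := by
      intro j hj
      rw [Finset.mem_Icc] at hj
      obtain ⟨m, rfl⟩ : ∃ m, j = m + 1 := ⟨j - 1, by omega⟩
      refine (P.enorm_wL2_transposeMultiplier_cutoff_succ_le η M m g).trans ?_
      refine mul_le_mul_right (mul_le_mul' (ENNReal.ofReal_le_ofReal ?_) (hQ2 g)) _
      rw [← mul_pow]
      refine pow_le_pow_left₀ (by positivity) ?_ M
      have h2 : (2 : ℝ) ^ n ≤ 4 * 2 ^ m := by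
        calc (2 : ℝ) ^ n ≤ 2 ^ (m + 2) := pow_le_pow_right₀ (by norm_num) (by omega)
          _ = _ := by ring
      have h3 : ((2 : ℝ) ^ m)⁻¹ ≤ 4 * ((2 : ℝ) ^ n)⁻¹ := by
        rw [← div_eq_mul_inv, le_div_iff₀ (by positivity), inv_mul_le_iff₀ (by positivity)]
        linarith
      have h4 : ((2 : ℝ) ^ m)⁻¹ ≤ 1 := (inv_two_pow_mem m).2
      have h5 : 0 ≤ ((2 : ℝ) ^ m)⁻¹ := (inv_two_pow_mem m).1.le
      nlinarith
    simp_rw [fatCutoff_apply]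
    rw [transposeMultiplier_sum fun i _ => (P.schwartzCutoff i).hasTemperateGrowth, map_sum]
    refine (enorm_sum_le _ _).trans ((Finset.sum_le_sum h1).trans ?_)
    rw [Finset.sum_const, nsmul_eq_mul, ENNReal.ofReal_mul (by positivity)]
    have hcard : ((Finset.Icc (n - 1) (n + 1)).card : ℝ≥0∞) ≤ 3 := by
      have : (Finset.Icc (n - 1) (n + 1)).card ≤ 3 := by
        rw [Nat.card_Icc]
        omega
      exact_mod_cast this
    calc _ ≤ 3 * (multiplierNorm η (P.schwartzφDiv M) * (ENNReal.ofReal (4 ^ M) *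
            ENNReal.ofReal ((((2 : ℝ) ^ n)⁻¹) ^ M) * ‖Q g‖ₑ)) := mul_le_mul_left hcard _
      _ = K₂ * (ENNReal.ofReal ((((2 : ℝ) ^ n)⁻¹) ^ M) * ‖Q g‖ₑ) := by
          rw [hK₂]
          ring
      _ ≤ _ := mul_le_mul_left le_add_self _

theorem two_rpow_mul_inv_two_pow_le {r : ℝ} {M : ℕ} (hM : |r| + 1 ≤ M) (n : ℕ) :
    (2 : ℝ) ^ (-(((n : ℝ) - 1) * r)) * (((2 : ℝ) ^ n)⁻¹) ^ M ≤ 2 ^ |r| * (1 / 2) ^ n := by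
  have e1 : (((2 : ℝ) ^ n)⁻¹) ^ M = (2 : ℝ) ^ (-((n : ℝ) * M)) := by
    rw [Real.rpow_neg (by norm_num), Real.rpow_mul (by norm_num), Real.rpow_natCast,
      Real.rpow_natCast, inv_pow]
  have e2 : ((1 : ℝ) / 2) ^ n = (2 : ℝ) ^ (-(n : ℝ)) := by
    rw [Real.rpow_neg (by norm_num), Real.rpow_natCast, one_div, inv_pow]
  rw [e1, e2, ← Real.rpow_add (by norm_num), ← Real.rpow_add (by norm_num)]
  refine Real.rpow_le_rpow_of_exponent_le (by norm_num) ?_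
  have hn : (0 : ℝ) ≤ n := n.cast_nonneg
  have h1 := neg_abs_le r
  have h2 := le_abs_self r
  nlinarith [mul_le_mul_of_nonneg_left hM hn]

end DyadicPartition

end Lift

/-! ### The operator on weighted Sobolev spaces -/

section LiftOperator

variable {d : ℕ}

namespace DyadicPartition

variable (P : DyadicPartition d) {r η η₀ : ℝ}

/-- The block norms grow at most like `2 ^ (n |r|)`. Inserting the fat cutoff and moving it to `g`
gains `2 ^ (-n M)`; with `M ≥ |r| + 1` a geometric factor is left. -/
theorem exists_norm_extension_block_le (h0 : 0 ≤ η₀) (h : η₀ ≤ η)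
    {L : WeightedL2 d η₀ →ₗ[ℂ] 𝓢'(Eucl d, ℂ)} {A : ℝ≥0∞} (hA : A ≠ ⊤)
    (hL : ∀ v g, ‖L v g‖ₑ ≤ A * (weightedL2Norm η₀ 1 (v : 𝓢'(Eucl d, ℂ)) * ‖wL2 η₀ g‖ₑ))
    (hcomm : ∀ (ψ : 𝓢(Eucl d, ℂ)) v g,
      L (weightedMultiplier η₀ ψ v) g = L v (transposeMultiplier ψ g))
    (r : ℝ) : ∃ M : ℕ, ∀ u : Sobolev P r η, ∃ C : ℝ≥0∞, C ≠ ⊤ ∧ ∀ n g,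
      ‖L (P.blockMap h0 h n u) g‖ₑ ≤ C * ENNReal.ofReal ((1 / 2) ^ n) *
        ‖((wL2 η₀).prod (wL2 η₀ ∘L
          transposeMultiplier (fun ξ : Eucl d => (((‖ξ‖ ^ 2) ^ M : ℝ) : ℂ)))) g‖ₑ := by
  obtain ⟨M, hM⟩ := exists_nat_ge (|r| + 1)
  obtain ⟨K, hK, hdecay⟩ := P.exists_enorm_fatCutoff_le η₀ M
  refine ⟨M, fun u => ⟨A * sobolevNorm P r η 1 (u : 𝓢'(Eucl d, ℂ)) * K *
    ENNReal.ofReal (2 ^ |r|), ?_, fun n g => ?_⟩⟩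
  · exact ENNReal.mul_ne_top (ENNReal.mul_ne_top (ENNReal.mul_ne_top hA u.2.ne) hK)
      ENNReal.ofReal_ne_top
  set q := ‖((wL2 η₀).prod (wL2 η₀ ∘L
          transposeMultiplier (fun ξ : Eucl d => (((‖ξ‖ ^ 2) ^ M : ℝ) : ℂ)))) g‖ₑ with hq
  have h1 : L (P.blockMap h0 h n u) g =
      L (P.blockMap h0 h n u) (transposeMultiplier (fun ξ => P.fatCutoff n ξ) g) := by
    conv_lhs => rw [← P.weightedMultiplier_fatCutoff_blockMap h0 h n u]
    exact hcomm _ _ _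
  rw [h1]
  calc _ ≤ A * ((ENNReal.ofReal ((2 : ℝ) ^ (-(((n : ℝ) - 1) * r))) *
        sobolevNorm P r η 1 (u : 𝓢'(Eucl d, ℂ))) *
          (K * (ENNReal.ofReal ((((2 : ℝ) ^ n)⁻¹) ^ M) * q))) := by
        refine (hL _ _).trans (mul_le_mul_right (mul_le_mul' ?_ (hdecay n g)) _)
        exact P.weightedL2Norm_block_le_sobolevNorm' h0 h n u
    _ = A * sobolevNorm P r η 1 (u : 𝓢'(Eucl d, ℂ)) * K *
        ENNReal.ofReal ((2 : ℝ) ^ (-(((n : ℝ) - 1) * r)) * (((2 : ℝ) ^ n)⁻¹) ^ M) * q := by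
        rw [ENNReal.ofReal_mul (by positivity)]
        ring
    _ ≤ A * sobolevNorm P r η 1 (u : 𝓢'(Eucl d, ℂ)) * K *
        ENNReal.ofReal (2 ^ |r| * (1 / 2) ^ n) * q := by
        refine mul_le_mul_left (mul_le_mul_right (ENNReal.ofReal_le_ofReal ?_) _) _
        exact two_rpow_mul_inv_two_pow_le hM n
    _ = _ := by
        rw [ENNReal.ofReal_mul (by positivity)]
        ring

/-- A bounded operator from `L²(⟨x⟩ ^ η₀)` to its dual that commutes with Fourier multipliers
acts on `H^r(⟨x⟩ ^ η)` block by block. -/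
theorem exists_lift (h0 : 0 ≤ η₀) (h : η₀ ≤ η)
    {L : WeightedL2 d η₀ →ₗ[ℂ] 𝓢'(Eucl d, ℂ)} {A : ℝ≥0∞} (hA : A ≠ ⊤)
    (hL : ∀ v g, ‖L v g‖ₑ ≤ A * (weightedL2Norm η₀ 1 (v : 𝓢'(Eucl d, ℂ)) * ‖wL2 η₀ g‖ₑ))
    (hcomm : ∀ (ψ : 𝓢(Eucl d, ℂ)) v g,
      L (weightedMultiplier η₀ ψ v) g = L v (transposeMultiplier ψ g))
    (r : ℝ) : ∃ T : Sobolev P r η →ₗ[ℂ] 𝓢'(Eucl d, ℂ),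
      ∀ u n, P.block n (T u) = L (P.blockMap h0 h n u) := by
  obtain ⟨M, hM⟩ := P.exists_norm_extension_block_le h0 h hA hL hcomm r
  set Q := (wL2 η₀).prod (wL2 η₀ ∘L
          transposeMultiplier (fun ξ : Eucl d => (((‖ξ‖ ^ 2) ^ M : ℝ) : ℂ))) with hQ
  have hM' : ∀ u : Sobolev P r η, ∃ C : ℝ, 0 ≤ C ∧ ∀ n g,
      ‖L (P.blockMap h0 h n u) g‖ ≤ C * ‖Q g‖ * (1 / 2) ^ n := by
    intro u
    obtain ⟨C, hC, hb⟩ := hM u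
    refine ⟨C.toReal, ENNReal.toReal_nonneg, fun n g => ?_⟩
    have h1 := norm_le_of_enorm_le (ENNReal.mul_ne_top hC ENNReal.ofReal_ne_top) (hb n g)
    rw [ENNReal.toReal_mul, ENNReal.toReal_ofReal (by positivity)] at h1
    exact h1.trans (le_of_eq (by ring))
  have hgeo : Summable fun n : ℕ => ((1 : ℝ) / 2) ^ n := summable_geometric_two
  have hsum : ∀ (u : Sobolev P r η) g, Summable fun n => L (P.blockMap h0 h n u) g := by
    intro u g
    obtain ⟨C, hC, hb⟩ := hM' u
    exact Summable.of_norm_bounded (hgeo.mul_left (C * ‖Q g‖)) fun n => hb n g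
  have hex : ∀ u : Sobolev P r η, ∃ w : 𝓢'(Eucl d, ℂ), ∀ g,
      w g = ∑' n, L (P.blockMap h0 h n u) g := by
    intro u
    obtain ⟨C, hC, hb⟩ := hM' u
    refine exists_temperedDistribution
      { toFun := fun g => ∑' n, L (P.blockMap h0 h n u) g
        map_add' := fun g g' => by
          rw [← (hsum u g).tsum_add (hsum u g')]
          exact tsum_congr fun n => map_add _ g g'
        map_smul' := fun c g => by
          rw [RingHom.id_apply, smul_eq_mul, ← tsum_mul_left]
          exact tsum_congr fun n => map_smul _ c g } Q (C := ENNReal.ofReal (C * 2))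
      ENNReal.ofReal_ne_top fun g => enorm_le_of_norm_le ENNReal.ofReal_ne_top ?_
    rw [ENNReal.toReal_ofReal (by positivity)]
    have h1 := tsum_of_norm_bounded (hgeo.mul_left (C * ‖Q g‖)).hasSum fun n => hb n g
    rw [tsum_mul_left, tsum_geometric_two] at h1
    exact h1.trans (le_of_eq (by ring))
  choose w hw using hex
  refine ⟨{ toFun := w
            map_add' := fun u v => ?_
            map_smul' := fun c u => ?_ }, fun u m => ?_⟩
  · ext g
    rw [show (w u + w v) g = w u g + w v g from rfl, hw, hw, hw,
      ← (hsum u g).tsum_add (hsum v g)]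
    exact tsum_congr fun n => by rw [map_add, map_add]; rfl
  · ext g
    rw [RingHom.id_apply, show (c • w u) g = c * w u g from rfl, hw, hw, ← tsum_mul_left]
    exact tsum_congr fun n => by rw [map_smul, map_smul]; rfl
  · ext g
    rw [block_apply]
    refine (hw u _).trans ?_
    have e1 : ∀ n, L (P.blockMap h0 h n u) (transposeMultiplier (fun ξ => P.schwartzCutoff m ξ) g) =
        L (weightedMultiplier η₀ (P.schwartzCutoff m) (P.blockMap h0 h n u)) g := fun n =>
      (hcomm _ _ _).symm
    simp_rw [e1]
    -- Only the neighbouring blocks interact with the `m`-th one, and these add up to the `m`-th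
    -- block itself by `sum_block_block`.
    rw [tsum_eq_sum (s := Finset.Icc (m - 1) (m + 1)) fun n hn => ?_]
    · rw [← evalLinear_apply]
      simp_rw [← evalLinear_apply]
      rw [← map_sum, ← map_sum]
      congr 2
      ext1
      rw [Submodule.coe_sum]
      simp_rw [weightedMultiplier_schwartzCutoff, coe_blockMap]
      rw [← P.sum_block_block m u]
      exact Finset.sum_congr rfl fun n _ => P.block_comm m n _
    · have : weightedMultiplier η₀ (P.schwartzCutoff m) (P.blockMap h0 h n u) = 0 := by
        ext1
        rw [weightedMultiplier_schwartzCutoff, coe_blockMap, block_comm,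
          P.block_block_eq_zero hn]
        rfl
      rw [this, map_zero]
      rfl

theorem lift_eq_of_mem (h0 : 0 ≤ η₀) (h : η₀ ≤ η)
    {L : WeightedL2 d η₀ →ₗ[ℂ] 𝓢'(Eucl d, ℂ)}
    (hcomm : ∀ (ψ : 𝓢(Eucl d, ℂ)) v g,
      L (weightedMultiplier η₀ ψ v) g = L v (transposeMultiplier ψ g))
    {T : Sobolev P r η →ₗ[ℂ] 𝓢'(Eucl d, ℂ)}
    (hT : ∀ u n, P.block n (T u) = L (P.blockMap h0 h n u)) (u : Sobolev P r η)
    (hu : (u : 𝓢'(Eucl d, ℂ)) ∈ WeightedL2 d η₀) : T u = L ⟨u, hu⟩ := by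
  refine P.eq_of_block_eq fun n => ?_
  rw [hT]
  ext g
  rw [block_apply, ← hcomm (P.schwartzCutoff n)]
  congr 2
  ext1
  rw [weightedMultiplier_schwartzCutoff, coe_blockMap]

/-- The lifted operator is diagonal with respect to the blocks, so the estimate is made term by
term. The fat cutoff acts as the identity on the `n`-th block, which makes the localised constant `c
n` applicable, and the change of weight on either side costs `λ ^ (-η)`. -/
theorem sobolevNorm_lift_le (h0 : 0 ≤ η₀) (h : η₀ ≤ η)
    {L : WeightedL2 d η₀ →ₗ[ℂ] 𝓢'(Eucl d, ℂ)} {s : ℝ} {c : ℕ → ℝ≥0∞} {K : ℝ≥0∞}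
    (hc : ∀ n v g, ‖L (weightedMultiplier η₀ (P.fatCutoff n) v) g‖ₑ ≤
      c n * (weightedL2Norm η₀ 1 (v : 𝓢'(Eucl d, ℂ)) * ‖wL2 η₀ g‖ₑ))
    (hK : ∀ n : ℕ, ENNReal.ofReal ((2 : ℝ) ^ (((n : ℝ) - 1) * s)) * c n ≤ K)
    {T : Sobolev P r η →ₗ[ℂ] 𝓢'(Eucl d, ℂ)}
    (hT : ∀ u n, P.block n (T u) = L (P.blockMap h0 h n u)) (u : Sobolev P r η) {lam : ℝ}
    (hlam : lam ∈ Ioc (0 : ℝ) 1) :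
    sobolevNorm P (r + s) (-η) lam (T u) ≤ K * ENNReal.ofReal (lam ^ (-2 * η)) *
      sobolevNorm P r η lam (u : 𝓢'(Eucl d, ℂ)) := by
  set κ := K * ENNReal.ofReal (lam ^ (-2 * η)) with hκ
  have hl := hlam.1
  have hterm : ∀ n : ℕ, ENNReal.ofReal ((2 : ℝ) ^ (((n : ℝ) - 1) * (r + s))) *
      weightedL2Norm (-η) lam (P.block n (T u)) ≤ κ * (ENNReal.ofReal
        ((2 : ℝ) ^ (((n : ℝ) - 1) * r)) * weightedL2Norm η lam (P.block n u)) := by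
    intro n
    have h1 : weightedL2Norm (-η) lam (P.block n (T u)) ≤ ENNReal.ofReal (lam ^ (-η)) *
        (c n * weightedL2Norm η₀ 1 (P.block n u)) := by
      refine weightedL2Norm_neg_le h0 h hlam fun g => ?_
      rw [hT, ← P.weightedMultiplier_fatCutoff_blockMap h0 h n u, mul_assoc]
      exact hc n _ g
    have h2 := weightedL2Norm_le_rescaled h0 h hlam (P.block n u)
    have e1 : lam ^ (-2 * η) = lam ^ (-η) * lam ^ (-η) := by
      rw [← Real.rpow_add hl]
      ring_nf
    have e2 : (2 : ℝ) ^ (((n : ℝ) - 1) * (r + s)) =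
        2 ^ (((n : ℝ) - 1) * s) * 2 ^ (((n : ℝ) - 1) * r) := by
      rw [← Real.rpow_add (by norm_num)]
      ring_nf
    rw [e2, ENNReal.ofReal_mul (by positivity), hκ, e1,
      ENNReal.ofReal_mul (Real.rpow_nonneg hl.le _)]
    set X := ENNReal.ofReal ((2 : ℝ) ^ (((n : ℝ) - 1) * s))
    set Y := ENNReal.ofReal ((2 : ℝ) ^ (((n : ℝ) - 1) * r))
    set Z := ENNReal.ofReal (lam ^ (-η))
    calc X * Y * weightedL2Norm (-η) lam (P.block n (T u))
        ≤ X * Y * (Z * (c n * (Z * weightedL2Norm η lam (P.block n u)))) :=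
          mul_le_mul_right (h1.trans (mul_le_mul_right (mul_le_mul_right h2 _) _)) _
      _ = (X * c n) * ((Z * Z) * (Y * weightedL2Norm η lam (P.block n u))) := by ring
      _ ≤ K * ((Z * Z) * (Y * weightedL2Norm η lam (P.block n u))) :=
          mul_le_mul_left (hK n) _
      _ = _ := by ring
  unfold sobolevNorm
  have e3 : κ = (κ ^ 2) ^ (1 / 2 : ℝ) := by
    rw [← ENNReal.rpow_natCast, ← ENNReal.rpow_mul]
    norm_num
  rw [e3, ← ENNReal.mul_rpow_of_nonneg _ _ (by norm_num : (0 : ℝ) ≤ 1 / 2),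
    ← ENNReal.tsum_mul_left]
  refine ENNReal.rpow_le_rpow (ENNReal.tsum_le_tsum fun n => ?_) (by norm_num)
  rw [← mul_pow]
  exact pow_le_pow_left' (hterm n) 2

theorem opNorm_le {r' η' : ℝ} {T : Sobolev P r η →ₗ[ℂ] 𝓢'(Eucl d, ℂ)} {C : ℝ≥0∞}
    (h : ∀ u, sobolevNorm P r' η' 1 (T u) ≤ C * sobolevNorm P r η 1 (u : 𝓢'(Eucl d, ℂ))) :
    opNorm P r η r' η' T ≤ C :=
  sInf_le h

theorem sobolevNorm_le_opNorm_mul {r' η' : ℝ} (T : Sobolev P r η →ₗ[ℂ] 𝓢'(Eucl d, ℂ))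
    {C : ℝ≥0∞} (hC : opNorm P r η r' η' T < C) (u : Sobolev P r η) :
    sobolevNorm P r' η' 1 (T u) ≤ C * sobolevNorm P r η 1 (u : 𝓢'(Eucl d, ℂ)) := by
  obtain ⟨D, hD, hlt⟩ := sInf_lt_iff.1 hC
  exact (hD u).trans (mul_le_mul_left hlt.le _)

end DyadicPartition

end LiftOperator

/-! ### Schwartz functions in weighted Sobolev spaces -/

section Density

variable {d : ℕ}

theorem eq_zero_of_weightedL2Norm_eq_zero {η lam : ℝ} {u : 𝓢'(Eucl d, ℂ)}
    (h : weightedL2Norm η lam u = 0) : u = 0 := by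
  ext g
  have h1 := enorm_apply_le_weightedL2Norm η lam u g
  rw [h, zero_mul, nonpos_iff_eq_zero, enorm_eq_zero] at h1
  exact h1

namespace DyadicPartition

variable (P : DyadicPartition d) {r η : ℝ}

theorem sobolevNorm_eq_rpow (r η lam : ℝ) (u : 𝓢'(Eucl d, ℂ)) : sobolevNorm P r η lam u =
    (∑' n : ℕ, (ENNReal.ofReal ((2 : ℝ) ^ (((n : ℝ) - 1) * r)) *
      weightedL2Norm η lam (P.block n u)) ^ 2) ^ (1 / 2 : ℝ) := rfl

theorem weightedL2Norm_block_lt_top_of_mem {v : 𝓢'(Eucl d, ℂ)} (hv : v ∈ WeightedL2 d η) (n : ℕ) :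
    weightedL2Norm η 1 (P.block n v) < ⊤ :=
  (P.weightedL2Norm_block_le η n v).trans_lt
    (ENNReal.mul_lt_top (P.multiplierBound_ne_top _).lt_top hv)

theorem fourierMultiplierCLM_coe {ψ : Eucl d → ℂ} (hψ : ψ.HasTemperateGrowth) (f : 𝓢(Eucl d, ℂ)) :
    TemperedDistribution.fourierMultiplierCLM ℂ ψ (f : 𝓢'(Eucl d, ℂ)) =
      (SchwartzMap.fourierMultiplierCLM ℂ ψ f : 𝓢(Eucl d, ℂ)) :=
  fourierMultiplierCLM_toTemperedDistributionCLM_eq hψ f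

/-- Dividing out `|ξ| ^ (2M)` gives the decay `4 ^ (-m M)` of the blocks, which beats `2 ^ (m r)`
once `M ≥ r + 1`. -/
theorem coe_mem_sobolev (r η : ℝ) (f : 𝓢(Eucl d, ℂ)) : (f : 𝓢'(Eucl d, ℂ)) ∈ Sobolev P r η := by
  obtain ⟨M, hM⟩ := exists_nat_ge (r + 1)
  set x : ℕ → ℝ≥0∞ := fun n => ENNReal.ofReal ((2 : ℝ) ^ (((n : ℝ) - 1) * r)) *
    weightedL2Norm η 1 (P.block n (f : 𝓢'(Eucl d, ℂ))) with hx
  have hfin : weightedL2Norm η 1 (TemperedDistribution.fourierMultiplierCLM ℂ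
      (fun ξ => (((‖ξ‖ ^ 2) ^ M : ℝ) : ℂ)) (f : 𝓢'(Eucl d, ℂ))) < ⊤ := by
    rw [fourierMultiplierCLM_coe (hasTemperateGrowth_norm_sq_pow M)]
    exact coe_mem_weightedL2 η _
  set C := multiplierNorm (-η) (P.schwartzφDiv M) *
    weightedL2Norm η 1 (TemperedDistribution.fourierMultiplierCLM ℂ
      (fun ξ => (((‖ξ‖ ^ 2) ^ M : ℝ) : ℂ)) (f : 𝓢'(Eucl d, ℂ))) with hC
  have hCt : C ≠ ⊤ := ENNReal.mul_ne_top (multiplierNorm_lt_top _ _).ne hfin.ne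
  have hx0 : x 0 ≠ ⊤ := ENNReal.mul_ne_top ENNReal.ofReal_ne_top
    (P.weightedL2Norm_block_lt_top_of_mem (coe_mem_weightedL2 η f) 0).ne
  have hsucc : ∀ m, x (m + 1) ≤ C * 2⁻¹ ^ m := by
    intro m
    have h2 : (2 : ℝ) ^ ((((m + 1 : ℕ) : ℝ) - 1) * r) * (((2 : ℝ) ^ m)⁻¹ ^ 2) ^ M ≤ 2⁻¹ ^ m := by
      have e1 : (((2 : ℝ) ^ m)⁻¹ ^ 2) ^ M = (2 : ℝ) ^ (-((m : ℝ) * (2 * M))) := by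
        rw [Real.rpow_neg (by norm_num), Real.rpow_mul (by norm_num), Real.rpow_natCast,
          show (2 * (M : ℝ)) = ((2 * M : ℕ) : ℝ) by push_cast; ring, Real.rpow_natCast, pow_mul]
        simp only [inv_pow]
      have e2 : (2 : ℝ)⁻¹ ^ m = (2 : ℝ) ^ (-(m : ℝ)) := by
        rw [Real.rpow_neg (by norm_num), Real.rpow_natCast, inv_pow]
      rw [e1, e2, ← Real.rpow_add (by norm_num)]
      refine Real.rpow_le_rpow_of_exponent_le (by norm_num) ?_
      push_cast
      have hm : (0 : ℝ) ≤ m := m.cast_nonneg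
      have hM0 : (0 : ℝ) ≤ M := M.cast_nonneg
      nlinarith [mul_le_mul_of_nonneg_left hM hm, mul_nonneg hm hM0]
    calc x (m + 1) ≤ ENNReal.ofReal ((2 : ℝ) ^ ((((m + 1 : ℕ) : ℝ) - 1) * r)) *
          (multiplierNorm (-η) (P.schwartzφDiv M) *
            (ENNReal.ofReal ((((2 : ℝ) ^ m)⁻¹ ^ 2) ^ M) * _)) :=
          mul_le_mul_right (P.weightedL2Norm_block_succ_le η M m _) _
      _ = C * ENNReal.ofReal ((2 : ℝ) ^ ((((m + 1 : ℕ) : ℝ) - 1) * r) *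
            (((2 : ℝ) ^ m)⁻¹ ^ 2) ^ M) := by
          rw [ENNReal.ofReal_mul (by positivity), hC]
          ring
      _ ≤ C * ENNReal.ofReal (2⁻¹ ^ m) :=
          mul_le_mul_right (ENNReal.ofReal_le_ofReal h2) _
      _ = C * 2⁻¹ ^ m := by
          rw [ENNReal.ofReal_pow (by norm_num), ENNReal.ofReal_inv_of_pos (by norm_num)]
          norm_num
  have hsum : ∑' n, x n ^ 2 ≠ ⊤ := by
    rw [tsum_eq_zero_add' ENNReal.summable]
    refine ENNReal.add_ne_top.2 ⟨ENNReal.pow_ne_top hx0, ne_top_of_le_ne_top ?_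
      (ENNReal.tsum_le_tsum fun m => (?_ : x (m + 1) ^ 2 ≤ C ^ 2 * 2⁻¹ ^ m))⟩
    · rw [ENNReal.tsum_mul_left, ENNReal.tsum_geometric_two]
      exact ENNReal.mul_ne_top (ENNReal.pow_ne_top hCt) (by norm_num)
    · calc x (m + 1) ^ 2 ≤ (C * 2⁻¹ ^ m) ^ 2 := pow_le_pow_left' (hsucc m) 2
        _ = C ^ 2 * (2⁻¹ ^ m * 2⁻¹ ^ m) := by ring
        _ ≤ C ^ 2 * (2⁻¹ ^ m * 1) := by
          gcongr
          exact pow_le_one₀ zero_le (by norm_num)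
        _ = _ := by rw [mul_one]
  exact (sobolevNorm_lt_top_iff P r η 1 _).2 hsum

theorem lowPass_mul_schwartzCutoff {n N : ℕ} (h : n < N) (ξ : Eucl d) :
    P.schwartzCutoff n ξ * P.lowPass N ξ = P.schwartzCutoff n ξ := by
  rcases le_or_gt ‖ξ‖ (4 / 3 * 2 ^ n) with hξ | hξ
  · rw [P.lowPass_eq_one, mul_one]
    have h1 : (2 : ℝ) ^ (n + 1) ≤ 2 ^ N := pow_le_pow_right₀ (by norm_num) h
    rw [pow_succ] at h1
    have : (0 : ℝ) < 2 ^ n := by positivity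
    linarith
  · rw [schwartzCutoff_apply, P.cutoff_eq_zero_of_gt hξ]
    simp

theorem lowPass_mul_schwartzCutoff_eq_zero {n N : ℕ} (h : N + 2 ≤ n) (ξ : Eucl d) :
    P.lowPass N ξ * P.schwartzCutoff n ξ = 0 := by
  rcases le_or_gt ‖ξ‖ (4 / 3 * 2 ^ N) with hξ | hξ
  · obtain ⟨m, rfl⟩ : ∃ m, n = m + 1 := ⟨n - 1, by omega⟩
    rw [schwartzCutoff_apply, P.cutoff_succ_eq_zero_of_lt]
    · simp
    · have h1 : (2 : ℝ) ^ (N + 1) ≤ 2 ^ m := pow_le_pow_right₀ (by norm_num) (by omega)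
      rw [pow_succ] at h1
      have : (0 : ℝ) < 2 ^ N := by positivity
      linarith
  · rw [P.lowPass_eq_zero hξ, zero_mul]

theorem lowPass_mul_lowPass {N : ℕ} (ξ : Eucl d) :
    P.lowPass N ξ * P.lowPass (N + 1) ξ = P.lowPass N ξ := by
  rcases le_or_gt ‖ξ‖ (4 / 3 * 2 ^ N) with hξ | hξ
  · rw [P.lowPass_eq_one (N := N + 1), mul_one]
    rw [pow_succ]
    have : (0 : ℝ) < 2 ^ N := by positivity
    linarith
  · rw [P.lowPass_eq_zero hξ, zero_mul]

/-! ### Approximation by frequency truncation -/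

/-- The low frequency part of a tempered distribution -/
def truncate (N : ℕ) : 𝓢'(Eucl d, ℂ) →L[ℂ] 𝓢'(Eucl d, ℂ) :=
  TemperedDistribution.fourierMultiplierCLM ℂ (fun ξ => P.lowPass N ξ)

theorem truncate_eq_sum (N : ℕ) (u : 𝓢'(Eucl d, ℂ)) :
    P.truncate N u = ∑ n ∈ Finset.range (N + 1), P.block n u := by
  simp_rw [truncate, ← sum_range_schwartzCutoff]
  rw [TemperedDistribution.fourierMultiplierCLM_sum ℂ
    fun i _ => (P.schwartzCutoff i).hasTemperateGrowth, sum_apply]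
  exact Finset.sum_congr rfl fun j _ => (P.block_eq j u).symm

theorem weightedL2Norm_truncate_le (η : ℝ) (N : ℕ) (u : 𝓢'(Eucl d, ℂ)) :
    weightedL2Norm η 1 (P.truncate N u) ≤ P.multiplierBound (-η) * weightedL2Norm η 1 u :=
  (weightedL2Norm_fourierMultiplierCLM_le η P.schwartzχ (inv_two_pow_mem N) u).trans
    (mul_le_mul_left (le_max_left _ _) _)

theorem block_truncate (n N : ℕ) (u : 𝓢'(Eucl d, ℂ)) : P.block n (P.truncate N u) =
    TemperedDistribution.fourierMultiplierCLM ℂ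
      (fun ξ => P.lowPass N ξ * P.schwartzCutoff n ξ) u := by
  rw [block_eq]
  exact fourierMultiplierCLM_comp (P.lowPass N).hasTemperateGrowth
    (P.schwartzCutoff n).hasTemperateGrowth u

theorem block_truncate_comm (n N : ℕ) (u : 𝓢'(Eucl d, ℂ)) :
    P.block n (P.truncate N u) = P.truncate N (P.block n u) := by
  rw [block_truncate, block_eq]
  simp_rw [mul_comm (P.lowPass N _)]
  exact (fourierMultiplierCLM_comp (P.schwartzCutoff n).hasTemperateGrowth
    (P.lowPass N).hasTemperateGrowth u).symm

theorem block_truncate_of_lt {n N : ℕ} (h : n < N) (u : 𝓢'(Eucl d, ℂ)) :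
    P.block n (P.truncate N u) = P.block n u := by
  rw [block_truncate, block_eq]
  simp_rw [mul_comm (P.lowPass N _), P.lowPass_mul_schwartzCutoff h]

theorem block_truncate_of_ge {n N : ℕ} (h : N + 2 ≤ n) (u : 𝓢'(Eucl d, ℂ)) :
    P.block n (P.truncate N u) = 0 := by
  rw [block_truncate]
  simp_rw [P.lowPass_mul_schwartzCutoff_eq_zero h]
  exact fourierMultiplierCLM_zero_apply u

theorem truncate_truncate (N : ℕ) (u : 𝓢'(Eucl d, ℂ)) :
    P.truncate (N + 1) (P.truncate N u) = P.truncate N u := by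
  have h := fourierMultiplierCLM_comp (P.lowPass N).hasTemperateGrowth
    (P.lowPass (N + 1)).hasTemperateGrowth u
  simp_rw [lowPass_mul_lowPass] at h
  exact h

theorem exists_sobolevNorm_sub_truncate_le {u : 𝓢'(Eucl d, ℂ)} (hu : u ∈ Sobolev P r η)
    {ε : ℝ≥0∞} (hε : 0 < ε) : ∃ N, sobolevNorm P r η 1 (u - P.truncate N u) ≤ ε := by
  set x : ℕ → ℝ≥0∞ := fun n => ENNReal.ofReal ((2 : ℝ) ^ (((n : ℝ) - 1) * r)) *
    weightedL2Norm η 1 (P.block n u) with hx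
  have hfin : ∑' n, x n ^ 2 ≠ ⊤ := (sobolevNorm_lt_top_iff P r η 1 u).1 hu
  set K := 1 + P.multiplierBound (-η) with hK
  have hKt : K ≠ ⊤ := ENNReal.add_ne_top.2 ⟨ENNReal.one_ne_top, P.multiplierBound_ne_top _⟩
  have hlim : Tendsto (fun N => K ^ 2 * ∑' k, x (k + N) ^ 2) atTop (𝓝 (K ^ 2 * 0)) :=
    ENNReal.Tendsto.const_mul (ENNReal.tendsto_sum_nat_add _ hfin)
      (Or.inr (ENNReal.pow_ne_top hKt))
  rw [mul_zero] at hlim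
  obtain ⟨N, hN⟩ := (hlim.eventually_lt_const (by positivity : 0 < ε ^ 2)).exists
  refine ⟨N, ?_⟩
  rw [sobolevNorm_eq_rpow]
  have e3 : ε = (ε ^ 2) ^ (1 / 2 : ℝ) := by
    rw [← ENNReal.rpow_natCast, ← ENNReal.rpow_mul]
    norm_num
  rw [e3]
  refine ENNReal.rpow_le_rpow (le_trans ?_ hN.le) (by norm_num)
  rw [← ENNReal.summable.sum_add_tsum_nat_add' (k := N)]
  have h0 : ∑ n ∈ Finset.range N, (ENNReal.ofReal ((2 : ℝ) ^ (((n : ℝ) - 1) * r)) *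
      weightedL2Norm η 1 (P.block n (u - P.truncate N u))) ^ 2 = 0 := by
    refine Finset.sum_eq_zero fun n hn => ?_
    rw [map_sub, P.block_truncate_of_lt (Finset.mem_range.1 hn), sub_self, weightedL2Norm_zero]
    simp
  rw [h0, zero_add, ← ENNReal.tsum_mul_left]
  refine ENNReal.tsum_le_tsum fun k => ?_
  rw [← mul_pow]
  refine pow_le_pow_left' ?_ 2
  have h1 : weightedL2Norm η 1 (P.block (k + N) (u - P.truncate N u)) ≤
      K * weightedL2Norm η 1 (P.block (k + N) u) := by
    rw [map_sub, block_truncate_comm, hK, add_mul, one_mul]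
    exact (weightedL2Norm_sub_le _ _ _ _).trans
      (add_le_add le_rfl (P.weightedL2Norm_truncate_le η N _))
  calc _ ≤ _ := mul_le_mul_right h1 _
    _ = _ := by ring

theorem truncate_mem_weightedL2 {u : 𝓢'(Eucl d, ℂ)} (hu : u ∈ Sobolev P r η) (N : ℕ) :
    P.truncate N u ∈ WeightedL2 d η := by
  rw [truncate_eq_sum]
  exact Submodule.sum_mem _ fun n _ => mem_weightedL2.2
    ((P.weightedL2Norm_block_le_sobolevNorm r η 1 n u).trans_lt
      (ENNReal.mul_lt_top ENNReal.ofReal_lt_top hu))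

/-- The truncation belongs to the weighted `L²` space and is approximated there by a Schwartz
function, which is truncated again at level `N + 1`. The difference then has at most `N + 3`
non-zero blocks, so the Sobolev norm is controlled by the `L²` norm whatever `r` is. -/
theorem exists_sobolevNorm_truncate_sub_le {u : 𝓢'(Eucl d, ℂ)} (hu : u ∈ Sobolev P r η) (N : ℕ)
    {ε : ℝ≥0∞} (hε : 0 < ε) : ∃ f : 𝓢(Eucl d, ℂ),
      sobolevNorm P r η 1 (P.truncate N u - (f : 𝓢'(Eucl d, ℂ))) ≤ ε := by
  set K := P.multiplierBound (-η) with hK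
  have hKt : K ≠ ⊤ := P.multiplierBound_ne_top _
  set D := ∑ n ∈ Finset.range (N + 3), (ENNReal.ofReal ((2 : ℝ) ^ (((n : ℝ) - 1) * r)) *
    (K * K)) ^ 2 with hD
  have hDt : D ≠ ⊤ := ENNReal.sum_ne_top.2 fun n _ => ENNReal.pow_ne_top
    (ENNReal.mul_ne_top ENNReal.ofReal_ne_top (ENNReal.mul_ne_top hKt hKt))
  have hD2 : D ^ (1 / 2 : ℝ) ≠ ⊤ := ENNReal.rpow_ne_top_of_nonneg (by norm_num) hDt
  obtain ⟨f, hf⟩ := exists_schwartz_weightedL2Norm_sub_lt (P.truncate_mem_weightedL2 hu N)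
    (ε := ε / (D ^ (1 / 2 : ℝ) + 1)) (ENNReal.div_pos hε.ne'
      (ENNReal.add_ne_top.2 ⟨hD2, ENNReal.one_ne_top⟩))
  set w := P.truncate N u - (f : 𝓢'(Eucl d, ℂ)) with hw
  refine ⟨SchwartzMap.fourierMultiplierCLM ℂ (fun ξ => P.lowPass (N + 1) ξ) f, ?_⟩
  have e : P.truncate N u - ((SchwartzMap.fourierMultiplierCLM ℂ (fun ξ => P.lowPass (N + 1) ξ) f
      : 𝓢(Eucl d, ℂ)) : 𝓢'(Eucl d, ℂ)) = P.truncate (N + 1) w := by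
    rw [hw, map_sub, truncate_truncate]
    congr 1
    exact (fourierMultiplierCLM_coe (P.lowPass (N + 1)).hasTemperateGrowth f).symm
  rw [e, sobolevNorm_eq_rpow, tsum_eq_sum (s := Finset.range (N + 3)) fun n hn => ?_]
  · calc _ ≤ (D * weightedL2Norm η 1 w ^ 2) ^ (1 / 2 : ℝ) := by
          refine ENNReal.rpow_le_rpow ?_ (by norm_num)
          rw [hD, Finset.sum_mul]
          refine Finset.sum_le_sum fun n _ => ?_
          rw [← mul_pow]
          refine pow_le_pow_left' ?_ 2
          rw [mul_assoc, mul_assoc]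
          exact mul_le_mul_right ((P.weightedL2Norm_block_le η n _).trans
            (mul_le_mul_right (P.weightedL2Norm_truncate_le η _ w) _)) _
      _ = D ^ (1 / 2 : ℝ) * weightedL2Norm η 1 w := by
          rw [ENNReal.mul_rpow_of_nonneg _ _ (by norm_num), ← ENNReal.rpow_natCast,
            ← ENNReal.rpow_mul]
          norm_num
      _ ≤ (D ^ (1 / 2 : ℝ) + 1) * (ε / (D ^ (1 / 2 : ℝ) + 1)) := by
          exact mul_le_mul' le_self_add hf.le
      _ = ε := ENNReal.mul_div_cancel (by simp) (ENNReal.add_ne_top.2 ⟨hD2, ENNReal.one_ne_top⟩)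
  · rw [Finset.mem_range, not_lt] at hn
    rw [P.block_truncate_of_ge (by omega), weightedL2Norm_zero]
    simp

/-- A linear map on `H^r(⟨x⟩ ^ η)` with bounded Littlewood-Paley blocks vanishes if it vanishes on
Schwartz functions. -/
theorem eq_zero_of_forall_coe {η' : ℝ} {T : Sobolev P r η →ₗ[ℂ] 𝓢'(Eucl d, ℂ)}
    {C : ℕ → ℝ≥0∞} (hC : ∀ n, C n ≠ ⊤)
    (hT : ∀ u n, weightedL2Norm η' 1 (P.block n (T u)) ≤
      C n * sobolevNorm P r η 1 (u : 𝓢'(Eucl d, ℂ)))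
    (h : ∀ f : 𝓢(Eucl d, ℂ), T ⟨f, P.coe_mem_sobolev r η f⟩ = 0) : T = 0 := by
  have key : ∀ u n, weightedL2Norm η' 1 (P.block n (T u)) = 0 := by
    intro u n
    have hle : ∀ ε : ℝ≥0∞, 0 < ε → weightedL2Norm η' 1 (P.block n (T u)) ≤ C n * (2 * ε) := by
      intro ε hε
      rcases eq_or_ne ε ⊤ with rfl | hεt
      · rcases eq_or_ne (C n) 0 with h0 | h0
        · have := hT u n
          rw [h0, zero_mul] at this
          exact this.trans zero_le
        · simp [ENNReal.mul_top h0]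
      obtain ⟨N, hN⟩ := P.exists_sobolevNorm_sub_truncate_le u.2 hε
      obtain ⟨f, hf⟩ := P.exists_sobolevNorm_truncate_sub_le u.2 N hε
      set u₁ : Sobolev P r η := ⟨_, hN.trans_lt hεt.lt_top⟩ with hu₁
      set u₂ : Sobolev P r η := ⟨_, hf.trans_lt hεt.lt_top⟩ with hu₂
      have e : u = u₁ + u₂ + ⟨f, P.coe_mem_sobolev r η f⟩ := by
        ext1
        rw [Submodule.coe_add, Submodule.coe_add]
        simp only [hu₁, hu₂]
        abel
      have e2 : P.block n (T u) = P.block n (T u₁) + P.block n (T u₂) := by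
        conv_lhs => rw [e]
        rw [map_add, map_add, h, map_zero, add_zero, map_add, map_add]
      rw [e2]
      calc _ ≤ C n * ε + C n * ε := (weightedL2Norm_add_le _ _ _ _).trans
            (add_le_add ((hT u₁ n).trans (mul_le_mul_right hN _))
              ((hT u₂ n).trans (mul_le_mul_right hf _)))
        _ = _ := by ring
    rw [← nonpos_iff_eq_zero]
    refine ENNReal.le_of_forall_pos_le_add fun δ hδ _ => ?_
    rw [zero_add]
    refine (hle (δ / (2 * (C n + 1))) (ENNReal.div_pos (by simpa using hδ.ne')
      (ENNReal.mul_ne_top (by norm_num)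
        (ENNReal.add_ne_top.2 ⟨hC n, ENNReal.one_ne_top⟩)))).trans ?_
    calc C n * (2 * (δ / (2 * (C n + 1)))) = (2 * C n) * (δ / (2 * (C n + 1))) := by ring
      _ ≤ (2 * (C n + 1)) * (δ / (2 * (C n + 1))) :=
        mul_le_mul_left (mul_le_mul_right le_self_add _) _
      _ = δ := ENNReal.mul_div_cancel (by simp)
        (ENNReal.mul_ne_top (by norm_num) (ENNReal.add_ne_top.2 ⟨hC n, ENNReal.one_ne_top⟩))
  ext1 u
  refine P.eq_of_block_eq fun n => ?_
  rw [eq_zero_of_weightedL2Norm_eq_zero (key u n), LinearMap.zero_apply, map_zero]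

end DyadicPartition

end Density

/-! ### Operators on weighted Sobolev spaces from bilinear forms -/

section Operator

variable {d : ℕ}

theorem multiplier_lift_eq (P : DyadicPartition d) {r η η₀ : ℝ} (h0 : 0 ≤ η₀) (h : η₀ ≤ η)
    {L : WeightedL2 d η₀ →ₗ[ℂ] 𝓢'(Eucl d, ℂ)} {m : Eucl d → ℂ} (hm : m.HasTemperateGrowth)
    (hinv : ∀ v g, L v (transposeMultiplier m g) = (v : 𝓢'(Eucl d, ℂ)) g)
    {T : Sobolev P r η →ₗ[ℂ] 𝓢'(Eucl d, ℂ)}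
    (hT : ∀ u n, P.block n (T u) = L (P.blockMap h0 h n u)) (u : Sobolev P r η) :
    TemperedDistribution.fourierMultiplierCLM ℂ m (T u) = u := by
  refine P.eq_of_block_eq fun n => ?_
  ext g
  have hc := (P.schwartzCutoff n).hasTemperateGrowth
  have e : transposeMultiplier m (transposeMultiplier (fun ξ => P.schwartzCutoff n ξ) g) =
      transposeMultiplier (fun ξ => P.schwartzCutoff n ξ) (transposeMultiplier m g) := by
    rw [transposeMultiplier_comp hm hc, transposeMultiplier_comp hc hm]
    simp_rw [mul_comm]
  rw [P.block_apply, fourierMultiplierCLM_apply_eq, e, ← P.block_apply, hT, hinv]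
  rfl

/-- Commutation is only available for Schwartz symbols, and `m` merely has temperate growth. On the
`n`-th block `m` may be replaced by its product with the fat cutoff, which is a Schwartz function.
-/
theorem lift_multiplier_eq (P : DyadicPartition d) {r η η₀ : ℝ} (h0 : 0 ≤ η₀) (h : η₀ ≤ η)
    {L : WeightedL2 d η₀ →ₗ[ℂ] 𝓢'(Eucl d, ℂ)} {m : Eucl d → ℂ} (hm : m.HasTemperateGrowth)
    (hcomm : ∀ (ψ : 𝓢(Eucl d, ℂ)) v g,
      L (weightedMultiplier η₀ ψ v) g = L v (transposeMultiplier ψ g))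
    (hinv : ∀ v g, L v (transposeMultiplier m g) = (v : 𝓢'(Eucl d, ℂ)) g)
    {T : Sobolev P r η →ₗ[ℂ] 𝓢'(Eucl d, ℂ)}
    (hT : ∀ u n, P.block n (T u) = L (P.blockMap h0 h n u)) (u u' : Sobolev P r η)
    (hu' : (u' : 𝓢'(Eucl d, ℂ)) = TemperedDistribution.fourierMultiplierCLM ℂ m u) :
    T u' = u := by
  refine P.eq_of_block_eq fun n => ?_
  ext g
  have hf := (P.fatCutoff n).hasTemperateGrowth
  have hc := (P.schwartzCutoff n).hasTemperateGrowth
  set ψ := SchwartzMap.smulLeftCLM ℂ m (P.fatCutoff n) with hψ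
  have hψ' : ∀ ξ, ψ ξ = m ξ * P.fatCutoff n ξ := fun ξ => by
    rw [hψ, SchwartzMap.smulLeftCLM_apply_apply hm, smul_eq_mul]
  have e1 : P.blockMap h0 h n u' = weightedMultiplier η₀ ψ (P.blockMap h0 h n u) := by
    ext1
    rw [coe_weightedMultiplier, P.coe_blockMap, P.coe_blockMap, hu', P.block_eq, P.block_eq,
      fourierMultiplierCLM_comp hm hc, fourierMultiplierCLM_comp hc ψ.hasTemperateGrowth]
    congr 2
    ext ξ
    rw [hψ', mul_left_comm, mul_comm (P.schwartzCutoff n ξ), P.fatCutoff_mul]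
  have e2 : transposeMultiplier ψ g = transposeMultiplier (fun ξ => m ξ * P.fatCutoff n ξ) g :=
    congrArg (fun θ => transposeMultiplier θ g) (funext hψ')
  rw [hT, e1, hcomm, e2, ← transposeMultiplier_comp hm hf, hinv,
    ← fourierMultiplierCLM_apply_eq, P.coe_blockMap,
    P.fourierMultiplierCLM_fatCutoff_block]

/-- The operator on `H^r(⟨x⟩ ^ η)` that belongs to a bounded bilinear form which commutes with
Fourier multipliers -/
theorem exists_operator (P : DyadicPartition d) {η₀ η : ℝ} (h0 : 0 ≤ η₀) (h : η₀ ≤ η) (r : ℝ)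
    (B : 𝓢(Eucl d, ℂ) →ₗ[ℂ] 𝓢(Eucl d, ℂ) →ₗ[ℂ] ℂ) {A : ℝ≥0∞} (hA : A ≠ ⊤)
    (hB : ∀ f g, ‖B f g‖ₑ ≤ A * (‖wL2 η₀ f‖ₑ * ‖wL2 η₀ g‖ₑ))
    (hcomm : ∀ ψ f g : 𝓢(Eucl d, ℂ),
      B (SchwartzMap.fourierMultiplierCLM ℂ (fun ξ => ψ ξ) f) g = B f (transposeMultiplier ψ g)) :
    ∃ T : Sobolev P r η →ₗ[ℂ] 𝓢'(Eucl d, ℂ),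
      (∀ f g : 𝓢(Eucl d, ℂ), T ⟨(f : 𝓢'(Eucl d, ℂ)), P.coe_mem_sobolev r η f⟩ g = B f g) ∧
      (∀ (s : ℝ) (c : ℕ → ℝ≥0∞) (K : ℝ≥0∞), (∀ n, c n ≠ ⊤) →
        (∀ n f g, ‖B (SchwartzMap.fourierMultiplierCLM ℂ (fun ξ => P.fatCutoff n ξ) f) g‖ₑ ≤
          c n * (‖wL2 η₀ f‖ₑ * ‖wL2 η₀ g‖ₑ)) →
        (∀ n : ℕ, ENNReal.ofReal ((2 : ℝ) ^ (((n : ℝ) - 1) * s)) * c n ≤ K) →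
        ∀ (u : Sobolev P r η), ∀ lam ∈ Ioc (0 : ℝ) 1,
          sobolevNorm P (r + s) (-η) lam (T u) ≤ K * ENNReal.ofReal (lam ^ (-2 * η)) *
            sobolevNorm P r η lam (u : 𝓢'(Eucl d, ℂ))) ∧
      (∀ m : Eucl d → ℂ, m.HasTemperateGrowth →
        (∀ f g : 𝓢(Eucl d, ℂ), B f (transposeMultiplier m g) = ∫ x, f x * g x) →
        (∀ u : Sobolev P r η, TemperedDistribution.fourierMultiplierCLM ℂ m (T u) = u) ∧
        ∀ u u' : Sobolev P r η, (u' : 𝓢'(Eucl d, ℂ)) =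
          TemperedDistribution.fourierMultiplierCLM ℂ m u → T u' = u) := by
  obtain ⟨L, hLB, hL⟩ := exists_weighted_extension B hA hB
  have hLc : ∀ (ψ : 𝓢(Eucl d, ℂ)) v g,
      L (weightedMultiplier η₀ ψ v) g = L v (transposeMultiplier ψ g) := fun ψ v g =>
by
    refine extension_multiplier_apply hA hL ψ (fun f g => ?_) v g
    rw [hLB f]
    have := hLB (SchwartzMap.fourierMultiplierCLM ℂ (fun ξ => ψ ξ) f) g
    rw [this]
    exact hcomm ψ f g
  obtain ⟨T, hT⟩ := P.exists_lift h0 h hA hL hLc r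
  refine ⟨T, fun f g => ?_, fun s c K hct hc hK u lam hlam => ?_, fun m hm hinv => ?_⟩
  · have h1 := P.lift_eq_of_mem h0 h hLc hT ⟨(f : 𝓢'(Eucl d, ℂ)), P.coe_mem_sobolev r η f⟩
      (coe_mem_weightedL2 η₀ f)
    exact (congrArg (fun w : 𝓢'(Eucl d, ℂ) => w g) h1).trans (hLB f g)
  · refine P.sobolevNorm_lift_le h0 h (fun n v g => ?_) hK hT u hlam
    exact enorm_extension_multiplier_le hA hL (P.fatCutoff n) (hct n)
      (fun f g => (congrArg _ (hLB _ g)).trans_le (hc n f g)) v g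
  · have hLi : ∀ v g, L v (transposeMultiplier m g) = (v : 𝓢'(Eucl d, ℂ)) g := fun v g =>
      extension_apply_eq hA hL (fun f => by
        rw [hLB, hinv, SchwartzMap.coe_apply]
        exact integral_congr_ae (.of_forall fun x => by simp [mul_comm])) v
    exact ⟨multiplier_lift_eq P h0 h hm hLi hT, lift_multiplier_eq P h0 h hm hLc hLi hT⟩

theorem neg_faddeevDiff_eq (k : ℝ) (γ : Eucl d) (u : 𝓢'(Eucl d, ℂ)) :
    -faddeevDiff k γ u = TemperedDistribution.fourierMultiplierCLM ℂ
      (fun ξ => symbol k γ 0 ((2 * Real.pi) • ξ)) u := by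
  have h1 : (fun ξ : Eucl d => ((‖ξ‖ ^ 2 : ℝ) : ℂ)).HasTemperateGrowth := by fun_prop
  have h2 : (fun ξ : Eucl d => ((⟪ξ, γ⟫ : ℝ) : ℂ)).HasTemperateGrowth := by fun_prop
  have hs : ∀ ξ : Eucl d, symbol k γ 0 ((2 * Real.pi) • ξ) =
      (((2 * Real.pi) ^ 2 : ℝ) : ℂ) * ((‖ξ‖ ^ 2 : ℝ) : ℂ) +
        (-((rad k γ ^ 2 : ℝ) : ℂ) + (4 * Real.pi * Complex.I) * ((⟪ξ, γ⟫ : ℝ) : ℂ)) := by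
    intro ξ
    rw [rad_sq]
    unfold symbol
    rw [norm_smul, inner_smul_right, real_inner_comm, mul_pow, Real.norm_of_nonneg (by positivity)]
    push_cast
    ring
  ext g
  rw [fourierMultiplierCLM_apply_eq]
  have e : transposeMultiplier (fun ξ => symbol k γ 0 ((2 * Real.pi) • ξ)) g =
      (((2 * Real.pi) ^ 2 : ℝ) : ℂ) • transposeMultiplier (fun ξ => ((‖ξ‖ ^ 2 : ℝ) : ℂ)) g +
      (-((rad k γ ^ 2 : ℝ) : ℂ) • g +
        (4 * Real.pi * Complex.I) • transposeMultiplier (fun ξ => ((⟪ξ, γ⟫ : ℝ) : ℂ)) g) := by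
    have hinj : Function.Injective (fun g : 𝓢(Eucl d, ℂ) => 𝓕⁻ g) :=
      fun a b hab => by simpa using congrArg (fun x : 𝓢(Eucl d, ℂ) => 𝓕 x) hab
    apply hinj
    ext ξ
    simp only [FourierTransform.fourierInv_add, FourierTransform.fourierInv_smul]
    rw [fourierInv_transposeMultiplier_apply (hasTemperateGrowth_symbol k γ 0), hs]
    simp only [_root_.add_apply, _root_.smul_apply, smul_eq_mul,
      fourierInv_transposeMultiplier_apply h1, fourierInv_transposeMultiplier_apply h2]
    ring
  rw [e, map_add, map_add, map_smul, map_smul, map_smul]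
  unfold faddeevDiff
  rw [TemperedDistribution.laplacian_eq_fourierMultiplierCLM,
    TemperedDistribution.lineDeriv_eq_fourierMultiplierCLM]
  change -((-(2 * Real.pi) ^ 2 : ℝ) • u (transposeMultiplier (fun ξ => ((‖ξ‖ ^ 2 : ℝ) : ℂ)) g) +
    ((rad k γ ^ 2 : ℝ) : ℂ) * u g - (2 : ℂ) * ((2 * Real.pi * Complex.I) *
      u (transposeMultiplier (fun ξ => ((⟪ξ, γ⟫ : ℝ) : ℂ)) g))) = _
  rw [Complex.real_smul]
  simp only [smul_eq_mul]
  push_cast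
  ring

end Operator

/-! ### Frequency localised bounds for the limit form -/

section FrequencyBounds

variable {n : ℕ} {l : Filter ℝ}

/-- A bound for a form on the `j`-th frequency annulus: `b j` at high frequencies -/
def freqBound (A : ℝ≥0∞) (b : ℕ → ℝ) (R : ℝ) (j : ℕ) : ℝ≥0∞ :=
  if 2 ≤ j ∧ 2 * R ≤ 2 ^ j then ENNReal.ofReal (b j) else A

theorem freqBound_ne_top {A : ℝ≥0∞} (hA : A ≠ ⊤) (b : ℕ → ℝ) (R : ℝ) (j : ℕ) :
    freqBound A b R j ≠ ⊤ := by
  unfold freqBound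
  split_ifs
  exacts [ENNReal.ofReal_ne_top, hA]

/-- On the support of the fat cutoff `|ξ| ≥ (3/4) 2 ^ (j - 2)`, and `2π · 3/4 ≥ 4` gives `|2πξ| ≥ 2
^ j`. Since `r_{k,γ} ≤ 2 ^ (j - 1)`, the real part of the symbol is at least `(3/4) 4 ^ j`. -/
theorem four_pow_le_norm_symbol (P : DyadicPartition (n + 2)) {k : ℝ} (hk : 0 < k)
    (γ : Eucl (n + 2)) (τ : ℝ) {j : ℕ} (hj : 2 ≤ j) (hR : 2 * rad k γ ≤ 2 ^ j)
    {ξ : Eucl (n + 2)} (hξ : P.fatCutoff j ξ ≠ 0) :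
    4 ^ j / 2 ≤ ‖symbol k γ τ ((2 * Real.pi) • ξ)‖ := by
  obtain ⟨m, rfl⟩ : ∃ m, j = m + 2 := ⟨j - 2, by omega⟩
  have h1 : 3 / 4 * 2 ^ m ≤ ‖ξ‖ := by
    by_contra! h
    exact hξ (P.fatCutoff_eq_zero h)
  have h2 := sub_rad_sq_le_norm_symbol k γ τ ((2 * Real.pi) • ξ)
  refine le_trans ?_ h2
  have h3 : (2 : ℝ) ^ (m + 2) ≤ ‖(2 * Real.pi) • ξ‖ := by
    rw [norm_smul, Real.norm_of_nonneg (by positivity), pow_add]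
    have : (0 : ℝ) < 2 ^ m := by positivity
    nlinarith [Real.pi_gt_three, norm_nonneg ξ]
  have h4 : ((2 : ℝ) ^ (m + 2)) ^ 2 = 4 ^ (m + 2) := by
    rw [← pow_mul, mul_comm, pow_mul]
    norm_num
  have h5 := rad_pos hk γ
  have h6 : (rad k γ) ^ 2 ≤ 4 ^ (m + 2) / 4 := by
    rw [← h4]
    nlinarith
  have h7 : (4 : ℝ) ^ (m + 2) ≤ ‖(2 * Real.pi) • ξ‖ ^ 2 := by
    rw [← h4]
    exact pow_le_pow_left₀ (by positivity) h3 2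
  have : (0 : ℝ) < 4 ^ (m + 2) := by positivity
  linarith

theorem norm_fatCutoff_le_symbol (P : DyadicPartition (n + 2)) {k : ℝ} (hk : 0 < k)
    (γ : Eucl (n + 2)) (τ : ℝ) {j : ℕ} (hj : 2 ≤ j) (hR : 2 * rad k γ ≤ 2 ^ j)
    (ξ : Eucl (n + 2)) :
    ‖P.fatCutoff j ξ‖ ≤ 2 * P.fatBound / 4 ^ j * ‖symbol k γ τ ((2 * Real.pi) • ξ)‖ := by
  have hF := P.fatBound_nonneg
  rcases eq_or_ne (P.fatCutoff j ξ) 0 with h0 | h0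
  · rw [h0, norm_zero]
    positivity
  · have h1 := four_pow_le_norm_symbol P hk γ τ hj hR h0
    calc _ ≤ P.fatBound := P.norm_fatCutoff_le j ξ
      _ = 2 * P.fatBound / 4 ^ j * (4 ^ j / 2) := by field_simp
      _ ≤ _ := by gcongr

theorem norm_fatCutoff_le_symbol_mul (P : DyadicPartition (n + 2)) {k : ℝ} (hk : 0 < k)
    (γ : Eucl (n + 2)) (τ τ' : ℝ) {j : ℕ} (hj : 2 ≤ j) (hR : 2 * rad k γ ≤ 2 ^ j)
    (ξ : Eucl (n + 2)) :
    ‖P.fatCutoff j ξ‖ ≤ 4 * P.fatBound / 16 ^ j * (‖symbol k γ τ ((2 * Real.pi) • ξ)‖ *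
      ‖symbol k γ τ' ((2 * Real.pi) • ξ)‖) := by
  have hF := P.fatBound_nonneg
  rcases eq_or_ne (P.fatCutoff j ξ) 0 with h0 | h0
  · rw [h0, norm_zero]
    positivity
  · have h1 := four_pow_le_norm_symbol P hk γ τ hj hR h0
    have h2 := four_pow_le_norm_symbol P hk γ τ' hj hR h0
    have e : (16 : ℝ) ^ j = 4 ^ j * 4 ^ j := by
      rw [← mul_pow]
      norm_num
    calc _ ≤ P.fatBound := P.norm_fatCutoff_le j ξ
      _ = 4 * P.fatBound / 16 ^ j * (4 ^ j / 2 * (4 ^ j / 2)) := by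
          rw [e]
          field_simp
          norm_num
      _ ≤ _ := by gcongr

theorem two_rpow_sub_one_mul (j : ℕ) (s : ℝ) :
    (2 : ℝ) ^ (((j : ℝ) - 1) * s) = (2 ^ j / 2) ^ s := by
  rw [Real.rpow_mul (by norm_num), Real.rpow_sub (by norm_num), Real.rpow_natCast, Real.rpow_one]

/-- A low block has `2 ^ (j - 1) ≤ 1` or `2 ^ (j - 1) < R`. -/
theorem two_rpow_le_of_low {R s : ℝ} (hR : 0 < R) (hs : 0 ≤ s) {j : ℕ}
    (hj : ¬(2 ≤ j ∧ 2 * R ≤ 2 ^ j)) : (2 : ℝ) ^ (((j : ℝ) - 1) * s) ≤ (1 + R) ^ s := by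
  rw [two_rpow_sub_one_mul]
  refine Real.rpow_le_rpow (by positivity) ?_ hs
  rcases lt_or_ge j 2 with h | h
  · have : (2 : ℝ) ^ j ≤ 2 ^ 1 := pow_le_pow_right₀ (by norm_num) (by omega)
    linarith
  · have : (2 : ℝ) ^ j < 2 * R := by
      by_contra! h2
      exact hj ⟨h, h2⟩
    linarith

/-- Here the restriction `s ≤ 2` enters: the left side is at most `(2 ^ j) ^ (s - 2)`, which
decreases in `2 ^ j ≥ 1 + R`, and `(1 + R)²` exceeds `min(R, 1) R`. -/
theorem two_rpow_mul_le_of_high {R s : ℝ} (hR : 0 < R) (hs : s ∈ Icc (0 : ℝ) 2) {j : ℕ}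
    (hj : 2 ≤ j ∧ 2 * R ≤ 2 ^ j) :
    (2 : ℝ) ^ (((j : ℝ) - 1) * s) * (4 ^ j)⁻¹ ≤ (1 + R) ^ s / (min R 1 * R) := by
  have h4 : (4 : ℝ) ^ j = (2 ^ j) ^ (2 : ℝ) := by
    rw [Real.rpow_two, ← pow_mul, mul_comm, pow_mul]
    norm_num
  have h2j : (2 : ℝ) ^ 2 ≤ 2 ^ j := pow_le_pow_right₀ (by norm_num) hj.1
  have hX : 1 + R ≤ (2 : ℝ) ^ j := by linarith [hj.2]
  have hm : 0 < min R 1 := lt_min hR one_pos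
  calc (2 : ℝ) ^ (((j : ℝ) - 1) * s) * (4 ^ j)⁻¹ ≤ (2 ^ j) ^ s * (4 ^ j)⁻¹ := by
        rw [two_rpow_sub_one_mul]
        gcongr
        · exact hs.1
        · exact half_le_self (by positivity)
    _ = ((2 : ℝ) ^ j) ^ (s - 2) := by
        rw [Real.rpow_sub (by positivity), h4, div_eq_mul_inv]
    _ ≤ (1 + R) ^ (s - 2) :=
        Real.rpow_le_rpow_of_nonpos (by positivity) hX (by linarith [hs.2])
    _ = (1 + R) ^ s / (1 + R) ^ 2 := by
        rw [Real.rpow_sub (by positivity), Real.rpow_two]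
    _ ≤ _ := by
        gcongr
        have : min R 1 ≤ 1 := min_le_right _ _
        nlinarith

theorem two_rpow_mul_le_of_le_two {s : ℝ} (hs : s ∈ Icc (0 : ℝ) 2) (j : ℕ) :
    (2 : ℝ) ^ (((j : ℝ) - 1) * s) * (16 ^ j)⁻¹ ≤ 1 := by
  have h1 : (1 : ℝ) ≤ 2 ^ j := one_le_pow₀ (by norm_num)
  rw [← div_eq_mul_inv, div_le_one (by positivity), two_rpow_sub_one_mul]
  calc ((2 : ℝ) ^ j / 2) ^ s ≤ (2 ^ j) ^ s :=
        Real.rpow_le_rpow (by positivity) (half_le_self (by positivity)) hs.1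
    _ ≤ (2 ^ j) ^ (2 : ℝ) := Real.rpow_le_rpow_of_exponent_le h1 hs.2
    _ ≤ 16 ^ j := by
        rw [Real.rpow_two, ← pow_mul, mul_comm, pow_mul]
        gcongr
        norm_num

/-- High blocks use the unweighted bound `hb`. On low blocks the cutoff is moved to `g`, where it
acts boundedly on the weighted space, and the bound of the full form applies. -/
theorem enorm_form_fatCutoff_le {d : ℕ} (P : DyadicPartition d) {η : ℝ} (hη : 0 ≤ η)
    {B : 𝓢(Eucl d, ℂ) →ₗ[ℂ] 𝓢(Eucl d, ℂ) →ₗ[ℂ] ℂ} {A : ℝ≥0∞}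
    (hB : ∀ f g, ‖B f g‖ₑ ≤ A * (‖wL2 η f‖ₑ * ‖wL2 η g‖ₑ))
    (hcomm : ∀ ψ f g : 𝓢(Eucl d, ℂ),
      B (SchwartzMap.fourierMultiplierCLM ℂ (fun ξ => ψ ξ) f) g = B f (transposeMultiplier ψ g))
    {b : ℕ → ℝ} {R : ℝ} (hb : ∀ j, 2 ≤ j → 2 * R ≤ 2 ^ j → ∀ f g,
      ‖B (SchwartzMap.fourierMultiplierCLM ℂ (fun ξ => P.fatCutoff j ξ) f) g‖ₑ ≤
        ENNReal.ofReal (b j) * (‖f.toLp 2 volume‖ₑ * ‖g.toLp 2 volume‖ₑ))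
    (j : ℕ) (f g : 𝓢(Eucl d, ℂ)) :
    ‖B (SchwartzMap.fourierMultiplierCLM ℂ (fun ξ => P.fatCutoff j ξ) f) g‖ₑ ≤
      freqBound (A * (3 * P.multiplierBound η)) b R j * (‖wL2 η f‖ₑ * ‖wL2 η g‖ₑ) := by
  unfold freqBound
  split_ifs with h
  · exact (hb j h.1 h.2 f g).trans (mul_le_mul_right
      (mul_le_mul' (enorm_toLp_le_wL2 hη f) (enorm_toLp_le_wL2 hη g)) _)
  · rw [hcomm]
    calc _ ≤ A * (‖wL2 η f‖ₑ * (3 * P.multiplierBound η * ‖wL2 η g‖ₑ)) :=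
          (hB _ _).trans (mul_le_mul_right (mul_le_mul_right
            (P.enorm_wL2_transposeMultiplier_fatCutoff_le η j g) _) _)
      _ = _ := by ring

/-! Properties of the limit form -/

theorem neBot_of_side (hl : l = 𝓝[>] 0 ∨ l = 𝓝[<] 0) : l.NeBot := by
  rcases hl with rfl | rfl <;> infer_instance

theorem eventually_ne_of_side (hl : l = 𝓝[>] 0 ∨ l = 𝓝[<] 0) : ∀ᶠ τ in l, τ ≠ 0 := by
  rcases hl with rfl | rfl
  · filter_upwards [self_mem_nhdsWithin] with τ hτ using (ne_of_gt hτ)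
  · filter_upwards [self_mem_nhdsWithin] with τ hτ using (ne_of_lt hτ)

theorem tendsto_id_of_side (hl : l = 𝓝[>] 0 ∨ l = 𝓝[<] 0) : Tendsto (fun τ : ℝ => τ) l (𝓝 0) := by
  rcases hl with rfl | rfl <;> exact tendsto_id.mono_left nhdsWithin_le_nhds

variable {k : ℝ} {γ : Eucl (n + 2)}
  {B : 𝓢(Eucl (n + 2), ℂ) →ₗ[ℂ] 𝓢(Eucl (n + 2), ℂ) →ₗ[ℂ] ℂ}

theorem limit_fourierMultiplierCLM [l.NeBot]
    (hB : ∀ f g, Tendsto (fun τ => faddeevForm k γ τ f g) l (𝓝 (B f g)))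
    {ψ : Eucl (n + 2) → ℂ} (hψ : ψ.HasTemperateGrowth) (f g : 𝓢(Eucl (n + 2), ℂ)) :
    B (SchwartzMap.fourierMultiplierCLM ℂ ψ f) g = B f (transposeMultiplier ψ g) := by
  have h1 := hB (SchwartzMap.fourierMultiplierCLM ℂ ψ f) g
  simp_rw [faddeevForm_fourierMultiplierCLM hψ] at h1
  exact tendsto_nhds_unique h1 (hB _ _)

theorem enorm_limit_le [l.NeBot]
    (hB : ∀ f g, Tendsto (fun τ => faddeevForm k γ τ f g) l (𝓝 (B f g)))
    {f g : 𝓢(Eucl (n + 2), ℂ)} {C : ℝ≥0∞} (h : ∀ τ, ‖faddeevForm k γ τ f g‖ₑ ≤ C) :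
    ‖B f g‖ₑ ≤ C :=
  le_of_tendsto (hB f g).enorm (.of_forall h)

theorem limit_symbol (hl : l = 𝓝[>] 0 ∨ l = 𝓝[<] 0)
    (hB : ∀ f g, Tendsto (fun τ => faddeevForm k γ τ f g) l (𝓝 (B f g)))
    (f g : 𝓢(Eucl (n + 2), ℂ)) :
    B f (transposeMultiplier (fun ξ => symbol k γ 0 ((2 * Real.pi) • ξ)) g) = ∫ x, f x * g x := by
  have := neBot_of_side hl
  have h1 := hB f (transposeMultiplier (fun ξ => symbol k γ 0 ((2 * Real.pi) • ξ)) g)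
  have h2 : Tendsto (fun τ : ℝ => (∫ x, f x * g x) + Complex.I * τ * faddeevForm k γ τ f g) l
      (𝓝 ((∫ x, f x * g x) + Complex.I * ((0 : ℝ) : ℂ) * B f g)) :=
    tendsto_const_nhds.add ((tendsto_const_nhds.mul
      ((Complex.continuous_ofReal.tendsto 0).comp (tendsto_id_of_side hl))).mul (hB f g))
  have h3 := h1.congr' (by
    filter_upwards [eventually_ne_of_side hl] with τ hτ
    exact faddeevForm_symbol k γ hτ f g)
  rw [tendsto_nhds_unique h3 h2]
  simp

theorem enorm_faddeevForm_fatCutoff_le (P : DyadicPartition (n + 2)) (hk : 0 < k) (τ : ℝ) (j : ℕ)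
    (hj : 2 ≤ j) (hR : 2 * rad k γ ≤ 2 ^ j) (f g : 𝓢(Eucl (n + 2), ℂ)) :
    ‖faddeevForm k γ τ (SchwartzMap.fourierMultiplierCLM ℂ (fun ξ => P.fatCutoff j ξ) f) g‖ₑ ≤
      ENNReal.ofReal (2 * P.fatBound / 4 ^ j) * (‖f.toLp 2 volume‖ₑ * ‖g.toLp 2 volume‖ₑ) :=
  enorm_faddeevForm_fourierMultiplierCLM_le (P.fatCutoff j).hasTemperateGrowth k γ τ
    (div_nonneg (mul_nonneg (by norm_num) P.fatBound_nonneg) (by positivity))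
    (norm_fatCutoff_le_symbol P hk γ τ hj hR) f g

theorem enorm_faddeevForm_sub_limit_fatCutoff_le (hl : l = 𝓝[>] 0 ∨ l = 𝓝[<] 0)
    (hB : ∀ f g, Tendsto (fun τ => faddeevForm k γ τ f g) l (𝓝 (B f g)))
    (P : DyadicPartition (n + 2)) (hk : 0 < k) {τ : ℝ} (hτ : τ ≠ 0) (j : ℕ)
    (hj : 2 ≤ j) (hR : 2 * rad k γ ≤ 2 ^ j) (f g : 𝓢(Eucl (n + 2), ℂ)) :
    ‖(faddeevForm k γ τ - B) (SchwartzMap.fourierMultiplierCLM ℂ (fun ξ => P.fatCutoff j ξ) f) g‖ₑ ≤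
      ENNReal.ofReal (4 * P.fatBound / 16 ^ j * |τ|) *
        (‖f.toLp 2 volume‖ₑ * ‖g.toLp 2 volume‖ₑ) := by
  have := neBot_of_side hl
  rw [LinearMap.sub_apply, LinearMap.sub_apply]
  set f' := SchwartzMap.fourierMultiplierCLM ℂ (fun ξ => P.fatCutoff j ξ) f with hf'
  have hlim : Tendsto (fun τ' => ‖faddeevForm k γ τ f' g - faddeevForm k γ τ' f' g‖ₑ) l
      (𝓝 ‖faddeevForm k γ τ f' g - B f' g‖ₑ) := (tendsto_const_nhds.sub (hB f' g)).enorm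
  have hr : Tendsto (fun τ' : ℝ => ENNReal.ofReal (4 * P.fatBound / 16 ^ j * |τ - τ'|) *
        (‖f.toLp 2 volume‖ₑ * ‖g.toLp 2 volume‖ₑ)) l
      (𝓝 (ENNReal.ofReal (4 * P.fatBound / 16 ^ j * |τ - 0|) *
        (‖f.toLp 2 volume‖ₑ * ‖g.toLp 2 volume‖ₑ))) := by
    refine ENNReal.Tendsto.mul_const (ENNReal.tendsto_ofReal ?_)
      (Or.inr (ENNReal.mul_ne_top enorm_ne_top enorm_ne_top))
    exact ((tendsto_const_nhds.sub (tendsto_id_of_side hl)).abs).const_mul _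
  rw [sub_zero] at hr
  refine le_of_tendsto_of_tendsto hlim hr ?_
  filter_upwards [eventually_ne_of_side hl] with τ' hτ'
  exact enorm_faddeevForm_sub_fourierMultiplierCLM_le (P.fatCutoff j).hasTemperateGrowth k γ hτ hτ'
    (div_nonneg (mul_nonneg (by norm_num) P.fatBound_nonneg) (by positivity))
    (norm_fatCutoff_le_symbol_mul P hk γ τ τ' hj hR) f g

end FrequencyBounds

/-! ### The limit operators -/

section LimitOperator

namespace DyadicPartition

variable {d : ℕ} (P : DyadicPartition d) {r η r' η' : ℝ}

theorem sobolevNorm_add_le (r η lam : ℝ) (u v : 𝓢'(Eucl d, ℂ)) :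
    sobolevNorm P r η lam (u + v) ≤ 2 * (sobolevNorm P r η lam u + sobolevNorm P r η lam v) := by
  set x : 𝓢'(Eucl d, ℂ) → ℕ → ℝ≥0∞ := fun u n => ENNReal.ofReal ((2 : ℝ) ^ (((n : ℝ) - 1) * r)) *
    weightedL2Norm η lam (P.block n u) with hx
  have hsq : ∀ a : ℝ≥0∞, (a ^ 2) ^ (1 / 2 : ℝ) = a := fun a => by
    rw [← ENNReal.rpow_natCast, ← ENNReal.rpow_mul]
    norm_num
  have hsq' : ∀ a : ℝ≥0∞, (a ^ (1 / 2 : ℝ)) ^ 2 = a := fun a => by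
    rw [← ENNReal.rpow_natCast, ← ENNReal.rpow_mul]
    norm_num
  have hdef : ∀ u, ∑' n, x u n ^ 2 = sobolevNorm P r η lam u ^ 2 := fun u => by
    rw [sobolevNorm_eq_rpow, hsq']
  rw [← hsq (2 * _), sobolevNorm_eq_rpow]
  refine ENNReal.rpow_le_rpow ?_ (by norm_num)
  have h2 : ∀ a b : ℝ≥0∞, (a + b) ^ 2 ≤ 2 * a ^ 2 + 2 * b ^ 2 := by
    intro a b
    have h := ENNReal.rpow_add_le_mul_rpow_add_rpow a b (p := 2) (by norm_num)
    norm_num [mul_add] at h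
    exact_mod_cast h
  have h3 : ∀ n : ℕ, (ENNReal.ofReal ((2 : ℝ) ^ (((n : ℝ) - 1) * r)) *
      weightedL2Norm η lam (P.block n (u + v))) ^ 2 ≤ 2 * x u n ^ 2 + 2 * x v n ^ 2 := fun n => by
    refine le_trans (pow_le_pow_left' ?_ 2) (h2 _ _)
    rw [hx, ← mul_add, map_add]
    exact mul_le_mul_right (weightedL2Norm_add_le _ _ _ _) _
  refine (ENNReal.tsum_le_tsum h3).trans ?_
  rw [ENNReal.tsum_add, ENNReal.tsum_mul_left, ENNReal.tsum_mul_left, hdef, hdef]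
  set X := sobolevNorm P r η lam u
  set Y := sobolevNorm P r η lam v
  calc 2 * X ^ 2 + 2 * Y ^ 2 ≤ (2 * X ^ 2 + 2 * Y ^ 2) + (2 * X ^ 2 + 2 * Y ^ 2 + 8 * X * Y) :=
        le_self_add
    _ = (2 * (X + Y)) ^ 2 := by ring

theorem opNorm_add_lt_top {T₁ T₂ : Sobolev P r η →ₗ[ℂ] 𝓢'(Eucl d, ℂ)}
    (h₁ : opNorm P r η r' η' T₁ < ⊤) (h₂ : opNorm P r η r' η' T₂ < ⊤) :
    opNorm P r η r' η' (T₁ + T₂) < ⊤ := by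
  obtain ⟨C₁, hC₁, hlt₁⟩ := sInf_lt_iff.1 h₁
  obtain ⟨C₂, hC₂, hlt₂⟩ := sInf_lt_iff.1 h₂
  refine (P.opNorm_le (C := 2 * (C₁ + C₂)) fun u => ?_).trans_lt
    (ENNReal.mul_lt_top (by norm_num) (ENNReal.add_lt_top.2 ⟨hlt₁, hlt₂⟩))
  refine (P.sobolevNorm_add_le _ _ _ _ _).trans ?_
  rw [mul_assoc, add_mul]
  exact mul_le_mul_right (add_le_add (hC₁ u) (hC₂ u)) _

theorem sobolevNorm_le_opNorm {T : Sobolev P r η →ₗ[ℂ] 𝓢'(Eucl d, ℂ)}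
    (hT : opNorm P r η r' η' T < ⊤) (u : Sobolev P r η) :
    sobolevNorm P r' η' 1 (T u) ≤
      opNorm P r η r' η' T * sobolevNorm P r η 1 (u : 𝓢'(Eucl d, ℂ)) := by
  have hu : sobolevNorm P r η 1 (u : 𝓢'(Eucl d, ℂ)) ≠ ⊤ := u.2.ne
  refine ENNReal.le_of_forall_pos_le_add fun δ hδ _ => ?_
  set S := sobolevNorm P r η 1 (u : 𝓢'(Eucl d, ℂ))
  have hS1 : S + 1 ≠ ⊤ := ENNReal.add_ne_top.2 ⟨hu, ENNReal.one_ne_top⟩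
  have hpos : (0 : ℝ≥0∞) < δ / (S + 1) := ENNReal.div_pos (by simpa using hδ.ne') hS1
  calc _ ≤ (opNorm P r η r' η' T + δ / (S + 1)) * S :=
        P.sobolevNorm_le_opNorm_mul T (ENNReal.lt_add_right hT.ne hpos.ne') u
    _ = opNorm P r η r' η' T * S + (δ / (S + 1)) * S := add_mul _ _ _
    _ ≤ opNorm P r η r' η' T * S + (δ / (S + 1)) * (S + 1) :=
        add_le_add le_rfl (mul_le_mul_right le_self_add _)
    _ = _ := by rw [ENNReal.div_mul_cancel (by simp) hS1]

theorem weightedL2Norm_block_le_opNorm {T : Sobolev P r η →ₗ[ℂ] 𝓢'(Eucl d, ℂ)}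
    (hT : opNorm P r η r' η' T < ⊤) (u : Sobolev P r η) (n : ℕ) :
    weightedL2Norm η' 1 (P.block n (T u)) ≤
      ENNReal.ofReal ((2 : ℝ) ^ (-(((n : ℝ) - 1) * r'))) * opNorm P r η r' η' T *
        sobolevNorm P r η 1 (u : 𝓢'(Eucl d, ℂ)) := by
  rw [mul_assoc]
  exact (P.weightedL2Norm_block_le_sobolevNorm r' η' 1 n _).trans
    (mul_le_mul_right (P.sobolevNorm_le_opNorm hT u) _)

theorem eq_of_forall_coe {T₁ T₂ : Sobolev P r η →ₗ[ℂ] 𝓢'(Eucl d, ℂ)}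
    (h₁ : opNorm P r η r' η' T₁ < ⊤) (h₂ : opNorm P r η r' η' T₂ < ⊤)
    (h : ∀ f : 𝓢(Eucl d, ℂ), T₁ ⟨f, P.coe_mem_sobolev r η f⟩ = T₂ ⟨f, P.coe_mem_sobolev r η f⟩) :
    T₁ = T₂ := by
  rw [← sub_eq_zero]
  refine P.eq_zero_of_forall_coe (η' := η')
    (C := fun n => ENNReal.ofReal ((2 : ℝ) ^ (-(((n : ℝ) - 1) * r'))) * opNorm P r η r' η' T₁ +
      ENNReal.ofReal ((2 : ℝ) ^ (-(((n : ℝ) - 1) * r'))) * opNorm P r η r' η' T₂)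
    (fun n => ENNReal.add_ne_top.2 ⟨ENNReal.mul_ne_top ENNReal.ofReal_ne_top h₁.ne,
      ENNReal.mul_ne_top ENNReal.ofReal_ne_top h₂.ne⟩) (fun u n => ?_) (fun f => ?_)
  · rw [LinearMap.sub_apply, map_sub, add_mul]
    exact (weightedL2Norm_sub_le _ _ _ _).trans (add_le_add
      (P.weightedL2Norm_block_le_opNorm h₁ u n) (P.weightedL2Norm_block_le_opNorm h₂ u n))
  · rw [LinearMap.sub_apply, h, sub_self]

end DyadicPartition

variable {n : ℕ} {l : Filter ℝ}

/-- Convergence in the operator norm implies convergence of the pairings of every block. On Schwartz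
functions the regularized pairings are the integrals defining the form, so both operators agree
there; boundedness and density do the rest. -/
theorem isLimitOperator_unique (P : DyadicPartition (n + 2)) (hl : l = 𝓝[>] 0 ∨ l = 𝓝[<] 0)
    {k : ℝ} {γ : Eucl (n + 2)} {r s η : ℝ}
    {H H' : Sobolev P r η →ₗ[ℂ] 𝓢'(Eucl (n + 2), ℂ)}
    (hH : opNorm P r η (r + s) (-η) H < ⊤)
    (hHf : ∀ f g : 𝓢(Eucl (n + 2), ℂ), Tendsto (fun τ => faddeevForm k γ τ f g) l
      (𝓝 (H ⟨f, P.coe_mem_sobolev r η f⟩ g)))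
    (hH' : IsLimitOperator P l k γ r s η H') : H' = H := by
  have hne := neBot_of_side hl
  obtain ⟨T, hT, hH'b, hlim⟩ := hH'
  refine P.eq_of_forall_coe hH'b hH fun f => P.eq_of_block_eq fun m => ?_
  ext g
  set f' : Sobolev P r η := ⟨f, P.coe_mem_sobolev r η f⟩ with hf'
  rw [P.block_apply m (H f')]
  set K := ENNReal.ofReal ((2 : ℝ) ^ (-(((m : ℝ) - 1) * (r + s)))) *
    sobolevNorm P r η 1 (f' : 𝓢'(Eucl (n + 2), ℂ)) * ‖wL2 η g‖ₑ with hK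
  have hKt : K ≠ ⊤ := ENNReal.mul_ne_top (ENNReal.mul_ne_top ENNReal.ofReal_ne_top f'.2.ne)
    enorm_ne_top
  have h1 : Tendsto (fun τ => P.block m (T τ f') g) l (𝓝 (P.block m (H' f') g)) := by
    rw [tendsto_iff_edist_tendsto_0]
    have h0 : Tendsto (fun τ => K * opNorm P r η (r + s) (-η) (T τ - H')) l (𝓝 (K * 0)) :=
      ENNReal.Tendsto.const_mul hlim (Or.inr hKt)
    rw [mul_zero] at h0
    refine tendsto_of_tendsto_of_tendsto_of_le_of_le' tendsto_const_nhds h0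
      (.of_forall fun _ => zero_le) ?_
    filter_upwards [hlim.eventually_lt_const ENNReal.zero_lt_top] with τ hτ
    have h2 := P.weightedL2Norm_block_le_opNorm hτ f' m
    have h3 := enorm_apply_le_wL2 (-η) (P.block m ((T τ - H') f')) g
    rw [neg_neg] at h3
    have e : P.block m (T τ f') g - P.block m (H' f') g = P.block m ((T τ - H') f') g := by
      rw [LinearMap.sub_apply, map_sub]
      rfl
    rw [edist_eq_enorm_sub, e]
    calc _ ≤ _ := h3
      _ ≤ _ := mul_le_mul_left h2 _
      _ = _ := by
        rw [hK]
        ring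
  have h2 : Tendsto (fun τ => P.block m (T τ f') g) l
      (𝓝 (H f' (transposeMultiplier (fun ξ => P.schwartzCutoff m ξ) g))) := by
    refine (hHf f _).congr' ?_
    filter_upwards [hT, eventually_ne_of_side hl] with τ hτ hτ0
    obtain ⟨hf, hg⟩ := hτ.1 f
    rw [P.block_apply, faddeevForm_apply k γ hτ0]
    exact (hg _).2.symm
  exact tendsto_nhds_unique h1 h2

/-- `H` is built from the limit form before any `s` is chosen, so one operator serves all `s`. The
basic bound is only required at `η₀`, which keeps the constant independent of `η`. -/
theorem exists_limitOperator (P : DyadicPartition (n + 2)) (hl : l = 𝓝[>] 0 ∨ l = 𝓝[<] 0)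
    (r : ℝ) {η₀ η C : ℝ} (hη₀ : 1 / 2 < η₀) (h : η₀ ≤ η) (hC : 0 < C)
    {k : ℝ} (hk : 0 < k) (γ : Eucl (n + 2))
    (hform : ∀ τ f g, ‖faddeevForm k γ τ f g‖ₑ ≤
      ENNReal.ofReal (C / (min (rad k γ) 1 * rad k γ)) * (‖wL2 η₀ f‖ₑ * ‖wL2 η₀ g‖ₑ)) :
    ∃ H : Sobolev P r η →ₗ[ℂ] 𝓢'(Eucl (n + 2), ℂ),
      (∀ s ∈ Icc (0 : ℝ) 2, IsLimitOperator P l k γ r s η H) ∧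
      (∀ f g : 𝓢(Eucl (n + 2), ℂ), Tendsto (fun τ => faddeevForm k γ τ f g) l
        (𝓝 (H ⟨f, P.coe_mem_sobolev r η f⟩ g))) ∧
      (∀ s ∈ Icc (0 : ℝ) 2, ∀ u : Sobolev P r η, ∀ lam ∈ Ioc (0 : ℝ) 1,
        sobolevNorm P (r + s) (-η) lam (H u) ≤
          ENNReal.ofReal ((C * (3 * P.multiplierBound η₀).toReal + 2 * P.fatBound) *
            ((1 + rad k γ) ^ s / (min (rad k γ) 1 * rad k γ))) *
            ENNReal.ofReal (lam ^ (-2 * η)) *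
              sobolevNorm P r η lam (u : 𝓢'(Eucl (n + 2), ℂ))) ∧
      (∀ u : Sobolev P r η, -faddeevDiff k γ (H u) = u) ∧
      ∀ (u : Sobolev P r η) (hu : faddeevDiff k γ u ∈ Sobolev P r η),
        -H ⟨faddeevDiff k γ u, hu⟩ = u := by
  have hne := neBot_of_side hl
  have h0 : 0 ≤ η₀ := by linarith
  have hR := rad_pos hk γ
  set R := rad k γ with hRdef
  have hm : 0 < min R 1 := lt_min hR one_pos
  have hF := P.fatBound_nonneg
  have hMt : 3 * P.multiplierBound η₀ ≠ ⊤ :=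
    ENNReal.mul_ne_top (by norm_num) (P.multiplierBound_ne_top _)
  set M := (3 * P.multiplierBound η₀).toReal with hM
  have hM0 : 0 ≤ M := ENNReal.toReal_nonneg
  have hMe : 3 * P.multiplierBound η₀ = ENNReal.ofReal M := (ENNReal.ofReal_toReal hMt).symm
  obtain ⟨B, hB, hBε⟩ := exists_faddeevForm_limit hl hk γ
  have hBb : ∀ f g, ‖B f g‖ₑ ≤
      ENNReal.ofReal (C / (min R 1 * R)) * (‖wL2 η₀ f‖ₑ * ‖wL2 η₀ g‖ₑ) := fun f g =>
    enorm_limit_le hB fun τ => hform τ f g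
  have hBc : ∀ ψ f g : 𝓢(Eucl (n + 2), ℂ),
      B (SchwartzMap.fourierMultiplierCLM ℂ (fun ξ => ψ ξ) f) g =
        B f (transposeMultiplier ψ g) := fun ψ f g =>
    limit_fourierMultiplierCLM hB ψ.hasTemperateGrowth f g
  obtain ⟨H, hHf, hHb, hHi⟩ := exists_operator P h0 h r B ENNReal.ofReal_ne_top hBb hBc
  have hD : ∀ τ f g, ‖(faddeevForm k γ τ - B) f g‖ₑ ≤ (ENNReal.ofReal (C / (min R 1 * R)) +
      ENNReal.ofReal (C / (min R 1 * R))) * (‖wL2 η₀ f‖ₑ * ‖wL2 η₀ g‖ₑ) := fun τ f g => by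
    rw [LinearMap.sub_apply, LinearMap.sub_apply, add_mul]
    exact enorm_sub_le.trans (add_le_add (hform τ f g) (hBb f g))
  have hDc : ∀ τ (ψ f g : 𝓢(Eucl (n + 2), ℂ)),
      (faddeevForm k γ τ - B) (SchwartzMap.fourierMultiplierCLM ℂ (fun ξ => ψ ξ) f) g =
        (faddeevForm k γ τ - B) f (transposeMultiplier ψ g) := fun τ ψ f g => by
    rw [LinearMap.sub_apply, LinearMap.sub_apply, LinearMap.sub_apply, LinearMap.sub_apply, hBc]
    congr 1
    exact faddeevForm_fourierMultiplierCLM ψ.hasTemperateGrowth k γ τ f g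
  have hex := fun τ => exists_operator P h0 h r (faddeevForm k γ τ - B)
    (ENNReal.add_ne_top.2 ⟨ENNReal.ofReal_ne_top, ENNReal.ofReal_ne_top⟩) (hD τ) (hDc τ)
  -- `D τ` is the operator of the difference form. Treating the difference as a form of its own lets
  -- the frequency localised bounds measure the rate of convergence.
  choose D hDf hDb hDi using hex
  have hbound : ∀ s ∈ Icc (0 : ℝ) 2, ∀ u : Sobolev P r η, ∀ lam ∈ Ioc (0 : ℝ) 1,
        sobolevNorm P (r + s) (-η) lam (H u) ≤
          ENNReal.ofReal ((C * M + 2 * P.fatBound) * ((1 + R) ^ s / (min R 1 * R))) *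
            ENNReal.ofReal (lam ^ (-2 * η)) *
              sobolevNorm P r η lam (u : 𝓢'(Eucl (n + 2), ℂ)) := by
    intro s hs
    refine hHb s (freqBound (ENNReal.ofReal (C / (min R 1 * R)) * (3 * P.multiplierBound η₀))
      (fun j => 2 * P.fatBound / 4 ^ j) R) _
      (freqBound_ne_top (ENNReal.mul_ne_top ENNReal.ofReal_ne_top hMt) _ _)
      (fun j f g => enorm_form_fatCutoff_le P h0 hBb hBc (fun j hj hjR f g =>
        enorm_limit_le hB fun τ => enorm_faddeevForm_fatCutoff_le P hk τ j hj hjR f g) j f g)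
      fun j => ?_
    unfold freqBound
    split_ifs with hj
    · rw [← ENNReal.ofReal_mul (by positivity)]
      refine ENNReal.ofReal_le_ofReal ?_
      calc (2 : ℝ) ^ (((j : ℝ) - 1) * s) * (2 * P.fatBound / 4 ^ j)
          = 2 * P.fatBound * ((2 : ℝ) ^ (((j : ℝ) - 1) * s) * (4 ^ j)⁻¹) := by ring
        _ ≤ 2 * P.fatBound * ((1 + R) ^ s / (min R 1 * R)) :=
          mul_le_mul_of_nonneg_left (two_rpow_mul_le_of_high hR hs hj) (by positivity)
        _ ≤ _ := by
          gcongr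
          exact le_add_of_nonneg_left (by positivity)
    · rw [hMe, ← ENNReal.ofReal_mul (by positivity), ← ENNReal.ofReal_mul (by positivity)]
      refine ENNReal.ofReal_le_ofReal ?_
      calc (2 : ℝ) ^ (((j : ℝ) - 1) * s) * (C / (min R 1 * R) * M)
          ≤ (1 + R) ^ s * (C / (min R 1 * R) * M) :=
            mul_le_mul_of_nonneg_right (two_rpow_le_of_low hR hs.1 hj) (by positivity)
        _ = C * M * ((1 + R) ^ s / (min R 1 * R)) := by ring
        _ ≤ _ := by
          gcongr
          exact le_add_of_nonneg_right (by positivity)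
  -- The limiting absorption estimate `ε` handles the low blocks, whose factor `2 ^ ((j - 1) s)` is
  -- bounded by `(1 + R) ^ s`; on the high blocks it would not be summable against this factor, and
  -- the Lipschitz bound `16 ^ (-j) |τ|` takes over.
  have hDop : ∀ s ∈ Icc (0 : ℝ) 2, ∀ τ, τ ≠ 0 → ∀ ε : ℝ, 0 ≤ ε →
      (∀ f g, ‖faddeevForm k γ τ f g - B f g‖ₑ ≤
        ENNReal.ofReal ε * (‖wL2 η₀ f‖ₑ * ‖wL2 η₀ g‖ₑ)) →
      opNorm P r η (r + s) (-η) (D τ) ≤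
        ENNReal.ofReal ((1 + R) ^ s * M * ε + 4 * P.fatBound * |τ|) := by
    intro s hs τ hτ ε hε hDε
    refine P.opNorm_le fun u => ?_
    have h1 := hDb τ s (freqBound (ENNReal.ofReal ε * (3 * P.multiplierBound η₀))
      (fun j => 4 * P.fatBound / 16 ^ j * |τ|) R)
      (ENNReal.ofReal ((1 + R) ^ s * M * ε + 4 * P.fatBound * |τ|))
      (freqBound_ne_top (ENNReal.mul_ne_top ENNReal.ofReal_ne_top hMt) _ _)
      (fun j f g => enorm_form_fatCutoff_le P h0 hDε (hDc τ) (fun j hj hjR f g =>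
        enorm_faddeevForm_sub_limit_fatCutoff_le hl hB P hk hτ j hj hjR f g) j f g)
      (fun j => ?_) u 1 (by norm_num)
    · rw [Real.one_rpow, ENNReal.ofReal_one, mul_one] at h1
      exact h1
    · unfold freqBound
      split_ifs with hj
      · rw [← ENNReal.ofReal_mul (by positivity)]
        refine ENNReal.ofReal_le_ofReal ?_
        calc (2 : ℝ) ^ (((j : ℝ) - 1) * s) * (4 * P.fatBound / 16 ^ j * |τ|)
            = 4 * P.fatBound * |τ| * ((2 : ℝ) ^ (((j : ℝ) - 1) * s) * (16 ^ j)⁻¹) := by ring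
          _ ≤ 4 * P.fatBound * |τ| * 1 :=
            mul_le_mul_of_nonneg_left (two_rpow_mul_le_of_le_two hs j) (by positivity)
          _ ≤ _ := by
            rw [mul_one]
            exact le_add_of_nonneg_left (by positivity)
      · rw [hMe, ← ENNReal.ofReal_mul (by positivity), ← ENNReal.ofReal_mul (by positivity)]
        refine ENNReal.ofReal_le_ofReal ?_
        calc (2 : ℝ) ^ (((j : ℝ) - 1) * s) * (ε * M) ≤ (1 + R) ^ s * (ε * M) :=
              mul_le_mul_of_nonneg_right (two_rpow_le_of_low hR hs.1 hj) (by positivity)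
          _ = (1 + R) ^ s * M * ε := by ring
          _ ≤ _ := le_add_of_nonneg_right (by positivity)
  have hDlim : ∀ s ∈ Icc (0 : ℝ) 2,
      Tendsto (fun τ => opNorm P r η (r + s) (-η) (D τ)) l (𝓝 0) := by
    intro s hs
    rw [ENNReal.tendsto_nhds_zero]
    intro δ hδ
    rcases eq_or_ne δ ⊤ with rfl | hδt
    · exact .of_forall fun _ => le_top
    have hδ' : 0 < δ.toReal := ENNReal.toReal_pos hδ.ne' hδt
    set ε := δ.toReal / 2 / ((1 + R) ^ s * M + 1) with hε
    have hε0 : 0 < ε := by positivity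
    have hτlim : Tendsto (fun τ : ℝ => 4 * P.fatBound * |τ|) l (𝓝 (4 * P.fatBound * |0|)) :=
      (tendsto_id_of_side hl).abs.const_mul _
    rw [abs_zero, mul_zero] at hτlim
    filter_upwards [eventually_ne_of_side hl, hBε η₀ hη₀ ε hε0,
      hτlim.eventually_lt_const (half_pos hδ')] with τ hτ0 hτε hτs
    refine (hDop s hs τ hτ0 ε hε0.le hτε).trans ?_
    rw [← ENNReal.ofReal_toReal hδt]
    refine ENNReal.ofReal_le_ofReal ?_
    have h1 : (1 + R) ^ s * M * ε ≤ δ.toReal / 2 := by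
      rw [hε, mul_div_assoc', div_le_iff₀ (by positivity)]
      nlinarith
    linarith
  have hHop : ∀ s ∈ Icc (0 : ℝ) 2, opNorm P r η (r + s) (-η) H < ⊤ := by
    intro s hs
    refine (P.opNorm_le (C := ENNReal.ofReal ((C * M + 2 * P.fatBound) *
      ((1 + R) ^ s / (min R 1 * R)))) fun u => ?_).trans_lt ENNReal.ofReal_lt_top
    have h1 := hbound s hs u 1 (by norm_num)
    rwa [Real.one_rpow, ENNReal.ofReal_one, mul_one] at h1
  have hinv := hHi _ (hasTemperateGrowth_symbol k γ 0) (limit_symbol hl hB)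
  -- The regularized operators are defined as `H + D τ`: on Schwartz functions this is the
  -- regularized form, and the distance to `H` is the norm of `D τ`.
  refine ⟨H, fun s hs => ⟨fun τ => H + D τ, ?_, hHop s hs, ?_⟩, fun f g => ?_, hbound,
    fun u => ?_, fun u hu => ?_⟩
  · filter_upwards [eventually_ne_of_side hl,
      (hDlim s hs).eventually_lt_const ENNReal.zero_lt_top] with τ hτ hDτ
    refine ⟨fun f => ⟨P.coe_mem_sobolev r η f, fun g => ⟨integrable_div_symbol k γ hτ f g, ?_⟩⟩,
      P.opNorm_add_lt_top (hHop s hs) hDτ⟩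
    rw [← faddeevForm_apply k γ hτ]
    change H ⟨f, P.coe_mem_sobolev r η f⟩ g + D τ ⟨f, P.coe_mem_sobolev r η f⟩ g = _
    rw [hHf, hDf]
    simp
  · simp only [add_sub_cancel_left]
    exact hDlim s hs
  · rw [hHf]
    exact hB f g
  · rw [neg_faddeevDiff_eq]
    exact hinv.1 u
  · have h1 := hinv.2 u (-⟨faddeevDiff k γ u, hu⟩) (by
      rw [← neg_faddeevDiff_eq]
      rfl)
    rwa [map_neg] at h1

end LimitOperator

end Faddeev

end

/-! ### The theorem -/

open Faddeev in
theorem theorem4p1 (d : ℕ) (hd : 2 ≤ d) (P : DyadicPartition d) (l : Filter ℝ)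
    (hl : l = 𝓝[>] 0 ∨ l = 𝓝[<] 0) (r : ℝ) :
    -- the limits exist, for all `s` at once, and they invert `-(Δ + r_{k,γ}² - 2 γ·∇)`
    (∀ (k : ℝ) (γ : Eucl d) (η : ℝ), 0 < k → 1 / 2 < η →
      ∃! H : Sobolev P r η →ₗ[ℂ] 𝓢'(Eucl d, ℂ),
        ∀ s ∈ Icc (0 : ℝ) 2, IsLimitOperator P l k γ r s η H) ∧
    (∀ (k : ℝ) (γ : Eucl d) (s η : ℝ) (H : Sobolev P r η →ₗ[ℂ] 𝓢'(Eucl d, ℂ)),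
      0 < k → s ∈ Icc (0 : ℝ) 2 → 1 / 2 < η → IsLimitOperator P l k γ r s η H →
        (∀ f : Sobolev P r η, -faddeevDiff k γ (H f) = f) ∧
        (∀ (f : Sobolev P r η) (hf : faddeevDiff k γ f ∈ Sobolev P r η),
          -H ⟨faddeevDiff k γ f, hf⟩ = f)) ∧
    -- the wavenumber explicit estimates
    (∀ s ∈ Icc (0 : ℝ) 2, ∀ η₀ : ℝ, 1 / 2 < η₀ → ∃ C : ℝ, 0 < C ∧
      ∀ (k : ℝ) (γ : Eucl d) (η : ℝ) (H : Sobolev P r η →ₗ[ℂ] 𝓢'(Eucl d, ℂ)),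
        0 < k → η₀ ≤ η → IsLimitOperator P l k γ r s η H → ∀ f : Sobolev P r η,
          sobolevNorm P (r + s) (-η) 1 (H f) ≤
            ENNReal.ofReal (C * ((1 + rad k γ) ^ s / (min (rad k γ) 1 * rad k γ))) *
              sobolevNorm P r η 1 (f : 𝓢'(Eucl d, ℂ)) ∧
          ∀ lam ∈ Ioo (0 : ℝ) 1,
            sobolevNorm P (r + s) (-η) lam (H f) ≤
              ENNReal.ofReal (C * (lam ^ (-2 * η) * (1 + rad k γ) ^ s /
                  (min (rad k γ) 1 * rad k γ))) *
                sobolevNorm P r η lam (f : 𝓢'(Eucl d, ℂ))) := by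
  obtain ⟨n, rfl⟩ : ∃ n, d = n + 2 := ⟨d - 2, by omega⟩
  refine ⟨fun k γ η hk hη => ?_, fun k γ s η H hk hs hη hH => ?_, fun s hs η₀ hη₀ => ?_⟩
  · obtain ⟨C, hC, hform⟩ := exists_enorm_faddeevForm_le n hη
    obtain ⟨H, hH, hHf, -⟩ := exists_limitOperator P hl r hη le_rfl hC hk γ (hform k hk γ)
    refine ⟨H, hH, fun H' hH' => ?_⟩
    -- A single value of `s` already determines the operator.
    have h0 : (0 : ℝ) ∈ Icc (0 : ℝ) 2 := by norm_num
    obtain ⟨-, -, hop, -⟩ := hH 0 h0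
    exact isLimitOperator_unique P hl hop hHf (hH' 0 h0)
  · obtain ⟨C, hC, hform⟩ := exists_enorm_faddeevForm_le n hη
    obtain ⟨H', hH', hHf, -, hinv⟩ :=
      exists_limitOperator P hl r hη le_rfl hC hk γ (hform k hk γ)
    obtain ⟨-, -, hop, -⟩ := hH' s hs
    rw [isLimitOperator_unique P hl hop hHf hH]
    exact hinv
  · obtain ⟨C, hC, hform⟩ := exists_enorm_faddeevForm_le n hη₀
    set K := C * (3 * P.multiplierBound η₀).toReal + 2 * P.fatBound with hK
    have hK0 : 0 ≤ K := add_nonneg (mul_nonneg hC.le ENNReal.toReal_nonneg)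
      (mul_nonneg (by norm_num) P.fatBound_nonneg)
    refine ⟨K + 1, by positivity, fun k γ η H hk hη hH f => ?_⟩
    -- The operator is constructed with the weight `η₀` and then lifted to all `η ≥ η₀`, so `K`
    -- depends on `η₀` alone.
    obtain ⟨H', hH', hHf, hb, -⟩ := exists_limitOperator P hl r hη₀ hη hC hk γ (hform k hk γ)
    obtain ⟨-, -, hop, -⟩ := hH' s hs
    rw [isLimitOperator_unique P hl hop hHf hH]
    have hR := rad_pos hk γ
    have hm : 0 < min (rad k γ) 1 := lt_min hR one_pos
    have hle : ∀ lam ∈ Ioc (0 : ℝ) 1, sobolevNorm P (r + s) (-η) lam (H' f) ≤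
        ENNReal.ofReal ((K + 1) * (lam ^ (-2 * η) * (1 + rad k γ) ^ s /
          (min (rad k γ) 1 * rad k γ))) * sobolevNorm P r η lam (f : 𝓢'(Eucl (n + 2), ℂ)) := by
      intro lam hlam
      refine (hb s hs f lam hlam).trans (mul_le_mul_left ?_ _)
      have hl0 : 0 ≤ lam ^ (-2 * η) := Real.rpow_nonneg hlam.1.le _
      rw [← ENNReal.ofReal_mul (by positivity)]
      refine ENNReal.ofReal_le_ofReal ?_
      calc K * ((1 + rad k γ) ^ s / (min (rad k γ) 1 * rad k γ)) * lam ^ (-2 * η)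
          = K * (lam ^ (-2 * η) * (1 + rad k γ) ^ s / (min (rad k γ) 1 * rad k γ)) := by ring
        _ ≤ _ := by
          gcongr
          linarith
    refine ⟨?_, fun lam hlam => hle lam ⟨hlam.1, hlam.2.le⟩⟩
    have h1 := hle 1 (by norm_num)
    rwa [Real.one_rpow, one_mul] at h1
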